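/- **Setting.** Let $d,m\ge 1$, $\mathbb T^m=\mathbb R^m/\mathbb Z^m$, and let $\omega\in\mathbb R^m$ with $\|\omega\|=1$; write $\partial_\tau=\omega\cdot\nabla_\phi$. Let $W\in C^4(\mathbb R^d\times\mathbb T^m;\mathbb R)$ be supported, in its first variable, in the closed ball of radius $1/2$ about the origin, with $\partial_\tau W\not\equiv 0$; if $d=1$, assume moreover $\int_{\mathbb R}\partial_\tau W(y,\phi)\,dy\ne 0$ for some $\phi$. Put $g=-\nabla_yW$, $g_{\max}=\|g\|_\infty$. Let $\nu\ne\delta_0$ be a probability measure on $[-1,1]$ and $\overline{c^2}=\int c^2\,d\nu(c)$. For $v\in\mathbb R^d\setminus\{0\}$ and $\kappa=(b,M,\phi,c)$ with $b\in\mathbb R^d$, $b\cdot v=0$, $M\in \mathrm{SO}(d,\mathbb R)$, $\phi\in\mathbb T^m$, $c\in\mathbb R$, let $y$ be the solution of $\ddot y(\tau)=cMg(M^{-1}y(\tau),\omega\tau+\phi)$, $y(0)=b-\frac12\frac{v}{\|v\|}$, $\dot y(0)=v$, and set $$R(v,\kappa)=c\int_0^\infty Mg\big(M^{-1}y(\tau),\omega\tau+\phi\big)\,d\tau,\qquad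 \Delta E(v,\kappa)=\tfrac12\big(\|v+R(v,\kappa)\|^2-\|v\|^2\big)$$ (with the convention $R(v,\kappa)=0$ if the integral does not converge absolutely; it converges when $\|v\|$ is large). For a unit vector $e$ and $b\cdot e=0$, let $\alpha^{(k)}(e,\kappa)$ and $\beta^{(\ell)}(e,\kappa)$ be the coefficients of the expansions in inverse powers of $s$, as $s\to\infty$, $$R(se,\kappa)=\sum_{k=1}^{2}\frac{\alpha^{(k)}(e,\kappa)}{s^k}+O(s^{-3}),\qquad \Delta E(se,\kappa)=\sum_{\ell=0}^{4}\frac{\beta^{(\ell)}(e,\kappa)}{s^\ell}+o(s^{-4}).$$ For a function $f$ of $(v,\kappa)$ let $\overline{f(v)}$ be its average over $\kappa$, where $b$ is uniform on the $(d-1)$-dimensional ball of radius $1/2$ perpendicular to $v$, $M$ is distributed according to the normalized Haar measure, $\phi$ is uniform on $\mathbb T^m$, $c$ has law $\nu$, and all four are independent. Let $C_d$ be the volume of the ball of radius $1/2$ in $\mathbb R^{d-1}$ ($C_1=1$) and $|\mathbb S^{d-1}|$ the area of the unit sphere of $\mathbb R^d$ ($|\mathbb S^0|=2$). Put $$D^2=\frac{2}{|\mathbb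 S^{d-1}|}\,\frac{\overline{c^2}}{C_d}\int_{\mathbb T^m}d\phi\int_{\mathbb R^{2d}}dy\,dy'\;\|y-y'\|^{1-d}\,\partial_\tau W(y,\phi)\,\partial_\tau W(y',\phi),\qquad B=\frac{d-3}{2}D^2 .$$ **Theorem.** The two expansions above are valid for every unit vector $e$ and every $\kappa$ with $b\cdot e=0$, and the following holds; all the integrands below are integrable. (i) For all unit vectors $e$, $\overline{\alpha^{(1)}(e)}=\overline{\alpha^{(2)}(e)}=0$. As $\|v\|\to\infty$, uniformly in the direction of $v$, $$\overline{\Delta E(v)}=\frac{B}{\|v\|^4}+O(\|v\|^{-5}),\qquad \overline{(\Delta E(v))^2}=\frac{D^2}{\|v\|^2}+O(\|v\|^{-3}).$$ Moreover $D^2>0$, and for all unit vectors $e$: $\overline{\beta^{(\ell)}(e)}=0$ for $\ell=0,1,2,3$, $\overline{\beta^{(4)}(e)}=B$, and $\overline{(\beta^{(1)}(e))^2}=D^2$. (ii) Let $(v_n)_{n\ge0}$ be a random walk $v_{n+1}=v_n+R(v_n,\kappa_n)$ where, conditionally on the past $(v_0,\kappa_0,\dots,\kappa_{n-1})$, $\kappa_n$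 has the law described above with $v=v_n$. Let $e_n=v_n/\|v_n\|$ and $\beta^{(\ell)}_n=\beta^{(\ell)}(e_n,\kappa_n)$. For every $n$ with $v_n\neq0$ almost surely, $\langle\beta_n^{(\ell)}\rangle=0$ for $0\le\ell\le3$ and $\langle\beta_n^{(4)}\rangle=B$. For all $n\ne n'$ with $v_n\ne0\ne v_{n'}$ almost surely and all $0\le\ell,\ell'\le3$, $$\big\langle\beta^{(\ell)}_n\beta^{(\ell')}_{n'}\big\rangle=\big\langle\beta^{(\ell)}_n(\beta^{(4)}_{n'}-B)\big\rangle=\big\langle(\beta^{(4)}_n-B)(\beta^{(4)}_{n'}-B)\big\rangle=0 .$$ The second moments $\langle\beta_n^{(\ell)}\beta_n^{(\ell')}\rangle$, $0\le\ell,\ell'\le4$, do not depend on $n$: they agree for any $n<n'$ with $v_n\ne0\neq v_{n'}$ almost surely, where in dimension $d=1$ one assumes in addition that almost surely $\|v_k\|^2\ge 12\,g_{\max}$ for $n\le k<n'$. -/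

import Mathlib

open MeasureTheory ProbabilityTheory Filter Topology Set Asymptotics
open scoped ENNReal

namespace SoftLorentz

noncomputable section

/-! ### Configuration space, torus, rotations -/

/-- The Euclidean space `ℝ^d`. -/
abbrev Space (d : ℕ) := EuclideanSpace ℝ (Fin d)

/-- The torus `𝕋^m = ℝ^m / ℤ^m`. -/
abbrev Torus (m : ℕ) := UnitAddTorus (Fin m)

/-- The canonical projection `ℝ^m → 𝕋^m`. -/
def toTorus {m : ℕ} (x : Space m) : Torus m := fun i => ((x i : ℝ) : UnitAddCircle)

/-- The rotation group `SO(d, ℝ)`. -/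
abbrev SO (d : ℕ) := Matrix.specialOrthogonalGroup (Fin d) ℝ

/-- The action of a matrix on a vector of `ℝ^d`. -/
def rot {d : ℕ} (M : SO d) (x : Space d) : Space d :=
  WithLp.toLp 2 (Matrix.mulVec (M : Matrix (Fin d) (Fin d) ℝ) x.ofLp)

instance instMeasurableSpaceSO (d : ℕ) : MeasurableSpace (SO d) := borel (SO d)

instance instBorelSpaceSO (d : ℕ) : BorelSpace (SO d) := ⟨rfl⟩

instance instIsTopologicalGroupSO (d : ℕ) : IsTopologicalGroup (SO d) where
  continuous_mul := continuous_induced_rng.2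
    ((continuous_subtype_val.comp continuous_fst).mul (continuous_subtype_val.comp continuous_snd))
  continuous_inv := continuous_induced_rng.2
    (Continuous.matrix_conjTranspose continuous_subtype_val)

instance instCompactSpaceSO (d : ℕ) : CompactSpace (SO d) := by
  refine isCompact_iff_compactSpace.1
    (?_ : IsCompact {A : Matrix (Fin d) (Fin d) ℝ | A ∈ Matrix.specialOrthogonalGroup (Fin d) ℝ})
  have hK : IsCompact (Set.pi Set.univ fun _ : Fin d => Set.pi Set.univ fun _ : Fin d =>
      Icc (-1 : ℝ) 1) :=
    isCompact_univ_pi fun _ => isCompact_univ_pi fun _ => isCompact_Icc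
  refine hK.of_isClosed_subset ?_ ?_
  · have h : {A : Matrix (Fin d) (Fin d) ℝ | A ∈ Matrix.specialOrthogonalGroup (Fin d) ℝ}
        = {A | A * A.transpose = 1} ∩ {A | A.det = 1} := by
      ext A
      simp only [Set.mem_ofPred_eq, mem_inter_iff, Matrix.mem_specialOrthogonalGroup_iff,
        Matrix.mem_orthogonalGroup_iff]
    rw [h]
    exact (isClosed_eq (continuous_id.mul continuous_id.matrix_transpose) continuous_const).inter
      (isClosed_eq continuous_id.matrix_det continuous_const)
  · intro A hA i _ j _
    have h := entry_norm_bound_of_unitary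
      ((Matrix.mem_specialOrthogonalGroup_iff).1 hA).1 i j
    rw [Real.norm_eq_abs, abs_le] at h
    exact h

/-- The normalized Haar measure on `SO(d, ℝ)`. -/
def haarSO (d : ℕ) : Measure (SO d) := Measure.haarMeasure ⊤

/-! ### The scatterer and the single scattering event -/

/-- `∂_τ W = (ω · ∇_φ) W`. -/
def dtau {d m : ℕ} (ω : Space m) (W : Space d → Torus m → ℝ) (y : Space d) (φ : Torus m) : ℝ :=
  deriv (fun s : ℝ => W y (φ + toTorus (s • ω))) 0

/-- The gradient force field `g = - ∇_y W`. -/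
def force {d m : ℕ} (W : Space d → Torus m → ℝ) (y : Space d) (φ : Torus m) : Space d :=
  - gradient (fun x => W x φ) y

/-- `g_max = ‖g‖_∞`. -/
def gmax {d m : ℕ} (g : Space d → Torus m → Space d) : ℝ :=
  ⨆ p : Space d × Torus m, ‖g p.1 p.2‖

/-- The parameters `κ = (b, M, φ, c)` of a scattering event: impact parameter, orientation, phase
and coupling constant. -/
abbrev Params (d m : ℕ) := Space d × SO d × Torus m × ℝ

/-- The force `c M g(M⁻¹ y, ω τ + φ)` exerted at the point `y` and time `τ`. -/
def scatForce {d m : ℕ} (g : Space d → Torus m → Space d) (ω : Space m) (κ : Params d m)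
    (y : Space d) (τ : ℝ) : Space d :=
  κ.2.2.2 • rot κ.2.1 (g (rot κ.2.1⁻¹ y) (toTorus (τ • ω) + κ.2.2.1))

/-- `y` solves `y'' = c M g(M⁻¹ y, ω τ + φ)` with `y(0) = b - (1/2) v/‖v‖` and `y'(0) = v`. -/
def IsTrajectory {d m : ℕ} (g : Space d → Torus m → Space d) (ω : Space m) (v : Space d)
    (κ : Params d m) (y : ℝ → Space d) : Prop :=
  y 0 = κ.1 - (1 / 2 : ℝ) • (‖v‖⁻¹ • v) ∧ deriv y 0 = v ∧
    ∀ τ : ℝ, DifferentiableAt ℝ y τ ∧ HasDerivAt (deriv y) (scatForce g ω κ (y τ) τ) τ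

/-- The trajectory of a particle impinging with velocity `v` on the scatterer with parameters `κ`
(for the force fields of interest the solution of the equation of motion is unique). -/
def trajectory {d m : ℕ} (g : Space d → Torus m → Space d) (ω : Space m) (v : Space d)
    (κ : Params d m) : ℝ → Space d :=
  Classical.epsilon (IsTrajectory g ω v κ)

/-- The momentum transfer `R(v, κ)`. -/
def R {d m : ℕ} (g : Space d → Torus m → Space d) (ω : Space m) (v : Space d)
    (κ : Params d m) : Space d :=
  ∫ τ in Ioi (0 : ℝ), scatForce g ω κ (trajectory g ω v κ τ) τ

/-- The energy transfer `ΔE(v, κ) = ((v + R(v, κ))² - v²) / 2`. -/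
def deltaE {d m : ℕ} (g : Space d → Torus m → Space d) (ω : Space m) (v : Space d)
    (κ : Params d m) : ℝ :=
  (1 / 2 : ℝ) * (‖v + R g ω v κ‖ ^ 2 - ‖v‖ ^ 2)

/-! ### High velocity expansions -/

/-- The `k`-th coefficient `a_k` of the asymptotic expansion
`f(s) = a_0 + a_1 / s + a_2 / s² + …` as `s → ∞`, that is,
`a_k = lim s^k (f(s) - ∑_{j < k} a_j / s^j)`. -/
def expansionCoeff {F : Type*} [NormedAddCommGroup F] [NormedSpace ℝ F] (f : ℝ → F) (k : ℕ) : F :=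
  limUnder atTop fun s : ℝ =>
    s ^ k • (f s - ∑ j : Fin k, (s ^ (j : ℕ))⁻¹ • expansionCoeff f j)
termination_by k
decreasing_by exact j.2

/-- The coefficient `α^(k)(e, κ)` in `R(v, κ) = ∑_k α^(k)(e, κ) / ‖v‖^k`, `e = v/‖v‖`. -/
def alpha {d m : ℕ} (g : Space d → Torus m → Space d) (ω : Space m) (k : ℕ) (e : Space d)
    (κ : Params d m) : Space d :=
  expansionCoeff (fun s : ℝ => R g ω (s • e) κ) k

/-- The coefficient `β^(ℓ)(e, κ)` in `ΔE(v, κ) = ∑_ℓ β^(ℓ)(e, κ) / ‖v‖^ℓ`, `e = v/‖v‖`. -/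
def beta {d m : ℕ} (g : Space d → Torus m → Space d) (ω : Space m) (l : ℕ) (e : Space d)
    (κ : Params d m) : ℝ :=
  expansionCoeff (fun s : ℝ => deltaE g ω (s • e) κ) l

/-! ### Averages over a scattering event -/

/-- The uniform distribution on the ball of radius `1/2` in the hyperplane perpendicular to `v`. -/
def impactLaw {d : ℕ} (v : Space d) : Measure (Space d) :=
  (ProbabilityTheory.cond (volume : Measure ((ℝ ∙ v)ᗮ : Submodule ℝ (Space d)))
    (Metric.closedBall 0 (1 / 2))).map Subtype.val

/-- The law of `κ = (b, M, φ, c)` for a particle impinging with velocity `v`: `b` is uniform on the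
ball of radius `1/2` perpendicular to `v`, `M` is Haar distributed on `SO(d, ℝ)`, `φ` is uniform on
the torus, `c` has law `ν`, and these are independent. The average of a function `f(v, κ)` over a
scattering event is its integral with respect to this law. -/
def scatLaw (d m : ℕ) (ν : Measure ℝ) (v : Space d) : Measure (Params d m) :=
  (impactLaw v).prod ((haarSO d).prod ((volume : Measure (Torus m)).prod ν))

/-- The volume `C_d` of the ball of radius `1/2` in `ℝ^{d-1}`. -/
def ballVol (d : ℕ) : ℝ := volume.real (Metric.closedBall (0 : Space (d - 1)) (1 / 2))

/-- The total area of the unit sphere in `ℝ^d` (equal to `2` for `d = 1`). -/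
def sphereArea (d : ℕ) : ℝ := (volume : Measure (Space d)).toSphere.real Set.univ

/-- The constant `D²`. -/
def Dsq {d m : ℕ} (ω : Space m) (W : Space d → Torus m → ℝ) (ν : Measure ℝ) : ℝ :=
  2 / sphereArea d * ((∫ c, c ^ 2 ∂ν) / ballVol d) *
    ∫ φ : Torus m, ∫ p : Space d × Space d,
      ‖p.1 - p.2‖ ^ (1 - (d : ℤ)) * dtau ω W p.1 φ * dtau ω W p.2 φ

/-- The constant `B = (d - 3)/2 · D²`. -/
def B {d m : ℕ} (ω : Space m) (W : Space d → Torus m → ℝ) (ν : Measure ℝ) : ℝ :=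
  ((d : ℝ) - 3) / 2 * Dsq ω W ν

/-! ### The random walk -/

/-- `v` is the random walk `v_{n+1} = v_n + R(v_n, κ_n)` driven by `κ`, with respect to the
filtration `ℱ`: `ℱ n` contains `v_0, κ_0, …, κ_{n-1}`, and conditionally on `ℱ n` the parameters
`κ_n` of the `n`-th scattering event have the law `scatLaw` determined by `v_n`. -/
structure IsRandomWalk {d m : ℕ} (g : Space d → Torus m → Space d) (ω : Space m) (ν : Measure ℝ)
    {Ω : Type*} {mΩ : MeasurableSpace Ω} (P : Measure Ω) (ℱ : Filtration ℕ mΩ)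
    (v : ℕ → Ω → Space d) (κ : ℕ → Ω → Params d m) : Prop where
  measurable_velocity : ∀ n, Measurable[ℱ n] (v n)
  measurable_params : ∀ n, Measurable[ℱ (n + 1)] (κ n)
  step : ∀ n, ∀ᵐ x ∂P, v (n + 1) x = v n x + R g ω (v n x) (κ n x)
  law : ∀ n, ∀ A : Set Ω, MeasurableSet[ℱ n] A → ∀ S : Set (Params d m), MeasurableSet S →
    P (A ∩ κ n ⁻¹' S) = ∫⁻ x in A, scatLaw d m ν (v n x) S ∂P

/-- The random variable `β_n^(ℓ) = β^(ℓ)(e_n, κ_n)`, `e_n = v_n / ‖v_n‖`. -/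
def betaWalk {d m : ℕ} (g : Space d → Torus m → Space d) (ω : Space m) {Ω : Type*}
    (v : ℕ → Ω → Space d) (κ : ℕ → Ω → Params d m) (l n : ℕ) (x : Ω) : ℝ :=
  beta g ω l (‖v n x‖⁻¹ • v n x) (κ n x)

end

end SoftLorentz

namespace SoftLorentz

section

variable {d m : ℕ} {F : Type*} [NormedAddCommGroup F]

/-! ### Functions on `ℝ^d × 𝕋^m` and their lifts to `ℝ^d × ℝ^m` -/

/-! Measure time in units of the inverse speed, `ε = 1/‖v‖`, and work in the frame of the scatterer.
The motion becomes `x'' = -ε² c ∇W(x, φ + ε t ω)` with unit initial velocity. For small `ε` the path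
is an `O(ε²)` perturbation of a straight line and has left the support for good by time `2`
(`IsFlight.eq_of_two_le`). Expanding the impulse in `ε` gives the `α^(k)`. For the energy, `½|p|² +
ε² c W` changes only through the explicit time dependence of `W`, which vanishes at both ends of the
flight. Hence `ΔE = ε ∫ c ∂_τ W` along the path (`IsFlight.energy`), and it is enough to expand this
integral to third order (`IsFlight.abs_work_sub_le`): a Taylor series in the phase along the
straight line, linear in `c`, plus two terms `work₂` and `work₃`, quadratic in `c`, coming from the
deviation of the path.

Averages. The terms linear in `c` are averages of a derivative along the phase flow, hence zero; the
work along the straight line even averages to zero before any expansion (`integral_lineWork`), which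
is why the mean energy transfer has error `O(‖v‖⁻⁵)` although `W` is only `C⁴`. Integration by parts
in the phase symmetrises the quadratic terms: `work₂` becomes a moment with weight `t - r`, odd
under `e ↦ -e`, which averages to zero (`integral_work₂_frame`); `work₃` becomes one half of the
moment of `⟨∇∂_τW, ∇∂_τW⟩` with weight `(t - r)²`. As for `α`, the average of `α^(1)` over impact
parameters is the integral over space of a gradient, and `α^(2)` is a phase derivative.

Averages over impact parameter and rotation turn a double integral along lines into an integral over
pairs of points with density proportional to `‖y - y'‖^(1-d)` (`integral_rot_line_line`). With
weight `1` this identifies the mean of `(β^(1))²` with `D²`. With weight `(t - r)²` it gives the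
kernel `‖y - y'‖^(3-d)` between gradients, and since the Laplacian of `‖z‖^(3-d)` is `(3-d)
‖z‖^(1-d)`, two integrations by parts give the factor `d - 3` in `B` (`integral_kernel_inner_G`).

Positivity. `D²` is a mean square of line integrals of `∂_τ W`. If it were zero, all these line
integrals would vanish, hence so would the Fourier transform of `∂_τ W` at every frequency
orthogonal to some direction: at every frequency if `d ≥ 2`, at frequency zero if `d = 1`
(`kernel_integral_pos`).

Random walk. Given the past, `κ_n` has the law determined by `v_n`, and the means of the `β^(ℓ)`
under this law do not depend on the direction; this gives the means and the vanishing correlations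
(`integral_mul_betaStep`). Second moments are independent of the direction by rotation invariance
when `d ≥ 2`; when `d = 1` the speed condition keeps the direction constant (`ae_direction_eq`). -/

theorem toTorus_add (x y : Space m) : toTorus (x + y) = toTorus x + toTorus y := by
  ext i; simp [toTorus]

theorem toTorus_zero : toTorus (0 : Space m) = 0 := by
  ext i; simp [toTorus]

theorem isOpenQuotientMap_toTorus : IsOpenQuotientMap (toTorus (m := m)) := by
  have h : IsOpenQuotientMap (Pi.map fun (_ : Fin m) (x : ℝ) => (x : UnitAddCircle)) :=
    IsOpenQuotientMap.piMap fun _ => QuotientAddGroup.isOpenQuotientMap_mk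
  exact h.comp (PiLp.homeomorph 2 fun _ : Fin m => ℝ).isOpenQuotientMap

theorem continuous_toTorus : Continuous (toTorus (m := m)) := isOpenQuotientMap_toTorus.continuous

theorem toTorus_surjective : Function.Surjective (toTorus (m := m)) :=
  isOpenQuotientMap_toTorus.surjective

/-- The lift of a function on `ℝ^d × 𝕋^m` to `ℝ^d × ℝ^m`. -/
def lift (h : Space d → Torus m → F) : Space d × Space m → F := fun p => h p.1 (toTorus p.2)

/-- The covering map `ℝ^d × ℝ^m → ℝ^d × 𝕋^m` is an open quotient map, so continuity can be tested
upstairs, where calculus takes place. -/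
theorem continuous_of_lift {h : Space d → Torus m → F} (hh : Continuous (lift h)) :
    Continuous fun p : Space d × Torus m => h p.1 p.2 :=
  (((Homeomorph.refl _).isOpenQuotientMap.prodMap isOpenQuotientMap_toTorus).isQuotientMap.continuous_iff).2 hh

theorem lift_dtau (ω : Space m) {h : Space d → Torus m → ℝ} (hh : Differentiable ℝ (lift h))
    (p : Space d × Space m) : lift (dtau ω h) p = fderiv ℝ (lift h) p (0, ω) := by
  have h1 : HasDerivAt (fun s : ℝ => p + s • ((0, ω) : Space d × Space m)) ((0, ω)) 0 := by
    simpa using ((hasDerivAt_id (0 : ℝ)).smul_const ((0, ω) : Space d × Space m)).const_add p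
  have h2 : HasFDerivAt (lift h) (fderiv ℝ (lift h) p) (p + (0 : ℝ) • ((0, ω) : Space d × Space m)) := by
    simpa using (hh p).hasFDerivAt
  have h3 := h2.comp_hasDerivAt (0 : ℝ) h1
  rw [← h3.deriv]
  change deriv _ _ = _
  congr 1
  ext s
  simp [lift, toTorus_add]

theorem lift_gradient {h : Space d → Torus m → ℝ} (hh : Differentiable ℝ (lift h))
    (p : Space d × Space m) : HasGradientAt (fun y => h y (toTorus p.2))
      ((InnerProductSpace.toDual ℝ (Space d)).symm
        ((fderiv ℝ (lift h) p).comp (ContinuousLinearMap.inl ℝ _ _))) p.1 := by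
  rw [hasGradientAt_iff_hasFDerivAt, LinearIsometryEquiv.apply_symm_apply]
  exact HasFDerivAt.comp (f := fun y => (y, p.2)) (g := lift h) p.1 (hh _).hasFDerivAt (hasFDerivAt_prodMk_left p.1 p.2)

theorem hasDerivAt_phase [NormedSpace ℝ F] (ω : Space m) {h : Space d → Torus m → F} (hh : Differentiable ℝ (lift h))
    (y : Space d) (x : Space m) (θ : ℝ) :
    HasDerivAt (fun s : ℝ => h y (toTorus x + toTorus (s • ω)))
      (fderiv ℝ (lift h) (y, x + θ • ω) (0, ω)) θ := by
  have h1 : HasDerivAt (fun s : ℝ => (y, x) + s • ((0, ω) : Space d × Space m)) ((0, ω)) θ := by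
    simpa using ((hasDerivAt_id θ).smul_const ((0, ω) : Space d × Space m)).const_add (y, x)
  have h2 : HasFDerivAt (lift h) (fderiv ℝ (lift h) (y, x + θ • ω))
      ((y, x) + θ • ((0, ω) : Space d × Space m)) := by
    simpa using (hh (y, x + θ • ω)).hasFDerivAt
  convert h2.comp_hasDerivAt θ h1 using 1
  ext s
  simp [lift, toTorus_add]

theorem contDiff_lift_dtau (ω : Space m) {h : Space d → Torus m → ℝ} {n k : WithTop ℕ∞}
    (hh : ContDiff ℝ n (lift h)) (hk : k + 1 ≤ n) : ContDiff ℝ k (lift (dtau ω h)) := by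
  have h1 : lift (dtau ω h) = fun p => fderiv ℝ (lift h) p (0, ω) :=
    funext (lift_dtau ω (hh.differentiable (by rintro rfl; simp at hk)))
  rw [h1]
  exact (hh.fderiv_right hk).clm_apply contDiff_const

/-- The spatial gradient. -/
noncomputable def grad (h : Space d → Torus m → ℝ) (y : Space d) (φ : Torus m) : Space d :=
  gradient (fun x => h x φ) y

theorem lift_grad {h : Space d → Torus m → ℝ} (hh : Differentiable ℝ (lift h)) :
    lift (grad h) = fun p => (InnerProductSpace.toDual ℝ (Space d)).symm
        ((fderiv ℝ (lift h) p).comp (ContinuousLinearMap.inl ℝ _ _)) :=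
  funext fun p => (lift_gradient hh p).gradient

theorem hasGradientAt_grad {h : Space d → Torus m → ℝ} (hh : Differentiable ℝ (lift h))
    (y : Space d) (φ : Torus m) : HasGradientAt (fun x => h x φ) (grad h y φ) y := by
  obtain ⟨x, rfl⟩ := toTorus_surjective φ
  exact (lift_gradient hh (y, x)).differentiableAt.hasGradientAt

/-- Riesz representation, restricted to the first factor, as a continuous linear map. -/
noncomputable def rieszFst (d m : ℕ) : (Space d × Space m →L[ℝ] ℝ) →L[ℝ] Space d :=
  LinearMap.toContinuousLinearMap
    { toFun := fun L => (InnerProductSpace.toDual ℝ (Space d)).symm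
        (L.comp (ContinuousLinearMap.inl ℝ _ _))
      map_add' := fun L L' => by simp [ContinuousLinearMap.add_comp]
      map_smul' := fun c L => by simp [ContinuousLinearMap.smul_comp] }

theorem rieszFst_apply (L : Space d × Space m →L[ℝ] ℝ) : rieszFst d m L =
    (InnerProductSpace.toDual ℝ (Space d)).symm (L.comp (ContinuousLinearMap.inl ℝ _ _)) := rfl

theorem contDiff_lift_grad {h : Space d → Torus m → ℝ} {n k : WithTop ℕ∞}
    (hh : ContDiff ℝ n (lift h)) (hk : k + 1 ≤ n) : ContDiff ℝ k (lift (grad h)) := by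
  rw [lift_grad (hh.differentiable (by rintro rfl; simp at hk))]
  exact (rieszFst d m).contDiff.comp (hh.fderiv_right hk)

/-- Symmetry of the second derivative of the lift: `∂_τ` and `∇_y` commute. -/
theorem fderiv_lift_grad (ω : Space m) {h : Space d → Torus m → ℝ} (hh : ContDiff ℝ 2 (lift h))
    (p : Space d × Space m) :
    fderiv ℝ (lift (grad h)) p (0, ω) = lift (grad (dtau ω h)) p := by
  have hd : Differentiable ℝ (lift h) := hh.differentiable (by norm_num)
  have hd2 : Differentiable ℝ (fderiv ℝ (lift h)) :=
    (hh.fderiv_right (m := 1) (by norm_num)).differentiable (by norm_num)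
  have hd3 : Differentiable ℝ (lift (dtau ω h)) :=
    (contDiff_lift_dtau ω hh (k := 1) (by norm_num)).differentiable (by norm_num)
  have h1 : HasFDerivAt (lift (grad h)) ((rieszFst d m).comp (fderiv ℝ (fderiv ℝ (lift h)) p)) p := by
    rw [lift_grad hd]
    exact (rieszFst d m).hasFDerivAt.comp p (hd2 p).hasFDerivAt
  have h2 : lift (dtau ω h) = fun p => fderiv ℝ (lift h) p (0, ω) := funext (lift_dtau ω hd)
  have h3 : HasFDerivAt (lift (dtau ω h)) ((fderiv ℝ (fderiv ℝ (lift h)) p).flip (0, ω)) p := by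
    rw [h2]
    exact (hd2 p).hasFDerivAt.clm_apply (hasFDerivAt_const _ _) |>.congr_fderiv (by ext <;> simp)
  simp only [lift_grad hd3]
  rw [h1.fderiv, h3.fderiv, ContinuousLinearMap.comp_apply, rieszFst_apply]
  congr 1
  ext u
  have hs : IsSymmSndFDerivAt ℝ (lift h) p := hh.contDiffAt.isSymmSndFDerivAt (by simp)
  simp only [ContinuousLinearMap.comp_apply, ContinuousLinearMap.flip_apply]
  exact hs.eq _ _

/-- The sphere of radius `1/2` lies in the closure of the exterior of the ball. It has to be
included because a flight with `b = 0` starts exactly on it. -/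
theorem eq_zero_of_half_le {h : Space d → Torus m → F}
    (hc : Continuous fun p : Space d × Torus m => h p.1 p.2)
    (hs : ∀ y φ, 1 / 2 < ‖y‖ → h y φ = 0) (y : Space d) (φ : Torus m) (hy : 1 / 2 ≤ ‖y‖) :
    h y φ = 0 := by
  have hcl : IsClosed {y : Space d | h y φ = 0} :=
    isClosed_eq (hc.comp (Continuous.prodMk_left φ)) continuous_const
  have h1 : (Metric.closedBall (0 : Space d) (1 / 2))ᶜ ⊆ {y : Space d | h y φ = 0} := by
    intro z hz
    exact hs z φ (by simpa using hz)
  have h2 := closure_minimal h1 hcl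
  rw [closure_compl, interior_closedBall _ (by norm_num)] at h2
  exact h2 (by simpa using hy)

theorem exists_bound {h : Space d → Torus m → F}
    (hc : Continuous fun p : Space d × Torus m => h p.1 p.2)
    (hs : ∀ y φ, 1 / 2 ≤ ‖y‖ → h y φ = 0) : ∃ C, 0 ≤ C ∧ ∀ y φ, ‖h y φ‖ ≤ C := by
  obtain ⟨C, hC⟩ := ((isCompact_closedBall (0 : Space d) (1 / 2)).prod
    (isCompact_univ (X := Torus m))).exists_bound_of_continuousOn hc.continuousOn
  refine ⟨max C 0, le_max_right _ _, fun y φ => ?_⟩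
  by_cases hy : ‖y‖ ≤ 1 / 2
  · exact (hC (y, φ) ⟨by simpa using hy, mem_univ _⟩).trans (le_max_left _ _)
  · rw [hs y φ (not_le.1 hy).le, norm_zero]; exact le_max_right _ _

/-- A bounded set of representatives of the phases, over which the derivatives of a lift can be
bounded by compactness. -/
theorem exists_mem_cube (φ : Torus m) : ∃ x : Space m, ‖x‖ ≤ √m ∧ toTorus x = φ := by
  obtain ⟨x, rfl⟩ := toTorus_surjective φ
  refine ⟨WithLp.toLp 2 fun i => Int.fract (x i), ?_, ?_⟩
  · rw [EuclideanSpace.norm_eq]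
    apply Real.sqrt_le_sqrt
    calc ∑ i, ‖Int.fract (x i)‖ ^ 2 ≤ ∑ _i : Fin m, (1 : ℝ) := by
          refine Finset.sum_le_sum fun i _ => ?_
          rw [Real.norm_eq_abs, abs_of_nonneg (Int.fract_nonneg _)]
          nlinarith [Int.fract_nonneg (x i), Int.fract_lt_one (x i)]
      _ = m := by simp
  · ext i
    simp only [toTorus]
    exact AddCircle.coe_fract (x i)

end

/-! ### Jets of the potential, with uniform bounds -/

section

variable {d m : ℕ}

/-- The derivatives `w k = ∂_τ^k W` of a potential and their gradients `G k = ∇_y ∂_τ^k W`, with a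
common bound `C`. -/
structure PotentialJet (ω : Space m) (w : ℕ → Space d → Torus m → ℝ)
    (G : ℕ → Space d → Torus m → Space d) (C : ℝ) : Prop where
  nonneg : 0 ≤ C
  w_cont : ∀ k ≤ 4, Continuous fun p : Space d × Torus m => w k p.1 p.2
  G_cont : ∀ k ≤ 3, Continuous fun p : Space d × Torus m => G k p.1 p.2
  w_supp : ∀ k ≤ 4, ∀ y φ, 1 / 2 ≤ ‖y‖ → w k y φ = 0
  G_supp : ∀ k ≤ 3, ∀ y φ, 1 / 2 ≤ ‖y‖ → G k y φ = 0
  w_time : ∀ k ≤ 3, ∀ y φ θ, HasDerivAt (fun s : ℝ => w k y (φ + toTorus (s • ω)))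
    (w (k + 1) y (φ + toTorus (θ • ω))) θ
  G_time : ∀ k ≤ 2, ∀ y φ θ, HasDerivAt (fun s : ℝ => G k y (φ + toTorus (s • ω)))
    (G (k + 1) y (φ + toTorus (θ • ω))) θ
  w_grad : ∀ k ≤ 3, ∀ y φ, HasGradientAt (fun x => w k x φ) (G k y φ) y
  w_chain : ∀ (x : ℝ → Space d) (x' : Space d) (φ : Torus m) (ε t : ℝ), HasDerivAt x x' t →
    HasDerivAt (fun s => w 0 (x s) (φ + toTorus ((ε * s) • ω)))
      (inner ℝ (G 0 (x t) (φ + toTorus ((ε * t) • ω))) x' +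
        ε * w 1 (x t) (φ + toTorus ((ε * t) • ω))) t
  w_bound : ∀ k ≤ 4, ∀ y φ, |w k y φ| ≤ C
  G_bound : ∀ k ≤ 3, ∀ y φ, ‖G k y φ‖ ≤ C
  G_lip : ∀ k ≤ 1, ∀ y y' φ, ‖G k y φ - G k y' φ‖ ≤ C * ‖y - y'‖

/-- The derivative of the lift is bounded on the compact set formed by the support and a ball of
representatives of all phases; off the support the spatial derivative is zero. The mean value
inequality on the convex set `ℝ^d` concludes. -/
theorem exists_lipschitz {F : Type*} [NormedAddCommGroup F] [NormedSpace ℝ F]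
    {h : Space d → Torus m → F} (hc : ContDiff ℝ 1 (lift h))
    (hs : ∀ y φ, 1 / 2 ≤ ‖y‖ → h y φ = 0) :
    ∃ C, 0 ≤ C ∧ ∀ y y' φ, ‖h y φ - h y' φ‖ ≤ C * ‖y - y'‖ := by
  obtain ⟨C, hC⟩ := ((isCompact_closedBall (0 : Space d) (1 / 2)).prod
    (isCompact_closedBall (0 : Space m) (√m))).exists_bound_of_continuousOn
      (hc.continuous_fderiv (by norm_num)).continuousOn
  have hd : Differentiable ℝ (lift h) := hc.differentiable (by norm_num)
  refine ⟨max C 0, le_max_right _ _, fun y y' φ => ?_⟩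
  obtain ⟨x, hx, rfl⟩ := exists_mem_cube φ
  have hder : ∀ z : Space d, HasFDerivAt (fun z => h z (toTorus x))
      ((fderiv ℝ (lift h) (z, x)).comp (ContinuousLinearMap.inl ℝ _ _)) z := fun z =>
    HasFDerivAt.comp (f := fun y => (y, x)) (g := lift h) z (hd _).hasFDerivAt
      (hasFDerivAt_prodMk_left z x)
  refine Convex.norm_image_sub_le_of_norm_hasFDerivWithin_le
    (fun z _ => (hder z).hasFDerivWithinAt) (fun z _ => ?_) convex_univ
    (mem_univ y') (mem_univ y)
  by_cases hz : ‖z‖ ≤ 1 / 2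
  · refine ((ContinuousLinearMap.opNorm_comp_le _ _).trans ?_).trans (le_max_left _ _)
    refine (mul_le_of_le_one_right (norm_nonneg _)
      (ContinuousLinearMap.norm_inl_le_one ℝ (Space d) (Space m))).trans ?_
    exact hC (z, x) ⟨by simpa using hz, by simpa using hx⟩
  · have h0 : HasFDerivAt (fun z => h z (toTorus x)) (0 : Space d →L[ℝ] F) z := by
      refine (hasFDerivAt_const (0 : F) z).congr_of_eventuallyEq ?_
      filter_upwards [(isOpen_lt continuous_const continuous_norm).mem_nhds (not_le.1 hz)] with u hu
      exact hs u _ (le_of_lt hu)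
    rw [(hder z).unique h0, norm_zero]
    exact le_max_right _ _

theorem contDiff_lift_iterate_dtau (ω : Space m) {W : Space d → Torus m → ℝ}
    (hW : ContDiff ℝ 4 (lift W)) : ∀ k ≤ 4,
    ContDiff ℝ ((4 - k : ℕ) : WithTop ℕ∞) (lift ((dtau ω)^[k] W)) := by
  intro k
  induction k with
  | zero => intro _; simpa using hW
  | succ k ih =>
    intro hk
    rw [Function.iterate_succ_apply']
    refine contDiff_lift_dtau ω (ih (by omega)) ?_
    have : 4 - k = (4 - (k + 1)) + 1 := by omega
    rw [this]; norm_cast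

theorem dtau_eq_zero (ω : Space m) {h : Space d → Torus m → ℝ}
    (hs : ∀ y φ, 1 / 2 < ‖y‖ → h y φ = 0) (y : Space d) (φ : Torus m) (hy : 1 / 2 < ‖y‖) :
    dtau ω h y φ = 0 := by
  simp [dtau, hs y _ hy]

theorem grad_eq_zero {h : Space d → Torus m → ℝ}
    (hs : ∀ y φ, 1 / 2 < ‖y‖ → h y φ = 0) (y : Space d) (φ : Torus m) (hy : 1 / 2 < ‖y‖) :
    grad h y φ = 0 := by
  have h0 : HasGradientAt (fun x => h x φ) 0 y := by
    rw [hasGradientAt_iff_hasFDerivAt, map_zero]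
    refine (hasFDerivAt_const (0 : ℝ) y).congr_of_eventuallyEq ?_
    filter_upwards [(isOpen_lt continuous_const continuous_norm).mem_nhds hy] with u hu
    exact hs u _ hu
  exact h0.gradient

/-- The ranges of `k` record what four derivatives allow: `w k` keeps `4 - k` of them, so it has a
gradient for `k ≤ 3`, which can be differentiated in time for `k ≤ 2`. Lipschitz bounds are recorded
only for the two gradients that the expansion of the flight needs. -/
theorem exists_potentialJet (ω : Space m) {W : Space d → Torus m → ℝ}
    (hW : ContDiff ℝ 4 (lift W)) (hsupp : ∀ y φ, 1 / 2 < ‖y‖ → W y φ = 0) :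
    ∃ C, PotentialJet ω (fun k => (dtau ω)^[k] W) (fun k => grad ((dtau ω)^[k] W)) C := by
  set w := fun k => (dtau ω)^[k] W with hw
  have hcd : ∀ k ≤ 4, ContDiff ℝ ((4 - k : ℕ) : WithTop ℕ∞) (lift (w k)) :=
    contDiff_lift_iterate_dtau ω hW
  have hcd1 : ∀ k ≤ 3, ContDiff ℝ 1 (lift (w k)) := fun k hk =>
    (hcd k (by omega)).of_le (by exact_mod_cast (by omega : 1 ≤ 4 - k))
  have hdiff : ∀ k ≤ 3, Differentiable ℝ (lift (w k)) := fun k hk =>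
    (hcd1 k hk).differentiable (by norm_num)
  have hcd2 : ∀ k ≤ 2, ContDiff ℝ 2 (lift (w k)) := fun k hk =>
    (hcd k (by omega)).of_le (by exact_mod_cast (by omega : 2 ≤ 4 - k))
  have hwc : ∀ k ≤ 4, Continuous fun p : Space d × Torus m => w k p.1 p.2 := fun k hk =>
    continuous_of_lift (hcd k hk).continuous
  have hGc : ∀ k ≤ 3, Continuous fun p : Space d × Torus m => grad (w k) p.1 p.2 := fun k hk =>
    continuous_of_lift (contDiff_lift_grad (k := 0) (hcd1 k hk) (by norm_num)).continuous
  have hws0 : ∀ k y φ, 1 / 2 < ‖y‖ → w k y φ = 0 := by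
    intro k
    induction k with
    | zero => exact hsupp
    | succ k ih => simp only [hw, Function.iterate_succ_apply']; exact dtau_eq_zero ω ih
  have hws : ∀ k ≤ 4, ∀ y φ, 1 / 2 ≤ ‖y‖ → w k y φ = 0 := fun k hk =>
    eq_zero_of_half_le (hwc k hk) (hws0 k)
  have hGs : ∀ k ≤ 3, ∀ y φ, 1 / 2 ≤ ‖y‖ → grad (w k) y φ = 0 := fun k hk =>
    eq_zero_of_half_le (hGc k hk) (grad_eq_zero (hws0 k))
  have hb : ∀ k, ∃ C, 0 ≤ C ∧ (k ≤ 4 → ∀ y φ, |w k y φ| ≤ C) ∧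
      (k ≤ 3 → ∀ y φ, ‖grad (w k) y φ‖ ≤ C) ∧
      (k ≤ 1 → ∀ y y' φ, ‖grad (w k) y φ - grad (w k) y' φ‖ ≤ C * ‖y - y'‖) := by
    intro k
    by_cases h4 : k ≤ 4
    swap
    · exact ⟨0, le_rfl, by omega, by omega, by omega⟩
    obtain ⟨C₁, hC₁, hC₁'⟩ := exists_bound (hwc k h4) (hws k h4)
    by_cases h3 : k ≤ 3
    swap
    · exact ⟨C₁, hC₁, fun _ => hC₁', by omega, by omega⟩
    obtain ⟨C₂, hC₂, hC₂'⟩ := exists_bound (hGc k h3) (hGs k h3)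
    by_cases h1 : k ≤ 1
    swap
    · exact ⟨max C₁ C₂, le_max_of_le_left hC₁, fun _ y φ => (hC₁' y φ).trans (le_max_left _ _),
        fun _ y φ => (hC₂' y φ).trans (le_max_right _ _), by omega⟩
    obtain ⟨C₃, hC₃, hC₃'⟩ := exists_lipschitz
      (contDiff_lift_grad (k := 1) (hcd2 k (by omega)) (by norm_num)) (hGs k h3)
    refine ⟨max (max C₁ C₂) C₃, le_max_of_le_right hC₃,
      fun _ y φ => (hC₁' y φ).trans ((le_max_left _ _).trans (le_max_left _ _)),
      fun _ y φ => (hC₂' y φ).trans ((le_max_right _ _).trans (le_max_left _ _)),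
      fun _ y y' φ => (hC₃' y y' φ).trans ?_⟩
    gcongr
    exact le_max_right _ _
  choose Cf hCf0 hCf1 hCf2 hCf3 using hb
  -- The common constant is the sum of the five nonnegative constants found for the individual
  -- orders.
  have hle : ∀ k ≤ 4, Cf k ≤ ∑ j ∈ Finset.range 5, Cf j := fun k hk =>
    Finset.single_le_sum (fun j _ => hCf0 j) (Finset.mem_range.2 (by omega))
  refine ⟨∑ j ∈ Finset.range 5, Cf j, Finset.sum_nonneg fun j _ => hCf0 j, hwc, hGc, hws, hGs,
    ?_, ?_, fun k hk => hasGradientAt_grad (hdiff k hk), ?_,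
    fun k hk y φ => (hCf1 k hk y φ).trans (hle k hk),
    fun k hk y φ => (hCf2 k hk y φ).trans (hle k (by omega)),
    fun k hk y y' φ => (hCf3 k hk y y' φ).trans ?_⟩
  · intro k hk y φ θ
    obtain ⟨x, rfl⟩ := toTorus_surjective φ
    refine (hasDerivAt_phase ω (hdiff k hk) y x θ).congr_deriv ?_
    rw [← lift_dtau ω (hdiff k hk)]
    simp only [lift, hw, Function.iterate_succ_apply', toTorus_add]
  · intro k hk y φ θ
    obtain ⟨x, rfl⟩ := toTorus_surjective φ
    refine (hasDerivAt_phase ω ((contDiff_lift_grad (k := 1) (hcd2 k hk)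
      (by norm_num)).differentiable (by norm_num)) y x θ).congr_deriv ?_
    rw [fderiv_lift_grad ω (hcd2 k hk)]
    simp only [lift, hw, Function.iterate_succ_apply', toTorus_add]
  · intro x x' φ ε t hx
    obtain ⟨ξ, rfl⟩ := toTorus_surjective φ
    have h1 : HasDerivAt (fun s => (x s, ξ + (ε * s) • ω)) (x', ε • ω) t := by
      refine hx.prodMk ?_
      simpa using (((hasDerivAt_id t).const_mul ε).smul_const ω).const_add ξ
    have h2 := (hdiff 0 (by norm_num) (x t, ξ + (ε * t) • ω)).hasFDerivAt.comp_hasDerivAt t h1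
    have h3 := congrFun (lift_grad (hdiff 0 (by norm_num))) (x t, ξ + (ε * t) • ω)
    have h4 := lift_dtau ω (hdiff 0 (by norm_num)) (x t, ξ + (ε * t) • ω)
    have h5 : ((x', ε • ω) : Space d × Space m) = (x', 0) + ε • (0, ω) := by simp
    simp only [lift, toTorus_add] at h3 h4
    rw [h5, map_add, map_smul, ← h4, smul_eq_mul] at h2
    rw [h3, InnerProductSpace.toDual_symm_apply]
    simpa [Function.comp_def, lift, toTorus_add, hw] using h2
  · gcongr
    exact hle k (by omega)

/-- The coupling constant is absorbed into the potential. The new bound involves `c₀` and not `|c|`,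
so that all later estimates are uniform in `c`. -/
theorem PotentialJet.smul {ω : Space m} {w : ℕ → Space d → Torus m → ℝ}
    {G : ℕ → Space d → Torus m → Space d} {C : ℝ} (h : PotentialJet ω w G C) {c c₀ : ℝ}
    (hc : |c| ≤ c₀) :
    PotentialJet ω (fun k y φ => c * w k y φ) (fun k y φ => c • G k y φ) (c₀ * C) where
  nonneg := mul_nonneg ((abs_nonneg c).trans hc) h.nonneg
  w_cont k hk := (h.w_cont k hk).const_smul c
  G_cont k hk := (h.G_cont k hk).const_smul c
  w_supp k hk y φ hy := by simp [h.w_supp k hk y φ hy]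
  G_supp k hk y φ hy := by simp [h.G_supp k hk y φ hy]
  w_time k hk y φ θ := (h.w_time k hk y φ θ).const_mul c
  G_time k hk y φ θ := (h.G_time k hk y φ θ).const_smul c
  w_grad k hk y φ := by
    have h1 := (h.w_grad k hk y φ).hasFDerivAt.const_mul c
    rw [hasGradientAt_iff_hasFDerivAt, map_smul]
    exact h1
  w_chain x x' φ ε t hx := by
    refine ((h.w_chain x x' φ ε t hx).const_mul c).congr_deriv ?_
    rw [real_inner_smul_left]; ring
  w_bound k hk y φ := by
    rw [abs_mul]
    exact mul_le_mul hc (h.w_bound k hk y φ) (abs_nonneg _) ((abs_nonneg c).trans hc)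
  G_bound k hk y φ := by
    rw [norm_smul]
    exact mul_le_mul hc (h.G_bound k hk y φ) (norm_nonneg _) ((abs_nonneg c).trans hc)
  G_lip k hk y y' φ := by
    rw [← smul_sub, norm_smul, mul_assoc]
    exact mul_le_mul hc (h.G_lip k hk y y' φ) (norm_nonneg _) ((abs_nonneg c).trans hc)

end

section

/-! ### Global solutions of Lipschitz differential equations -/

section Picard

open scoped NNReal Nat

variable {X : Type*} [NormedAddCommGroup X] [NormedSpace ℝ X]

/-- The Picard iterates for `u' = f t u`, `u 0 = x₀`. -/
noncomputable def picardIter (f : ℝ → X → X) (x₀ : X) : ℕ → ℝ → X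
  | 0 => fun _ => x₀
  | n + 1 => fun t => x₀ + ∫ s in (0 : ℝ)..t, f s (picardIter f x₀ n s)

theorem continuous_picardIter {f : ℝ → X → X} (hf : Continuous (Function.uncurry f)) (x₀ : X)
    (n : ℕ) : Continuous (picardIter f x₀ n) := by
  induction n with
  | zero => exact continuous_const
  | succ n ih =>
    exact continuous_const.add (intervalIntegral.continuous_primitive
      (fun a b => (hf.comp (continuous_id.prodMk ih)).intervalIntegrable a b) 0)

/-- Each integration of the Lipschitz bound contributes a power of `|t|` and a factor of the
factorial, so the increments are summable on every bounded time interval, with no smallness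
condition on its length. -/
theorem norm_picardIter_succ_sub_le {f : ℝ → X → X} (hf : Continuous (Function.uncurry f)) {K : ℝ≥0}
    (hK : ∀ t, LipschitzWith K (f t)) {x₀ : X} {C T : ℝ}
    (hC : ∀ t, |t| ≤ T → ‖f t x₀‖ ≤ C) (n : ℕ) : ∀ t, |t| ≤ T →
    ‖picardIter f x₀ (n + 1) t - picardIter f x₀ n t‖ ≤ C * K ^ n * |t| ^ (n + 1) / (n + 1)! := by
  have hcont : ∀ n, Continuous fun s => f s (picardIter f x₀ n s) := fun n =>
    hf.comp (continuous_id.prodMk (continuous_picardIter hf x₀ n))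
  have hmem : ∀ t s, |t| ≤ T → s ∈ uIoc 0 t → |s| ≤ T := by
    intro t s ht hs
    rw [mem_uIoc] at hs
    rw [abs_le] at ht ⊢
    rcases hs with hs | hs <;> constructor <;> linarith
  induction n with
  | zero =>
    intro t ht
    have h := intervalIntegral.norm_integral_le_of_norm_le_const
      (f := fun s => f s x₀) (a := 0) (b := t) (C := C) fun s hs => hC s (hmem t s ht hs)
    simpa [picardIter] using h
  | succ n ih =>
    intro t ht
    have e : picardIter f x₀ (n + 1 + 1) t - picardIter f x₀ (n + 1) t =
        ∫ s in (0 : ℝ)..t, (f s (picardIter f x₀ (n + 1) s) - f s (picardIter f x₀ n s)) := by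
      rw [intervalIntegral.integral_sub ((hcont _).intervalIntegrable _ _)
        ((hcont _).intervalIntegrable _ _)]
      simp only [picardIter, add_sub_add_left_eq_sub]
    rw [e]
    have hb : ‖∫ s in (0 : ℝ)..t, (f s (picardIter f x₀ (n + 1) s) - f s (picardIter f x₀ n s))‖ ≤
        ∫ s in uIoc 0 t, C * K ^ (n + 1) / (n + 1)! * |s - 0| ^ (n + 1) := by
      rw [intervalIntegral.norm_intervalIntegral_eq]
      apply norm_integral_le_of_norm_le (Continuous.integrableOn_uIoc (by fun_prop))
      refine (ae_restrict_mem measurableSet_uIoc).mono fun s hs => ?_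
      have h1 := (hK s).norm_sub_le (picardIter f x₀ (n + 1) s) (picardIter f x₀ n s)
      refine h1.trans ((mul_le_mul_of_nonneg_left (ih s (hmem t s ht hs)) K.2).trans (le_of_eq ?_))
      rw [sub_zero, NNReal.val_eq_coe]; ring
    refine hb.trans (le_of_eq ?_)
    rw [integral_const_mul, integral_pow_abs_sub_uIoc, sub_zero, Nat.factorial_succ (n + 1)]
    push_cast
    field_simp

/-- The solution is produced together with the convergence of the iterates to it: the iterates
depend continuously on parameters, and the measurability of the energy transfer rests on this. -/
theorem exists_tendsto_picardIter [CompleteSpace X] {f : ℝ → X → X}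
    (hf : Continuous (Function.uncurry f)) {K : ℝ≥0} (hK : ∀ t, LipschitzWith K (f t)) (x₀ : X) :
    ∃ u : ℝ → X, (∀ t, Tendsto (fun n => picardIter f x₀ n t) atTop (𝓝 (u t))) ∧ u 0 = x₀ ∧
      ∀ t, HasDerivAt u (f t (u t)) t := by
  set a : ℕ → ℝ → X := fun n t => picardIter f x₀ (n + 1) t - picardIter f x₀ n t with ha
  set u : ℝ → X := fun t => x₀ + ∑' n, a n t with hu
  have hsum : ∀ N t, picardIter f x₀ N t = x₀ + ∑ n ∈ Finset.range N, a n t := by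
    intro N t
    rw [Finset.sum_range_sub (fun n => picardIter f x₀ n t)]
    simp [picardIter]
  have key : ∀ T : ℝ, ∃ M : ℕ → ℝ, Summable M ∧ ∀ n t, t ∈ Icc (-T) T → ‖a n t‖ ≤ M n := by
    intro T
    obtain ⟨C, hC⟩ := (isCompact_Icc (a := -T) (b := T)).exists_bound_of_continuousOn
      (f := fun t => f t x₀) (hf.comp (continuous_id.prodMk continuous_const)).continuousOn
    by_cases hT : T < 0
    · exact ⟨fun _ => 0, summable_zero, fun n t ht => absurd ht (by simp [Icc_eq_empty, hT])⟩
    have hC0 : 0 ≤ C := (norm_nonneg _).trans (hC 0 ⟨by linarith, by linarith⟩)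
    refine ⟨fun n => C * T * ((K * T) ^ n / n !),
      (Real.summable_pow_div_factorial _).mul_left _, fun n t ht => ?_⟩
    refine (norm_picardIter_succ_sub_le hf hK (T := T) (C := C)
      (fun t ht => hC t (abs_le.1 ht)) n t (abs_le.2 ht)).trans ?_
    beta_reduce
    rw [mul_pow, ← mul_div_assoc]
    have h1 : C * K ^ n * |t| ^ (n + 1) ≤ C * T * (K ^ n * T ^ n) := by
      calc C * K ^ n * |t| ^ (n + 1) ≤ C * K ^ n * T ^ (n + 1) := by
            gcongr; exact abs_le.2 ht
        _ = C * T * (K ^ n * T ^ n) := by ring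
    have h2 : (n ! : ℝ) ≤ (n + 1)! := by exact_mod_cast Nat.factorial_le (Nat.le_succ n)
    have h3 : 0 ≤ C * T * (K ^ n * T ^ n) := by
      have : 0 ≤ T := not_lt.1 hT
      positivity
    gcongr
  have hunif : ∀ T : ℝ, TendstoUniformlyOn (fun N => picardIter f x₀ N) u atTop (Icc (-T) T) := by
    intro T
    obtain ⟨M, hM, hM'⟩ := key T
    have h1 := tendstoUniformlyOn_tsum_nat hM hM'
    have h2 : (fun N => picardIter f x₀ N) = fun N t => x₀ + ∑ n ∈ Finset.range N, a n t := by
      ext N t; exact hsum N t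
    rw [h2, Metric.tendstoUniformlyOn_iff] at *
    intro ε hε
    filter_upwards [h1 ε hε] with N hN t ht
    rw [hu]; simpa [dist_add_left] using hN t ht
  have hmem : ∀ t : ℝ, t ∈ Icc (-|t|) |t| := fun t => abs_le.1 le_rfl
  have hlim : ∀ t, Tendsto (fun n => picardIter f x₀ n t) atTop (𝓝 (u t)) := fun t =>
    (hunif |t|).tendsto_at (hmem t)
  have hucont : Continuous u := by
    rw [continuous_iff_continuousAt]
    intro t
    refine ((hunif (|t| + 1)).continuousOn (Frequently.of_forall fun n =>
      (continuous_picardIter hf x₀ n).continuousOn)).continuousAt (Icc_mem_nhds ?_ ?_) <;>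
    [linarith [neg_abs_le t]; linarith [le_abs_self t]]
  -- The integral equation is the limit of the Picard recursion, by dominated convergence; the bound
  -- is the growth of `f` at `x₀` plus the Lipschitz constant times the total increment.
  have hint : ∀ t, u t = x₀ + ∫ s in (0 : ℝ)..t, f s (u s) := by
    intro t
    obtain ⟨M, hM, hM'⟩ := key |t|
    have hM0 : ∀ n, 0 ≤ M n := fun n => (norm_nonneg _).trans (hM' n t (hmem t))
    refine tendsto_nhds_unique ((hlim t).comp (tendsto_add_atTop_nat 1)) ?_
    refine Tendsto.const_add x₀ ?_
    refine intervalIntegral.tendsto_integral_filter_of_dominated_convergence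
      (fun s => ‖f s x₀‖ + K * ∑' n, M n)
      (Eventually.of_forall fun n => (hf.comp (continuous_id.prodMk
        (continuous_picardIter hf x₀ n))).aestronglyMeasurable)
      (Eventually.of_forall fun n => Eventually.of_forall fun s hs => ?_)
      (((hf.comp (continuous_id.prodMk continuous_const)).norm.add continuous_const
        ).intervalIntegrable _ _)
      (Eventually.of_forall fun s hs => ((hf.comp (continuous_const.prodMk
        continuous_id)).tendsto (u s)).comp (hlim s))
    have hs' : s ∈ Icc (-|t|) |t| := by
      rw [mem_uIoc] at hs
      rcases hs with hs | hs
      · exact ⟨by linarith [hs.1, abs_nonneg t], by linarith [hs.2, le_abs_self t]⟩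
      · exact ⟨by linarith [hs.1, neg_abs_le t], by linarith [hs.2, abs_nonneg t]⟩
    have h1 : ‖picardIter f x₀ n s - x₀‖ ≤ ∑' n, M n := by
      rw [hsum n s, add_sub_cancel_left]
      exact (norm_sum_le_of_le _ fun k _ => hM' k s hs').trans
        (hM.sum_le_tsum _ fun k _ => hM0 k)
    calc ‖f s (picardIter f x₀ n s)‖
        = ‖f s x₀ + (f s (picardIter f x₀ n s) - f s x₀)‖ := by rw [add_sub_cancel]
      _ ≤ ‖f s x₀‖ + K * ‖picardIter f x₀ n s - x₀‖ :=
          (norm_add_le _ _).trans (by gcongr; exact (hK s).norm_sub_le _ _)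
      _ ≤ _ := by gcongr
  refine ⟨u, hlim, by rw [hint 0]; simp, fun t => ?_⟩
  have h := ((hf.comp (continuous_id.prodMk hucont)).integral_hasStrictDerivAt 0 t).hasDerivAt
  exact (h.const_add x₀).congr_of_eventuallyEq (Eventually.of_forall hint)

end Picard

end

section

variable {d m : ℕ} {ω : Space m} {w : ℕ → Space d → Torus m → ℝ}
  {G : ℕ → Space d → Torus m → Space d} {C : ℝ}

/-! ### The rescaled flight through a scatterer -/

/-- `x` (with derivative `p`) solves the rescaled equation of motion
`x'' = - ε² ∇W (x, φ + ε t ω)` with initial data `(x₀, e)`. -/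
structure IsFlight (ω : Space m) (G₀ : Space d → Torus m → Space d) (ε : ℝ) (φ : Torus m)
    (x₀ e : Space d) (x p : ℝ → Space d) : Prop where
  x_zero : x 0 = x₀
  p_zero : p 0 = e
  hx : ∀ t, HasDerivAt x (p t) t
  hp : ∀ t, HasDerivAt p (-(ε ^ 2) • G₀ (x t) (φ + toTorus ((ε * t) • ω))) t

/-- The vector field on phase space of the rescaled equation of motion. -/
noncomputable def flightField (ω : Space m) (G₀ : Space d → Torus m → Space d) (ε : ℝ) (φ : Torus m) (t : ℝ)
    (u : Space d × Space d) : Space d × Space d :=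
  (u.2, -(ε ^ 2) • G₀ u.1 (φ + toTorus ((ε * t) • ω)))

theorem PotentialJet.continuous_flightField (h : PotentialJet ω w G C) :
    Continuous fun q : ℝ × Torus m × ℝ × (Space d × Space d) =>
      flightField ω (G 0) q.1 q.2.1 q.2.2.1 q.2.2.2 := by
  have h1 : Continuous fun q : ℝ × Torus m × ℝ × (Space d × Space d) =>
      G 0 q.2.2.2.1 (q.2.1 + toTorus ((q.1 * q.2.2.1) • ω)) :=
    (h.G_cont 0 (by norm_num)).comp (f := fun q : ℝ × Torus m × ℝ × (Space d × Space d) =>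
      (q.2.2.2.1, q.2.1 + toTorus ((q.1 * q.2.2.1) • ω)))
      (by have := continuous_toTorus (m := m); fun_prop)
  exact (by fun_prop : Continuous fun q : ℝ × Torus m × ℝ × (Space d × Space d) =>
    q.2.2.2.2).prodMk ((by fun_prop : Continuous fun q : ℝ × Torus m × ℝ × (Space d × Space d) =>
    -(q.1 ^ 2)).smul h1)

/-- On the product with its sup norm the component `x' = p` has Lipschitz constant `1` and the force
component has constant `ε² C`, hence the maximum. -/
theorem PotentialJet.lipschitz_flightField (h : PotentialJet ω w G C) (ε : ℝ) (φ : Torus m)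
    (t : ℝ) : LipschitzWith (max 1 (ε ^ 2 * C).toNNReal) (flightField ω (G 0) ε φ t) := by
  refine LipschitzWith.of_dist_le_mul fun u u' => ?_
  have hC := h.nonneg
  rw [Prod.dist_eq, Prod.dist_eq]
  set D := max (dist u.1 u'.1) (dist u.2 u'.2) with hD
  have hD0 : 0 ≤ D := le_max_of_le_left dist_nonneg
  have hm : ((max 1 (ε ^ 2 * C).toNNReal : NNReal) : ℝ) = max 1 (ε ^ 2 * C) := by
    rw [NNReal.coe_max, Real.coe_toNNReal _ (by positivity)]; simp
  rw [hm]
  refine max_le ?_ ?_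
  · calc dist u.2 u'.2 ≤ 1 * D := by rw [one_mul]; exact le_max_right _ _
      _ ≤ _ := by gcongr; exact le_max_left _ _
  · simp only [flightField]
    rw [dist_eq_norm, ← smul_sub, norm_smul, norm_neg, norm_pow, Real.norm_eq_abs, sq_abs]
    calc ε ^ 2 * ‖_‖ ≤ ε ^ 2 * (C * ‖u.1 - u'.1‖) := by
          gcongr; exact h.G_lip 0 (by norm_num) _ _ _
      _ = ε ^ 2 * C * dist u.1 u'.1 := by rw [dist_eq_norm]; ring
      _ ≤ max 1 (ε ^ 2 * C) * D := by
          gcongr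
          · exact le_max_right _ _
          · exact le_max_left _ _

theorem PotentialJet.exists_flight (h : PotentialJet ω w G C) (ε : ℝ) (φ : Torus m)
    (x₀ e : Space d) : ∃ x p, IsFlight ω (G 0) ε φ x₀ e x p ∧ ∀ t, Tendsto (fun n =>
      picardIter (flightField ω (G 0) ε φ) (x₀, e) n t) atTop (𝓝 (x t, p t)) := by
  have hc : Continuous (Function.uncurry (flightField ω (G 0) ε φ)) :=
    h.continuous_flightField.comp (f := fun q : ℝ × (Space d × Space d) => (ε, φ, q.1, q.2))
      (by fun_prop)
  obtain ⟨u, hu, hu0, hu'⟩ := exists_tendsto_picardIter hc (h.lipschitz_flightField ε φ) (x₀, e)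
  refine ⟨fun t => (u t).1, fun t => (u t).2, ⟨by simp [hu0], by simp [hu0],
    fun t => (hu' t).fst, fun t => (hu' t).snd⟩, hu⟩

/-- The equations are assumed only from time `a` on, so that a flight can be compared with the free
motion that solves them only after the exit from the scatterer. -/
theorem PotentialJet.flight_unique (h : PotentialJet ω w G C) {ε : ℝ} {φ : Torus m} {a : ℝ}
    {x p x' p' : ℝ → Space d} (hx : ∀ t ≥ a, HasDerivAt x (p t) t)
    (hp : ∀ t ≥ a, HasDerivAt p (-(ε ^ 2) • G 0 (x t) (φ + toTorus ((ε * t) • ω))) t)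
    (hx' : ∀ t ≥ a, HasDerivAt x' (p' t) t)
    (hp' : ∀ t ≥ a, HasDerivAt p' (-(ε ^ 2) • G 0 (x' t) (φ + toTorus ((ε * t) • ω))) t)
    (h0 : x a = x' a) (h1 : p a = p' a) (t : ℝ) (ht : a ≤ t) : x t = x' t ∧ p t = p' t := by
  have := ODE_solution_unique (f := fun t => (x t, p t)) (g := fun t => (x' t, p' t))
    (a := a) (b := t) (h.lipschitz_flightField ε φ)
    (fun s hs => ((hx s hs.1).prodMk (hp s hs.1)).continuousAt.continuousWithinAt)
    (fun s hs => ((hx s hs.1).prodMk (hp s hs.1)).hasDerivWithinAt)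
    (fun s hs => ((hx' s hs.1).prodMk (hp' s hs.1)).continuousAt.continuousWithinAt)
    (fun s hs => ((hx' s hs.1).prodMk (hp' s hs.1)).hasDerivWithinAt)
    (by simp [h0, h1]) (right_mem_Icc.2 ht)
  simpa using this

/-- The straight line through `b` with direction `e`, entering the scatterer at time `0`. -/
noncomputable def line (b e : Space d) (t : ℝ) : Space d := b + (t - 1 / 2) • e

theorem line_zero (b e : Space d) : line b e 0 = b - (1 / 2 : ℝ) • e := by
  simp [line, sub_eq_add_neg]

theorem inner_line {b e : Space d} (he : ‖e‖ = 1) (hb : inner ℝ e b = 0) (t : ℝ) :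
    inner ℝ e (line b e t) = t - 1 / 2 := by
  rw [line, inner_add_right, hb, real_inner_smul_right, real_inner_self_eq_norm_sq, he]; ring

theorem norm_ge_of_inner {e y : Space d} (he : ‖e‖ = 1) {r : ℝ} (hr : r ≤ |inner ℝ e y|) :
    r ≤ ‖y‖ := by
  have := abs_real_inner_le_norm e y
  rw [he, one_mul] at this
  exact hr.trans this

namespace IsFlight

variable {ε A : ℝ} {φ : Torus m} {b e : Space d} {x p : ℝ → Space d}
  {G₀ : Space d → Torus m → Space d}

theorem norm_p_sub_le (hf : IsFlight ω G₀ ε φ (line b e 0) e x p)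
    (hA : ∀ y φ, ‖G₀ y φ‖ ≤ A) {t : ℝ} (ht : 0 ≤ t) : ‖p t - e‖ ≤ ε ^ 2 * A * t := by
  have h1 := norm_image_sub_le_of_norm_deriv_le_segment' (f := p) (a := 0) (b := t)
    (C := ε ^ 2 * A) (fun s _ => (hf.hp s).hasDerivWithinAt) (fun s _ => by
      rw [norm_smul, norm_neg, norm_pow, Real.norm_eq_abs, sq_abs]
      gcongr
      exact hA _ _) t (right_mem_Icc.2 ht)
  simpa [hf.p_zero] using h1

theorem norm_x_sub_le (hf : IsFlight ω G₀ ε φ (line b e 0) e x p)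
    (hA : ∀ y φ, ‖G₀ y φ‖ ≤ A) {t : ℝ} (ht : 0 ≤ t) :
    ‖x t - line b e t‖ ≤ ε ^ 2 * A * t * t := by
  have hA0 : 0 ≤ A := (norm_nonneg _).trans (hA 0 0)
  have hl : ∀ s, HasDerivAt (line b e) e s := fun s => by
    have := (((hasDerivAt_id s).sub_const (1 / 2 : ℝ)).smul_const e).const_add b
    rwa [one_smul] at this
  have h1 := norm_image_sub_le_of_norm_deriv_le_segment' (f := fun s => x s - line b e s) (a := 0)
    (b := t) (C := ε ^ 2 * A * t) (fun s _ => ((hf.hx s).sub (hl s)).hasDerivWithinAt)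
    (fun s hs => (hf.norm_p_sub_le hA hs.1).trans (by gcongr; exact hs.2.le)) t (right_mem_Icc.2 ht)
  simpa [hf.x_zero] using h1

/-- Up to time `2` the velocity changes by at most `2 ε² A ≤ 1/6`, so its component along `e` stays
positive. -/
theorem inner_p_two_pos (hf : IsFlight ω G₀ ε φ (line b e 0) e x p)
    (hA : ∀ y φ, ‖G₀ y φ‖ ≤ A) (he : ‖e‖ = 1) (hε : 12 * (ε ^ 2 * A) ≤ 1) :
    0 < inner ℝ e (p 2) := by
  have h1 := hf.norm_p_sub_le hA (t := 2) (by norm_num)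
  have h2 := abs_real_inner_le_norm e (p 2 - e)
  rw [inner_sub_right, real_inner_self_eq_norm_sq, he, one_mul] at h2
  have := (abs_le.1 (h2.trans h1)).1
  linarith

/-- At time `2` the straight line has height `3/2` along `e`, and the deviation is at most `4 ε² A ≤
1/3`. -/
theorem inner_x_two_gt (hf : IsFlight ω G₀ ε φ (line b e 0) e x p)
    (hA : ∀ y φ, ‖G₀ y φ‖ ≤ A) (he : ‖e‖ = 1) (hb : inner ℝ e b = 0)
    (hε : 12 * (ε ^ 2 * A) ≤ 1) : 1 / 2 < inner ℝ e (x 2) := by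
  have h1 := hf.norm_x_sub_le hA (t := 2) (by norm_num)
  have h2 := abs_real_inner_le_norm e (x 2 - line b e 2)
  rw [inner_sub_right, inner_line he hb, he, one_mul] at h2
  have := (abs_le.1 (h2.trans h1)).1
  linarith

/-- After time `2` the particle has left the scatterer for good. -/
theorem eq_of_two_le (h : PotentialJet ω w G C) (hf : IsFlight ω (G 0) ε φ (line b e 0) e x p)
    (hA : ∀ y φ, ‖G 0 y φ‖ ≤ A) (he : ‖e‖ = 1) (hb : inner ℝ e b = 0)
    (hε : 12 * (ε ^ 2 * A) ≤ 1) {t : ℝ} (ht : 2 ≤ t) :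
    p t = p 2 ∧ 1 / 2 ≤ ‖x t‖ := by
  have h1 := hf.inner_p_two_pos hA he hε
  have h2 := hf.inner_x_two_gt hA he hb hε
  have hout : ∀ s ≥ (2 : ℝ), 1 / 2 ≤ ‖x 2 + (s - 2) • p 2‖ := fun s hs => by
    refine norm_ge_of_inner he (le_trans ?_ (le_abs_self _))
    rw [inner_add_right, real_inner_smul_right]
    have : 0 ≤ (s - 2) * inner ℝ e (p 2) := mul_nonneg (by linarith) h1.le
    linarith
  -- From time `2` on, position and velocity both point outwards along `e`, so the free motion
  -- avoids the support and solves the equation; by uniqueness it is the flight.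
  have := h.flight_unique (a := 2) (fun t _ => hf.hx t) (fun t _ => hf.hp t)
    (x' := fun s => x 2 + (s - 2) • p 2) (p' := fun _ => p 2)
    (fun s _ => by
      simpa using (((hasDerivAt_id s).sub_const (2 : ℝ)).smul_const (p 2)).const_add (x 2))
    (fun s hs => by
      rw [h.G_supp 0 (by norm_num) _ _ (hout s hs), smul_zero]
      exact hasDerivAt_const _ _)
    (by simp) rfl t ht
  exact ⟨this.2, by rw [this.1]; exact hout t ht⟩

theorem continuous_x (hf : IsFlight ω G₀ ε φ (line b e 0) e x p) : Continuous x :=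
  continuous_iff_continuousAt.2 fun t => (hf.hx t).continuousAt

end IsFlight

theorem PotentialJet.continuous_G_comp (h : PotentialJet ω w G C) {k : ℕ} (hk : k ≤ 3)
    {T : Type*} [TopologicalSpace T] {x : T → Space d} {φ : T → Torus m} (hx : Continuous x)
    (hφ : Continuous φ) : Continuous fun t => G k (x t) (φ t) :=
  (h.G_cont k hk).comp (hx.prodMk hφ)

theorem PotentialJet.continuous_w_comp (h : PotentialJet ω w G C) {k : ℕ} (hk : k ≤ 4)
    {T : Type*} [TopologicalSpace T] {x : T → Space d} {φ : T → Torus m} (hx : Continuous x)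
    (hφ : Continuous φ) : Continuous fun t => w k (x t) (φ t) :=
  (h.w_cont k hk).comp (hx.prodMk hφ)

theorem continuous_phase (ω : Space m) (φ : Torus m) (ε : ℝ) :
    Continuous fun t : ℝ => φ + toTorus ((ε * t) • ω) :=
  continuous_const.add (continuous_toTorus.comp (by fun_prop))

namespace IsFlight

variable {ε A : ℝ} {φ : Torus m} {b e : Space d} {x p : ℝ → Space d}

theorem p_two (h : PotentialJet ω w G C) (hf : IsFlight ω (G 0) ε φ (line b e 0) e x p) :
    p 2 = e - ε ^ 2 • ∫ t in (0 : ℝ)..2, G 0 (x t) (φ + toTorus ((ε * t) • ω)) := by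
  have hc : Continuous fun t => G 0 (x t) (φ + toTorus ((ε * t) • ω)) :=
    h.continuous_G_comp (by norm_num) hf.continuous_x (continuous_phase ω φ ε)
  have h1 := intervalIntegral.integral_eq_sub_of_hasDerivAt (a := 0) (b := 2)
    (fun t _ => hf.hp t) ((hc.const_smul (-(ε ^ 2))).intervalIntegrable 0 2)
  rw [intervalIntegral.integral_smul, hf.p_zero, neg_smul] at h1
  rw [sub_eq_add_neg e, h1]; abel

/-- Duhamel's formula. The kernel `max (t - r) 0` extends the integral from `[0, t]` to the fixed
interval `[0, 2]`, which makes the deviation a parametric integral and allows symmetrisation in `t`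
and `r` later. -/
theorem x_eq (h : PotentialJet ω w G C) (hf : IsFlight ω (G 0) ε φ (line b e 0) e x p)
    {t : ℝ} (ht : t ∈ Icc (0 : ℝ) 2) :
    x t = line b e t + ε ^ 2 • -∫ r in (0 : ℝ)..2,
      max (t - r) 0 • G 0 (x r) (φ + toTorus ((ε * r) • ω)) := by
  have hc : Continuous fun t => G 0 (x t) (φ + toTorus ((ε * t) • ω)) :=
    h.continuous_G_comp (by norm_num) hf.continuous_x (continuous_phase ω φ ε)
  -- In the derivative of `(t - r) p r + x r` the two velocity terms cancel and only the force
  -- remains.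
  have h1 := intervalIntegral.integral_eq_sub_of_hasDerivAt (a := 0) (b := t)
    (f := fun r => (t - r) • p r + x r)
    (f' := fun r => (-(ε ^ 2)) • (t - r) • G 0 (x r) (φ + toTorus ((ε * r) • ω)))
    (fun r _ => by
      refine ((((hasDerivAt_id r).const_sub t).smul (hf.hp r)).add (hf.hx r)).congr_deriv ?_
      simp only [id]
      module)
    ((((continuous_const.sub continuous_id).smul hc).const_smul (-(ε ^ 2))).intervalIntegrable 0 t)
  have hm : Continuous fun r => max (t - r) 0 • G 0 (x r) (φ + toTorus ((ε * r) • ω)) :=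
    ((continuous_const.sub continuous_id).max continuous_const).smul hc
  have h2 : ∫ r in (0 : ℝ)..2, max (t - r) 0 • G 0 (x r) (φ + toTorus ((ε * r) • ω)) =
      ∫ r in (0 : ℝ)..t, (t - r) • G 0 (x r) (φ + toTorus ((ε * r) • ω)) := by
    rw [← intervalIntegral.integral_add_adjacent_intervals (b := t)
      (hm.intervalIntegrable _ _) (hm.intervalIntegrable _ _)]
    have e1 : ∫ r in (0 : ℝ)..t, max (t - r) 0 • G 0 (x r) (φ + toTorus ((ε * r) • ω)) =
        ∫ r in (0 : ℝ)..t, (t - r) • G 0 (x r) (φ + toTorus ((ε * r) • ω)) := by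
      refine intervalIntegral.integral_congr fun r hr => ?_
      rw [uIcc_of_le ht.1] at hr
      simp only [max_eq_left (sub_nonneg.2 hr.2)]
    have e2 : ∫ r in t..2, max (t - r) 0 • G 0 (x r) (φ + toTorus ((ε * r) • ω)) = 0 := by
      refine intervalIntegral.integral_zero_ae (Eventually.of_forall fun r hr => ?_)
      replace hr := uIoc_subset_uIcc hr
      rw [uIcc_of_le ht.2] at hr
      simp only [max_eq_right (sub_nonpos.2 hr.1), zero_smul]
    rw [e1, e2, add_zero]
  rw [h2]
  rw [intervalIntegral.integral_smul] at h1
  simp only [sub_self, zero_smul, zero_add, sub_zero, hf.p_zero, hf.x_zero] at h1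
  have h3 : x t = (-(ε ^ 2)) • (∫ r in (0 : ℝ)..t, (t - r) • G 0 (x r)
      (φ + toTorus ((ε * r) • ω))) + (t • e + line b e 0) := by rw [h1]; abel
  rw [h3]
  simp only [line]
  module

/-- Along the flight `½‖p‖² + ε² W` has derivative `ε³ ∂_τ W`, and `W` vanishes at times `0` and
`2`. The kinetic energy is thus controlled by one more power of `ε` than the force. -/
theorem energy (h : PotentialJet ω w G C) (hf : IsFlight ω (G 0) ε φ (line b e 0) e x p)
    (hA : ∀ y φ, ‖G 0 y φ‖ ≤ A) (he : ‖e‖ = 1) (hb : inner ℝ e b = 0)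
    (hε : 12 * (ε ^ 2 * A) ≤ 1) :
    (1 / 2 : ℝ) * (‖p 2‖ ^ 2 - 1) =
      ε ^ 3 * ∫ t in (0 : ℝ)..2, w 1 (x t) (φ + toTorus ((ε * t) • ω)) := by
  have hc : Continuous fun t => w 1 (x t) (φ + toTorus ((ε * t) • ω)) :=
    h.continuous_w_comp (by norm_num) hf.continuous_x (continuous_phase ω φ ε)
  have h1 := intervalIntegral.integral_eq_sub_of_hasDerivAt (a := 0) (b := 2)
    (f := fun t => (1 / 2 : ℝ) * ‖p t‖ ^ 2 + ε ^ 2 * w 0 (x t) (φ + toTorus ((ε * t) • ω)))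
    (f' := fun t => ε ^ 3 * w 1 (x t) (φ + toTorus ((ε * t) • ω)))
    (fun t _ => by
      refine (((hf.hp t).norm_sq.const_mul (1 / 2 : ℝ)).add
        ((h.w_chain x (p t) φ ε t (hf.hx t)).const_mul (ε ^ 2))).congr_deriv ?_
      rw [real_inner_smul_right, real_inner_comm (p t)]
      ring)
    ((hc.const_mul _).intervalIntegrable _ _)
  have h2 : w 0 (x 2) (φ + toTorus ((ε * 2) • ω)) = 0 :=
    h.w_supp 0 (by norm_num) _ _ (hf.eq_of_two_le h hA he hb hε le_rfl).2
  have h3 : w 0 (x 0) (φ + toTorus ((ε * 0) • ω)) = 0 := by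
    refine h.w_supp 0 (by norm_num) _ _ (norm_ge_of_inner he ?_)
    rw [hf.x_zero, inner_line he hb]; norm_num
  rw [intervalIntegral.integral_const_mul, h2, h3, hf.p_zero, he] at h1
  rw [h1]; ring

end IsFlight

end

/-! ### Expansion of one flight in powers of the inverse speed -/

section

/-! ### Taylor estimates -/

/-- Mean value inequality on `[0, t]`; the factor `1 / (n + 1)` is given up so that the lemma
iterates with an unchanged constant. -/
theorem norm_le_mul_pow_succ {F : Type*} [NormedAddCommGroup F] [NormedSpace ℝ F] {f f' : ℝ → F}
    {K T : ℝ} {n : ℕ} (hK : 0 ≤ K) (hf : ∀ t, HasDerivAt f (f' t) t) (h0 : f 0 = 0)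
    (hb : ∀ t, 0 ≤ t → t ≤ T → ‖f' t‖ ≤ K * t ^ n) (t : ℝ) (ht : 0 ≤ t) (htT : t ≤ T) :
    ‖f t‖ ≤ K * t ^ (n + 1) := by
  have h1 := norm_image_sub_le_of_norm_deriv_le_segment' (f := f) (a := 0) (b := t)
    (C := K * t ^ n) (fun s _ => (hf s).hasDerivWithinAt)
    (fun s hs => (hb s hs.1 (hs.2.le.trans htT)).trans (by gcongr; exacts [hs.1, hs.2.le])) t
    (right_mem_Icc.2 ht)
  simpa [h0, pow_succ, mul_assoc] using h1

theorem norm_sub_le_of_hasDerivAt {F : Type*} [NormedAddCommGroup F] [NormedSpace ℝ F]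
    {f f' : ℝ → F} {K : ℝ} (hK : 0 ≤ K) (hf : ∀ t, HasDerivAt f (f' t) t)
    (hb : ∀ t, ‖f' t‖ ≤ K) (t : ℝ) (ht : 0 ≤ t) : ‖f t - f 0‖ ≤ K * t := by
  have := norm_le_mul_pow_succ (f := fun t => f t - f 0) (n := 0) (T := t) hK
    (fun t => (hf t).sub_const _) (by simp) (fun s _ _ => by simpa using hb s) t ht le_rfl
  simpa using this

theorem norm_sub_sub_le_of_hasDerivAt {F : Type*} [NormedAddCommGroup F] [NormedSpace ℝ F]
    {f f' f'' : ℝ → F} {K : ℝ} (hK : 0 ≤ K) (hf : ∀ t, HasDerivAt f (f' t) t)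
    (hf' : ∀ t, HasDerivAt f' (f'' t) t) (hb : ∀ t, ‖f'' t‖ ≤ K) (t : ℝ) (ht : 0 ≤ t) :
    ‖f t - f 0 - t • f' 0‖ ≤ K * t ^ 2 := by
  refine norm_le_mul_pow_succ (f := fun t => f t - f 0 - t • f' 0) (n := 1) (T := t) hK
    (fun t => ((hf t).sub_const _).sub ((hasDerivAt_id t).smul_const (f' 0))) (by simp)
    (fun s hs _ => ?_) t ht le_rfl
  simpa using norm_sub_le_of_hasDerivAt hK hf' hb s hs

theorem norm_intervalIntegral_le {F : Type*} [NormedAddCommGroup F] [NormedSpace ℝ F] {f : ℝ → F}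
    {K : ℝ} (h : ∀ t ∈ Icc (0 : ℝ) 2, ‖f t‖ ≤ K) : ‖∫ t in (0 : ℝ)..2, f t‖ ≤ 2 * K := by
  have := intervalIntegral.norm_integral_le_of_norm_le_const (a := 0) (b := 2) (f := f) (C := K)
    fun t ht => h t (by rw [uIoc_of_le (by norm_num)] at ht; exact ⟨ht.1.le, ht.2⟩)
  rw [sub_zero, abs_of_pos (by norm_num : (0 : ℝ) < 2)] at this
  linarith

variable {d m : ℕ} {ω : Space m} {w : ℕ → Space d → Torus m → ℝ}
  {G : ℕ → Space d → Torus m → Space d} {C : ℝ}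

theorem continuous_line (b e : Space d) : Continuous (line b e) := by
  unfold line; fun_prop

/-! ### Coefficients of the high velocity expansion, in the frame of the scatterer -/

/-- `∫ t^k ∂_τ^{k+1} W` along the straight line. -/
noncomputable def workMoment (w : ℕ → Space d → Torus m → ℝ) (k : ℕ) (b e : Space d) (φ : Torus m) : ℝ :=
  ∫ t in (0 : ℝ)..2, t ^ k * w (k + 1) (line b e t) φ

/-- `∫ t^k ∇ ∂_τ^k W` along the straight line. -/
noncomputable def forceMoment (G : ℕ → Space d → Torus m → Space d) (k : ℕ) (b e : Space d)
    (φ : Torus m) : Space d :=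
  ∫ t in (0 : ℝ)..2, t ^ k • G k (line b e t) φ

/-- The deviation from the straight line: its leading term (`k = 0`) and its next to leading term
(`k = 1`). -/
noncomputable def deviation (G : ℕ → Space d → Torus m → Space d) (k : ℕ) (b e : Space d)
    (φ : Torus m) (t : ℝ) : Space d :=
  -∫ r in (0 : ℝ)..2, (max (t - r) 0 * r ^ k) • G k (line b e r) φ

/-- The leading part of the work that is quadratic in the potential. -/
noncomputable def work₂ (G : ℕ → Space d → Torus m → Space d) (b e : Space d) (φ : Torus m) : ℝ :=
  ∫ t in (0 : ℝ)..2, inner ℝ (G 1 (line b e t) φ) (deviation G 0 b e φ t)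

/-- The next to leading part of the work that is quadratic in the potential. -/
noncomputable def work₃ (G : ℕ → Space d → Torus m → Space d) (b e : Space d) (φ : Torus m) : ℝ :=
  ∫ t in (0 : ℝ)..2, (t * inner ℝ (G 2 (line b e t) φ) (deviation G 0 b e φ t) +
    inner ℝ (G 1 (line b e t) φ) (deviation G 1 b e φ t))

namespace PotentialJet

theorem G_taylor (h : PotentialJet ω w G C) {k : ℕ} (hk : k ≤ 1) (y : Space d) (φ : Torus m)
    {θ : ℝ} (hθ : 0 ≤ θ) :
    ‖G k y (φ + toTorus (θ • ω)) - G k y φ - θ • G (k + 1) y φ‖ ≤ C * θ ^ 2 := by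
  have := norm_sub_sub_le_of_hasDerivAt h.nonneg (h.G_time k (by omega) y φ)
    (h.G_time (k + 1) (by omega) y φ) (fun t => h.G_bound _ (by omega) _ _) θ hθ
  simpa [toTorus_zero] using this

/-- Only the Lipschitz bound on `G 1` enters; the remainder is differentiated along the segment from
`y` to `y + u`. -/
theorem w_taylor_space (h : PotentialJet ω w G C) (y u : Space d) (φ : Torus m) :
    |w 1 (y + u) φ - w 1 y φ - inner ℝ (G 1 y φ) u| ≤ C * ‖u‖ ^ 2 := by
  have hu : ∀ s : ℝ, HasDerivAt (fun s : ℝ => y + s • u) u s := fun s => by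
    simpa using ((hasDerivAt_id s).smul_const u).const_add y
  have h1 : ∀ s : ℝ, HasDerivAt
      (fun s : ℝ => w 1 (y + s • u) φ - w 1 y φ - s * inner ℝ (G 1 y φ) u)
      (inner ℝ (G 1 (y + s • u) φ) u - inner ℝ (G 1 y φ) u) s := fun s => by
    have := (h.w_grad 1 (by norm_num) (y + s • u) φ).hasFDerivAt.comp_hasDerivAt s (hu s)
    refine ((this.sub_const _).sub ((hasDerivAt_id s).mul_const _)).congr_deriv ?_
    simp [InnerProductSpace.toDual_apply_apply]
  have := norm_le_mul_pow_succ (n := 1) (T := 1) (K := C * ‖u‖ ^ 2)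
    (mul_nonneg h.nonneg (sq_nonneg _)) h1 (by simp) (fun s hs _ => by
      rw [← inner_sub_left]
      refine (norm_inner_le_norm _ _).trans ?_
      have h2 := h.G_lip 1 le_rfl (y + s • u) y φ
      rw [add_sub_cancel_left, norm_smul, Real.norm_eq_abs, abs_of_nonneg hs] at h2
      nlinarith [norm_nonneg u]) 1 zero_le_one le_rfl
  simpa using this

theorem deviation_bound (h : PotentialJet ω w G C) {k : ℕ} (hk : k ≤ 1) (b e : Space d)
    (φ : Torus m) {t : ℝ} (ht : t ∈ Icc (0 : ℝ) 2) : ‖deviation G k b e φ t‖ ≤ 8 * C := by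
  rw [deviation, norm_neg]
  refine (norm_intervalIntegral_le (K := 4 * C) fun r hr => ?_).trans (by linarith)
  rw [norm_smul, norm_mul, norm_pow, Real.norm_of_nonneg (le_max_right _ _),
    Real.norm_of_nonneg hr.1]
  have h1 : max (t - r) 0 ≤ 2 := max_le (by linarith [ht.2, hr.1]) (by norm_num)
  have h2 : r ^ k ≤ 2 := by interval_cases k <;> [norm_num; simpa using hr.2]
  have h3 := h.G_bound k (by omega) (line b e r) φ
  have h4 : max (t - r) 0 * r ^ k ≤ 2 * 2 :=
    mul_le_mul h1 h2 (pow_nonneg hr.1 _) (by norm_num)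
  calc _ ≤ 2 * 2 * C := mul_le_mul h4 h3 (norm_nonneg _) (by norm_num)
    _ = 4 * C := by ring

theorem continuous_deviation (h : PotentialJet ω w G C) {k : ℕ} (hk : k ≤ 1) (b e : Space d)
    (φ : Torus m) : Continuous (deviation G k b e φ) := by
  have hc : Continuous fun r => G k (line b e r) φ :=
    h.continuous_G_comp (by omega) (continuous_line b e) continuous_const
  refine (intervalIntegral.continuous_parametric_intervalIntegral_of_continuous' ?_ 0 2).neg
  exact (by fun_prop : Continuous fun q : ℝ × ℝ => max (q.1 - q.2) 0 * q.2 ^ k).smul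
    (hc.comp continuous_snd)

end PotentialJet

namespace IsFlight

variable {ε : ℝ} {φ : Torus m} {b e : Space d} {x p : ℝ → Space d}

theorem norm_x_sub_line_le (h : PotentialJet ω w G C)
    (hf : IsFlight ω (G 0) ε φ (line b e 0) e x p) {t : ℝ} (ht : t ∈ Icc (0 : ℝ) 2) :
    ‖x t - line b e t‖ ≤ 4 * C * ε ^ 2 := by
  have := hf.norm_x_sub_le (h.G_bound 0 (by norm_num)) ht.1
  have h2 : t * t ≤ 4 := by nlinarith [ht.1, ht.2]
  have h3 := h.nonneg
  calc _ ≤ _ := this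
    _ = ε ^ 2 * C * (t * t) := by ring
    _ ≤ ε ^ 2 * C * 4 := by gcongr
    _ = _ := by ring

/-- Two sources of error: the position is off the line by `4 C ε²`, which costs a Lipschitz constant
`C`, and the phase shift `ε t ≤ 2 ε` is expanded to first order. -/
theorem norm_force_sub_le (h : PotentialJet ω w G C)
    (hf : IsFlight ω (G 0) ε φ (line b e 0) e x p) (hε : 0 ≤ ε) {t : ℝ} (ht : t ∈ Icc (0 : ℝ) 2) :
    ‖G 0 (x t) (φ + toTorus ((ε * t) • ω)) - G 0 (line b e t) φ - (ε * t) • G 1 (line b e t) φ‖ ≤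
      (4 * C ^ 2 + 4 * C) * ε ^ 2 := by
  have h1 := h.G_lip 0 (by norm_num) (x t) (line b e t) (φ + toTorus ((ε * t) • ω))
  have h2 := h.G_taylor (k := 0) (by norm_num) (line b e t) φ (mul_nonneg hε ht.1)
  have h3 := hf.norm_x_sub_line_le h ht
  have hC := h.nonneg
  have h4 : C * (ε * t) ^ 2 ≤ C * (4 * ε ^ 2) := by
    have : t ^ 2 ≤ 4 := by nlinarith [ht.1, ht.2]
    rw [mul_pow]; nlinarith [mul_nonneg hC (sq_nonneg ε)]
  have h5 : G 0 (x t) (φ + toTorus ((ε * t) • ω)) - G 0 (line b e t) φ -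
      (ε * t) • G 1 (line b e t) φ = (G 0 (x t) (φ + toTorus ((ε * t) • ω)) -
      G 0 (line b e t) (φ + toTorus ((ε * t) • ω))) + (G 0 (line b e t)
      (φ + toTorus ((ε * t) • ω)) - G 0 (line b e t) φ - (ε * t) • G 1 (line b e t) φ) := by abel
  rw [h5]
  refine (norm_add_le _ _).trans ?_
  simp only [zero_add] at h2
  nlinarith [mul_le_mul_of_nonneg_left h3 hC]

theorem norm_impulse_sub_le (h : PotentialJet ω w G C)
    (hf : IsFlight ω (G 0) ε φ (line b e 0) e x p) (hε : 0 ≤ ε) :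
    ‖(∫ t in (0 : ℝ)..2, G 0 (x t) (φ + toTorus ((ε * t) • ω))) - forceMoment G 0 b e φ -
      ε • forceMoment G 1 b e φ‖ ≤ 2 * ((4 * C ^ 2 + 4 * C) * ε ^ 2) := by
  have hc : Continuous fun t => G 0 (x t) (φ + toTorus ((ε * t) • ω)) :=
    h.continuous_G_comp (by norm_num) hf.continuous_x (continuous_phase ω φ ε)
  have hc0 : Continuous fun t => G 0 (line b e t) φ :=
    h.continuous_G_comp (by norm_num) (continuous_line b e) continuous_const
  have hc1 : Continuous fun t => G 1 (line b e t) φ :=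
    h.continuous_G_comp (by norm_num) (continuous_line b e) continuous_const
  have hc1' : Continuous fun t : ℝ => ε • t ^ 1 • G 1 (line b e t) φ :=
    ((continuous_pow 1).smul hc1).const_smul ε
  have e1 : (∫ t in (0 : ℝ)..2, G 0 (x t) (φ + toTorus ((ε * t) • ω))) - forceMoment G 0 b e φ -
      ε • forceMoment G 1 b e φ = ∫ t in (0 : ℝ)..2, (G 0 (x t) (φ + toTorus ((ε * t) • ω)) -
        G 0 (line b e t) φ - ε • t ^ 1 • G 1 (line b e t) φ) := by
    rw [intervalIntegral.integral_sub ((hc.fun_sub hc0).intervalIntegrable _ _)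
      (hc1'.intervalIntegrable _ _), intervalIntegral.integral_sub (hc.intervalIntegrable _ _)
      (hc0.intervalIntegrable _ _), intervalIntegral.integral_smul]
    simp [forceMoment]
  rw [e1]
  refine norm_intervalIntegral_le fun t ht => ?_
  have := hf.norm_force_sub_le h hε ht
  simpa only [pow_one, mul_smul] using this

/-- The rescaled deviation `z = ε⁻² (x - line)`. -/
theorem exists_deviation (h : PotentialJet ω w G C)
    (hf : IsFlight ω (G 0) ε φ (line b e 0) e x p) (hε : 0 < ε) {t : ℝ} (ht : t ∈ Icc (0 : ℝ) 2) :
    ∃ z, x t = line b e t + ε ^ 2 • z ∧ ‖z‖ ≤ 4 * C ∧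
      ‖z - deviation G 0 b e φ t - ε • deviation G 1 b e φ t‖ ≤
        4 * ((4 * C ^ 2 + 4 * C) * ε ^ 2) := by
  have hc : Continuous fun t => G 0 (x t) (φ + toTorus ((ε * t) • ω)) :=
    h.continuous_G_comp (by norm_num) hf.continuous_x (continuous_phase ω φ ε)
  have hc0 : Continuous fun t => G 0 (line b e t) φ :=
    h.continuous_G_comp (by norm_num) (continuous_line b e) continuous_const
  have hc1 : Continuous fun t => G 1 (line b e t) φ :=
    h.continuous_G_comp (by norm_num) (continuous_line b e) continuous_const
  have hm : Continuous fun r => max (t - r) 0 :=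
    (continuous_const.sub continuous_id).max continuous_const
  have hm1 : Continuous fun r : ℝ => (max (t - r) 0 * r ^ 1) • G 1 (line b e r) φ :=
    (hm.mul (continuous_pow 1)).smul hc1
  have hm0 : Continuous fun r : ℝ => (max (t - r) 0 * r ^ 0) • G 0 (line b e r) φ :=
    (hm.mul (continuous_pow 0)).smul hc0
  have hx := hf.x_eq h ht
  refine ⟨_, hx, ?_, ?_⟩
  · have h1 := hf.norm_x_sub_line_le h ht
    rw [hx, add_sub_cancel_left, norm_smul, norm_pow, Real.norm_of_nonneg hε.le] at h1
    have h2 : (0 : ℝ) < ε ^ 2 := by positivity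
    rw [mul_comm] at h1
    exact le_of_mul_le_mul_right h1 h2
  · have e1 : -(∫ r in (0 : ℝ)..2, max (t - r) 0 • G 0 (x r) (φ + toTorus ((ε * r) • ω))) -
        deviation G 0 b e φ t - ε • deviation G 1 b e φ t =
        -∫ r in (0 : ℝ)..2, (max (t - r) 0 • G 0 (x r) (φ + toTorus ((ε * r) • ω)) -
          (max (t - r) 0 * r ^ 0) • G 0 (line b e r) φ -
          ε • (max (t - r) 0 * r ^ 1) • G 1 (line b e r) φ) := by
      rw [intervalIntegral.integral_sub (((hm.fun_smul hc).fun_sub hm0).intervalIntegrable 0 2)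
        ((hm1.fun_const_smul ε).intervalIntegrable 0 2),
        intervalIntegral.integral_sub ((hm.fun_smul hc).intervalIntegrable 0 2)
        (hm0.intervalIntegrable 0 2), intervalIntegral.integral_smul]
      simp only [deviation]
      module
    rw [e1, norm_neg]
    refine (norm_intervalIntegral_le (K := 2 * ((4 * C ^ 2 + 4 * C) * ε ^ 2))
      fun r hr => ?_).trans (by linarith)
    have h1 := hf.norm_force_sub_le h hε.le hr
    have h2 : max (t - r) 0 ≤ 2 := max_le (by linarith [ht.2, hr.1]) (by norm_num)
    have e2 : max (t - r) 0 • G 0 (x r) (φ + toTorus ((ε * r) • ω)) -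
          (max (t - r) 0 * r ^ 0) • G 0 (line b e r) φ -
          ε • (max (t - r) 0 * r ^ 1) • G 1 (line b e r) φ = max (t - r) 0 •
        (G 0 (x r) (φ + toTorus ((ε * r) • ω)) - G 0 (line b e r) φ -
          (ε * r) • G 1 (line b e r) φ) := by module
    rw [e2, norm_smul, Real.norm_of_nonneg (le_max_right _ _)]
    exact mul_le_mul h2 h1 (norm_nonneg _) (by norm_num)

/-- The constant in the expansion of the work. -/
noncomputable def _root_.SoftLorentz.workConst (C : ℝ) : ℝ :=
  16 * C ^ 3 + 32 * C ^ 2 + 12 * C * (4 * C ^ 2 + 4 * C)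

/-- On the straight line the phase is left unexpanded: four derivatives of `W` would give only a
little-o remainder there, while the effect of the deviation alone is controlled up to `O(ε⁴)`. -/
theorem abs_power_sub_le (h : PotentialJet ω w G C)
    (hf : IsFlight ω (G 0) ε φ (line b e 0) e x p) (hε : 0 < ε) (hε1 : ε ≤ 1) {t : ℝ}
    (ht : t ∈ Icc (0 : ℝ) 2) :
    |w 1 (x t) (φ + toTorus ((ε * t) • ω)) - w 1 (line b e t) (φ + toTorus ((ε * t) • ω)) -
      ε ^ 2 * inner ℝ (G 1 (line b e t) φ) (deviation G 0 b e φ t) -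
      ε ^ 3 * (t * inner ℝ (G 2 (line b e t) φ) (deviation G 0 b e φ t) +
        inner ℝ (G 1 (line b e t) φ) (deviation G 1 b e φ t))| ≤ workConst C * ε ^ 4 := by
  have hC := h.nonneg
  obtain ⟨z, hx, hz, hz'⟩ := hf.exists_deviation h hε ht
  set q := line b e t
  set θ := φ + toTorus ((ε * t) • ω)
  set z₀ := deviation G 0 b e φ t
  set z₁ := deviation G 1 b e φ t
  have hz₁ : ‖z₁‖ ≤ 8 * C := h.deviation_bound le_rfl b e φ ht
  have h1 := h.w_taylor_space q (ε ^ 2 • z) θ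
  rw [← hx, real_inner_smul_right, norm_smul, norm_pow, Real.norm_of_nonneg hε.le] at h1
  have h2 : ‖G 1 q θ - G 1 q φ - (ε * t) • G 2 q φ‖ ≤ 4 * C * ε ^ 2 := by
    refine (h.G_taylor (k := 1) le_rfl q φ (mul_nonneg hε.le ht.1)).trans ?_
    have : t ^ 2 ≤ 4 := by nlinarith [ht.1, ht.2]
    rw [mul_pow]; nlinarith [mul_nonneg hC (sq_nonneg ε)]
  -- The three terms are the error in the field, the error in the deviation, and the product of the
  -- two first order corrections, which is already of order `ε²`.
  have e1 : inner ℝ (G 1 q θ) z - inner ℝ (G 1 q φ) z₀ -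
      ε * (t * inner ℝ (G 2 q φ) z₀ + inner ℝ (G 1 q φ) z₁) =
      inner ℝ (G 1 q θ - G 1 q φ - (ε * t) • G 2 q φ) z +
      inner ℝ (G 1 q φ + (ε * t) • G 2 q φ) (z - z₀ - ε • z₁) +
      ε ^ 2 * (t * inner ℝ (G 2 q φ) z₁) := by
    simp only [inner_sub_left, inner_add_left, inner_sub_right, real_inner_smul_left,
      real_inner_smul_right]
    ring
  have b1 : |inner ℝ (G 1 q θ - G 1 q φ - (ε * t) • G 2 q φ) z| ≤ 4 * C * ε ^ 2 * (4 * C) :=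
    (abs_real_inner_le_norm _ _).trans (mul_le_mul h2 hz (norm_nonneg _) (by positivity))
  have b2 : |inner ℝ (G 1 q φ + (ε * t) • G 2 q φ) (z - z₀ - ε • z₁)| ≤
      3 * C * (4 * ((4 * C ^ 2 + 4 * C) * ε ^ 2)) := by
    refine (abs_real_inner_le_norm _ _).trans (mul_le_mul ?_ hz' (norm_nonneg _) (by positivity))
    refine (norm_add_le _ _).trans ?_
    rw [norm_smul, Real.norm_of_nonneg (mul_nonneg hε.le ht.1)]
    have g1 := h.G_bound 1 (by norm_num) q φ
    have g2 := h.G_bound 2 (by norm_num) q φ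
    have : ε * t ≤ 2 := by nlinarith [ht.1, ht.2]
    have := mul_le_mul this g2 (norm_nonneg _) (by norm_num)
    linarith
  have b3 : |ε ^ 2 * (t * inner ℝ (G 2 q φ) z₁)| ≤ ε ^ 2 * (2 * (C * (8 * C))) := by
    rw [abs_mul, abs_mul, abs_of_nonneg (sq_nonneg ε), abs_of_nonneg ht.1]
    have := (abs_real_inner_le_norm (G 2 q φ) z₁).trans
      (mul_le_mul (h.G_bound 2 (by norm_num) q φ) hz₁ (norm_nonneg _) hC)
    exact mul_le_mul_of_nonneg_left (mul_le_mul ht.2 this (abs_nonneg _) (by norm_num))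
      (sq_nonneg _)
  have h3 : |inner ℝ (G 1 q θ) z - inner ℝ (G 1 q φ) z₀ -
      ε * (t * inner ℝ (G 2 q φ) z₀ + inner ℝ (G 1 q φ) z₁)| ≤
      (32 * C ^ 2 + 12 * C * (4 * C ^ 2 + 4 * C)) * ε ^ 2 := by
    rw [e1]
    refine (abs_add_three _ _ _).trans ?_
    linarith
  have e2 : w 1 (x t) θ - w 1 q θ - ε ^ 2 * inner ℝ (G 1 q φ) z₀ -
      ε ^ 3 * (t * inner ℝ (G 2 q φ) z₀ + inner ℝ (G 1 q φ) z₁) =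
      (w 1 (x t) θ - w 1 q θ - ε ^ 2 * inner ℝ (G 1 q θ) z) +
      ε ^ 2 * (inner ℝ (G 1 q θ) z - inner ℝ (G 1 q φ) z₀ -
      ε * (t * inner ℝ (G 2 q φ) z₀ + inner ℝ (G 1 q φ) z₁)) := by ring
  rw [e2]
  refine (abs_add_le _ _).trans ?_
  rw [abs_mul, abs_of_nonneg (sq_nonneg ε)]
  have h4 : C * (ε ^ 2 * ‖z‖) ^ 2 ≤ C * (ε ^ 2 * (4 * C)) ^ 2 := by gcongr
  have h5 := mul_le_mul_of_nonneg_left h3 (sq_nonneg ε)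
  -- `16 C³` is the spatial Taylor remainder, `32 C²` collects the first and third errors bounded
  -- above, and the last summand is the second one.
  unfold workConst
  nlinarith

theorem abs_work_sub_le (h : PotentialJet ω w G C)
    (hf : IsFlight ω (G 0) ε φ (line b e 0) e x p) (hε : 0 < ε) (hε1 : ε ≤ 1) :
    |(∫ t in (0 : ℝ)..2, w 1 (x t) (φ + toTorus ((ε * t) • ω))) -
      (∫ t in (0 : ℝ)..2, w 1 (line b e t) (φ + toTorus ((ε * t) • ω))) -
      ε ^ 2 * work₂ G b e φ - ε ^ 3 * work₃ G b e φ| ≤ 2 * (workConst C * ε ^ 4) := by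
  have hc : Continuous fun t => w 1 (x t) (φ + toTorus ((ε * t) • ω)) :=
    h.continuous_w_comp (by norm_num) hf.continuous_x (continuous_phase ω φ ε)
  have hc0 : Continuous fun t => w 1 (line b e t) (φ + toTorus ((ε * t) • ω)) :=
    h.continuous_w_comp (by norm_num) (continuous_line b e) (continuous_phase ω φ ε)
  have hc1 : Continuous fun t => G 1 (line b e t) φ :=
    h.continuous_G_comp (by norm_num) (continuous_line b e) continuous_const
  have hc2 : Continuous fun t => G 2 (line b e t) φ :=
    h.continuous_G_comp (by norm_num) (continuous_line b e) continuous_const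
  have hd0 := h.continuous_deviation (k := 0) (by norm_num) b e φ
  have hd1 := h.continuous_deviation (k := 1) (by norm_num) b e φ
  have e1 : (∫ t in (0 : ℝ)..2, w 1 (x t) (φ + toTorus ((ε * t) • ω))) -
      (∫ t in (0 : ℝ)..2, w 1 (line b e t) (φ + toTorus ((ε * t) • ω))) -
      ε ^ 2 * work₂ G b e φ - ε ^ 3 * work₃ G b e φ =
      ∫ t in (0 : ℝ)..2, (w 1 (x t) (φ + toTorus ((ε * t) • ω)) -
      w 1 (line b e t) (φ + toTorus ((ε * t) • ω)) -
      ε ^ 2 * inner ℝ (G 1 (line b e t) φ) (deviation G 0 b e φ t) -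
      ε ^ 3 * (t * inner ℝ (G 2 (line b e t) φ) (deviation G 0 b e φ t) +
        inner ℝ (G 1 (line b e t) φ) (deviation G 1 b e φ t))) := by
    have i2 : Continuous fun t => ε ^ 2 * inner ℝ (G 1 (line b e t) φ) (deviation G 0 b e φ t) :=
      (hc1.inner hd0).const_mul _
    have i3 : Continuous fun t => ε ^ 3 * (t * inner ℝ (G 2 (line b e t) φ)
        (deviation G 0 b e φ t) + inner ℝ (G 1 (line b e t) φ) (deviation G 1 b e φ t)) :=
      ((continuous_id.mul (hc2.inner hd0)).add (hc1.inner hd1)).const_mul _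
    rw [intervalIntegral.integral_sub (((hc.fun_sub hc0).fun_sub i2).intervalIntegrable _ _)
      (i3.intervalIntegrable _ _), intervalIntegral.integral_sub
      ((hc.fun_sub hc0).intervalIntegrable _ _) (i2.intervalIntegrable _ _),
      intervalIntegral.integral_sub (hc.intervalIntegrable _ _) (hc0.intervalIntegrable _ _),
      intervalIntegral.integral_const_mul, intervalIntegral.integral_const_mul]
    rfl
  rw [e1, ← Real.norm_eq_abs]
  exact norm_intervalIntegral_le fun t ht => hf.abs_power_sub_le h hε hε1 ht

end IsFlight

/-- Taylor expansion of the work along the straight line. -/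
theorem PotentialJet.work_line_isLittleO (h : PotentialJet ω w G C) (b e : Space d) (φ : Torus m)
    {η : ℝ} (hη : 0 < η) : ∃ δ > 0, ∀ ε, 0 ≤ ε → ε ≤ δ →
    |(∫ t in (0 : ℝ)..2, w 1 (line b e t) (φ + toTorus ((ε * t) • ω))) -
      (workMoment w 0 b e φ + ε * workMoment w 1 b e φ + ε ^ 2 * (workMoment w 2 b e φ / 2) +
        ε ^ 3 * (workMoment w 3 b e φ / 6))| ≤ η * ε ^ 3 := by
  -- `w 4` is merely continuous; uniform continuity on a compact set gives one `δ` for all points of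
  -- the segment.
  have hunif : ∃ δ > 0, ∀ θ : ℝ, |θ| ≤ δ → ∀ t ∈ Icc (0 : ℝ) 2,
      |w 4 (line b e t) (φ + toTorus (θ • ω)) - w 4 (line b e t) φ| ≤ η / 16 := by
    have hc : Continuous fun q : ℝ × ℝ => w 4 (line b e q.2) (φ + toTorus (q.1 • ω)) :=
      h.continuous_w_comp le_rfl ((continuous_line b e).comp continuous_snd)
        (continuous_const.add (continuous_toTorus.comp (by fun_prop)))
    have huc := ((isCompact_Icc (a := (-1 : ℝ)) (b := 1)).prod
      (isCompact_Icc (a := (0 : ℝ)) (b := 2))).uniformContinuousOn_of_continuous hc.continuousOn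
    rw [Metric.uniformContinuousOn_iff] at huc
    obtain ⟨δ, hδ, hδ'⟩ := huc (η / 16) (by positivity)
    refine ⟨min (δ / 2) 1, by positivity, fun θ hθ t ht => ?_⟩
    have h1 := hδ' (θ, t) ⟨abs_le.1 (hθ.trans (min_le_right _ _)), ht⟩ (0, t)
      ⟨⟨by norm_num, by norm_num⟩, ht⟩ (by
        rw [Prod.dist_eq]
        simp only [dist_self, Real.dist_eq, sub_zero]
        exact max_lt (lt_of_le_of_lt (hθ.trans (min_le_left _ _)) (by linarith)) hδ)
    simp only [Real.dist_eq, zero_smul, toTorus_zero, add_zero] at h1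
    exact h1.le
  obtain ⟨δ, hδ, hδ'⟩ := hunif
  have hpt : ∀ t ∈ Icc (0 : ℝ) 2, ∀ θ, 0 ≤ θ → θ ≤ δ →
      |w 1 (line b e t) (φ + toTorus (θ • ω)) - (w 1 (line b e t) φ + θ * w 2 (line b e t) φ +
        θ ^ 2 / 2 * w 3 (line b e t) φ + θ ^ 3 / 6 * w 4 (line b e t) φ)| ≤ η / 16 * θ ^ 3 := by
    intro t ht
    have hη' : 0 ≤ η / 16 := by positivity
    set y := line b e t
    have hm1 : ∀ s a : ℝ, HasDerivAt (fun θ : ℝ => θ * a) a s := fun s a => by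
      simpa using (hasDerivAt_id s).mul_const a
    have hm2 : ∀ s a : ℝ, HasDerivAt (fun θ : ℝ => θ ^ 2 / 2 * a) (s * a) s := fun s a => by
      refine (((hasDerivAt_pow 2 s).div_const 2).mul_const a).congr_deriv ?_
      push_cast; ring
    have hm3 : ∀ s a : ℝ, HasDerivAt (fun θ : ℝ => θ ^ 3 / 6 * a) (s ^ 2 / 2 * a) s :=
      fun s a => by
        refine (((hasDerivAt_pow 3 s).div_const 6).mul_const a).congr_deriv ?_
        push_cast; ring
    -- The modulus of continuity of `w 4` is integrated three times, down to `w 1`.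
    have s3 := norm_le_mul_pow_succ (n := 0) (T := δ) hη'
      (f := fun θ => w 3 y (φ + toTorus (θ • ω)) - (w 3 y φ + θ * w 4 y φ))
      (f' := fun θ => w 4 y (φ + toTorus (θ • ω)) - w 4 y φ)
      (fun s => (h.w_time 3 le_rfl y φ s).sub ((hm1 s _).const_add _)) (by simp [toTorus_zero])
      (fun s hs hs' => by simpa using hδ' s (by rwa [abs_of_nonneg hs]) t ht)
    have s2 := norm_le_mul_pow_succ (n := 1) (T := δ) hη'
      (f := fun θ => w 2 y (φ + toTorus (θ • ω)) -
        (w 2 y φ + θ * w 3 y φ + θ ^ 2 / 2 * w 4 y φ))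
      (fun s => (h.w_time 2 (by norm_num) y φ s).sub (((hm1 s _).const_add _).add (hm2 s _)))
      (by simp [toTorus_zero]) (fun s hs hs' => s3 s hs hs')
    have s1 := norm_le_mul_pow_succ (n := 2) (T := δ) hη'
      (f := fun θ => w 1 y (φ + toTorus (θ • ω)) -
        (w 1 y φ + θ * w 2 y φ + θ ^ 2 / 2 * w 3 y φ + θ ^ 3 / 6 * w 4 y φ))
      (fun s => (h.w_time 1 (by norm_num) y φ s).sub
        ((((hm1 s _).const_add _).add (hm2 s _)).add (hm3 s _)))
      (by simp [toTorus_zero]) (fun s hs hs' => s2 s hs hs')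
    exact s1
  -- The phase shift `ε t` goes up to `2 ε`, hence `δ / 2`. The choice `η / 16` pays for `t³ ≤ 8`
  -- and for the length `2` of the interval.
  refine ⟨δ / 2, by positivity, fun ε hε hεδ => ?_⟩
  have hc : Continuous fun t => w 1 (line b e t) (φ + toTorus ((ε * t) • ω)) :=
    h.continuous_w_comp (by norm_num) (continuous_line b e) (continuous_phase ω φ ε)
  have hk : ∀ k ≤ 3, Continuous fun t : ℝ => t ^ k * w (k + 1) (line b e t) φ := fun k hk =>
    (continuous_pow k).mul (h.continuous_w_comp (by omega) (continuous_line b e) continuous_const)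
  have h0 := hk 0 (by norm_num)
  have h1 := (hk 1 (by norm_num)).const_mul ε
  have h2 := (hk 2 (by norm_num)).const_mul (ε ^ 2 / 2)
  have h3 := (hk 3 (by norm_num)).const_mul (ε ^ 3 / 6)
  have e1 : (∫ t in (0 : ℝ)..2, w 1 (line b e t) (φ + toTorus ((ε * t) • ω))) -
      (workMoment w 0 b e φ + ε * workMoment w 1 b e φ + ε ^ 2 * (workMoment w 2 b e φ / 2) +
        ε ^ 3 * (workMoment w 3 b e φ / 6)) =
      ∫ t in (0 : ℝ)..2, (w 1 (line b e t) (φ + toTorus ((ε * t) • ω)) -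
        (t ^ 0 * w (0 + 1) (line b e t) φ + ε * (t ^ 1 * w (1 + 1) (line b e t) φ) +
        ε ^ 2 / 2 * (t ^ 2 * w (2 + 1) (line b e t) φ) +
        ε ^ 3 / 6 * (t ^ 3 * w (3 + 1) (line b e t) φ))) := by
    rw [intervalIntegral.integral_sub (hc.intervalIntegrable _ _)
      ((((h0.fun_add h1).fun_add h2).fun_add h3).intervalIntegrable _ _),
      intervalIntegral.integral_add (((h0.fun_add h1).fun_add h2).intervalIntegrable _ _)
      (h3.intervalIntegrable _ _), intervalIntegral.integral_add
      ((h0.fun_add h1).intervalIntegrable _ _) (h2.intervalIntegrable _ _),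
      intervalIntegral.integral_add (h0.intervalIntegrable _ _) (h1.intervalIntegrable _ _),
      intervalIntegral.integral_const_mul, intervalIntegral.integral_const_mul,
      intervalIntegral.integral_const_mul]
    simp only [workMoment]
    ring
  rw [e1]
  rw [show η * ε ^ 3 = 2 * (η / 2 * ε ^ 3) by ring, ← Real.norm_eq_abs]
  refine norm_intervalIntegral_le fun t ht => ?_
  have h4 := hpt t ht (ε * t) (mul_nonneg hε ht.1) (by nlinarith [ht.1, ht.2])
  rw [Real.norm_eq_abs]
  have e2 : ε ^ 2 / 2 * (t ^ 2 * w (2 + 1) (line b e t) φ) =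
      (ε * t) ^ 2 / 2 * w 3 (line b e t) φ := by ring_nf
  have e3 : ε ^ 3 / 6 * (t ^ 3 * w (3 + 1) (line b e t) φ) =
      (ε * t) ^ 3 / 6 * w 4 (line b e t) φ := by ring_nf
  have e4 : ε * (t ^ 1 * w (1 + 1) (line b e t) φ) = ε * t * w 2 (line b e t) φ := by ring_nf
  have e5 : t ^ 0 * w (0 + 1) (line b e t) φ = w 1 (line b e t) φ := by simp
  rw [e2, e3, e4, e5]
  refine h4.trans ?_
  have : t ^ 3 ≤ 8 := by
    calc t ^ 3 ≤ 2 ^ 3 := pow_le_pow_left₀ ht.1 ht.2 3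
      _ = 8 := by norm_num
  rw [mul_pow]
  nlinarith [mul_nonneg hη.le (pow_nonneg hε 3)]

/-- A first order estimate with an explicit uniform constant, which is what the second moment of the
energy transfer needs. -/
theorem PotentialJet.abs_work_line_sub_le (h : PotentialJet ω w G C) (b e : Space d)
    (φ : Torus m) {ε : ℝ} (hε : 0 ≤ ε) :
    |(∫ t in (0 : ℝ)..2, w 1 (line b e t) (φ + toTorus ((ε * t) • ω))) - workMoment w 0 b e φ| ≤
      4 * C * ε := by
  have hc : Continuous fun t => w 1 (line b e t) (φ + toTorus ((ε * t) • ω)) :=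
    h.continuous_w_comp (by norm_num) (continuous_line b e) (continuous_phase ω φ ε)
  have hc' : Continuous fun t : ℝ => t ^ 0 * w (0 + 1) (line b e t) φ :=
    (continuous_pow 0).mul (h.continuous_w_comp (by norm_num) (continuous_line b e)
      continuous_const)
  rw [workMoment, ← intervalIntegral.integral_sub (hc.intervalIntegrable _ _)
    (hc'.intervalIntegrable _ _)]
  rw [show 4 * C * ε = 2 * (2 * C * ε) by ring, ← Real.norm_eq_abs]
  refine norm_intervalIntegral_le fun t ht => ?_
  have h1 := norm_sub_le_of_hasDerivAt h.nonneg (h.w_time 1 (by norm_num) (line b e t) φ)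
    (fun s => h.w_bound 2 (by norm_num) _ _) (ε * t) (mul_nonneg hε ht.1)
  simp only [zero_smul, toTorus_zero, add_zero, pow_zero, one_mul, zero_add] at h1 ⊢
  refine h1.trans ?_
  nlinarith [mul_nonneg h.nonneg hε, ht.2]

end

/-! ### From the laboratory frame to the frame of the scatterer -/

section

variable {d m : ℕ}

/-! ### Rotations -/

theorem SO.transpose_mul_self (M : SO d) :
    (M : Matrix (Fin d) (Fin d) ℝ).transpose * (M : Matrix (Fin d) (Fin d) ℝ) = 1 := by
  have h := (Matrix.mem_specialOrthogonalGroup_iff.1 M.2).1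
  exact (Matrix.mem_orthogonalGroup_iff' _ _).1 h

theorem rot_mul (M N : SO d) (x : Space d) : rot (M * N) x = rot M (rot N x) := by
  simp [rot, Matrix.mulVec_mulVec]

theorem rot_one (x : Space d) : rot 1 x = x := by
  simp [rot]

theorem rot_inv_rot (M : SO d) (x : Space d) : rot M⁻¹ (rot M x) = x := by
  rw [← rot_mul, inv_mul_cancel, rot_one]

theorem rot_rot_inv (M : SO d) (x : Space d) : rot M (rot M⁻¹ x) = x := by
  rw [← rot_mul, mul_inv_cancel, rot_one]

theorem inner_rot_rot (M : SO d) (x y : Space d) : inner ℝ (rot M x) (rot M y) = inner ℝ x y := by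
  simp only [rot, EuclideanSpace.inner_eq_star_dotProduct, star_trivial]
  rw [Matrix.dotProduct_mulVec, ← Matrix.mulVec_transpose, Matrix.mulVec_mulVec,
    SO.transpose_mul_self, Matrix.one_mulVec]

/-- A rotation as a linear isometry. -/
noncomputable def rotL (M : SO d) : Space d ≃ₗᵢ[ℝ] Space d where
  toFun := rot M
  invFun := rot M⁻¹
  map_add' x y := by simp [rot, Matrix.mulVec_add]
  map_smul' c x := by simp [rot, Matrix.mulVec_smul]
  left_inv := rot_inv_rot M
  right_inv := rot_rot_inv M
  norm_map' x := by
    rw [norm_eq_sqrt_real_inner, norm_eq_sqrt_real_inner x]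
    exact congrArg _ (inner_rot_rot M x x)

theorem rotL_apply (M : SO d) (x : Space d) : rotL M x = rot M x := rfl

theorem norm_rot (M : SO d) (x : Space d) : ‖rot M x‖ = ‖x‖ := (rotL M).norm_map x

theorem rot_add (M : SO d) (x y : Space d) : rot M (x + y) = rot M x + rot M y :=
  (rotL M).map_add x y

theorem rot_sub (M : SO d) (x y : Space d) : rot M (x - y) = rot M x - rot M y :=
  (rotL M).map_sub x y

theorem rot_neg (M : SO d) (x : Space d) : rot M (-x) = -rot M x := (rotL M).map_neg x

theorem rot_smul (M : SO d) (c : ℝ) (x : Space d) : rot M (c • x) = c • rot M x :=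
  (rotL M).map_smul c x

theorem continuous_rot : Continuous fun q : SO d × Space d => rot q.1 q.2 := by
  unfold rot
  refine (PiLp.continuous_toLp 2 _).comp ?_
  exact Continuous.matrix_mulVec (continuous_subtype_val.comp continuous_fst)
    ((PiLp.continuous_ofLp 2 _).comp continuous_snd)

variable {ω : Space m} {w : ℕ → Space d → Torus m → ℝ}
  {G : ℕ → Space d → Torus m → Space d} {C : ℝ}

/-! ### From the trajectory to the rescaled flight -/

/-- With `y τ = M x(s τ)` two time derivatives produce `s²`, which cancels `ε² = s⁻²`, while the
phase `ε (s τ)` is `τ` again. -/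
theorem isTrajectory_of_isFlight {s : ℝ} (hs : 0 < s) {e : Space d} (he : ‖e‖ = 1)
    {κ : Params d m} {x p : ℝ → Space d}
    (hf : IsFlight ω (fun y φ => κ.2.2.2 • G 0 y φ) s⁻¹ κ.2.2.1
      (line (rot κ.2.1⁻¹ κ.1) (rot κ.2.1⁻¹ e) 0) (rot κ.2.1⁻¹ e) x p) :
    IsTrajectory (fun y φ => -G 0 y φ) ω (s • e) κ (fun τ => rot κ.2.1 (x (s * τ))) := by
  have h1 : ∀ τ : ℝ, HasDerivAt (fun τ => rot κ.2.1 (x (s * τ))) (s • rot κ.2.1 (p (s * τ))) τ := by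
    intro τ
    have h := (hf.hx (s * τ)).scomp τ ((hasDerivAt_id τ).const_mul s)
    have h' := (rotL κ.2.1).toContinuousLinearEquiv.toContinuousLinearMap.hasFDerivAt.comp_hasDerivAt τ h
    refine h'.congr_deriv ?_
    simp [rotL_apply]
  have hd : deriv (fun τ => rot κ.2.1 (x (s * τ))) = fun τ => s • rot κ.2.1 (p (s * τ)) :=
    funext fun τ => (h1 τ).deriv
  refine ⟨?_, ?_, fun τ => ⟨(h1 τ).differentiableAt, ?_⟩⟩
  · beta_reduce
    rw [mul_zero, hf.x_zero, line_zero, rot_sub, rot_smul, rot_rot_inv, rot_rot_inv, norm_smul, he,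
      Real.norm_of_nonneg hs.le, mul_one, inv_smul_smul₀ hs.ne']
  · rw [hd]
    beta_reduce
    rw [mul_zero, hf.p_zero, rot_rot_inv]
  · rw [hd]
    have h := (hf.hp (s * τ)).scomp τ ((hasDerivAt_id τ).const_mul s)
    have h' := ((rotL κ.2.1).toContinuousLinearEquiv.toContinuousLinearMap.hasFDerivAt.comp_hasDerivAt
      τ h).const_smul s
    refine h'.congr_deriv ?_
    have e1 : s⁻¹ * (s * τ) = τ := by field_simp
    simp only [mul_one, ContinuousLinearEquiv.coe_coe, LinearIsometryEquiv.coe_toContinuousLinearEquiv,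
      rotL_apply, scatForce, rot_inv_rot, rot_smul, rot_neg, e1, smul_neg,
      add_comm (toTorus (τ • ω))]
    match_scalars
    field_simp

theorem isFlight_of_isTrajectory {s : ℝ} (hs : 0 < s) {e : Space d} (he : ‖e‖ = 1)
    {κ : Params d m} {y : ℝ → Space d}
    (hy : IsTrajectory (fun y φ => -G 0 y φ) ω (s • e) κ y) :
    IsFlight ω (fun y φ => κ.2.2.2 • G 0 y φ) s⁻¹ κ.2.2.1
      (line (rot κ.2.1⁻¹ κ.1) (rot κ.2.1⁻¹ e) 0) (rot κ.2.1⁻¹ e)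
      (fun t => rot κ.2.1⁻¹ (y (s⁻¹ * t))) (fun t => s⁻¹ • rot κ.2.1⁻¹ (deriv y (s⁻¹ * t))) := by
  obtain ⟨h0, h1, h2⟩ := hy
  refine ⟨?_, ?_, fun t => ?_, fun t => ?_⟩
  · rw [mul_zero, h0, line_zero, rot_sub, rot_smul, norm_smul, he, Real.norm_of_nonneg hs.le,
      mul_one, inv_smul_smul₀ hs.ne']
  · beta_reduce
    rw [mul_zero, h1, rot_smul, inv_smul_smul₀ hs.ne']
  · have h := (h2 (s⁻¹ * t)).1.hasDerivAt.scomp t ((hasDerivAt_id t).const_mul s⁻¹)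
    have h' := (rotL κ.2.1⁻¹).toContinuousLinearEquiv.toContinuousLinearMap.hasFDerivAt.comp_hasDerivAt
      t h
    refine h'.congr_deriv ?_
    simp [rotL_apply]
  · have h := (h2 (s⁻¹ * t)).2.scomp t ((hasDerivAt_id t).const_mul s⁻¹)
    have h' := ((rotL κ.2.1⁻¹).toContinuousLinearEquiv.toContinuousLinearMap.hasFDerivAt.comp_hasDerivAt
      t h).const_smul s⁻¹
    refine h'.congr_deriv ?_
    simp only [mul_one, ContinuousLinearEquiv.coe_coe, LinearIsometryEquiv.coe_toContinuousLinearEquiv,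
      rotL_apply, scatForce, rot_inv_rot, rot_smul, rot_neg, smul_neg,
      add_comm (toTorus ((s⁻¹ * t) • ω))]
    match_scalars
    ring

/-- Existence of some trajectory makes the chosen one a trajectory, and any trajectory rescales to a
flight. No uniqueness is needed here, since the estimates above hold for every flight. -/
theorem PotentialJet.exists_flight_of_trajectory (h : PotentialJet ω w G C) {s : ℝ} (hs : 0 < s)
    {e : Space d} (he : ‖e‖ = 1) (κ : Params d m) :
    ∃ x p, IsFlight ω (fun y φ => κ.2.2.2 • G 0 y φ) s⁻¹ κ.2.2.1
      (line (rot κ.2.1⁻¹ κ.1) (rot κ.2.1⁻¹ e) 0) (rot κ.2.1⁻¹ e) x p ∧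
      ∀ τ, trajectory (fun y φ => -G 0 y φ) ω (s • e) κ τ = rot κ.2.1 (x (s * τ)) := by
  obtain ⟨x, p, hf, -⟩ := (h.smul (c := κ.2.2.2) le_rfl).exists_flight s⁻¹ κ.2.2.1
    (line (rot κ.2.1⁻¹ κ.1) (rot κ.2.1⁻¹ e) 0) (rot κ.2.1⁻¹ e)
  have hy : IsTrajectory (fun y φ => -G 0 y φ) ω (s • e) κ
      (trajectory (fun y φ => -G 0 y φ) ω (s • e) κ) :=
    Classical.epsilon_spec (p := IsTrajectory (fun y φ => -G 0 y φ) ω (s • e) κ)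
      ⟨_, isTrajectory_of_isFlight hs he hf⟩
  refine ⟨_, _, isFlight_of_isTrajectory hs he hy, fun τ => ?_⟩
  beta_reduce
  rw [rot_rot_inv, inv_mul_cancel_left₀ hs.ne']

theorem inner_rot_inv {e b : Space d} (M : SO d) (hb : inner ℝ e b = 0) :
    inner ℝ (rot M⁻¹ e) (rot M⁻¹ b) = 0 := by rw [inner_rot_rot, hb]

/-- The momentum transfer in terms of the rescaled flight. -/
theorem R_eq_of_flight (h : PotentialJet ω w G C) {s A : ℝ} (hs : 0 < s)
    {e : Space d} (he : ‖e‖ = 1) {κ : Params d m} (hb : inner ℝ e κ.1 = 0)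
    (hA : ∀ y φ, ‖κ.2.2.2 • G 0 y φ‖ ≤ A) (hsA : 12 * A ≤ s ^ 2) :
    ∃ x p, IsFlight ω (fun y φ => κ.2.2.2 • G 0 y φ) s⁻¹ κ.2.2.1
      (line (rot κ.2.1⁻¹ κ.1) (rot κ.2.1⁻¹ e) 0) (rot κ.2.1⁻¹ e) x p ∧
      12 * (s⁻¹ ^ 2 * A) ≤ 1 ∧
      R (fun y φ => -G 0 y φ) ω (s • e) κ = -(s⁻¹ • rot κ.2.1 (∫ t in (0 : ℝ)..2,
        κ.2.2.2 • G 0 (x t) (κ.2.2.1 + toTorus ((s⁻¹ * t) • ω)))) ∧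
      s • e + R (fun y φ => -G 0 y φ) ω (s • e) κ = s • rot κ.2.1 (p 2) := by
  obtain ⟨x, p, hf, hx⟩ := h.exists_flight_of_trajectory hs he κ
  have hj := h.smul (c := κ.2.2.2) le_rfl
  have he' : ‖rot κ.2.1⁻¹ e‖ = 1 := by rw [norm_rot, he]
  have hε : 12 * (s⁻¹ ^ 2 * A) ≤ 1 := by
    rw [inv_pow, ← mul_assoc, mul_comm 12, mul_assoc, inv_mul_le_iff₀ (by positivity), mul_one]
    exact hsA
  have hR : R (fun y φ => -G 0 y φ) ω (s • e) κ = -(s⁻¹ • rot κ.2.1 (∫ t in (0 : ℝ)..2,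
        κ.2.2.2 • G 0 (x t) (κ.2.2.1 + toTorus ((s⁻¹ * t) • ω)))) := by
    set H : ℝ → Space d := fun t => κ.2.2.2 • G 0 (x t) (κ.2.2.1 + toTorus ((s⁻¹ * t) • ω)) with hH
    have e1 : ∀ τ, scatForce (fun y φ => -G 0 y φ) ω κ
        (trajectory (fun y φ => -G 0 y φ) ω (s • e) κ τ) τ = -rotL κ.2.1 (H (s * τ)) := by
      intro τ
      rw [hx, scatForce, rot_inv_rot, hH, rotL_apply, rot_neg, smul_neg, rot_smul,
        inv_mul_cancel_left₀ hs.ne', add_comm]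
    -- The force vanishes along the flight from time `2` on.
    have e2 : ∫ t in Ioi (0 : ℝ), H t = ∫ t in (0 : ℝ)..2, H t := by
      rw [intervalIntegral.integral_of_le (by norm_num)]
      refine (setIntegral_eq_of_subset_of_forall_sdiff_eq_zero measurableSet_Ioi
        Ioc_subset_Ioi_self fun t ht => ?_)
      have ht2 : 2 ≤ t := by
        by_contra! hlt
        exact ht.2 ⟨ht.1, hlt.le⟩
      exact hj.G_supp 0 (by norm_num) _ _
        (hf.eq_of_two_le hj hA he' (inner_rot_inv _ hb) hε ht2).2
    rw [R]
    simp_rw [e1]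
    have e3 := (rotL κ.2.1).toLinearIsometry.integral_comp_comm (μ := volume.restrict (Ioi (0 : ℝ)))
      (fun τ => H (s * τ))
    simp only [LinearIsometryEquiv.coe_toLinearIsometry] at e3
    rw [integral_neg, e3,
      integral_comp_mul_left_Ioi _ _ hs, mul_zero, e2, rotL_apply, rot_smul]
  refine ⟨x, p, hf, hε, hR, ?_⟩
  rw [hR, hf.p_two hj, rot_sub, rot_rot_inv, rot_smul, smul_sub, smul_smul]
  have : s * s⁻¹ ^ 2 = s⁻¹ := by field_simp
  rw [this, sub_eq_add_neg]

theorem deltaE_eq_of_flight {s : ℝ} (hs : 0 < s) {e : Space d} (he : ‖e‖ = 1) {κ : Params d m}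
    {g : Space d → Torus m → Space d} {p₂ : Space d}
    (hp : s • e + R g ω (s • e) κ = s • rot κ.2.1 p₂) :
    deltaE g ω (s • e) κ = s ^ 2 * ((1 / 2 : ℝ) * (‖p₂‖ ^ 2 - 1)) := by
  rw [deltaE, hp, norm_smul, norm_smul, norm_rot, he, Real.norm_of_nonneg hs.le]; ring

end

section

/-! ### Coefficients of asymptotic expansions -/

/-- Uniqueness of asymptotic expansions, by strong induction: once the lower coefficients are known,
multiplication by `s ^ k` isolates `a k`, the higher terms and the remainder tending to zero. -/
theorem expansionCoeff_eq {F : Type*} [NormedAddCommGroup F] [NormedSpace ℝ F] {f : ℝ → F}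
    {a : ℕ → F} {n : ℕ} (h : (fun s : ℝ => f s - ∑ j ∈ Finset.range (n + 1), (s ^ j)⁻¹ • a j)
      =o[atTop] fun s : ℝ => (s ^ n)⁻¹) (k : ℕ) (hk : k ≤ n) : expansionCoeff f k = a k := by
  induction k using Nat.strong_induction_on with
  | _ k ih =>
    rw [expansionCoeff]
    refine Tendsto.limUnder_eq ?_
    have e1 : ∀ s : ℝ, ∑ j : Fin k, (s ^ (j : ℕ))⁻¹ • expansionCoeff f j =
        ∑ j ∈ Finset.range k, (s ^ j)⁻¹ • a j := fun s => by
      rw [Finset.sum_range fun j => (s ^ j)⁻¹ • a j]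
      exact Finset.sum_congr rfl fun j _ => by rw [ih j j.2 (j.2.le.trans hk)]
    simp_rw [e1]
    have h1 : Tendsto (fun s : ℝ => s ^ k •
        (f s - ∑ j ∈ Finset.range (n + 1), (s ^ j)⁻¹ • a j)) atTop (𝓝 0) := by
      have h2 := h.tendsto_inv_smul_nhds_zero
      refine squeeze_zero_norm' ?_ (tendsto_zero_iff_norm_tendsto_zero.1 h2)
      filter_upwards [eventually_ge_atTop 1] with s hs
      rw [norm_smul, norm_smul, inv_inv, norm_pow, norm_pow, Real.norm_of_nonneg (by linarith)]
      gcongr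
    have h3 : Tendsto (fun s : ℝ => ∑ j ∈ Finset.Ico (k + 1) (n + 1), s ^ k • (s ^ j)⁻¹ • a j)
        atTop (𝓝 (∑ j ∈ Finset.Ico (k + 1) (n + 1), (0 : ℝ) • a j)) := by
      refine tendsto_finsetSum _ fun j hj => ?_
      rw [Finset.mem_Ico] at hj
      have h4 : Tendsto (fun s : ℝ => (s ^ (j - k))⁻¹ • a j) atTop (𝓝 ((0 : ℝ) • a j)) :=
        (tendsto_inv_atTop_zero.comp (tendsto_pow_atTop (by omega))).smul_const _
      refine h4.congr' ?_
      filter_upwards [eventually_gt_atTop 0] with s hs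
      rw [smul_smul]
      congr 1
      rw [show j = (j - k) + k by omega, pow_add, Nat.add_sub_cancel]
      field_simp
    simp only [zero_smul, Finset.sum_const_zero] at h3
    have h5 := (h1.add h3).add_const (a k)
    rw [zero_add, zero_add] at h5
    refine h5.congr' ?_
    filter_upwards [eventually_gt_atTop 0] with s hs
    rw [← Finset.sum_range_add_sum_Ico _ (by omega : k + 1 ≤ n + 1), Finset.sum_range_succ,
      ← Finset.smul_sum, smul_sub, smul_sub, smul_add, smul_add, smul_smul (s ^ k) (s ^ k)⁻¹,
      mul_inv_cancel₀ (by positivity), one_smul]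
    abel

variable {d m : ℕ} {ω : Space m} {w : ℕ → Space d → Torus m → ℝ}
  {G : ℕ → Space d → Torus m → Space d} {C : ℝ}

theorem forceMoment_smul (c : ℝ) (k : ℕ) (b e : Space d) (φ : Torus m) :
    forceMoment (fun k y φ => c • G k y φ) k b e φ = c • forceMoment G k b e φ := by
  rw [forceMoment, forceMoment, ← intervalIntegral.integral_smul]
  congr 1; ext1 t; rw [smul_comm]

theorem deviation_smul (c : ℝ) (k : ℕ) (b e : Space d) (φ : Torus m) (t : ℝ) :
    deviation (fun k y φ => c • G k y φ) k b e φ t = c • deviation G k b e φ t := by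
  rw [deviation, deviation, smul_neg, ← intervalIntegral.integral_smul]
  congr 2; ext1 t; rw [smul_comm]

theorem work₂_smul (c : ℝ) (b e : Space d) (φ : Torus m) :
    work₂ (fun k y φ => c • G k y φ) b e φ = c ^ 2 * work₂ G b e φ := by
  rw [work₂, work₂, ← intervalIntegral.integral_const_mul]
  congr 1; ext1 t; rw [deviation_smul, real_inner_smul_left, real_inner_smul_right]; ring

theorem work₃_smul (c : ℝ) (b e : Space d) (φ : Torus m) :
    work₃ (fun k y φ => c • G k y φ) b e φ = c ^ 2 * work₃ G b e φ := by
  rw [work₃, work₃, ← intervalIntegral.integral_const_mul]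
  congr 1; ext1 t
  simp only [deviation_smul, real_inner_smul_left, real_inner_smul_right]; ring

/-- The coefficients of the expansion of the momentum transfer. -/
noncomputable def alphaHat (G : ℕ → Space d → Torus m → Space d) (k : ℕ) (e : Space d)
    (κ : Params d m) : Space d :=
  match k with
  | 1 => -(κ.2.2.2 • rot κ.2.1 (forceMoment G 0 (rot κ.2.1⁻¹ κ.1) (rot κ.2.1⁻¹ e) κ.2.2.1))
  | 2 => -(κ.2.2.2 • rot κ.2.1 (forceMoment G 1 (rot κ.2.1⁻¹ κ.1) (rot κ.2.1⁻¹ e) κ.2.2.1))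
  | _ => 0

/-- The coefficients of the expansion of the energy transfer, in the frame of the scatterer. -/
noncomputable def betaRed (w : ℕ → Space d → Torus m → ℝ) (G : ℕ → Space d → Torus m → Space d)
    (l : ℕ) (b e : Space d) (φ : Torus m) (c : ℝ) : ℝ :=
  match l with
  | 1 => c * workMoment w 0 b e φ
  | 2 => c * workMoment w 1 b e φ
  | 3 => c * (workMoment w 2 b e φ / 2) + c ^ 2 * work₂ G b e φ
  | 4 => c * (workMoment w 3 b e φ / 6) + c ^ 2 * work₃ G b e φ
  | _ => 0

/-- The coefficients of the expansion of the energy transfer. -/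
noncomputable def betaHat (w : ℕ → Space d → Torus m → ℝ) (G : ℕ → Space d → Torus m → Space d)
    (l : ℕ) (e : Space d) (κ : Params d m) : ℝ :=
  betaRed w G l (rot κ.2.1⁻¹ κ.1) (rot κ.2.1⁻¹ e) κ.2.2.1 κ.2.2.2

/-- The work along the straight line at inverse velocity `ε`. -/
noncomputable def lineWork (ω : Space m) (w : ℕ → Space d → Torus m → ℝ) (ε : ℝ) (b e : Space d)
    (φ : Torus m) : ℝ :=
  ∫ t in (0 : ℝ)..2, w 1 (line b e t) (φ + toTorus ((ε * t) • ω))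

namespace PotentialJet

theorem norm_R_sub_le (h : PotentialJet ω w G C) {s c₀ : ℝ} (hs : 0 < s)
    {e : Space d} (he : ‖e‖ = 1) {κ : Params d m} (hb : inner ℝ e κ.1 = 0) (hc : |κ.2.2.2| ≤ c₀)
    (hsC : 12 * (c₀ * C) ≤ s ^ 2) :
    ‖R (fun y φ => -G 0 y φ) ω (s • e) κ - ∑ k ∈ Finset.Icc 1 2, (s ^ k)⁻¹ • alphaHat G k e κ‖ ≤
      2 * (4 * (c₀ * C) ^ 2 + 4 * (c₀ * C)) * (s ^ 3)⁻¹ := by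
  have hj := h.smul hc
  obtain ⟨x, p, hf, -, hR, -⟩ := R_eq_of_flight h hs he hb (hj.G_bound 0 (by norm_num)) hsC
  have h1 := hf.norm_impulse_sub_le hj (inv_nonneg.2 hs.le)
  rw [forceMoment_smul, forceMoment_smul] at h1
  have e1 : ∑ k ∈ Finset.Icc 1 2, (s ^ k)⁻¹ • alphaHat G k e κ =
      s⁻¹ • alphaHat G 1 e κ + (s ^ 2)⁻¹ • alphaHat G 2 e κ := by
    rw [show Finset.Icc 1 2 = {1, 2} from rfl, Finset.sum_pair (by norm_num), pow_one]
  rw [hR, e1]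
  simp only [alphaHat]
  set I := ∫ t in (0 : ℝ)..2, κ.2.2.2 • G 0 (x t) (κ.2.2.1 + toTorus ((s⁻¹ * t) • ω))
  set A₁ := forceMoment G 0 (rot κ.2.1⁻¹ κ.1) (rot κ.2.1⁻¹ e) κ.2.2.1
  set A₂ := forceMoment G 1 (rot κ.2.1⁻¹ κ.1) (rot κ.2.1⁻¹ e) κ.2.2.1
  have e2 : -(s⁻¹ • rot κ.2.1 I) - (s⁻¹ • -(κ.2.2.2 • rot κ.2.1 A₁) +
      (s ^ 2)⁻¹ • -(κ.2.2.2 • rot κ.2.1 A₂)) =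
      -(s⁻¹ • rot κ.2.1 (I - κ.2.2.2 • A₁ - s⁻¹ • κ.2.2.2 • A₂)) := by
    simp only [rot_sub, rot_smul]
    match_scalars <;> field_simp
  rw [e2, norm_neg, norm_smul, norm_rot, Real.norm_of_nonneg (inv_nonneg.2 hs.le)]
  calc _ ≤ s⁻¹ * (2 * ((4 * (c₀ * C) ^ 2 + 4 * (c₀ * C)) * s⁻¹ ^ 2)) := by gcongr
    _ = _ := by field_simp

/-- Because `lineWork` is not expanded, the error is `O(s⁻⁵)` with a constant that depends only on
`c₀` and `C`. The averaged statement uses this form, the pointwise expansion being only `o(s⁻⁴)`. -/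
theorem abs_deltaE_sub_le (h : PotentialJet ω w G C) {s c₀ : ℝ} (hs : 1 ≤ s)
    {e : Space d} (he : ‖e‖ = 1) {κ : Params d m} (hb : inner ℝ e κ.1 = 0) (hc : |κ.2.2.2| ≤ c₀)
    (hsC : 12 * (c₀ * C) ≤ s ^ 2) :
    |deltaE (fun y φ => -G 0 y φ) ω (s • e) κ -
      s⁻¹ * (κ.2.2.2 * lineWork ω w s⁻¹ (rot κ.2.1⁻¹ κ.1) (rot κ.2.1⁻¹ e) κ.2.2.1) -
      (s ^ 3)⁻¹ * (κ.2.2.2 ^ 2 * work₂ G (rot κ.2.1⁻¹ κ.1) (rot κ.2.1⁻¹ e) κ.2.2.1) -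
      (s ^ 4)⁻¹ * (κ.2.2.2 ^ 2 * work₃ G (rot κ.2.1⁻¹ κ.1) (rot κ.2.1⁻¹ e) κ.2.2.1)| ≤
      2 * workConst (c₀ * C) * (s ^ 5)⁻¹ := by
  have hs0 : 0 < s := by linarith
  have hj := h.smul hc
  obtain ⟨x, p, hf, hε, -, hp⟩ := R_eq_of_flight h hs0 he hb (hj.G_bound 0 (by norm_num)) hsC
  have h1 := hf.abs_work_sub_le hj (inv_pos.2 hs0) (inv_le_one_of_one_le₀ hs)
  rw [work₂_smul, work₃_smul] at h1
  have h2 := hf.energy hj (hj.G_bound 0 (by norm_num)) (by rw [norm_rot, he])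
    (inner_rot_inv _ hb) hε
  rw [deltaE_eq_of_flight hs0 he hp, h2]
  set I := ∫ t in (0 : ℝ)..2, κ.2.2.2 * w 1 (x t) (κ.2.2.1 + toTorus ((s⁻¹ * t) • ω))
  rw [intervalIntegral.integral_const_mul] at h1
  rw [lineWork]
  set J := ∫ t in (0 : ℝ)..2, w 1 (line (rot κ.2.1⁻¹ κ.1) (rot κ.2.1⁻¹ e) t)
    (κ.2.2.1 + toTorus ((s⁻¹ * t) • ω))
  set X := κ.2.2.2 ^ 2 * work₂ G (rot κ.2.1⁻¹ κ.1) (rot κ.2.1⁻¹ e) κ.2.2.1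
  set Y := κ.2.2.2 ^ 2 * work₃ G (rot κ.2.1⁻¹ κ.1) (rot κ.2.1⁻¹ e) κ.2.2.1
  have e1 : s ^ 2 * (s⁻¹ ^ 3 * I) - s⁻¹ * (κ.2.2.2 * J) - (s ^ 3)⁻¹ * X - (s ^ 4)⁻¹ * Y =
      s⁻¹ * (I - κ.2.2.2 * J - s⁻¹ ^ 2 * X - s⁻¹ ^ 3 * Y) := by
    field_simp
  rw [e1, abs_mul, abs_of_pos (inv_pos.2 hs0)]
  calc _ ≤ s⁻¹ * (2 * (workConst (c₀ * C) * s⁻¹ ^ 4)) := by gcongr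
    _ = _ := by field_simp

theorem R_isBigO (h : PotentialJet ω w G C) {e : Space d} (he : ‖e‖ = 1) {κ : Params d m}
    (hb : inner ℝ e κ.1 = 0) :
    (fun s : ℝ => R (fun y φ => -G 0 y φ) ω (s • e) κ -
      ∑ k ∈ Finset.Icc 1 2, (s ^ k)⁻¹ • alphaHat G k e κ) =O[atTop] fun s : ℝ => (s ^ 3)⁻¹ := by
  refine IsBigO.of_bound (2 * (4 * (|κ.2.2.2| * C) ^ 2 + 4 * (|κ.2.2.2| * C))) ?_
  filter_upwards [eventually_gt_atTop 0, (tendsto_pow_atTop two_ne_zero).eventually_ge_atTop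
    (12 * (|κ.2.2.2| * C))] with s hs hs'
  rw [Real.norm_of_nonneg (by positivity : 0 ≤ (s ^ 3)⁻¹)]
  exact h.norm_R_sub_le hs he hb le_rfl hs'

theorem deltaE_isLittleO (h : PotentialJet ω w G C) {e : Space d} (he : ‖e‖ = 1) {κ : Params d m}
    (hb : inner ℝ e κ.1 = 0) :
    (fun s : ℝ => deltaE (fun y φ => -G 0 y φ) ω (s • e) κ -
      ∑ l ∈ Finset.range 5, (s ^ l)⁻¹ * betaHat w G l e κ) =o[atTop] fun s : ℝ => (s ^ 4)⁻¹ := by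
  set K := 2 * workConst (|κ.2.2.2| * C)
  have hK : Tendsto (fun s : ℝ => K * s⁻¹) atTop (𝓝 0) := by
    simpa using tendsto_inv_atTop_zero.const_mul K
  rw [isLittleO_iff]
  intro η hη
  set b' := rot κ.2.1⁻¹ κ.1
  set e' := rot κ.2.1⁻¹ e
  set φ := κ.2.2.1
  set c := κ.2.2.2
  -- Multiplication by `|c|` leaves at most `η / 2`, also when `c = 0`; the other half absorbs the
  -- remainder of order `s⁻⁵`.
  have hη' : 0 < η / (2 * (|c| + 1)) := by positivity
  obtain ⟨δ, hδ, hδ'⟩ := h.work_line_isLittleO b' e' φ hη'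
  filter_upwards [eventually_ge_atTop 1, (tendsto_pow_atTop two_ne_zero).eventually_ge_atTop
    (12 * (|c| * C)), hK.eventually_le_const (half_pos hη),
    tendsto_inv_atTop_zero.eventually_le_const hδ] with s hs hsC hsη hsδ
  have hs0 : 0 < s := by linarith
  have h1 := h.abs_deltaE_sub_le hs he hb le_rfl hsC
  have h2 := hδ' s⁻¹ (inv_nonneg.2 hs0.le) hsδ
  set D := deltaE (fun y φ => -G 0 y φ) ω (s • e) κ
  change |lineWork ω w s⁻¹ b' e' φ - _| ≤ _ at h2
  set L := lineWork ω w s⁻¹ b' e' φ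
  simp only [Finset.sum_range_succ, Finset.sum_range_zero, betaHat, betaRed]
  set P := workMoment w 0 b' e' φ + s⁻¹ * workMoment w 1 b' e' φ +
    s⁻¹ ^ 2 * (workMoment w 2 b' e' φ / 2) + s⁻¹ ^ 3 * (workMoment w 3 b' e' φ / 6) with hP
  have e1 : D - (0 + (s ^ 0)⁻¹ * 0 + (s ^ 1)⁻¹ * (c * workMoment w 0 b' e' φ) +
      (s ^ 2)⁻¹ * (c * workMoment w 1 b' e' φ) + (s ^ 3)⁻¹ * (c * (workMoment w 2 b' e' φ / 2) +
      c ^ 2 * work₂ G b' e' φ) + (s ^ 4)⁻¹ * (c * (workMoment w 3 b' e' φ / 6) +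
      c ^ 2 * work₃ G b' e' φ)) = (D - s⁻¹ * (c * L) - (s ^ 3)⁻¹ * (c ^ 2 * work₂ G b' e' φ) -
      (s ^ 4)⁻¹ * (c ^ 2 * work₃ G b' e' φ)) + s⁻¹ * (c * (L - P)) := by
    rw [hP]; field_simp; ring
  rw [e1, Real.norm_eq_abs, Real.norm_of_nonneg (by positivity : 0 ≤ (s ^ 4)⁻¹)]
  refine (abs_add_le _ _).trans ?_
  rw [abs_mul, abs_mul, abs_of_pos (inv_pos.2 hs0)]
  have h3 : s⁻¹ * (|c| * |L - P|) ≤ s⁻¹ * (|c| * (η / (2 * (|c| + 1)) * s⁻¹ ^ 3)) := by gcongr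
  have h4 : s⁻¹ * (|c| * (η / (2 * (|c| + 1)) * s⁻¹ ^ 3)) =
      (|c| / (|c| + 1)) * (η / 2 * (s ^ 4)⁻¹) := by field_simp
  have h5 : |c| / (|c| + 1) ≤ 1 := (div_le_one (by positivity)).2 (by linarith)
  have h6 : (|c| / (|c| + 1)) * (η / 2 * (s ^ 4)⁻¹) ≤ 1 * (η / 2 * (s ^ 4)⁻¹) := by gcongr
  have h7 : K * (s ^ 5)⁻¹ ≤ η / 2 * (s ^ 4)⁻¹ := by
    have : K * (s ^ 5)⁻¹ = K * s⁻¹ * (s ^ 4)⁻¹ := by field_simp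
    rw [this]; gcongr
  linarith

theorem alpha_eq (h : PotentialJet ω w G C) {e : Space d} (he : ‖e‖ = 1) {κ : Params d m}
    (hb : inner ℝ e κ.1 = 0) {k : ℕ} (hk : k ≤ 2) :
    alpha (fun y φ => -G 0 y φ) ω k e κ = alphaHat G k e κ := by
  refine expansionCoeff_eq (n := 2) (a := fun k => alphaHat G k e κ) ?_ k hk
  have h1 := h.R_isBigO he hb
  -- The coefficient of order zero vanishes, so the sum may start at `1`.
  have e1 : ∀ s : ℝ, ∑ j ∈ Finset.range (2 + 1), (s ^ j)⁻¹ • alphaHat G j e κ =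
      ∑ k ∈ Finset.Icc 1 2, (s ^ k)⁻¹ • alphaHat G k e κ := fun s => by
    rw [show Finset.Icc 1 2 = {1, 2} from rfl, Finset.sum_pair (by norm_num)]
    simp [Finset.sum_range_succ, alphaHat]
  simp_rw [e1]
  refine h1.trans_isLittleO ?_
  have h2 : (fun s : ℝ => (s ^ 3)⁻¹) = fun s : ℝ => s⁻¹ * (s ^ 2)⁻¹ := by
    ext s; rw [pow_succ, mul_inv, mul_comm]
  rw [h2]
  simpa using ((isLittleO_one_iff ℝ).2 tendsto_inv_atTop_zero).mul_isBigO
    (isBigO_refl (fun s : ℝ => (s ^ 2)⁻¹) atTop)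

theorem beta_eq (h : PotentialJet ω w G C) {e : Space d} (he : ‖e‖ = 1) {κ : Params d m}
    (hb : inner ℝ e κ.1 = 0) {l : ℕ} (hl : l ≤ 4) :
    beta (fun y φ => -G 0 y φ) ω l e κ = betaHat w G l e κ :=
  expansionCoeff_eq (n := 4) (a := fun l => betaHat w G l e κ) (h.deltaE_isLittleO he hb) l hl

end PotentialJet

end

/-! ### Laws of the scattering parameters and regularity of the coefficients -/

section

variable {d m : ℕ}

/-! ### Measures on the parameter space -/

instance : SecondCountableTopology (SO d) := by
  have : SecondCountableTopology (Matrix (Fin d) (Fin d) ℝ) :=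
    inferInstanceAs (SecondCountableTopology (Fin d → Fin d → ℝ))
  exact TopologicalSpace.Subtype.secondCountableTopology
    {A : Matrix (Fin d) (Fin d) ℝ | A ∈ Matrix.specialOrthogonalGroup (Fin d) ℝ}

instance : (haarSO d).IsHaarMeasure := by unfold haarSO; infer_instance

instance : IsProbabilityMeasure (haarSO d) :=
  ⟨by simpa [haarSO] using Measure.haarMeasure_self (K₀ := (⊤ : TopologicalSpace.PositiveCompacts (SO d)))⟩

instance : IsProbabilityMeasure (volume : Measure (Torus m)) := by
  have : IsProbabilityMeasure (volume : Measure UnitAddCircle) := ⟨UnitAddCircle.measure_univ⟩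
  exact inferInstanceAs (IsProbabilityMeasure (Measure.pi fun _ : Fin m => (volume : Measure UnitAddCircle)))

theorem isProbabilityMeasure_cond_closedBall (K : Submodule ℝ (Space d)) :
    IsProbabilityMeasure (ProbabilityTheory.cond (volume : Measure K)
      (Metric.closedBall 0 (1 / 2))) :=
  cond_isProbabilityMeasure_of_finite (Metric.measure_closedBall_pos _ _ (by norm_num)).ne'
    measure_closedBall_lt_top.ne

instance (v : Space d) : IsProbabilityMeasure (impactLaw v) := by
  have := isProbabilityMeasure_cond_closedBall (ℝ ∙ v)ᗮ
  exact Measure.isProbabilityMeasure_map measurable_subtype_coe.aemeasurable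

instance (ν : Measure ℝ) [IsProbabilityMeasure ν] (v : Space d) :
    IsProbabilityMeasure (scatLaw d m ν v) := by unfold scatLaw; infer_instance

theorem ae_impactLaw {v : Space d} : ∀ᵐ b ∂impactLaw v, inner ℝ v b = 0 ∧ ‖b‖ ≤ 1 / 2 := by
  rw [impactLaw, ae_map_iff measurable_subtype_coe.aemeasurable]
  · have h : ∀ᵐ b ∂(ProbabilityTheory.cond (volume : Measure ((ℝ ∙ v)ᗮ : Submodule ℝ (Space d)))
        (Metric.closedBall 0 (1 / 2))), b ∈ Metric.closedBall 0 (1 / 2) :=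
      ae_cond_mem Metric.isClosed_closedBall.measurableSet
    filter_upwards [h] with b hb
    refine ⟨Submodule.mem_orthogonal_singleton_iff_inner_right.1 b.2, by simpa using hb⟩
  · exact ((isClosed_eq (by fun_prop) continuous_const).inter
      (isClosed_le continuous_norm continuous_const)).measurableSet

theorem impactLaw_smul {r : ℝ} (hr : r ≠ 0) (v : Space d) : impactLaw (r • v) = impactLaw v := by
  -- The hyperplane is part of the type of the measure, so the equality of subspaces is used on a
  -- generalised statement.
  have h : ∀ K K' : Submodule ℝ (Space d), K = K' →
      (ProbabilityTheory.cond (volume : Measure K) (Metric.closedBall 0 (1 / 2))).map Subtype.val =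
      (ProbabilityTheory.cond (volume : Measure K') (Metric.closedBall 0 (1 / 2))).map
        Subtype.val := by
    rintro K _ rfl; rfl
  exact h _ _ (congrArg _ (Submodule.span_singleton_smul_eq (IsUnit.mk0 r hr) v))

theorem scatLaw_smul (ν : Measure ℝ) {r : ℝ} (hr : r ≠ 0) (v : Space d) :
    scatLaw d m ν (r • v) = scatLaw d m ν v := by
  rw [scatLaw, impactLaw_smul hr, scatLaw]

variable {ω : Space m} {w : ℕ → Space d → Torus m → ℝ}
  {G : ℕ → Space d → Torus m → Space d} {C : ℝ}

/-! ### Continuity and bounds of the coefficients -/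

theorem continuous_line_uncurry :
    Continuous fun q : (Space d × Space d × Torus m) × ℝ => line q.1.1 q.1.2.1 q.2 := by
  unfold line; fun_prop

namespace PotentialJet

theorem continuous_G_line (h : PotentialJet ω w G C) {k : ℕ} (hk : k ≤ 3) :
    Continuous fun q : (Space d × Space d × Torus m) × ℝ =>
      G k (line q.1.1 q.1.2.1 q.2) q.1.2.2 :=
  h.continuous_G_comp hk continuous_line_uncurry (by fun_prop)

theorem continuous_w_line (h : PotentialJet ω w G C) {k : ℕ} (hk : k ≤ 4) :
    Continuous fun q : (Space d × Space d × Torus m) × ℝ =>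
      w k (line q.1.1 q.1.2.1 q.2) q.1.2.2 :=
  h.continuous_w_comp hk continuous_line_uncurry (by fun_prop)

theorem continuous_workMoment (h : PotentialJet ω w G C) {k : ℕ} (hk : k ≤ 3) :
    Continuous fun q : Space d × Space d × Torus m => workMoment w k q.1 q.2.1 q.2.2 :=
  intervalIntegral.continuous_parametric_intervalIntegral_of_continuous'
    (f := fun (q : Space d × Space d × Torus m) t => t ^ k * w (k + 1) (line q.1 q.2.1 t) q.2.2)
    ((continuous_snd.pow k).mul (h.continuous_w_line (by omega))) 0 2

theorem continuous_forceMoment (h : PotentialJet ω w G C) {k : ℕ} (hk : k ≤ 3) :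
    Continuous fun q : Space d × Space d × Torus m => forceMoment G k q.1 q.2.1 q.2.2 :=
  intervalIntegral.continuous_parametric_intervalIntegral_of_continuous'
    (f := fun (q : Space d × Space d × Torus m) t => t ^ k • G k (line q.1 q.2.1 t) q.2.2)
    ((continuous_snd.pow k).smul (h.continuous_G_line hk)) 0 2

theorem continuous_deviation_uncurry (h : PotentialJet ω w G C) {k : ℕ} (hk : k ≤ 1) :
    Continuous fun q : (Space d × Space d × Torus m) × ℝ =>
      deviation G k q.1.1 q.1.2.1 q.1.2.2 q.2 := by
  refine (intervalIntegral.continuous_parametric_intervalIntegral_of_continuous'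
    (f := fun (q : (Space d × Space d × Torus m) × ℝ) r =>
      (max (q.2 - r) 0 * r ^ k) • G k (line q.1.1 q.1.2.1 r) q.1.2.2) ?_ 0 2).neg
  have h1 : Continuous fun q : ((Space d × Space d × Torus m) × ℝ) × ℝ =>
      max (q.1.2 - q.2) 0 * q.2 ^ k := by fun_prop
  have h2 : Continuous fun q : ((Space d × Space d × Torus m) × ℝ) × ℝ =>
      G k (line q.1.1.1 q.1.1.2.1 q.2) q.1.1.2.2 :=
    (h.continuous_G_line (k := k) (by omega)).comp
      (f := fun q : ((Space d × Space d × Torus m) × ℝ) × ℝ => (q.1.1, q.2)) (by fun_prop)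
  exact h1.smul h2

theorem continuous_work₂ (h : PotentialJet ω w G C) :
    Continuous fun q : Space d × Space d × Torus m => work₂ G q.1 q.2.1 q.2.2 :=
  intervalIntegral.continuous_parametric_intervalIntegral_of_continuous'
    (f := fun (q : Space d × Space d × Torus m) t =>
      inner ℝ (G 1 (line q.1 q.2.1 t) q.2.2) (deviation G 0 q.1 q.2.1 q.2.2 t))
    ((h.continuous_G_line (by norm_num)).inner (h.continuous_deviation_uncurry (by norm_num))) 0 2

theorem continuous_work₃ (h : PotentialJet ω w G C) :
    Continuous fun q : Space d × Space d × Torus m => work₃ G q.1 q.2.1 q.2.2 :=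
  intervalIntegral.continuous_parametric_intervalIntegral_of_continuous'
    (f := fun (q : Space d × Space d × Torus m) t =>
      t * inner ℝ (G 2 (line q.1 q.2.1 t) q.2.2) (deviation G 0 q.1 q.2.1 q.2.2 t) +
        inner ℝ (G 1 (line q.1 q.2.1 t) q.2.2) (deviation G 1 q.1 q.2.1 q.2.2 t))
    ((continuous_snd.mul ((h.continuous_G_line (by norm_num)).inner
      (h.continuous_deviation_uncurry (by norm_num)))).add
      ((h.continuous_G_line (by norm_num)).inner (h.continuous_deviation_uncurry (by norm_num))))
    0 2

theorem continuous_betaRed (h : PotentialJet ω w G C) (l : ℕ) :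
    Continuous fun q : (Space d × Space d × Torus m) × ℝ =>
      betaRed w G l q.1.1 q.1.2.1 q.1.2.2 q.2 := by
  have hw : ∀ k ≤ 3, Continuous fun q : (Space d × Space d × Torus m) × ℝ =>
      workMoment w k q.1.1 q.1.2.1 q.1.2.2 := fun k hk =>
    (h.continuous_workMoment hk).comp continuous_fst
  have h2 := h.continuous_work₂.comp (continuous_fst (X := Space d × Space d × Torus m) (Y := ℝ))
  have h3 := h.continuous_work₃.comp (continuous_fst (X := Space d × Space d × Torus m) (Y := ℝ))
  have hc : Continuous fun q : (Space d × Space d × Torus m) × ℝ => q.2 := continuous_snd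
  rcases l with _ | _ | _ | _ | _ | l
  · exact continuous_const
  · exact hc.mul (hw 0 (by norm_num))
  · exact hc.mul (hw 1 (by norm_num))
  · exact (hc.mul ((hw 2 (by norm_num)).div_const 2)).add ((hc.pow 2).mul h2)
  · exact (hc.mul ((hw 3 (by norm_num)).div_const 6)).add ((hc.pow 2).mul h3)
  · exact continuous_const

end PotentialJet

/-- The data of a scattering event in the frame of the scatterer. -/
def toFrame (q : Space d × Params d m) : (Space d × Space d × Torus m) × ℝ :=
  ((rot q.2.2.1⁻¹ q.2.1, rot q.2.2.1⁻¹ q.1, q.2.2.2.1), q.2.2.2.2)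

theorem continuous_toFrame : Continuous (toFrame (d := d) (m := m)) := by
  refine ((Continuous.prodMk ?_ (Continuous.prodMk ?_ (by fun_prop)))).prodMk (by fun_prop)
  · exact continuous_rot.comp (f := fun q : Space d × Params d m => (q.2.2.1⁻¹, q.2.1))
      (by fun_prop)
  · exact continuous_rot.comp (f := fun q : Space d × Params d m => (q.2.2.1⁻¹, q.1))
      (by fun_prop)

namespace PotentialJet

theorem continuous_betaHat (h : PotentialJet ω w G C) (l : ℕ) :
    Continuous fun q : Space d × Params d m => betaHat w G l q.1 q.2 :=
  (h.continuous_betaRed l).comp continuous_toFrame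

theorem continuous_alphaHat (h : PotentialJet ω w G C) (k : ℕ) (e : Space d) :
    Continuous fun κ : Params d m => alphaHat G k e κ := by
  have hf : ∀ k ≤ 1, Continuous fun κ : Params d m => -(κ.2.2.2 • rot κ.2.1
      (forceMoment G k (rot κ.2.1⁻¹ κ.1) (rot κ.2.1⁻¹ e) κ.2.2.1)) := by
    intro k hk
    have h0 : Continuous fun κ : Params d m =>
        (rot κ.2.1⁻¹ κ.1, rot κ.2.1⁻¹ e, κ.2.2.1) := by
      have := continuous_fst.comp
        ((continuous_toFrame (d := d) (m := m)).comp (Continuous.prodMk_right e))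
      exact this
    have h1 := (h.continuous_forceMoment (k := k) (by omega)).comp h0
    have hM : Continuous fun κ : Params d m => κ.2.1 := continuous_fst.comp continuous_snd
    have h2 : Continuous fun κ : Params d m => rot κ.2.1
        (forceMoment G k (rot κ.2.1⁻¹ κ.1) (rot κ.2.1⁻¹ e) κ.2.2.1) :=
      Continuous.comp (g := fun p : SO d × Space d => rot p.1 p.2) continuous_rot (hM.prodMk h1)
    have hc : Continuous fun κ : Params d m => κ.2.2.2 :=
      continuous_snd.comp (continuous_snd.comp continuous_snd)
    exact (hc.smul h2).neg
  rcases k with _ | _ | _ | k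
  · exact continuous_const
  · exact hf 0 (by norm_num)
  · exact hf 1 (by norm_num)
  · exact continuous_const

theorem abs_workMoment_le (h : PotentialJet ω w G C) {k : ℕ} (hk : k ≤ 3) (b e : Space d)
    (φ : Torus m) : |workMoment w k b e φ| ≤ 16 * C := by
  have := norm_intervalIntegral_le (f := fun t => t ^ k * w (k + 1) (line b e t) φ) (K := 8 * C)
    fun t ht => by
      rw [norm_mul, norm_pow, Real.norm_of_nonneg ht.1]
      have h1 : t ^ k ≤ 8 := by
        calc t ^ k ≤ 2 ^ k := pow_le_pow_left₀ ht.1 ht.2 k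
          _ ≤ 2 ^ 3 := pow_le_pow_right₀ (by norm_num) hk
          _ = 8 := by norm_num
      exact mul_le_mul h1 (h.w_bound _ (by omega) _ _) (norm_nonneg _) (by norm_num)
  rw [workMoment, ← Real.norm_eq_abs]
  linarith

theorem norm_forceMoment_le (h : PotentialJet ω w G C) {k : ℕ} (hk : k ≤ 3) (b e : Space d)
    (φ : Torus m) : ‖forceMoment G k b e φ‖ ≤ 16 * C := by
  have := norm_intervalIntegral_le (f := fun t => t ^ k • G k (line b e t) φ) (K := 8 * C)
    fun t ht => by
      rw [norm_smul, norm_pow, Real.norm_of_nonneg ht.1]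
      have h1 : t ^ k ≤ 8 := by
        calc t ^ k ≤ 2 ^ k := pow_le_pow_left₀ ht.1 ht.2 k
          _ ≤ 2 ^ 3 := pow_le_pow_right₀ (by norm_num) hk
          _ = 8 := by norm_num
      exact mul_le_mul h1 (h.G_bound _ (by omega) _ _) (norm_nonneg _) (by norm_num)
  rw [forceMoment]
  linarith

theorem abs_inner_G_deviation_le (h : PotentialJet ω w G C) {j k : ℕ} (hj : j ≤ 3) (hk : k ≤ 1)
    (b e : Space d) (φ : Torus m) {t : ℝ} (ht : t ∈ Icc (0 : ℝ) 2) :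
    |inner ℝ (G j (line b e t) φ) (deviation G k b e φ t)| ≤ C * (8 * C) :=
  (abs_real_inner_le_norm _ _).trans (mul_le_mul (h.G_bound j hj _ _)
    (h.deviation_bound hk b e φ ht) (norm_nonneg _) h.nonneg)

theorem abs_work₂_le (h : PotentialJet ω w G C) (b e : Space d) (φ : Torus m) :
    |work₂ G b e φ| ≤ 2 * (C * (8 * C)) := by
  rw [work₂, ← Real.norm_eq_abs]
  exact norm_intervalIntegral_le fun t ht =>
    h.abs_inner_G_deviation_le (j := 1) (k := 0) (by norm_num) (by norm_num) b e φ ht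

theorem abs_work₃_le (h : PotentialJet ω w G C) (b e : Space d) (φ : Torus m) :
    |work₃ G b e φ| ≤ 2 * (3 * (C * (8 * C))) := by
  rw [work₃, ← Real.norm_eq_abs]
  refine norm_intervalIntegral_le fun t ht => ?_
  rw [Real.norm_eq_abs]
  refine (abs_add_le _ _).trans ?_
  rw [abs_mul, abs_of_nonneg ht.1]
  have h1 := h.abs_inner_G_deviation_le (j := 2) (k := 0) (by norm_num) (by norm_num) b e φ ht
  have h2 := h.abs_inner_G_deviation_le (j := 1) (k := 1) (by norm_num) (by norm_num) b e φ ht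
  nlinarith [ht.1, ht.2, abs_nonneg (inner ℝ (G 2 (line b e t) φ) (deviation G 0 b e φ t))]

theorem exists_betaRed_bound (h : PotentialJet ω w G C) : ∃ K, 0 ≤ K ∧ ∀ l b e φ c, |c| ≤ 1 →
    |betaRed w G l b e φ c| ≤ K := by
  have hC := h.nonneg
  refine ⟨16 * C + 48 * C ^ 2, by positivity, fun l b e φ c hc => ?_⟩
  have hw : ∀ k ≤ 3, ∀ n : ℝ, 1 ≤ n → |c * (workMoment w k b e φ / n)| ≤ 16 * C := by
    intro k hk n hn
    rw [abs_mul, abs_div, abs_of_pos (by linarith : 0 < n)]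
    have h1 := h.abs_workMoment_le hk b e φ
    have h2 : |workMoment w k b e φ| / n ≤ 16 * C :=
      (div_le_self (abs_nonneg _) hn).trans h1
    have h3 : 0 ≤ |workMoment w k b e φ| / n := by positivity
    nlinarith [abs_nonneg c]
  have hc2 : ∀ x y : ℝ, |x| ≤ y → |c ^ 2 * x| ≤ y := by
    intro x y hxy
    rw [abs_mul, abs_pow]
    have : |c| ^ 2 ≤ 1 := pow_le_one₀ (abs_nonneg c) hc
    nlinarith [abs_nonneg x]
  have hC2 : 0 ≤ C ^ 2 := sq_nonneg C
  match l with
  | 0 => simp only [betaRed, abs_zero]; positivity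
  | 1 =>
    have := hw 0 (by norm_num) 1 le_rfl
    rw [div_one] at this
    simp only [betaRed]; linarith
  | 2 =>
    have := hw 1 (by norm_num) 1 le_rfl
    rw [div_one] at this
    simp only [betaRed]; linarith
  | 3 =>
    simp only [betaRed]
    refine (abs_add_le _ _).trans ?_
    have h1 := hw 2 (by norm_num) 2 (by norm_num)
    have h2 := hc2 _ _ (h.abs_work₂_le b e φ)
    nlinarith
  | 4 =>
    simp only [betaRed]
    refine (abs_add_le _ _).trans ?_
    have h1 := hw 3 (by norm_num) 6 (by norm_num)
    have h2 := hc2 _ _ (h.abs_work₃_le b e φ)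
    nlinarith
  | _ + 5 => simp only [betaRed, abs_zero]; positivity

end PotentialJet

end

/-! ### Integral geometry of lines and rotations -/

section

variable {d m : ℕ}

/-! ### Transitivity of the rotation group -/

/-- The Householder reflection in the hyperplane orthogonal to the unit vector `n`. -/
noncomputable def householder (n : Space d) : Matrix (Fin d) (Fin d) ℝ :=
  1 - (2 : ℝ) • Matrix.vecMulVec n.ofLp n.ofLp

theorem dotProduct_self_of_norm {n : Space d} (hn : ‖n‖ = 1) : n.ofLp ⬝ᵥ n.ofLp = 1 := by
  have := real_inner_self_eq_norm_sq n
  rw [hn, EuclideanSpace.inner_eq_star_dotProduct] at this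
  simpa using this

theorem householder_mem {n : Space d} (hn : ‖n‖ = 1) :
    householder n ∈ Matrix.orthogonalGroup (Fin d) ℝ := by
  rw [Matrix.mem_orthogonalGroup_iff, householder]
  have h := dotProduct_self_of_norm hn
  have h2 : Matrix.vecMulVec n.ofLp n.ofLp * Matrix.vecMulVec n.ofLp n.ofLp =
      Matrix.vecMulVec n.ofLp n.ofLp := by
    rw [Matrix.vecMulVec_mul_vecMulVec, h, one_smul]
  rw [Matrix.transpose_sub, Matrix.transpose_one, Matrix.transpose_smul, Matrix.transpose_vecMulVec]
  simp only [sub_mul, mul_sub, one_mul, mul_one, Matrix.smul_mul, Matrix.mul_smul, h2]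
  module

theorem det_householder {n : Space d} (hn : ‖n‖ = 1) : (householder n).det = -1 := by
  have h := dotProduct_self_of_norm hn
  have : householder n = 1 + Matrix.vecMulVec ((-2 : ℝ) • n.ofLp) n.ofLp := by
    rw [householder, Matrix.smul_vecMulVec]; module
  rw [this, Matrix.vecMulVec_eq Unit, Matrix.det_one_add_replicateCol_mul_replicateRow,
    dotProduct_smul, h]
  norm_num

/-- The product of two reflections. -/
noncomputable def rotOfPair (n n' : Space d) (hn : ‖n‖ = 1) (hn' : ‖n'‖ = 1) : SO d :=
  ⟨householder n * householder n', Matrix.mem_specialOrthogonalGroup_iff.2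
    ⟨mul_mem (householder_mem hn) (householder_mem hn'), by
      rw [Matrix.det_mul, det_householder hn, det_householder hn']; norm_num⟩⟩

theorem toLp_householder_mulVec (n x : Space d) :
    WithLp.toLp 2 ((householder n).mulVec x.ofLp) = x - (2 * inner ℝ n x) • n := by
  have : inner ℝ n x = n.ofLp ⬝ᵥ x.ofLp := by
    rw [EuclideanSpace.inner_eq_star_dotProduct, dotProduct_comm]; simp
  rw [this, householder, Matrix.sub_mulVec, Matrix.one_mulVec, Matrix.smul_mulVec,
    Matrix.vecMulVec_mulVec]
  ext i
  simp
  ring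

theorem rot_rotOfPair {n n' : Space d} (hn : ‖n‖ = 1) (hn' : ‖n'‖ = 1) (x : Space d) :
    rot (rotOfPair n n' hn hn') x = (x - (2 * inner ℝ n' x) • n') -
      (2 * inner ℝ n (x - (2 * inner ℝ n' x) • n')) • n := by
  rw [← toLp_householder_mulVec n' x, ← toLp_householder_mulVec n]
  simp [rot, rotOfPair, Matrix.mulVec_mulVec]

/-- The reflection along `e - e'` exchanges two unit vectors. -/
theorem reflection_apply_eq {e e' : Space d} (he : ‖e‖ = 1) (he' : ‖e'‖ = 1) (hne : e ≠ e') :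
    ∃ n : Space d, ‖n‖ = 1 ∧ e - (2 * inner ℝ n e) • n = e' := by
  have h0 : ‖e - e'‖ ≠ 0 := norm_ne_zero_iff.2 (sub_ne_zero.2 hne)
  refine ⟨‖e - e'‖⁻¹ • (e - e'), by rw [norm_smul, norm_inv, norm_norm, inv_mul_cancel₀ h0], ?_⟩
  have h1 : ‖e - e'‖ ^ 2 = 2 * inner ℝ (e - e') e := by
    rw [norm_sub_sq_real, he, he', inner_sub_left, real_inner_self_eq_norm_sq, he,
      real_inner_comm e e']
    ring
  rw [real_inner_smul_left, smul_smul,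
    show 2 * (‖e - e'‖⁻¹ * inner ℝ (e - e') e) * ‖e - e'‖⁻¹ =
      (2 * inner ℝ (e - e') e) / ‖e - e'‖ ^ 2 by field_simp, ← h1, div_self (pow_ne_zero 2 h0)]
  module

/-- A reflection takes `e` to `e'`, and the reflection along `e'` itself restores the determinant at
the price of a sign. This works in dimension one too, and the sign is harmless for integrals over
full lines. -/
theorem exists_rot_eq_or_neg {e e' : Space d} (he : ‖e‖ = 1) (he' : ‖e'‖ = 1) :
    ∃ N : SO d, rot N e = e' ∨ rot N e = -e' := by
  by_cases hne : e = e'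
  · exact ⟨1, Or.inl (by rw [rot_one, hne])⟩
  obtain ⟨n, hn, hne⟩ := reflection_apply_eq he he' hne
  refine ⟨rotOfPair e' n he' hn, Or.inr ?_⟩
  rw [rot_rotOfPair, hne, real_inner_self_eq_norm_sq, he']
  module

theorem exists_orthogonal_unit (hd : 2 ≤ d) (e : Space d) : ∃ n : Space d, ‖n‖ = 1 ∧ inner ℝ n e = 0 := by
  have h : (ℝ ∙ e)ᗮ ≠ ⊥ := by
    intro h
    have h1 := (ℝ ∙ e).finrank_add_finrank_orthogonal
    rw [h, finrank_bot, finrank_euclideanSpace_fin] at h1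
    have := finrank_span_le_card (R := ℝ) ({e} : Set (Space d))
    rw [Set.toFinset_singleton, Finset.card_singleton] at this
    omega
  obtain ⟨x, hx, hx0⟩ := Submodule.exists_mem_ne_zero_of_ne_bot h
  have h0 := norm_ne_zero_iff.2 hx0
  refine ⟨‖x‖⁻¹ • x, by rw [norm_smul, norm_inv, norm_norm, inv_mul_cancel₀ h0], ?_⟩
  rw [real_inner_smul_left, Submodule.mem_orthogonal_singleton_iff_inner_left.1 hx, mul_zero]

/-- Now the determinant is restored by a reflection that fixes `e'`; the unit vector orthogonal to
`e'` is what requires `d ≥ 2`. -/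
theorem exists_rot_eq (hd : 2 ≤ d) {e e' : Space d} (he : ‖e‖ = 1) (he' : ‖e'‖ = 1) :
    ∃ N : SO d, rot N e = e' := by
  by_cases hne : e = e'
  · exact ⟨1, by rw [rot_one, hne]⟩
  obtain ⟨n, hn, hne⟩ := reflection_apply_eq he he' hne
  obtain ⟨k, hk, hke⟩ := exists_orthogonal_unit hd e'
  refine ⟨rotOfPair k n hk hn, ?_⟩
  rw [rot_rotOfPair, hne, hke]
  module

/-! ### Integration along parallel lines -/

theorem finrank_orthogonal {e : Space d} (he : ‖e‖ = 1) :
    Module.finrank ℝ ((ℝ ∙ e)ᗮ : Submodule ℝ (Space d)) = d - 1 := by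
  have h1 := (ℝ ∙ e).finrank_add_finrank_orthogonal
  rw [finrank_euclideanSpace_fin, finrank_span_singleton (by rintro rfl; simp at he)] at h1
  omega

theorem volume_closedBall_orthogonal {e : Space d} (he : ‖e‖ = 1) :
    volume (Metric.closedBall (0 : ((ℝ ∙ e)ᗮ : Submodule ℝ (Space d))) (1 / 2)) =
      volume (Metric.closedBall (0 : Space (d - 1)) (1 / 2)) := by
  have b := (stdOrthonormalBasis ℝ ((ℝ ∙ e)ᗮ : Submodule ℝ (Space d))).reindex
    (finCongr (finrank_orthogonal he))
  rw [← b.measurePreserving_repr.measure_preimage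
    Metric.isClosed_closedBall.measurableSet.nullMeasurableSet]
  congr 1
  ext x
  simp

theorem ballVol_pos : 0 < ballVol d :=
  ENNReal.toReal_pos (Metric.measure_closedBall_pos _ _ (by norm_num)).ne'
    measure_closedBall_lt_top.ne

/-- The orthogonal decomposition along `e` is an isometry; this is Fubini's theorem for the lines
parallel to `e`. -/
theorem measurePreserving_hyperplane {e : Space d} (he : ‖e‖ = 1) :
    MeasurePreserving (fun p : ℝ × ((ℝ ∙ e)ᗮ : Submodule ℝ (Space d)) => p.1 • e + (p.2 : Space d))
      (volume.prod volume) volume := by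
  have h1 := ((LinearIsometryEquiv.toSpanUnitSingleton (𝕜 := ℝ) e he).measurePreserving.prod
    (MeasurePreserving.id (volume : Measure ((ℝ ∙ e)ᗮ : Submodule ℝ (Space d)))))
  have h2 := WithLp.volume_preserving_toLp (ℝ ∙ e) ((ℝ ∙ e)ᗮ : Submodule ℝ (Space d))
  have h3 : MeasurePreserving ((ℝ ∙ e).orthogonalDecomposition.symm : _ → Space d) volume volume :=
    LinearIsometryEquiv.measurePreserving _
  have h := h3.comp (h2.comp h1)
  convert h using 1
  ext p : 1
  rfl

end

section

variable {d m : ℕ}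

/-! ### Polar coordinates on the rotation group -/

/-- The weight `‖z‖^(1-d)` cancels the Jacobian `r^(d-1)` of polar coordinates. -/
theorem lintegral_polar (hd : 1 ≤ d) {f : Space d → ℝ≥0∞} (hf : Measurable f) :
    ∫⁻ z, ENNReal.ofReal (‖z‖ ^ (1 - (d : ℤ))) * f z =
      ∫⁻ σ, (∫⁻ r in Ioi (0 : ℝ), f (r • (σ : Space d))) ∂(volume : Measure (Space d)).toSphere := by
  have : Nonempty (Fin d) := ⟨⟨0, hd⟩⟩
  have h0 : ∫⁻ z, ENNReal.ofReal (‖z‖ ^ (1 - (d : ℤ))) * f z =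
      ∫⁻ z : ({0}ᶜ : Set (Space d)), ENNReal.ofReal (‖(z : Space d)‖ ^ (1 - (d : ℤ))) * f z
        ∂(volume : Measure (Space d)).comap Subtype.val := by
    rw [lintegral_subtype_comap (measurableSet_singleton _).compl
      fun z : Space d => ENNReal.ofReal (‖z‖ ^ (1 - (d : ℤ))) * f z, restrict_compl_singleton]
  have hmp := (volume : Measure (Space d)).measurePreserving_homeomorphUnitSphereProd
  have h1 : ∀ z : ({0}ᶜ : Set (Space d)), ENNReal.ofReal (‖(z : Space d)‖ ^ (1 - (d : ℤ))) * f z =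
      (fun p : Metric.sphere (0 : Space d) 1 × Ioi (0 : ℝ) =>
        ENNReal.ofReal ((p.2 : ℝ) ^ (1 - (d : ℤ))) * f ((p.2 : ℝ) • (p.1 : Space d)))
        (homeomorphUnitSphereProd (Space d) z) := by
    intro z
    have hz : ‖(z : Space d)‖ ≠ 0 := norm_ne_zero_iff.2 z.2
    simp only [homeomorphUnitSphereProd_apply_fst_coe, homeomorphUnitSphereProd_apply_snd_coe]
    rw [smul_smul, mul_inv_cancel₀ hz, one_smul]
  have hm : Measurable fun p : Metric.sphere (0 : Space d) 1 × Ioi (0 : ℝ) =>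
      ENNReal.ofReal ((p.2 : ℝ) ^ (1 - (d : ℤ))) * f ((p.2 : ℝ) • (p.1 : Space d)) := by
    refine Measurable.mul ?_ (hf.comp ?_)
    · exact ((measurable_subtype_coe.comp measurable_snd).pow_const _).ennreal_ofReal
    · exact (measurable_subtype_coe.comp measurable_snd).smul
        (measurable_subtype_coe.comp measurable_fst)
  rw [h0, (lintegral_congr h1).trans (hmp.lintegral_comp hm), lintegral_prod _ hm.aemeasurable]
  refine lintegral_congr fun σ => ?_
  have hm' : Measurable fun r : Ioi (0 : ℝ) =>
      ENNReal.ofReal ((r : ℝ) ^ (1 - (d : ℤ))) * f ((r : ℝ) • (σ : Space d)) :=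
    hm.comp (measurable_prodMk_left (x := σ))
  rw [Measure.volumeIoiPow, lintegral_withDensity_eq_lintegral_mul _
    (measurable_subtype_coe.pow_const _).ennreal_ofReal hm', ← lintegral_subtype_comap measurableSet_Ioi fun r : ℝ => f (r • (σ : Space d))]
  refine lintegral_congr fun r => ?_
  have hr : (0 : ℝ) < r := r.2
  simp only [Pi.mul_apply, finrank_euclideanSpace_fin]
  rw [← mul_assoc, ← ENNReal.ofReal_mul (by positivity)]
  have : (r : ℝ) ^ (d - 1) * (r : ℝ) ^ (1 - (d : ℤ)) = 1 := by
    rw [← zpow_natCast, ← zpow_add₀ hr.ne']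
    have : ((d - 1 : ℕ) : ℤ) + (1 - (d : ℤ)) = 0 := by omega
    rw [this, zpow_zero]
  rw [this, ENNReal.ofReal_one, one_mul]

theorem measurePreserving_rot (M : SO d) : MeasurePreserving (rot M) volume volume :=
  (rotL M).measurePreserving

theorem measurable_smul_rot (e : Space d) :
    Measurable fun p : SO d × ℝ => p.2 • rot p.1⁻¹ e :=
  (continuous_snd.smul (continuous_rot.comp (f := fun p : SO d × ℝ => (p.1⁻¹, e))
    (by fun_prop))).measurable

/-- Left invariance of the Haar measure moves `e` to `e'` or to `-e'`; in the second case the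
substitution `u ↦ -u` on the line finishes. -/
theorem lintegral_rot_line_eq (f : Space d → ℝ≥0∞) {e e' : Space d}
    (he : ‖e‖ = 1) (he' : ‖e'‖ = 1) :
    ∫⁻ M, (∫⁻ u : ℝ, f (u • rot M⁻¹ e')) ∂haarSO d = ∫⁻ M, (∫⁻ u : ℝ, f (u • rot M⁻¹ e)) ∂haarSO d := by
  have hN : ∀ (N : SO d) (x : Space d),
      ∫⁻ M, (∫⁻ u : ℝ, f (u • rot M⁻¹ (rot N x))) ∂haarSO d =
        ∫⁻ M, (∫⁻ u : ℝ, f (u • rot M⁻¹ x)) ∂haarSO d := by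
    intro N x
    rw [← lintegral_mul_left_eq_self (μ := haarSO d)
      (fun M => ∫⁻ u : ℝ, f (u • rot M⁻¹ x)) N⁻¹]
    refine lintegral_congr fun M => lintegral_congr fun u => ?_
    rw [mul_inv_rev, inv_inv, rot_mul]
  obtain ⟨N, hN1 | hN1⟩ := exists_rot_eq_or_neg he he'
  · rw [← hN1, hN]
  · rw [← hN N e, hN1]
    refine lintegral_congr fun M => ?_
    rw [← lintegral_neg_eq_self]
    refine lintegral_congr fun u => ?_
    rw [rot_neg, smul_neg, neg_smul]

/-- The left side does not depend on `e`, so it may be integrated over the sphere. After exchanging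
the integrals, for fixed `M` the lines through the origin cover space by polar coordinates, twice
because each line consists of two rays: hence the factor `2`. -/
theorem lintegral_rot_line (hd : 1 ≤ d) {f : Space d → ℝ≥0∞} (hf : Measurable f) {e : Space d}
    (he : ‖e‖ = 1) :
    (volume : Measure (Space d)).toSphere univ * ∫⁻ M, (∫⁻ u : ℝ, f (u • rot M⁻¹ e)) ∂haarSO d =
      2 * ∫⁻ z, ENNReal.ofReal (‖z‖ ^ (1 - (d : ℤ))) * f z := by
  have hmeas : Measurable fun q : (Metric.sphere (0 : Space d) 1 × SO d) × ℝ =>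
      f (q.2 • rot q.1.2⁻¹ (q.1.1 : Space d)) := by
    refine hf.comp (Continuous.measurable ?_)
    exact continuous_snd.smul (continuous_rot.comp
      (f := fun q : (Metric.sphere (0 : Space d) 1 × SO d) × ℝ => (q.1.2⁻¹, (q.1.1 : Space d)))
      (by fun_prop))
  have h1 : ∀ M : SO d, ∫⁻ σ, (∫⁻ u : ℝ, f (u • rot M⁻¹ (σ : Space d))) ∂(volume : Measure (Space d)).toSphere =
      2 * ∫⁻ z, ENNReal.ofReal (‖z‖ ^ (1 - (d : ℤ))) * f z := by
    intro M
    have hfM : Measurable fun z => f (rot M⁻¹ z) := hf.comp (measurePreserving_rot _).measurable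
    have h2 : ∀ σ : Metric.sphere (0 : Space d) 1, ∫⁻ u : ℝ, f (u • rot M⁻¹ (σ : Space d)) =
        (∫⁻ u in Ioi (0 : ℝ), f (rot M⁻¹ (u • (σ : Space d)))) +
        ∫⁻ u in Ioi (0 : ℝ), f (rot M⁻¹ (-(u • (σ : Space d)))) := by
      intro σ
      have hg : Measurable fun u : ℝ => f (u • rot M⁻¹ (σ : Space d)) :=
        hf.comp (measurable_id.smul_const _)
      rw [← lintegral_add_compl _ (measurableSet_Ioi (a := (0 : ℝ))), compl_Ioi,
        ← restrict_Iio_eq_restrict_Iic]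
      congr 1
      · simp only [rot_smul]
      · rw [← (Measure.measurePreserving_neg (volume : Measure ℝ)).setLIntegral_comp_preimage
          measurableSet_Iio hg]
        simp only [neg_preimage, Set.neg_Iio, neg_zero, rot_neg, rot_smul, neg_smul]
    have hm1 : Measurable fun σ : Metric.sphere (0 : Space d) 1 =>
        ∫⁻ u in Ioi (0 : ℝ), f (rot M⁻¹ (u • (σ : Space d))) := by
      refine Measurable.lintegral_prod_right' (f := fun p : Metric.sphere (0 : Space d) 1 × ℝ =>
        f (rot M⁻¹ (p.2 • (p.1 : Space d)))) ?_
      exact hfM.comp (measurable_snd.smul (measurable_subtype_coe.comp measurable_fst))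
    rw [lintegral_congr h2, lintegral_add_left hm1, ← lintegral_polar hd hfM,
      ← lintegral_polar hd (f := fun z => f (rot M⁻¹ (-z))) (hfM.comp measurable_neg), two_mul]
    congr 1
    · rw [← (measurePreserving_rot M⁻¹).lintegral_comp (f := fun z =>
        ENNReal.ofReal (‖z‖ ^ (1 - (d : ℤ))) * f z)
        ((measurable_norm.pow_const _).ennreal_ofReal.mul hf)]
      simp only [norm_rot]
    · rw [← lintegral_neg_eq_self, ← (measurePreserving_rot M⁻¹).lintegral_comp (f := fun z =>
        ENNReal.ofReal (‖z‖ ^ (1 - (d : ℤ))) * f z)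
        ((measurable_norm.pow_const _).ennreal_ofReal.mul hf)]
      simp only [norm_rot, norm_neg, neg_neg]
  calc (volume : Measure (Space d)).toSphere univ * ∫⁻ M, (∫⁻ u : ℝ, f (u • rot M⁻¹ e)) ∂haarSO d
      = ∫⁻ σ, (∫⁻ M, (∫⁻ u : ℝ, f (u • rot M⁻¹ (σ : Space d))) ∂haarSO d)
          ∂(volume : Measure (Space d)).toSphere := by
        rw [lintegral_congr fun σ : Metric.sphere (0 : Space d) 1 =>
          lintegral_rot_line_eq f he (mem_sphere_zero_iff_norm.1 σ.2), lintegral_const, mul_comm]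
    _ = ∫⁻ M, (∫⁻ σ, (∫⁻ u : ℝ, f (u • rot M⁻¹ (σ : Space d)))
          ∂(volume : Measure (Space d)).toSphere) ∂haarSO d :=
        lintegral_lintegral_swap hmeas.lintegral_prod_right'.aemeasurable
    _ = _ := by rw [lintegral_congr h1, lintegral_const, measure_univ, mul_one]

theorem sphereArea_pos (hd : 1 ≤ d) : 0 < sphereArea d := by
  have : Nonempty (Fin d) := ⟨⟨0, hd⟩⟩
  refine ENNReal.toReal_pos ?_ (measure_ne_top _ _)
  rw [Ne, Measure.measure_univ_eq_zero]
  exact Measure.toSphere_ne_zero _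

/-- An identity of measures, so that it applies to integrals of signed and vector valued functions
and not only to nonnegative ones. -/
theorem map_smul_rot (hd : 1 ≤ d) {e : Space d} (he : ‖e‖ = 1) :
    ((haarSO d).prod volume).map (fun p : SO d × ℝ => p.2 • rot p.1⁻¹ e) =
      ENNReal.ofReal (2 / sphereArea d) •
        (volume : Measure (Space d)).withDensity fun z => ENNReal.ofReal (‖z‖ ^ (1 - (d : ℤ))) := by
  have hS := sphereArea_pos hd
  refine Measure.ext fun s hs => ?_
  have h := lintegral_rot_line hd (f := s.indicator 1) (measurable_one.indicator hs) he
  have hS' : (volume : Measure (Space d)).toSphere univ = ENNReal.ofReal (sphereArea d) :=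
    (ENNReal.ofReal_toReal (measure_ne_top _ _)).symm
  rw [hS'] at h
  have h1 : ∫⁻ M, (∫⁻ u : ℝ, s.indicator 1 (u • rot M⁻¹ e)) ∂haarSO d =
      ((haarSO d).prod volume).map (fun p : SO d × ℝ => p.2 • rot p.1⁻¹ e) s := by
    have hm : Measurable fun p : SO d × ℝ =>
        s.indicator (1 : Space d → ℝ≥0∞) (p.2 • rot p.1⁻¹ e) :=
      (measurable_one.indicator hs).comp (measurable_smul_rot e)
    rw [← lintegral_indicator_one hs, lintegral_map (measurable_one.indicator hs)
      (measurable_smul_rot e), lintegral_prod _ hm.aemeasurable]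
  have h2 : ∫⁻ z, ENNReal.ofReal (‖z‖ ^ (1 - (d : ℤ))) * s.indicator 1 z =
      (volume : Measure (Space d)).withDensity
        (fun z => ENNReal.ofReal (‖z‖ ^ (1 - (d : ℤ)))) s := by
    rw [withDensity_apply _ hs, ← lintegral_indicator hs]
    refine lintegral_congr fun z => ?_
    by_cases hz : z ∈ s <;> simp [hz]
  rw [h1, h2] at h
  rw [Measure.smul_apply, smul_eq_mul, ENNReal.ofReal_div_of_pos hS, ENNReal.div_eq_inv_mul,
    mul_assoc, ENNReal.ofReal_ofNat, ← h, ← mul_assoc, ENNReal.inv_mul_cancel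
    (by simpa using hS) ENNReal.ofReal_ne_top, one_mul]

theorem integral_rot_line {F : Type*} [NormedAddCommGroup F] [NormedSpace ℝ F] (hd : 1 ≤ d)
    {e : Space d} (he : ‖e‖ = 1) {f : Space d → F} (hf : StronglyMeasurable f) :
    ∫ p : SO d × ℝ, f (p.2 • rot p.1⁻¹ e) ∂(haarSO d).prod volume =
      (2 / sphereArea d) • ∫ z, ‖z‖ ^ (1 - (d : ℤ)) • f z := by
  rw [← integral_map (φ := fun p : SO d × ℝ => p.2 • rot p.1⁻¹ e)
    (measurable_smul_rot e).aemeasurable hf.aestronglyMeasurable, map_smul_rot hd he,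
    integral_smul_measure, ENNReal.toReal_ofReal (div_nonneg zero_le_two (sphereArea_pos hd).le)]
  congr 1
  rw [integral_withDensity_eq_integral_toReal_smul (measurable_norm.pow_const _).ennreal_ofReal
    (Eventually.of_forall fun _ => ENNReal.ofReal_lt_top)]
  refine integral_congr_ae (Eventually.of_forall fun z => ?_)
  simp only
  rw [ENNReal.toReal_ofReal (by positivity)]

/-- In polar coordinates the weighted integral only sees the length of each ray inside the ball,
which is at most `r`. -/
theorem integrableOn_norm_zpow (hd : 1 ≤ d) (r : ℝ) :
    IntegrableOn (fun z : Space d => ‖z‖ ^ (1 - (d : ℤ))) (Metric.ball 0 r) := by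
  have : Nonempty (Fin d) := ⟨⟨0, hd⟩⟩
  have hm : Measurable fun z : Space d => ‖z‖ ^ (1 - (d : ℤ)) := measurable_norm.pow_const _
  refine ⟨hm.aestronglyMeasurable, ?_⟩
  have h := lintegral_polar hd (f := (Metric.ball (0 : Space d) r).indicator 1)
    (measurable_one.indicator measurableSet_ball)
  have h1 : ∫⁻ z : Space d, ENNReal.ofReal (‖z‖ ^ (1 - (d : ℤ))) * (Metric.ball 0 r).indicator 1 z =
      ∫⁻ z in Metric.ball (0 : Space d) r, ‖‖z‖ ^ (1 - (d : ℤ))‖ₑ := by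
    rw [← lintegral_indicator measurableSet_ball]
    refine lintegral_congr fun z => ?_
    have hp : 0 ≤ ‖z‖ ^ (1 - (d : ℤ)) := by positivity
    rw [← Real.enorm_of_nonneg hp]
    by_cases hz : z ∈ Metric.ball (0 : Space d) r <;> simp only [hz, indicator_of_mem,
      indicator_of_notMem, not_false_eq_true, Pi.one_apply, mul_one, mul_zero]
  rw [HasFiniteIntegral, ← h1, h]
  have h2 : ∀ σ : Metric.sphere (0 : Space d) 1,
      ∫⁻ u in Ioi (0 : ℝ), (Metric.ball (0 : Space d) r).indicator 1 (u • (σ : Space d)) ≤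
        ENNReal.ofReal r := by
    intro σ
    have h3 : ∀ u ∈ Ioi (0 : ℝ), (Metric.ball (0 : Space d) r).indicator (1 : Space d → ℝ≥0∞)
        (u • (σ : Space d)) ≤ (Ioo 0 r).indicator 1 u := by
      intro u hu
      by_cases hur : u < r
      · rw [indicator_of_mem (s := Ioo 0 r) ⟨hu, hur⟩]
        exact indicator_le_self' (fun _ _ => zero_le) _
      · rw [indicator_of_notMem]
        · exact zero_le
        · rw [mem_ball_zero_iff, norm_smul, mem_sphere_zero_iff_norm.1 σ.2, mul_one,
            Real.norm_of_nonneg (le_of_lt hu)]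
          exact hur
    calc _ ≤ ∫⁻ u in Ioi (0 : ℝ), (Ioo 0 r).indicator 1 u :=
          setLIntegral_mono' measurableSet_Ioi h3
      _ ≤ ∫⁻ u : ℝ, (Ioo 0 r).indicator 1 u := setLIntegral_le_lintegral _ _
      _ = ENNReal.ofReal r := by
        rw [lintegral_indicator_one measurableSet_Ioo, Real.volume_Ioo, sub_zero]
  refine (lintegral_mono h2).trans_lt ?_
  rw [lintegral_const]
  exact ENNReal.mul_lt_top ENNReal.ofReal_lt_top (measure_lt_top _ _)

end

section

variable {d m : ℕ} {E : Type*} [NormedAddCommGroup E] [NormedSpace ℝ E]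

/-! ### Averages over the impact parameter -/

theorem inner_coe_orthogonal (e : Space d) (b : ((ℝ ∙ e)ᗮ : Submodule ℝ (Space d))) :
    inner ℝ e (b : Space d) = 0 :=
  Submodule.mem_orthogonal_singleton_iff_inner_right.1 b.2

theorem integral_impactLaw {e : Space d} (he : ‖e‖ = 1) {F : Space d → E} (hF : Continuous F) :
    ∫ b, F b ∂impactLaw e = (ballVol d)⁻¹ •
      ∫ b in Metric.closedBall (0 : ((ℝ ∙ e)ᗮ : Submodule ℝ (Space d))) (1 / 2), F b := by
  rw [impactLaw, integral_map measurable_subtype_coe.aemeasurable hF.aestronglyMeasurable,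
    ProbabilityTheory.cond, integral_smul_measure, volume_closedBall_orthogonal he,
    ENNReal.toReal_inv, ballVol, measureReal_def]

theorem norm_line_ge_left {b e : Space d} (he : ‖e‖ = 1) (hb : inner ℝ e b = 0) (t : ℝ) :
    ‖b‖ ≤ ‖line b e t‖ := by
  have h : ‖line b e t‖ ^ 2 = ‖b‖ ^ 2 + (t - 1 / 2) ^ 2 := by
    rw [line, norm_add_sq_real, real_inner_smul_right, real_inner_comm, hb, norm_smul, he,
      mul_one, Real.norm_eq_abs, sq_abs]
    ring
  exact (sq_le_sq₀ (norm_nonneg _) (norm_nonneg _)).1 (by rw [h]; nlinarith [sq_nonneg (t - 1 / 2)])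

theorem half_le_norm_line {b e : Space d} (he : ‖e‖ = 1) (hb : inner ℝ e b = 0) {t : ℝ}
    (ht : t ∉ Ioc (0 : ℝ) 2) : 1 / 2 ≤ ‖line b e t‖ := by
  refine norm_ge_of_inner he ?_
  rw [inner_line he hb, le_abs]
  by_contra! h
  exact ht ⟨by linarith [h.2], by linarith [h.1]⟩

theorem integral_line_eq {e b : Space d} (he : ‖e‖ = 1) (hb : inner ℝ e b = 0) {h : Space d → E}
    (hs : ∀ y, 1 / 2 ≤ ‖y‖ → h y = 0) :
    ∫ t in (0 : ℝ)..2, h (line b e t) = ∫ t : ℝ, h (t • e + b) := by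
  rw [intervalIntegral.integral_of_le zero_le_two, setIntegral_eq_integral_of_forall_compl_eq_zero
    fun t ht => hs _ (half_le_norm_line he hb ht),
    ← integral_sub_right_eq_self (fun t : ℝ => h (t • e + b)) (1 / 2)]
  simp only [line, add_comm]

/-- The lines issuing from the disc of impact parameters sweep out a cylinder that contains the
support of `h`; the normalisation of the impact law leaves the factor `1 / C_d`. -/
theorem integral_impactLaw_line {e : Space d} (he : ‖e‖ = 1) {h : Space d → E}
    (hc : Continuous h) (hs : ∀ y, 1 / 2 ≤ ‖y‖ → h y = 0) :
    ∫ b, (∫ t in (0 : ℝ)..2, h (line b e t)) ∂impactLaw e = (ballVol d)⁻¹ • ∫ y, h y := by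
  have hl : Continuous fun q : Space d × ℝ => line q.1 e q.2 := by unfold line; fun_prop
  have hmp := measurePreserving_hyperplane he
  have hi : Integrable h := hc.integrable_of_hasCompactSupport
    (HasCompactSupport.intro (isCompact_closedBall 0 (1 / 2)) fun y hy => hs y (by
      rw [mem_closedBall_zero_iff, not_le] at hy; exact hy.le))
  have hi' : Integrable (fun p : ℝ × ((ℝ ∙ e)ᗮ : Submodule ℝ (Space d)) =>
      h (p.1 • e + (p.2 : Space d))) (volume.prod volume) := hmp.integrable_comp_of_integrable hi
  rw [integral_impactLaw he (intervalIntegral.continuous_parametric_intervalIntegral_of_continuous'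
    (f := fun b t => h (line b e t)) (hc.comp hl) 0 2),
    setIntegral_eq_integral_of_forall_compl_eq_zero]
  · congr 1
    rw [← hmp.map_eq, integral_map hmp.aemeasurable (by
      rw [hmp.map_eq]; exact hc.aestronglyMeasurable), integral_prod_symm _ hi']
    exact integral_congr_ae (Eventually.of_forall fun b =>
      integral_line_eq he (inner_coe_orthogonal e b) hs)
  · intro b hb
    rw [mem_closedBall_zero_iff, not_le] at hb
    refine (intervalIntegral.integral_congr (g := fun _ => (0 : E)) fun t _ => ?_).trans
      intervalIntegral.integral_zero
    exact hs _ (hb.le.trans (norm_line_ge_left he (inner_coe_orthogonal e b) t))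

/-- One point of the line becomes `y`, the other `y - u e` with `u = t - r`. The integral over `u`
is a function of `y` supported in the ball, to which the single line formula applies. -/
theorem integral_impactLaw_line_line {e : Space d} (he : ‖e‖ = 1) {k : ℝ → ℝ} (hk : Continuous k)
    {H : Space d → Space d → ℝ} (hH : Continuous fun p : Space d × Space d => H p.1 p.2)
    (hs : ∀ x y, 1 / 2 ≤ ‖x‖ ∨ 1 / 2 ≤ ‖y‖ → H x y = 0) :
    ∫ b, (∫ t in (0 : ℝ)..2, ∫ r in (0 : ℝ)..2, k (t - r) * H (line b e t) (line b e r))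
      ∂impactLaw e = (ballVol d)⁻¹ * ∫ y, ∫ u : ℝ, k u * H y (y - u • e) := by
  -- Two points of the ball are less than `1` apart; any fixed bounded range of `u` containing these
  -- offsets gives continuity in `y`.
  have h1 : ∀ y, ∫ u : ℝ, k u * H y (y - u • e) =
      ∫ u in (-2 : ℝ)..2, k u * H y (y - u • e) := by
    intro y
    rw [intervalIntegral.integral_of_le (by norm_num),
      setIntegral_eq_integral_of_forall_compl_eq_zero]
    intro u hu
    rw [hs, mul_zero]
    by_contra! h
    have : ‖u • e‖ ≤ ‖y‖ + ‖y - u • e‖ := by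
      have := norm_sub_le y (y - u • e)
      rwa [sub_sub_cancel] at this
    rw [norm_smul, he, mul_one, Real.norm_eq_abs] at this
    have h2 : |u| < 1 := by linarith [h.1, h.2]
    rw [abs_lt] at h2
    exact hu ⟨by linarith [h2.1], by linarith [h2.2]⟩
  have hc : Continuous fun y => ∫ u : ℝ, k u * H y (y - u • e) := by
    simp only [h1]
    refine intervalIntegral.continuous_parametric_intervalIntegral_of_continuous'
      (f := fun y u => k u * H y (y - u • e)) ?_ _ _
    exact (hk.comp continuous_snd).mul (hH.comp (f := fun q : Space d × ℝ =>
      (q.1, q.1 - q.2 • e)) (by fun_prop))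
  rw [← smul_eq_mul, ← integral_impactLaw_line he hc fun y hy => by simp [hs _ _ (Or.inl hy)]]
  refine integral_congr_ae ?_
  filter_upwards [ae_impactLaw (v := e)] with b hb
  refine intervalIntegral.integral_congr fun t _ => ?_
  beta_reduce
  rw [intervalIntegral.integral_of_le zero_le_two, setIntegral_eq_integral_of_forall_compl_eq_zero
    fun r hr => by rw [hs _ _ (Or.inr (half_le_norm_line he hb.1 hr)), mul_zero],
    ← integral_sub_left_eq_self (fun u : ℝ => k u * H (line b e t) (line b e t - u • e)) volume t]
  refine integral_congr_ae (Eventually.of_forall fun r => ?_)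
  have : line b e t - (t - r) • e = line b e r := by unfold line; module
  simp only [this]

/-! ### Averages over rotations -/

theorem measurable_norm_zpow_sub : Measurable fun p : Space d × Space d =>
    ‖p.1 - p.2‖ ^ (1 - (d : ℤ)) := by
  have : Measurable fun z : Space d => ‖z‖ ^ (1 - (d : ℤ)) := measurable_norm.pow_const _
  exact this.comp (measurable_fst.sub measurable_snd)

/-- The shear `(x, y) ↦ (x - y, y)` preserves volume and turns the majorant into a product: a
locally integrable kernel on the unit ball times a bounded function of `y`. -/
theorem integrable_norm_zpow_mul (hd : 1 ≤ d) {H : Space d × Space d → ℝ} {K : ℝ}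
    (hH : Measurable H) (hK : ∀ p, |H p| ≤ K)
    (hs : ∀ x y, 1 / 2 ≤ ‖x‖ ∨ 1 / 2 ≤ ‖y‖ → H (x, y) = 0) :
    Integrable fun p : Space d × Space d => ‖p.1 - p.2‖ ^ (1 - (d : ℤ)) * H p := by
  have h1 : Integrable ((Metric.ball (0 : Space d) 1).indicator fun _ => K) :=
    (integrable_indicator_iff measurableSet_ball).2
      (integrableOn_const measure_ball_lt_top.ne)
  have h2 : Integrable ((Metric.ball (0 : Space d) 1).indicator
      fun z => ‖z‖ ^ (1 - (d : ℤ))) :=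
    (integrable_indicator_iff measurableSet_ball).2 (integrableOn_norm_zpow hd 1)
  have h3 := (h2.mul_prod h1)
  have hmp := measurePreserving_sub_prod (volume : Measure (Space d)) (volume : Measure (Space d))
  have h4 := hmp.integrable_comp_of_integrable h3
  refine h4.mono' (measurable_norm_zpow_sub.mul hH).aestronglyMeasurable
    (Eventually.of_forall fun p => ?_)
  have h0 : 0 ≤ ‖p.1 - p.2‖ ^ (1 - (d : ℤ)) := by positivity
  have hK0 : 0 ≤ K := (abs_nonneg _).trans (hK 0)
  rw [norm_mul, Real.norm_of_nonneg h0, Real.norm_eq_abs]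
  by_cases h : 1 / 2 ≤ ‖p.1‖ ∨ 1 / 2 ≤ ‖p.2‖
  · rw [hs _ _ h, abs_zero, mul_zero]
    refine mul_nonneg (indicator_nonneg (fun z _ => by positivity) _)
      (indicator_nonneg (fun z _ => hK0) _)
  · push Not at h
    have ha : p.1 - p.2 ∈ Metric.ball (0 : Space d) 1 := by
      rw [mem_ball_zero_iff]; linarith [norm_sub_le p.1 p.2, h.1, h.2]
    have hb : p.2 ∈ Metric.ball (0 : Space d) 1 := by
      rw [mem_ball_zero_iff]; linarith [h.2]
    simp only [Function.comp]
    rw [indicator_of_mem ha, indicator_of_mem hb]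
    exact mul_le_mul_of_nonneg_left (hK p) h0

/-- The impact average leaves an integral over a point `y` and a signed offset `u` in the direction
`M⁻¹ e`. Averaging over `M` turns `u M⁻¹ e` into a vector `z` with density `(2 / |𝕊^(d-1)|)
‖z‖^(1-d)`. Only `|u| = ‖z‖` survives, so the weight `k` has to be even. -/
theorem integral_rot_line_line (hd : 1 ≤ d) {e : Space d} (he : ‖e‖ = 1) {k : ℝ → ℝ}
    (hk : Continuous k) (hk' : ∀ u, k |u| = k u) {H : Space d → Space d → ℝ}
    (hH : Continuous fun p : Space d × Space d => H p.1 p.2)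
    (hs : ∀ x y, 1 / 2 ≤ ‖x‖ ∨ 1 / 2 ≤ ‖y‖ → H x y = 0) :
    ∫ M, (∫ b, (∫ t in (0 : ℝ)..2, ∫ r in (0 : ℝ)..2,
      k (t - r) * H (line (rot M⁻¹ b) (rot M⁻¹ e) t) (line (rot M⁻¹ b) (rot M⁻¹ e) r))
        ∂impactLaw e) ∂haarSO d =
      2 / sphereArea d / ballVol d * ∫ p : Space d × Space d,
        ‖p.1 - p.2‖ ^ (1 - (d : ℤ)) * (k ‖p.1 - p.2‖ * H p.1 p.2) := by
  have hrot : Continuous fun q : (SO d × ℝ) => q.2 • rot q.1⁻¹ e :=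
    continuous_snd.smul (continuous_rot.comp (f := fun q : SO d × ℝ => (q.1⁻¹, e)) (by fun_prop))
  have hcp : HasCompactSupport fun p : Space d × Space d => k ‖p.1 - p.2‖ * H p.1 p.2 :=
    HasCompactSupport.intro ((isCompact_closedBall (0 : Space d) (1 / 2)).prod
      (isCompact_closedBall (0 : Space d) (1 / 2))) fun p hp => by
        rw [hs, mul_zero]
        by_contra! h
        exact hp ⟨by simpa using h.1.le, by simpa using h.2.le⟩
  have hcpc : Continuous fun p : Space d × Space d => k ‖p.1 - p.2‖ * H p.1 p.2 :=
    (hk.comp (by fun_prop : Continuous fun p : Space d × Space d => ‖p.1 - p.2‖)).mul hH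
  obtain ⟨K, hK⟩ := hcp.exists_bound_of_continuous hcpc
  have hint := integrable_norm_zpow_mul hd hcpc.measurable hK
    fun x y hxy => by simp only; rw [hs x y hxy, mul_zero]
  -- the average over the impact parameter
  have h1 : ∀ M : SO d, ∫ b, (∫ t in (0 : ℝ)..2, ∫ r in (0 : ℝ)..2,
      k (t - r) * H (line (rot M⁻¹ b) (rot M⁻¹ e) t) (line (rot M⁻¹ b) (rot M⁻¹ e) r))
        ∂impactLaw e =
      (ballVol d)⁻¹ * ∫ y, ∫ u : ℝ, k u * H y (y - u • rot M⁻¹ e) := by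
    intro M
    have hM : Continuous (rot M⁻¹) := (rotL M⁻¹).continuous
    have hl : ∀ b t, line (rot M⁻¹ b) (rot M⁻¹ e) t = rot M⁻¹ (line b e t) := by
      intro b t; rw [line, line, rot_add, rot_smul]
    simp only [hl]
    rw [integral_impactLaw_line_line he hk (H := fun x y => H (rot M⁻¹ x) (rot M⁻¹ y))
      (hH.comp (f := fun p : Space d × Space d => (rot M⁻¹ p.1, rot M⁻¹ p.2)) (by fun_prop))
      (fun x y hxy => hs _ _ (by simpa only [norm_rot] using hxy))]
    congr 1
    rw [← (measurePreserving_rot M⁻¹).integral_comp (rotL M⁻¹).toHomeomorph.measurableEmbedding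
      (fun y => ∫ u : ℝ, k u * H y (y - u • rot M⁻¹ e))]
    simp only [rot_sub, rot_smul]
  simp only [h1]
  rw [integral_const_mul]
  -- Fubini
  have hc : Continuous fun q : (SO d × ℝ) × Space d =>
      k q.1.2 * H q.2 (q.2 - q.1.2 • rot q.1.1⁻¹ e) :=
    (hk.comp (by fun_prop)).mul (hH.comp (f := fun q : (SO d × ℝ) × Space d =>
      (q.2, q.2 - q.1.2 • rot q.1.1⁻¹ e))
      (continuous_snd.prodMk (continuous_snd.sub (hrot.comp continuous_fst))))
  have hcs : HasCompactSupport fun q : (SO d × ℝ) × Space d =>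
      k q.1.2 * H q.2 (q.2 - q.1.2 • rot q.1.1⁻¹ e) := by
    refine HasCompactSupport.intro ((isCompact_univ.prod (isCompact_Icc (a := -1) (b := 1))).prod
      (isCompact_closedBall (0 : Space d) (1 / 2))) fun q hq => ?_
    rw [hs, mul_zero]
    by_contra! h
    refine hq ⟨⟨mem_univ _, ?_⟩, by simpa using h.1.le⟩
    have := norm_sub_le q.2 (q.2 - q.1.2 • rot q.1.1⁻¹ e)
    rw [sub_sub_cancel, norm_smul, norm_rot, he, mul_one, Real.norm_eq_abs] at this
    exact abs_le.1 (by linarith [h.1, h.2])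
  have hi : Integrable (fun q : (SO d × ℝ) × Space d =>
      k q.1.2 * H q.2 (q.2 - q.1.2 • rot q.1.1⁻¹ e)) (((haarSO d).prod volume).prod volume) :=
    hc.integrable_of_hasCompactSupport hcs
  have h2 : ∫ M, (∫ y, ∫ u : ℝ, k u * H y (y - u • rot M⁻¹ e)) ∂haarSO d =
      ∫ y, ∫ q : SO d × ℝ, k q.2 * H y (y - q.2 • rot q.1⁻¹ e) ∂(haarSO d).prod volume := by
    rw [← integral_prod_symm _ hi, integral_prod _ hi, integral_prod _ hi.integral_prod_left]
    refine integral_congr_ae (Eventually.of_forall fun M => ?_)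
    simp only
    refine integral_integral_swap (f := fun y u => k u * H y (y - u • rot M⁻¹ e)) ?_
    have hcM : Continuous fun q : Space d × ℝ => k q.2 * H q.1 (q.1 - q.2 • rot M⁻¹ e) :=
      hc.comp (f := fun q : Space d × ℝ => ((M, q.2), q.1)) (by fun_prop)
    refine hcM.integrable_of_hasCompactSupport (HasCompactSupport.intro
      ((isCompact_closedBall (0 : Space d) (1 / 2)).prod (isCompact_Icc (a := -1) (b := 1)))
      fun q hq => ?_)
    rw [hs, mul_zero]
    by_contra! h
    refine hq ⟨by simpa using h.1.le, ?_⟩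
    have := norm_sub_le q.1 (q.1 - q.2 • rot M⁻¹ e)
    rw [sub_sub_cancel, norm_smul, norm_rot, he, mul_one, Real.norm_eq_abs] at this
    exact abs_le.1 (by linarith [h.1, h.2])
  have h3 : ∀ y, ∫ q : SO d × ℝ, k q.2 * H y (y - q.2 • rot q.1⁻¹ e) ∂(haarSO d).prod volume =
      2 / sphereArea d * ∫ y', ‖y - y'‖ ^ (1 - (d : ℤ)) * (k ‖y - y'‖ * H y y') := by
    intro y
    have hm : StronglyMeasurable fun z => k ‖z‖ * H y (y - z) :=
      ((hk.comp continuous_norm).mul (hH.comp (f := fun z => (y, y - z))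
        (by fun_prop))).stronglyMeasurable
    have := integral_rot_line hd he hm
    simp only [norm_smul, norm_rot, he, mul_one, Real.norm_eq_abs, hk', smul_eq_mul] at this
    rw [this, ← integral_sub_left_eq_self (fun z =>
      ‖z‖ ^ (1 - (d : ℤ)) * (k ‖z‖ * H y (y - z))) volume y]
    simp only [sub_sub_cancel]
  rw [h2]
  simp only [h3]
  rw [integral_const_mul, ← mul_assoc, Measure.volume_eq_prod, integral_prod _ hint]
  congr 1
  field_simp

end

section

variable {d m : ℕ} {E : Type*} [NormedAddCommGroup E] [NormedSpace ℝ E]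

/-! ### The law of the impact parameter -/

/-- The points of a cylinder around the axis `e` whose projection along `e` lies in `S`. -/
def cylinder (e : Space d) (S : Set (Space d)) : Set (Space d) :=
  {y | inner ℝ e y ∈ Icc (0 : ℝ) 1 ∧ ‖y - (inner ℝ e y : ℝ) • e‖ ≤ 1 / 2 ∧
    y - (inner ℝ e y : ℝ) • e ∈ S}

theorem measurableSet_cylinder_uncurry {S : Set (Space d)} (hS : MeasurableSet S) :
    MeasurableSet {p : Space d × Space d | p.2 ∈ cylinder p.1 S} := by
  have h1 : Measurable fun p : Space d × Space d => inner ℝ p.1 p.2 :=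
    (by fun_prop : Continuous _).measurable
  have h2 : Measurable fun p : Space d × Space d => p.2 - (inner ℝ p.1 p.2 : ℝ) • p.1 :=
    (by fun_prop : Continuous _).measurable
  exact (h1 measurableSet_Icc).inter ((measurableSet_le h2.norm measurable_const).inter (h2 hS))

theorem measurableSet_cylinder (e : Space d) {S : Set (Space d)} (hS : MeasurableSet S) :
    MeasurableSet (cylinder e S) :=
  (measurable_prodMk_left (x := e)) (measurableSet_cylinder_uncurry hS)

/-- The disc lies in a hyperplane that moves with `e`. Thickening it to a cylinder of height one
expresses its measure by the volume of a subset of a fixed space. -/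
theorem impactLaw_apply {e : Space d} (he : ‖e‖ = 1) {S : Set (Space d)} (hS : MeasurableSet S) :
    impactLaw e S = (volume (Metric.closedBall (0 : Space (d - 1)) (1 / 2)))⁻¹ *
      volume (cylinder e S) := by
  have h : (fun p : ℝ × ((ℝ ∙ e)ᗮ : Submodule ℝ (Space d)) => p.1 • e + (p.2 : Space d)) ⁻¹'
      cylinder e S = Icc 0 1 ×ˢ (Metric.closedBall 0 (1 / 2) ∩ Subtype.val ⁻¹' S) := by
    ext p
    have h1 : inner ℝ e (p.1 • e + (p.2 : Space d)) = p.1 := by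
      rw [inner_add_right, inner_coe_orthogonal, real_inner_smul_right,
        real_inner_self_eq_norm_sq, he]
      ring
    simp only [cylinder, mem_preimage, mem_ofPred_eq, h1, add_sub_cancel_left, mem_prod, mem_inter_iff,
      mem_closedBall_zero_iff, Submodule.coe_norm]
  rw [impactLaw, Measure.map_apply measurable_subtype_coe hS,
    ProbabilityTheory.cond_apply Metric.isClosed_closedBall.measurableSet,
    volume_closedBall_orthogonal he, ← (measurePreserving_hyperplane he).measure_preimage
      (measurableSet_cylinder e hS).nullMeasurableSet, h, Measure.prod_prod, Real.volume_Icc]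
  simp

/-- In the cylinder form the direction enters as the parameter of a jointly measurable set, so
sections have measurable volume; only `v = 0` has to be set apart. -/
theorem measurable_impactLaw : Measurable (impactLaw (d := d)) := by
  refine Measure.measurable_of_measurable_coe _ fun S hS => ?_
  have h : (fun v : Space d => impactLaw v S) = fun v => if v = 0 then impactLaw (0 : Space d) S else
      (volume (Metric.closedBall (0 : Space (d - 1)) (1 / 2)))⁻¹ *
        volume (cylinder (‖v‖⁻¹ • v) S) := by
    ext v
    split_ifs with hv
    · rw [hv]
    · have h0 := norm_ne_zero_iff.2 hv
      rw [← impactLaw_apply (by rw [norm_smul, norm_inv, norm_norm, inv_mul_cancel₀ h0]) hS,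
        impactLaw_smul (inv_ne_zero h0)]
  rw [h]
  refine Measurable.ite (measurableSet_singleton 0) measurable_const (Measurable.const_mul ?_ _)
  have h2 : Measurable fun p : Space d × Space d => (‖p.1‖⁻¹ • p.1, p.2) :=
    ((measurable_fst.norm.inv).smul measurable_fst).prodMk measurable_snd
  exact measurable_measure_prodMk_left (h2 (measurableSet_cylinder_uncurry hS))

theorem impactLaw_rot {e : Space d} (he : ‖e‖ = 1) (N : SO d) :
    impactLaw (rot N e) = (impactLaw e).map (rot N) := by
  refine Measure.ext fun S hS => ?_
  have hN := (measurePreserving_rot N).measurable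
  rw [Measure.map_apply hN hS, impactLaw_apply (by rw [norm_rot, he]) hS,
    impactLaw_apply he (hN hS), ← (measurePreserving_rot N).measure_preimage
      (measurableSet_cylinder _ hS).nullMeasurableSet]
  congr 2
  ext y
  simp only [cylinder, mem_preimage, mem_ofPred_eq, inner_rot_rot, ← rot_smul, ← rot_sub, norm_rot]

/-! ### Averages over a scattering event as iterated integrals -/

theorem integrable_of_continuous_of_bound {X : Type*} [TopologicalSpace X] [MeasurableSpace X]
    [OpensMeasurableSpace X] [SecondCountableTopology X] {μ : Measure X}
    [IsFiniteMeasure μ] {F : X → ℝ} (hF : Continuous F) {K : ℝ} (hK : ∀ x, |F x| ≤ K) :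
    Integrable F μ :=
  Integrable.of_bound hF.aestronglyMeasurable K (Eventually.of_forall hK)

variable {ν : Measure ℝ} [IsProbabilityMeasure ν]

theorem integrable_mul_scatLaw {F : Space d × SO d × Torus m → ℝ} (hF : Continuous F) {K : ℝ}
    (hK : ∀ x, |F x| ≤ K) {ρ : ℝ → ℝ} (hρ : Integrable ρ ν) (v : Space d) :
    Integrable (fun κ : Params d m => ρ κ.2.2.2 * F (κ.1, κ.2.1, κ.2.2.1)) (scatLaw d m ν v) := by
  have h1 : Integrable (fun κ : Params d m => ρ κ.2.2.2) (scatLaw d m ν v) := by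
    unfold scatLaw
    have h2 := (measurePreserving_snd (μ := impactLaw v) (ν := (haarSO d).prod
      ((volume : Measure (Torus m)).prod ν)))
    have h3 := (measurePreserving_snd (μ := haarSO d) (ν := (volume : Measure (Torus m)).prod ν))
    have h4 := (measurePreserving_snd (μ := (volume : Measure (Torus m))) (ν := ν))
    exact (h4.comp (h3.comp h2)).integrable_comp_of_integrable hρ
  have hFc : Continuous fun κ : Params d m => F (κ.1, κ.2.1, κ.2.2.1) := hF.comp (by fun_prop)
  exact h1.mul_bdd (c := K) hFc.aestronglyMeasurable (Eventually.of_forall fun κ => hK _)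

/-- The average over a scattering event, with the average over the phase carried out first. -/
theorem integral_scatLaw {F : Space d × SO d × Torus m → ℝ} (hF : Continuous F) {K : ℝ}
    (hK : ∀ x, |F x| ≤ K) {ρ : ℝ → ℝ} (hρ : Integrable ρ ν) (v : Space d) :
    ∫ κ : Params d m, ρ κ.2.2.2 * F (κ.1, κ.2.1, κ.2.2.1) ∂scatLaw d m ν v =
      (∫ c, ρ c ∂ν) * ∫ b, (∫ M, (∫ φ, F (b, M, φ)) ∂haarSO d) ∂impactLaw v := by
  have hi := integrable_mul_scatLaw hF hK hρ v
  unfold scatLaw at hi ⊢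
  rw [integral_prod _ hi, ← integral_const_mul]
  refine integral_congr_ae ?_
  filter_upwards [hi.prod_right_ae] with b hb
  rw [integral_prod _ hb, ← integral_const_mul]
  refine integral_congr_ae ?_
  filter_upwards [hb.prod_right_ae] with M hM
  rw [integral_prod _ hM, ← integral_const_mul]
  refine integral_congr_ae (Eventually.of_forall fun φ => ?_)
  simp only
  rw [integral_mul_const]

/-- The average over a scattering event, with the average over the impact parameter carried out
first. -/
theorem integral_scatLaw_symm {F : Space d × SO d × Torus m → ℝ} (hF : Continuous F) {K : ℝ}
    (hK : ∀ x, |F x| ≤ K) {ρ : ℝ → ℝ} (hρ : Integrable ρ ν) (v : Space d) :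
    ∫ κ : Params d m, ρ κ.2.2.2 * F (κ.1, κ.2.1, κ.2.2.1) ∂scatLaw d m ν v =
      (∫ c, ρ c ∂ν) * ∫ φ, ∫ M, (∫ b, F (b, M, φ) ∂impactLaw v) ∂haarSO d := by
  rw [integral_scatLaw hF hK hρ]
  congr 1
  have hi : Integrable F ((impactLaw v).prod ((haarSO d).prod (volume : Measure (Torus m)))) :=
    integrable_of_continuous_of_bound hF hK
  have h1 : ∫ b, (∫ M, (∫ φ, F (b, M, φ)) ∂haarSO d) ∂impactLaw v =
      ∫ q, F q ∂(impactLaw v).prod ((haarSO d).prod (volume : Measure (Torus m))) := by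
    rw [integral_prod _ hi]
    refine integral_congr_ae ?_
    filter_upwards [hi.prod_right_ae] with b hb
    rw [integral_prod _ hb]
  rw [h1, integral_prod_symm _ hi, integral_prod_symm _ hi.integral_prod_right]

theorem continuous_frame (e : Space d) : Continuous fun q : Space d × SO d × Torus m =>
    (rot q.2.1⁻¹ q.1, rot q.2.1⁻¹ e, q.2.2) := by
  refine Continuous.prodMk ?_ (Continuous.prodMk ?_ (by fun_prop))
  · exact continuous_rot.comp (f := fun q : Space d × SO d × Torus m => (q.2.1⁻¹, q.1))
      (by fun_prop)
  · exact continuous_rot.comp (f := fun q : Space d × SO d × Torus m => (q.2.1⁻¹, e))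
      (by fun_prop)

/-- Averages of functions of the data in the frame of the scatterer are rotation invariant. -/
theorem integral_scatLaw_rot {f : (Space d × Space d × Torus m) × ℝ → E}
    (hf : Continuous f) {e : Space d} (he : ‖e‖ = 1) (N : SO d) :
    ∫ κ, f (toFrame (rot N e, κ)) ∂scatLaw d m ν (rot N e) =
      ∫ κ, f (toFrame (e, κ)) ∂scatLaw d m ν e := by
  have hN := (measurePreserving_rot N).measurable
  -- Rotating `b` and `M` together maps the law at `e` to the law at `N e` and leaves the data in
  -- the frame of the scatterer unchanged.
  let T : Params d m → Params d m := fun κ => (rot N κ.1, N * κ.2.1, κ.2.2)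
  have hT : MeasurePreserving T (scatLaw d m ν e) (scatLaw d m ν (rot N e)) := by
    unfold scatLaw
    have h1 : MeasurePreserving (rot N) (impactLaw e) (impactLaw (rot N e)) :=
      ⟨hN, (impactLaw_rot he N).symm⟩
    exact h1.prod ((measurePreserving_mul_left (haarSO d) N).prod (MeasurePreserving.id _))
  have hc : Continuous fun κ : Params d m => f (toFrame (rot N e, κ)) :=
    hf.comp (continuous_toFrame.comp (Continuous.prodMk_right _))
  rw [← hT.map_eq, integral_map hT.aemeasurable hc.aestronglyMeasurable]
  refine integral_congr_ae (Eventually.of_forall fun κ => ?_)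
  simp only [T, toFrame, mul_inv_rev, rot_mul, rot_inv_rot]

/-! ### Interchanging integrals -/

theorem integral_intervalIntegral_swap {X : Type*} [TopologicalSpace X] [CompactSpace X] [T2Space X]
    [SecondCountableTopology X] [MeasurableSpace X] [BorelSpace X] {μ : Measure X}
    [IsFiniteMeasure μ] {f : X → ℝ → E} (hf : Continuous fun q : X × ℝ => f q.1 q.2) :
    ∫ x, (∫ t in (0 : ℝ)..2, f x t) ∂μ = ∫ t in (0 : ℝ)..2, ∫ x, f x t ∂μ := by
  simp only [intervalIntegral.integral_of_le zero_le_two]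
  refine integral_integral_swap ?_
  have h1 : IntegrableOn (fun q : X × ℝ => f q.1 q.2) (univ ×ˢ Icc 0 2) (μ.prod volume) :=
    hf.continuousOn.integrableOn_compact (isCompact_univ.prod isCompact_Icc)
  have h2 := h1.mono_set (prod_mono (subset_refl univ) Ioc_subset_Icc_self)
  rwa [IntegrableOn, ← Measure.prod_restrict, Measure.restrict_univ] at h2

theorem intervalIntegral_swap {f : ℝ → ℝ → E} (hf : Continuous fun q : ℝ × ℝ => f q.1 q.2) :
    ∫ t in (0 : ℝ)..2, ∫ r in (0 : ℝ)..2, f t r = ∫ t in (0 : ℝ)..2, ∫ r in (0 : ℝ)..2, f r t := by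
  simp only [intervalIntegral.integral_of_le zero_le_two]
  refine integral_integral_swap ?_
  have h1 : IntegrableOn (fun q : ℝ × ℝ => f q.1 q.2) (Icc 0 2 ×ˢ Icc 0 2) :=
    hf.continuousOn.integrableOn_compact (isCompact_Icc.prod isCompact_Icc)
  have h2 := h1.mono_set (prod_mono Ioc_subset_Icc_self Ioc_subset_Icc_self)
  rwa [IntegrableOn, Measure.volume_eq_prod, ← Measure.prod_restrict] at h2

theorem integral_intervalIntegral_swap₂ {X : Type*} [TopologicalSpace X] [CompactSpace X] [T2Space X]
    [SecondCountableTopology X] [MeasurableSpace X] [BorelSpace X] {μ : Measure X}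
    [IsFiniteMeasure μ] {f : X → ℝ → ℝ → E} (hf : Continuous fun q : X × ℝ × ℝ => f q.1 q.2.1 q.2.2) :
    ∫ x, (∫ t in (0 : ℝ)..2, ∫ r in (0 : ℝ)..2, f x t r) ∂μ =
      ∫ t in (0 : ℝ)..2, ∫ r in (0 : ℝ)..2, ∫ x, f x t r ∂μ := by
  rw [integral_intervalIntegral_swap (f := fun x t => ∫ r in (0 : ℝ)..2, f x t r)]
  · refine intervalIntegral.integral_congr fun t _ => ?_
    exact integral_intervalIntegral_swap (f := fun x r => f x t r)
      (hf.comp (f := fun q : X × ℝ => (q.1, t, q.2)) (by fun_prop))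
  · exact intervalIntegral.continuous_parametric_intervalIntegral_of_continuous'
      (f := fun (q : X × ℝ) r => f q.1 q.2 r)
      (hf.comp (f := fun q : (X × ℝ) × ℝ => (q.1.1, q.1.2, q.2)) (by fun_prop)) 0 2

/-- Derivatives along the flow of the phase average to zero. -/
theorem integral_torus_deriv_eq_zero [CompleteSpace E] {ω : Space m} {f f' : Torus m → E} (hf : Continuous f)
    (hf' : Continuous f')
    (h : ∀ φ (θ : ℝ), HasDerivAt (fun s : ℝ => f (φ + toTorus (s • ω))) (f' (φ + toTorus (θ • ω))) θ) :
    ∫ φ, f' φ = 0 := by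
  have hph : Continuous fun q : Torus m × ℝ => q.1 + toTorus (q.2 • ω) :=
    continuous_fst.add (continuous_toTorus.comp (by fun_prop))
  -- Integrated over a flow time of length `2`, the derivative is a difference of two translates of
  -- `f`, with equal averages over the torus. Neither ergodicity nor a nonresonance condition on `ω`
  -- is involved.
  have h1 : ∀ φ, ∫ t in (0 : ℝ)..2, f' (φ + toTorus (t • ω)) = f (φ + toTorus ((2 : ℝ) • ω)) - f φ := by
    intro φ
    rw [intervalIntegral.integral_eq_sub_of_hasDerivAt (fun t _ => h φ t)
      ((hf'.comp (hph.comp (Continuous.prodMk_right φ))).intervalIntegrable 0 2)]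
    simp [toTorus_zero]
  have h2 := integral_intervalIntegral_swap (μ := (volume : Measure (Torus m)))
    (f := fun φ t => f' (φ + toTorus (t • ω))) (hf'.comp hph)
  have hint : ∀ g : Torus m → E, Continuous g → Integrable g := fun g hg =>
    hg.integrable_of_hasCompactSupport (HasCompactSupport.of_compactSpace g)
  simp only [h1, integral_add_right_eq_self f'] at h2
  rw [integral_sub (hint (fun φ => f (φ + toTorus ((2 : ℝ) • ω))) (hf.comp (by fun_prop))) (hint f hf), integral_add_right_eq_self f,
    sub_self, intervalIntegral.integral_const, sub_zero] at h2
  exact (smul_eq_zero_iff_right two_ne_zero).1 h2.symm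

end

section

variable {d m : ℕ} {ω : Space m} {w : ℕ → Space d → Torus m → ℝ}
  {G : ℕ → Space d → Torus m → Space d} {C : ℝ}

/-! ### Averages over the phase -/

theorem integrable_torus {E : Type*} [NormedAddCommGroup E] {f : Torus m → E} (hf : Continuous f) :
    Integrable f :=
  hf.integrable_of_hasCompactSupport (HasCompactSupport.of_compactSpace f)

namespace PotentialJet

theorem integral_w_succ (h : PotentialJet ω w G C) {k : ℕ} (hk : k ≤ 3) (y : Space d) :
    ∫ φ, w (k + 1) y φ = 0 :=
  integral_torus_deriv_eq_zero (h.continuous_w_comp (k := k) (by omega) continuous_const continuous_id)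
    (h.continuous_w_comp (by omega) continuous_const continuous_id) (h.w_time k hk y)

theorem integral_G_succ (h : PotentialJet ω w G C) {k : ℕ} (hk : k ≤ 2) (y : Space d) :
    ∫ φ, G (k + 1) y φ = 0 :=
  integral_torus_deriv_eq_zero (h.continuous_G_comp (k := k) (by omega) continuous_const continuous_id)
    (h.continuous_G_comp (by omega) continuous_const continuous_id) (h.G_time k hk y)

theorem continuous_inner_G (h : PotentialJet ω w G C) {j k : ℕ} (hj : j ≤ 3) (hk : k ≤ 3)
    (x y : Space d) : Continuous fun φ : Torus m => inner ℝ (G j x φ) (G k y φ) :=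
  (h.continuous_G_comp hj continuous_const continuous_id).inner
    (h.continuous_G_comp hk continuous_const continuous_id)

/-- Integration by parts in the phase: the derivative of the product along the flow averages to
zero. -/
theorem integral_inner_G_succ (h : PotentialJet ω w G C) {j k : ℕ} (hj : j ≤ 2) (hk : k ≤ 2)
    (x y : Space d) :
    ∫ φ, inner ℝ (G (j + 1) x φ) (G k y φ) = -∫ φ, inner ℝ (G j x φ) (G (k + 1) y φ) := by
  have h1 := integral_torus_deriv_eq_zero (ω := ω)
    (f := fun φ => inner ℝ (G j x φ) (G k y φ))
    (f' := fun φ => inner ℝ (G j x φ) (G (k + 1) y φ) + inner ℝ (G (j + 1) x φ) (G k y φ))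
    (h.continuous_inner_G (by omega) (by omega) x y)
    ((h.continuous_inner_G (by omega) (by omega) x y).add
      (h.continuous_inner_G (by omega) (by omega) x y))
    (fun φ θ => (h.G_time j hj x φ θ).inner ℝ (h.G_time k hk y φ θ))
  rw [integral_add (integrable_torus (h.continuous_inner_G (by omega) (by omega) x y))
    (integrable_torus (h.continuous_inner_G (by omega) (by omega) x y))] at h1
  linarith

theorem integral_workMoment (h : PotentialJet ω w G C) {k : ℕ} (hk : k ≤ 3) (b e : Space d) :
    ∫ φ, workMoment w k b e φ = 0 := by
  unfold workMoment
  rw [integral_intervalIntegral_swap (f := fun φ t => t ^ k * w (k + 1) (line b e t) φ)]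
  · simp only [integral_const_mul, h.integral_w_succ hk, mul_zero, intervalIntegral.integral_zero]
  · exact (continuous_snd.pow k).mul (h.continuous_w_comp (by omega)
      ((continuous_line b e).comp continuous_snd) continuous_fst)

theorem integral_forceMoment_one (h : PotentialJet ω w G C) (b e : Space d) :
    ∫ φ, forceMoment G 1 b e φ = 0 := by
  unfold forceMoment
  rw [integral_intervalIntegral_swap (f := fun φ t => t ^ 1 • G 1 (line b e t) φ)]
  · simp only [integral_smul, h.integral_G_succ (k := 0) (by norm_num), smul_zero,
      intervalIntegral.integral_zero]
  · exact (continuous_snd.pow 1).smul (h.continuous_G_comp (by norm_num)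
      ((continuous_line b e).comp continuous_snd) continuous_fst)

/-- Translation invariance removes the shift `ε t ω`, and what is left is the average of a `∂_τ`
derivative. The vanishing is exact for every `ε`. -/
theorem integral_lineWork (h : PotentialJet ω w G C) (ε : ℝ) (b e : Space d) :
    ∫ φ, lineWork ω w ε b e φ = 0 := by
  unfold lineWork
  rw [integral_intervalIntegral_swap
    (f := fun φ t => w 1 (line b e t) (φ + toTorus ((ε * t) • ω)))]
  · have h1 : ∀ t : ℝ, ∫ φ, w 1 (line b e t) (φ + toTorus ((ε * t) • ω)) = 0 := fun t => by
      rw [integral_add_right_eq_self (fun φ => w 1 (line b e t) φ)]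
      exact h.integral_w_succ (k := 0) (by norm_num) _
    simp only [h1, intervalIntegral.integral_zero]
  · exact h.continuous_w_comp (by norm_num) ((continuous_line b e).comp continuous_snd)
      (continuous_fst.add (continuous_toTorus.comp (by fun_prop)))

theorem inner_G_deviation (h : PotentialJet ω w G C) {k : ℕ} (hk : k ≤ 3) (x b e : Space d)
    (φ : Torus m) (t : ℝ) :
    inner ℝ x (deviation G k b e φ t) =
      ∫ r in (0 : ℝ)..2, -(max (t - r) 0 * r ^ k * inner ℝ x (G k (line b e r) φ)) := by
  have hc : Continuous fun r => (max (t - r) 0 * r ^ k) • G k (line b e r) φ :=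
    (by fun_prop : Continuous fun r : ℝ => max (t - r) 0 * r ^ k).smul
      (h.continuous_G_comp hk (continuous_line b e) continuous_const)
  have h1 := (innerSL ℝ x).intervalIntegral_comp_comm (μ := volume) (hc.intervalIntegrable 0 2)
  rw [deviation, inner_neg_right, intervalIntegral.integral_neg]
  simp only [innerSL_apply_apply, real_inner_smul_right] at h1
  rw [h1]

theorem continuous_G_pair (h : PotentialJet ω w G C) {j k : ℕ} (hj : j ≤ 3) (hk : k ≤ 3)
    (b e : Space d) : Continuous fun q : Torus m × ℝ × ℝ =>
      inner ℝ (G j (line b e q.2.1) q.1) (G k (line b e q.2.2) q.1) :=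
  (h.continuous_G_comp hj ((continuous_line b e).comp (by fun_prop)) continuous_fst).inner
    (h.continuous_G_comp hk ((continuous_line b e).comp (by fun_prop)) continuous_fst)

end PotentialJet

theorem two_mul_intervalIntegral_eq {f : ℝ → ℝ → ℝ} (hf : Continuous fun q : ℝ × ℝ => f q.1 q.2) :
    2 * ∫ t in (0 : ℝ)..2, ∫ r in (0 : ℝ)..2, f t r =
      ∫ t in (0 : ℝ)..2, ∫ r in (0 : ℝ)..2, (f t r + f r t) := by
  have h1 : ∀ t, Continuous fun r => f t r := fun t => hf.comp (Continuous.prodMk_right t)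
  have h2 : ∀ t, Continuous fun r => f r t := fun t => hf.comp (Continuous.prodMk_left t)
  have h3 : Continuous fun t => ∫ r in (0 : ℝ)..2, f t r :=
    intervalIntegral.continuous_parametric_intervalIntegral_of_continuous' hf 0 2
  have h4 : Continuous fun t => ∫ r in (0 : ℝ)..2, f r t :=
    intervalIntegral.continuous_parametric_intervalIntegral_of_continuous'
      (f := fun t r => f r t) (hf.comp continuous_swap) 0 2
  have h5 : ∀ t, ∫ r in (0 : ℝ)..2, (f t r + f r t) =
      (∫ r in (0 : ℝ)..2, f t r) + ∫ r in (0 : ℝ)..2, f r t := fun t =>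
    intervalIntegral.integral_add ((h1 t).intervalIntegrable 0 2) ((h2 t).intervalIntegrable 0 2)
  simp only [h5]
  rw [intervalIntegral.integral_add (h3.intervalIntegrable 0 2) (h4.intervalIntegrable 0 2),
    two_mul, intervalIntegral_swap hf]

theorem max_sub_max (x : ℝ) : max x 0 - max (-x) 0 = x := by
  rcases le_total x 0 with h | h
  · rw [max_eq_right h, max_eq_left (by linarith)]; ring
  · rw [max_eq_left h, max_eq_right (by linarith)]; ring

theorem max_add_max (x : ℝ) : max x 0 * x + max (-x) 0 * (-x) = x ^ 2 := by
  rcases le_total x 0 with h | h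
  · rw [max_eq_right h, max_eq_left (by linarith)]; ring
  · rw [max_eq_left h, max_eq_right (by linarith)]; ring

/-- The antisymmetrised second order work. -/
noncomputable def crossMoment (G : ℕ → Space d → Torus m → Space d) (b e : Space d) (φ : Torus m) :
    ℝ :=
  ∫ t in (0 : ℝ)..2, ∫ r in (0 : ℝ)..2,
    (t - r) * inner ℝ (G 1 (line b e t) φ) (G 0 (line b e r) φ)

/-- The symmetrised third order work. -/
noncomputable def squareMoment (G : ℕ → Space d → Torus m → Space d) (b e : Space d)
    (φ : Torus m) : ℝ :=
  ∫ t in (0 : ℝ)..2, ∫ r in (0 : ℝ)..2,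
    (t - r) ^ 2 * inner ℝ (G 1 (line b e t) φ) (G 1 (line b e r) φ)

namespace PotentialJet

theorem continuous_G_pair_time (h : PotentialJet ω w G C) {j k : ℕ} (hj : j ≤ 3) (hk : k ≤ 3)
    (b e : Space d) (φ : Torus m) : Continuous fun q : ℝ × ℝ =>
      inner ℝ (G j (line b e q.1) φ) (G k (line b e q.2) φ) :=
  (h.continuous_G_comp hj ((continuous_line b e).comp continuous_fst) continuous_const).inner
    (h.continuous_G_comp hk ((continuous_line b e).comp continuous_snd) continuous_const)

/-- After symmetrising in `t` and `r`, moving `∂_τ` from one factor to the other changes the sign,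
so the weights combine to `(t - r)⁺ - (r - t)⁺ = t - r`. -/
theorem integral_work₂ (h : PotentialJet ω w G C) (b e : Space d) :
    ∫ φ, work₂ G b e φ = -(1 / 2) * ∫ φ, crossMoment G b e φ := by
  have h1 : ∀ φ, 2 * work₂ G b e φ = ∫ t in (0 : ℝ)..2, ∫ r in (0 : ℝ)..2,
      (-(max (t - r) 0 * inner ℝ (G 1 (line b e t) φ) (G 0 (line b e r) φ)) +
        -(max (r - t) 0 * inner ℝ (G 1 (line b e r) φ) (G 0 (line b e t) φ))) := by
    intro φ
    rw [work₂, ← two_mul_intervalIntegral_eq (f := fun t r =>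
      -(max (t - r) 0 * inner ℝ (G 1 (line b e t) φ) (G 0 (line b e r) φ)))
      (((by fun_prop : Continuous fun q : ℝ × ℝ => max (q.1 - q.2) 0).mul
        (h.continuous_G_pair_time (by norm_num) (by norm_num) b e φ)).neg)]
    simp only [h.inner_G_deviation (k := 0) (by norm_num), pow_zero, mul_one]
  have h2 : 2 * ∫ φ, work₂ G b e φ = -∫ φ, crossMoment G b e φ := by
    rw [← integral_const_mul, ← integral_neg]
    simp only [h1, crossMoment, ← intervalIntegral.integral_neg]
    rw [integral_intervalIntegral_swap₂ (f := fun φ t r =>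
        -(max (t - r) 0 * inner ℝ (G 1 (line b e t) φ) (G 0 (line b e r) φ)) +
        -(max (r - t) 0 * inner ℝ (G 1 (line b e r) φ) (G 0 (line b e t) φ))),
      integral_intervalIntegral_swap₂ (f := fun φ t r =>
        -((t - r) * inner ℝ (G 1 (line b e t) φ) (G 0 (line b e r) φ)))]
    · refine intervalIntegral.integral_congr fun t _ => intervalIntegral.integral_congr fun r _ => ?_
      have hi : ∀ j k, j ≤ 3 → k ≤ 3 → ∀ (x y : Space d) (c : ℝ), Integrable fun φ : Torus m =>
          -(c * inner ℝ (G j x φ) (G k y φ)) := fun j k hj hk x y c =>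
        integrable_torus (((h.continuous_inner_G hj hk x y).const_mul c).neg)
      rw [integral_add (hi _ _ (by norm_num) (by norm_num) _ _ _)
        (hi _ _ (by norm_num) (by norm_num) _ _ _), integral_neg, integral_neg, integral_neg,
        integral_const_mul, integral_const_mul, integral_const_mul,
        h.integral_inner_G_succ (j := 0) (k := 0) (by norm_num) (by norm_num) (line b e r)]
      simp only [real_inner_comm, zero_add]
      have := max_sub_max (t - r)
      rw [neg_sub] at this
      generalize ∫ φ, inner ℝ (G 1 (line b e t) φ) (G 0 (line b e r) φ) = z
      linear_combination -z * this
    · exact ((by fun_prop : Continuous fun q : Torus m × ℝ × ℝ => q.2.1 - q.2.2).mul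
        (h.continuous_G_pair (by norm_num) (by norm_num) b e)).neg
    · exact ((by fun_prop : Continuous fun q : Torus m × ℝ × ℝ => max (q.2.1 - q.2.2) 0).mul
        (h.continuous_G_pair (by norm_num) (by norm_num) b e)).neg.add
        ((by fun_prop : Continuous fun q : Torus m × ℝ × ℝ => max (q.2.2 - q.2.1) 0).mul
        ((h.continuous_G_pair (j := 1) (k := 0) (by norm_num) (by norm_num) b e).comp
          (f := fun q : Torus m × ℝ × ℝ => (q.1, q.2.2, q.2.1)) (by fun_prop))).neg
  linarith

/-- Integration by parts replaces `⟨G 2, G 0⟩` by `-⟨G 1, G 1⟩`, leaving the weight `(t - r)⁺ (t -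
r)`; with its mirror image it adds up to `(t - r)²`. -/
theorem integral_work₃ (h : PotentialJet ω w G C) (b e : Space d) :
    ∫ φ, work₃ G b e φ = 1 / 2 * ∫ φ, squareMoment G b e φ := by
  have hp := fun j k (hj : j ≤ 3) (hk : k ≤ 3) φ => h.continuous_G_pair_time hj hk b e φ
  have h1 : ∀ φ, 2 * work₃ G b e φ = ∫ t in (0 : ℝ)..2, ∫ r in (0 : ℝ)..2,
      (-(max (t - r) 0 * (t * inner ℝ (G 2 (line b e t) φ) (G 0 (line b e r) φ) +
          r * inner ℝ (G 1 (line b e t) φ) (G 1 (line b e r) φ))) +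
        -(max (r - t) 0 * (r * inner ℝ (G 2 (line b e r) φ) (G 0 (line b e t) φ) +
          t * inner ℝ (G 1 (line b e r) φ) (G 1 (line b e t) φ)))) := by
    intro φ
    rw [work₃, ← two_mul_intervalIntegral_eq (f := fun t r =>
      -(max (t - r) 0 * (t * inner ℝ (G 2 (line b e t) φ) (G 0 (line b e r) φ) +
          r * inner ℝ (G 1 (line b e t) φ) (G 1 (line b e r) φ))))
      (((by fun_prop : Continuous fun q : ℝ × ℝ => max (q.1 - q.2) 0).mul
        ((continuous_fst.mul (hp 2 0 (by norm_num) (by norm_num) φ)).add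
        (continuous_snd.mul (hp 1 1 (by norm_num) (by norm_num) φ)))).neg)]
    congr 1
    refine intervalIntegral.integral_congr fun t _ => ?_
    rw [h.inner_G_deviation (k := 0) (by norm_num), h.inner_G_deviation (k := 1) (by norm_num),
      ← intervalIntegral.integral_const_mul, ← intervalIntegral.integral_add]
    · refine intervalIntegral.integral_congr fun r _ => ?_
      ring
    · exact (((by fun_prop : Continuous fun r : ℝ => max (t - r) 0 * r ^ 0).mul
        ((hp 2 0 (by norm_num) (by norm_num) φ).comp (Continuous.prodMk_right t))).neg.const_mul
          t).intervalIntegrable 0 2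
    · exact (((by fun_prop : Continuous fun r : ℝ => max (t - r) 0 * r ^ 1).mul
        ((hp 1 1 (by norm_num) (by norm_num) φ).comp
          (Continuous.prodMk_right t))).neg).intervalIntegrable 0 2
  have h2 : 2 * ∫ φ, work₃ G b e φ = ∫ φ, squareMoment G b e φ := by
    rw [← integral_const_mul]
    simp only [h1, squareMoment]
    rw [integral_intervalIntegral_swap₂ (f := fun φ t r =>
        (-(max (t - r) 0 * (t * inner ℝ (G 2 (line b e t) φ) (G 0 (line b e r) φ) +
          r * inner ℝ (G 1 (line b e t) φ) (G 1 (line b e r) φ))) +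
        -(max (r - t) 0 * (r * inner ℝ (G 2 (line b e r) φ) (G 0 (line b e t) φ) +
          t * inner ℝ (G 1 (line b e r) φ) (G 1 (line b e t) φ))))),
      integral_intervalIntegral_swap₂ (f := fun φ t r =>
        ((t - r) ^ 2 * inner ℝ (G 1 (line b e t) φ) (G 1 (line b e r) φ)))]
    · refine intervalIntegral.integral_congr fun t _ => intervalIntegral.integral_congr fun r _ => ?_
      have hi : ∀ j k, j ≤ 3 → k ≤ 3 → ∀ (x y : Space d) (c : ℝ), Integrable fun φ : Torus m =>
          c * inner ℝ (G j x φ) (G k y φ) := fun j k hj hk x y c =>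
        integrable_torus ((h.continuous_inner_G hj hk x y).const_mul c)
      have key : ∀ (x y : Space d) (a b c : ℝ), ∫ φ, -(c * (a * inner ℝ (G 2 x φ) (G 0 y φ) +
          b * inner ℝ (G 1 x φ) (G 1 y φ))) = c * (a - b) * ∫ φ, inner ℝ (G 1 x φ) (G 1 y φ) := by
        intro x y a b c
        rw [integral_neg, integral_const_mul, integral_add (hi _ _ (by norm_num) (by norm_num) _ _ _)
          (hi _ _ (by norm_num) (by norm_num) _ _ _), integral_const_mul, integral_const_mul,
          h.integral_inner_G_succ (j := 1) (k := 0) (by norm_num) (by norm_num) x y]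
        simp only [zero_add]
        ring
      have hi' : ∀ (x y : Space d) (a b c : ℝ), Integrable fun φ : Torus m =>
          -(c * (a * inner ℝ (G 2 x φ) (G 0 y φ) + b * inner ℝ (G 1 x φ) (G 1 y φ))) :=
        fun x y a b c => (((hi _ _ (by norm_num) (by norm_num) _ _ _).add
          (hi _ _ (by norm_num) (by norm_num) _ _ _)).const_mul c).neg
      rw [integral_add (hi' _ _ _ _ _) (hi' _ _ _ _ _), key, key, integral_const_mul]
      simp only [real_inner_comm]
      have := max_add_max (t - r)
      rw [neg_sub] at this
      generalize ∫ φ, inner ℝ (G 1 (line b e t) φ) (G 1 (line b e r) φ) = z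
      linear_combination z * this
    · exact ((by fun_prop : Continuous fun q : Torus m × ℝ × ℝ => (q.2.1 - q.2.2) ^ 2).mul
        (h.continuous_G_pair (by norm_num) (by norm_num) b e))
    · have hs := fun j k (hj : j ≤ 3) (hk : k ≤ 3) => (h.continuous_G_pair hj hk b e).comp
          (f := fun q : Torus m × ℝ × ℝ => (q.1, q.2.2, q.2.1)) (by fun_prop)
      have ht := fun j k (hj : j ≤ 3) (hk : k ≤ 3) => h.continuous_G_pair hj hk b e
      exact ((by fun_prop : Continuous fun q : Torus m × ℝ × ℝ => max (q.2.1 - q.2.2) 0).mul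
        (((by fun_prop : Continuous fun q : Torus m × ℝ × ℝ => q.2.1).mul
          (ht 2 0 (by norm_num) (by norm_num))).add
        ((by fun_prop : Continuous fun q : Torus m × ℝ × ℝ => q.2.2).mul
          (ht 1 1 (by norm_num) (by norm_num))))).neg.add
        ((by fun_prop : Continuous fun q : Torus m × ℝ × ℝ => max (q.2.2 - q.2.1) 0).mul
        (((by fun_prop : Continuous fun q : Torus m × ℝ × ℝ => q.2.2).mul
          (hs 2 0 (by norm_num) (by norm_num))).add
        ((by fun_prop : Continuous fun q : Torus m × ℝ × ℝ => q.2.1).mul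
          (hs 1 1 (by norm_num) (by norm_num))))).neg
  linarith

end PotentialJet

end

section

variable {d m : ℕ} {ω : Space m} {w : ℕ → Space d → Torus m → ℝ}
  {G : ℕ → Space d → Torus m → Space d} {C : ℝ}

/-! ### Averages of the coefficients -/

namespace PotentialJet

theorem integrable_mul_w (h : PotentialJet ω w G C) {k : ℕ} (hk : k ≤ 4) {K : Space d → ℝ}
    (hK : Continuous K) (φ : Torus m) : Integrable fun y => K y * w k y φ :=
  have hc : Continuous fun y => K y * w k y φ :=
    hK.mul (h.continuous_w_comp hk continuous_id continuous_const)
  hc.integrable_of_hasCompactSupport (HasCompactSupport.intro (isCompact_closedBall 0 (1 / 2)) fun y hy => by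
      rw [mem_closedBall_zero_iff, not_le] at hy
      rw [h.w_supp k hk y φ hy.le, mul_zero])

theorem integrable_mul_inner_G (h : PotentialJet ω w G C) {k : ℕ} (hk : k ≤ 3) {K : Space d → ℝ}
    (hK : Continuous K) (φ : Torus m) (a : Space d) :
    Integrable fun y => K y * inner ℝ (G k y φ) a :=
  have hc : Continuous fun y => K y * inner ℝ (G k y φ) a :=
    hK.mul ((h.continuous_G_comp hk continuous_id continuous_const).inner continuous_const)
  hc.integrable_of_hasCompactSupport (HasCompactSupport.intro (isCompact_closedBall 0 (1 / 2)) fun y hy => by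
      rw [mem_closedBall_zero_iff, not_le] at hy
      rw [h.G_supp k hk y φ hy.le, inner_zero_left, mul_zero])

theorem integral_mul_inner_G (h : PotentialJet ω w G C) {k : ℕ} (hk : k ≤ 3) {K : Space d → ℝ}
    {K' : Space d → Space d} (hK : ∀ y, HasGradientAt K (K' y) y) (hK' : Continuous K')
    (φ : Torus m) (a : Space d) :
    ∫ y, K y * inner ℝ (G k y φ) a = -∫ y, inner ℝ (K' y) a * w k y φ := by
  have hKc : Continuous K := continuous_iff_continuousAt.2 fun y => (hK y).continuousAt
  exact integral_bilinear_hasLineDerivAt_right_eq_neg_left_of_integrable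
    (B := ContinuousLinearMap.mul ℝ ℝ) (v := a)
    (h.integrable_mul_w (by omega) (hK'.inner continuous_const) φ)
    (h.integrable_mul_inner_G hk hKc φ a) (h.integrable_mul_w (by omega) hKc φ)
    (fun y _ => (hK y).hasFDerivAt.hasLineDerivAt a)
    (fun y _ => (h.w_grad k hk y φ).hasFDerivAt.hasLineDerivAt a)

theorem integral_inner_G (h : PotentialJet ω w G C) {k : ℕ} (hk : k ≤ 3) (φ : Torus m)
    (a : Space d) : ∫ y, inner ℝ (G k y φ) a = 0 := by
  have := h.integral_mul_inner_G hk (K := fun _ => 1) (K' := fun _ => 0)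
    (fun y => by
      rw [hasGradientAt_iff_hasFDerivAt, map_zero]; exact hasFDerivAt_const _ _)
    continuous_const φ a
  simpa using this

theorem hasDerivAt_w_line (h : PotentialJet ω w G C) {k : ℕ} (hk : k ≤ 3) (b e : Space d)
    (φ : Torus m) (t : ℝ) :
    HasDerivAt (fun t => w k (line b e t) φ) (inner ℝ (G k (line b e t) φ) e) t := by
  have h1 : HasDerivAt (line b e) e t := by
    have := (((hasDerivAt_id t).sub_const (1 / 2)).smul_const e).const_add b
    rwa [one_smul] at this
  exact (h.w_grad k hk (line b e t) φ).hasFDerivAt.comp_hasDerivAt t h1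

theorem w_line_zero (h : PotentialJet ω w G C) {k : ℕ} (hk : k ≤ 4) {b e : Space d} (he : ‖e‖ = 1)
    (hb : inner ℝ e b = 0) (φ : Torus m) : w k (line b e 0) φ = 0 :=
  h.w_supp k hk _ _ (half_le_norm_line he hb (by simp))

theorem w_line_two (h : PotentialJet ω w G C) {k : ℕ} (hk : k ≤ 4) {b e : Space d} (he : ‖e‖ = 1)
    (hb : inner ℝ e b = 0) (φ : Torus m) : w k (line b e 2) φ = 0 := by
  refine h.w_supp k hk _ _ (norm_ge_of_inner he ?_)
  rw [inner_line he hb]; norm_num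

theorem continuous_crossMoment (h : PotentialJet ω w G C) :
    Continuous fun q : Space d × Space d × Torus m => crossMoment G q.1 q.2.1 q.2.2 := by
  refine intervalIntegral.continuous_parametric_intervalIntegral_of_continuous'
    (f := fun (q : Space d × Space d × Torus m) t => ∫ r in (0 : ℝ)..2,
      (t - r) * inner ℝ (G 1 (line q.1 q.2.1 t) q.2.2) (G 0 (line q.1 q.2.1 r) q.2.2)) ?_ 0 2
  refine intervalIntegral.continuous_parametric_intervalIntegral_of_continuous'
    (f := fun (q : (Space d × Space d × Torus m) × ℝ) r =>
      (q.2 - r) * inner ℝ (G 1 (line q.1.1 q.1.2.1 q.2) q.1.2.2) (G 0 (line q.1.1 q.1.2.1 r) q.1.2.2))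
      ?_ 0 2
  have h1 := (h.continuous_G_line (k := 1) (by norm_num)).comp
    (f := fun q : ((Space d × Space d × Torus m) × ℝ) × ℝ => q.1) continuous_fst
  have h2 := (h.continuous_G_line (k := 0) (by norm_num)).comp
    (f := fun q : ((Space d × Space d × Torus m) × ℝ) × ℝ => (q.1.1, q.2)) (by fun_prop)
  exact (by fun_prop : Continuous fun q : ((Space d × Space d × Torus m) × ℝ) × ℝ =>
    q.1.2 - q.2).mul (h1.inner h2)

theorem continuous_squareMoment (h : PotentialJet ω w G C) :
    Continuous fun q : Space d × Space d × Torus m => squareMoment G q.1 q.2.1 q.2.2 := by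
  refine intervalIntegral.continuous_parametric_intervalIntegral_of_continuous'
    (f := fun (q : Space d × Space d × Torus m) t => ∫ r in (0 : ℝ)..2,
      (t - r) ^ 2 * inner ℝ (G 1 (line q.1 q.2.1 t) q.2.2) (G 1 (line q.1 q.2.1 r) q.2.2)) ?_ 0 2
  refine intervalIntegral.continuous_parametric_intervalIntegral_of_continuous'
    (f := fun (q : (Space d × Space d × Torus m) × ℝ) r =>
      (q.2 - r) ^ 2 * inner ℝ (G 1 (line q.1.1 q.1.2.1 q.2) q.1.2.2)
        (G 1 (line q.1.1 q.1.2.1 r) q.1.2.2)) ?_ 0 2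
  have h1 := (h.continuous_G_line (k := 1) (by norm_num)).comp
    (f := fun q : ((Space d × Space d × Torus m) × ℝ) × ℝ => q.1) continuous_fst
  have h2 := (h.continuous_G_line (k := 1) (by norm_num)).comp
    (f := fun q : ((Space d × Space d × Torus m) × ℝ) × ℝ => (q.1.1, q.2)) (by fun_prop)
  exact (by fun_prop : Continuous fun q : ((Space d × Space d × Torus m) × ℝ) × ℝ =>
    (q.1.2 - q.2) ^ 2).mul (h1.inner h2)

theorem abs_double_moment_le (h : PotentialJet ω w G C) {j k : ℕ} (hj : j ≤ 3) (hk : k ≤ 3)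
    {p : ℝ → ℝ} (hp : ∀ x, |x| ≤ 2 → |p x| ≤ 4) (b e : Space d) (φ : Torus m) :
    |∫ t in (0 : ℝ)..2, ∫ r in (0 : ℝ)..2,
      p (t - r) * inner ℝ (G j (line b e t) φ) (G k (line b e r) φ)| ≤ 2 * (2 * (4 * (C * C))) := by
  have hC := h.nonneg
  rw [← Real.norm_eq_abs]
  refine norm_intervalIntegral_le fun t ht => norm_intervalIntegral_le fun r hr => ?_
  rw [norm_mul]
  refine mul_le_mul (hp _ (abs_le.2 ⟨by linarith [ht.1, hr.2], by linarith [ht.2, hr.1]⟩)) ?_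
    (norm_nonneg _) (by norm_num)
  exact (abs_real_inner_le_norm _ _).trans (mul_le_mul (h.G_bound j hj _ _) (h.G_bound k hk _ _)
    (norm_nonneg _) hC)

theorem abs_crossMoment_le (h : PotentialJet ω w G C) (b e : Space d) (φ : Torus m) :
    |crossMoment G b e φ| ≤ 2 * (2 * (4 * (C * C))) :=
  h.abs_double_moment_le (p := id) (by norm_num) (by norm_num)
    (fun x hx => by simp only [id]; linarith) b e φ

theorem abs_squareMoment_le (h : PotentialJet ω w G C) (b e : Space d) (φ : Torus m) :
    |squareMoment G b e φ| ≤ 2 * (2 * (4 * (C * C))) :=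
  h.abs_double_moment_le (p := fun x => x ^ 2) (by norm_num) (by norm_num)
    (fun x hx => by rw [abs_pow]; nlinarith [abs_nonneg x]) b e φ

end PotentialJet

theorem integral_line_line {e b : Space d} (he : ‖e‖ = 1) (hb : inner ℝ e b = 0)
    {H : Space d → Space d → ℝ} (hs : ∀ x y, 1 / 2 ≤ ‖x‖ ∨ 1 / 2 ≤ ‖y‖ → H x y = 0) :
    ∫ t in (0 : ℝ)..2, ∫ r in (0 : ℝ)..2, H (line b e t) (line b e r) =
      ∫ t : ℝ, ∫ r : ℝ, H (t • e + b) (r • e + b) := by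
  have h1 : ∀ x, ∫ r in (0 : ℝ)..2, H x (line b e r) = ∫ r : ℝ, H x (r • e + b) := fun x =>
    integral_line_eq he hb fun y hy => hs x y (Or.inr hy)
  simp only [h1]
  exact integral_line_eq he hb (h := fun x => ∫ r : ℝ, H x (r • e + b)) fun x hx => by
    simp only [fun y => hs x y (Or.inl hx), integral_zero]

/-- With `t - r` written as the component of `x - y` along `e`, the moment is an integral over pairs
of points of a line, and the orientation enters only through this linear factor. -/
theorem crossMoment_eq {e b : Space d} (he : ‖e‖ = 1) (hb : inner ℝ e b = 0) (φ : Torus m) :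
    crossMoment G b e φ = ∫ t in (0 : ℝ)..2, ∫ r in (0 : ℝ)..2,
      (fun x y => inner ℝ e (x - y) * inner ℝ (G 1 x φ) (G 0 y φ)) (line b e t) (line b e r) := by
  have : ∀ t r, inner ℝ e (line b e t - line b e r) = t - r := fun t r => by
    rw [inner_sub_right, inner_line he hb, inner_line he hb]; ring
  simp only [this, crossMoment]

/-- The line with the opposite direction is the same set of points, while the weight is odd in `e`.
-/
theorem PotentialJet.crossMoment_neg (h : PotentialJet ω w G C) {e b : Space d} (he : ‖e‖ = 1)
    (hb : inner ℝ e b = 0) (φ : Torus m) :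
    crossMoment G b (-e) φ = -crossMoment G b e φ := by
  have hs : ∀ a x y : Space d, 1 / 2 ≤ ‖x‖ ∨ 1 / 2 ≤ ‖y‖ →
      inner ℝ a (x - y) * inner ℝ (G 1 x φ) (G 0 y φ) = 0 := by
    rintro a x y (hx | hy)
    · rw [h.G_supp 1 (by norm_num) x φ hx, inner_zero_left, mul_zero]
    · rw [h.G_supp 0 (by norm_num) y φ hy, inner_zero_right, mul_zero]
  have he' : ‖-e‖ = 1 := by rwa [norm_neg]
  have hb' : inner ℝ (-e) b = 0 := by rw [inner_neg_left, hb, neg_zero]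
  rw [crossMoment_eq he' hb', crossMoment_eq he hb, integral_line_line he' hb' (hs _),
    integral_line_line he hb (hs _), ← integral_neg_eq_self, ← integral_neg]
  refine integral_congr_ae (Eventually.of_forall fun t => ?_)
  beta_reduce
  rw [← integral_neg_eq_self, ← integral_neg]
  refine integral_congr_ae (Eventually.of_forall fun r => ?_)
  simp only [smul_neg, neg_smul, neg_neg, inner_neg_left, neg_mul]

/-- In dimension one no rotation reverses `e`, but the inner product factors through `e`.
Integration by parts in `r` gives `∫ (t - r) ∂W = ∫ W`, independent of `t`, and the remaining
integral over `t` is that of a derivative vanishing at both ends. -/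
theorem PotentialJet.crossMoment_eq_zero (h : PotentialJet ω w G C) (hd : d = 1) {e b : Space d}
    (he : ‖e‖ = 1) (hb : inner ℝ e b = 0) (φ : Torus m) : crossMoment G b e φ = 0 := by
  subst hd
  have hin : ∀ x y : Space 1, inner ℝ x y = inner ℝ x e * inner ℝ y e := by
    intro x y
    have h1 := real_inner_self_eq_norm_sq e
    rw [he] at h1
    simp only [PiLp.inner_apply, Finset.univ_unique, Fin.default_eq_zero, Finset.sum_singleton,
      RCLike.inner_apply, conj_trivial] at h1 ⊢
    linear_combination -(x 0 * y 0) * h1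
  have hc : ∀ k ≤ 3, Continuous fun t => inner ℝ (G k (line b e t) φ) e := fun k hk =>
    (h.continuous_G_comp hk (continuous_line b e) continuous_const).inner continuous_const
  have hwc : Continuous fun t => w 0 (line b e t) φ :=
    h.continuous_w_comp (by norm_num) (continuous_line b e) continuous_const
  have h0 : ∫ t in (0 : ℝ)..2, inner ℝ (G 1 (line b e t) φ) e = 0 := by
    rw [intervalIntegral.integral_eq_sub_of_hasDerivAt
      (fun t _ => h.hasDerivAt_w_line (by norm_num) b e φ t)
      ((hc 1 (by norm_num)).intervalIntegrable 0 2), h.w_line_zero (by norm_num) he hb,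
      h.w_line_two (by norm_num) he hb, sub_zero]
  have h1 : ∀ t, ∫ r in (0 : ℝ)..2, (t - r) * inner ℝ (G 0 (line b e r) φ) e =
      ∫ r in (0 : ℝ)..2, w 0 (line b e r) φ := by
    intro t
    have hc1 : Continuous fun r => (t - r) * inner ℝ (G 0 (line b e r) φ) e :=
      (continuous_const.sub continuous_id).mul (hc 0 (by norm_num))
    have h2 := intervalIntegral.integral_eq_sub_of_hasDerivAt (a := 0) (b := 2)
      (f := fun r => (t - r) * w 0 (line b e r) φ)
      (f' := fun r => (t - r) * inner ℝ (G 0 (line b e r) φ) e - w 0 (line b e r) φ)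
      (fun r _ => (((hasDerivAt_id r).const_sub t).mul
        (h.hasDerivAt_w_line (by norm_num) b e φ r)).congr_deriv (by simp only [id]; ring))
      ((hc1.sub hwc).intervalIntegrable 0 2)
    rw [intervalIntegral.integral_sub (hc1.intervalIntegrable 0 2) (hwc.intervalIntegrable 0 2),
      h.w_line_zero (by norm_num) he hb, h.w_line_two (by norm_num) he hb] at h2
    linarith
  have h2 : ∀ t, ∫ r in (0 : ℝ)..2, (t - r) * inner ℝ (G 1 (line b e t) φ) (G 0 (line b e r) φ) =
      inner ℝ (G 1 (line b e t) φ) e * ∫ r in (0 : ℝ)..2, w 0 (line b e r) φ := by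
    intro t
    rw [← h1 t, ← intervalIntegral.integral_const_mul]
    refine intervalIntegral.integral_congr fun r _ => ?_
    rw [hin]; ring
  simp only [crossMoment, h2]
  rw [intervalIntegral.integral_mul_const, h0, zero_mul]

/-! ### Averages in the frame of the scatterer -/

section Frame

variable {ν : Measure ℝ} [IsProbabilityMeasure ν] {f : Space d → Space d → Torus m → ℝ} {K : ℝ}
  {ρ : ℝ → ℝ}

theorem integrable_frame (hf : Continuous fun q : Space d × Space d × Torus m => f q.1 q.2.1 q.2.2)
    (hK : ∀ b e φ, |f b e φ| ≤ K) (hρ : Integrable ρ ν) (v e : Space d) :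
    Integrable (fun κ : Params d m => ρ κ.2.2.2 * f (rot κ.2.1⁻¹ κ.1) (rot κ.2.1⁻¹ e) κ.2.2.1)
      (scatLaw d m ν v) :=
  integrable_mul_scatLaw (F := fun q => f (rot q.2.1⁻¹ q.1) (rot q.2.1⁻¹ e) q.2.2)
    (hf.comp (continuous_frame e)) (fun _ => hK _ _ _) hρ v

theorem integral_frame (hf : Continuous fun q : Space d × Space d × Torus m => f q.1 q.2.1 q.2.2)
    (hK : ∀ b e φ, |f b e φ| ≤ K) (hρ : Integrable ρ ν) (v e : Space d) :
    ∫ κ : Params d m, ρ κ.2.2.2 * f (rot κ.2.1⁻¹ κ.1) (rot κ.2.1⁻¹ e) κ.2.2.1 ∂scatLaw d m ν v =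
      (∫ c, ρ c ∂ν) * ∫ b, (∫ M, (∫ φ, f (rot M⁻¹ b) (rot M⁻¹ e) φ) ∂haarSO d) ∂impactLaw v :=
  integral_scatLaw (F := fun q => f (rot q.2.1⁻¹ q.1) (rot q.2.1⁻¹ e) q.2.2)
    (hf.comp (continuous_frame e)) (fun _ => hK _ _ _) hρ v

theorem integral_frame_symm
    (hf : Continuous fun q : Space d × Space d × Torus m => f q.1 q.2.1 q.2.2)
    (hK : ∀ b e φ, |f b e φ| ≤ K) (hρ : Integrable ρ ν) (v e : Space d) :
    ∫ κ : Params d m, ρ κ.2.2.2 * f (rot κ.2.1⁻¹ κ.1) (rot κ.2.1⁻¹ e) κ.2.2.1 ∂scatLaw d m ν v =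
      (∫ c, ρ c ∂ν) * ∫ φ, ∫ M, (∫ b, f (rot M⁻¹ b) (rot M⁻¹ e) φ ∂impactLaw v) ∂haarSO d :=
  integral_scatLaw_symm (F := fun q => f (rot q.2.1⁻¹ q.1) (rot q.2.1⁻¹ e) q.2.2)
    (hf.comp (continuous_frame e)) (fun _ => hK _ _ _) hρ v

theorem integral_frame_eq_zero
    (hf : Continuous fun q : Space d × Space d × Torus m => f q.1 q.2.1 q.2.2)
    (hK : ∀ b e φ, |f b e φ| ≤ K) (hρ : Integrable ρ ν) (h0 : ∀ b e, ∫ φ, f b e φ = 0)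
    (v e : Space d) :
    ∫ κ : Params d m, ρ κ.2.2.2 * f (rot κ.2.1⁻¹ κ.1) (rot κ.2.1⁻¹ e) κ.2.2.1
      ∂scatLaw d m ν v = 0 := by
  rw [integral_frame hf hK hρ]
  simp only [h0, integral_zero, mul_zero]

end Frame

end

section

variable {d m : ℕ} {ω : Space m} {w : ℕ → Space d → Torus m → ℝ}
  {G : ℕ → Space d → Torus m → Space d} {C : ℝ} {ν : Measure ℝ}

/-! ### Averages of the expansion coefficients -/

theorem ae_scatLaw_mem {v : Space d} (hν : ∀ᵐ c ∂ν, c ∈ Icc (-1 : ℝ) 1) :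
    ∀ᵐ κ ∂scatLaw d m ν v, inner ℝ v κ.1 = 0 ∧ |κ.2.2.2| ≤ 1 := by
  have h1 : ∀ᵐ κ : Params d m ∂scatLaw d m ν v, inner ℝ v κ.1 = 0 := by
    have := (Measure.quasiMeasurePreserving_fst (μ := impactLaw v) (ν := (haarSO d).prod
      ((volume : Measure (Torus m)).prod ν))).ae (ae_impactLaw (v := v))
    unfold scatLaw
    filter_upwards [this] with κ hκ using hκ.1
  have h2 : ∀ᵐ κ : Params d m ∂scatLaw d m ν v, κ.2.2.2 ∈ Icc (-1 : ℝ) 1 := by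
    unfold scatLaw
    exact Measure.quasiMeasurePreserving_snd.ae (Measure.quasiMeasurePreserving_snd.ae
      (Measure.quasiMeasurePreserving_snd.ae hν))
  filter_upwards [h1, h2] with κ hκ1 hκ2 using ⟨hκ1, abs_le.2 hκ2⟩

variable [IsProbabilityMeasure ν]

theorem integrable_pow_of_mem_Icc (hν : ∀ᵐ c ∂ν, c ∈ Icc (-1 : ℝ) 1) (n : ℕ) :
    Integrable (fun c => c ^ n) ν := by
  refine Integrable.of_bound (by fun_prop) 1 ?_
  filter_upwards [hν] with c hc
  rw [Real.norm_eq_abs, abs_pow]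
  exact pow_le_one₀ (abs_nonneg c) (abs_le.2 hc)

namespace PotentialJet

theorem integrable_betaHat (h : PotentialJet ω w G C) (hν : ∀ᵐ c ∂ν, c ∈ Icc (-1 : ℝ) 1) (l : ℕ)
    (v e : Space d) : Integrable (betaHat w G l e) (scatLaw d m ν v) := by
  obtain ⟨K, -, hK⟩ := h.exists_betaRed_bound
  refine Integrable.of_bound ((h.continuous_betaHat l).comp
    (Continuous.prodMk_right e)).aestronglyMeasurable K ?_
  filter_upwards [ae_scatLaw_mem hν] with κ hκ
  exact hK l _ _ _ _ hκ.2

theorem integrable_alphaHat (h : PotentialJet ω w G C) (hν : ∀ᵐ c ∂ν, c ∈ Icc (-1 : ℝ) 1) (k : ℕ)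
    (v e : Space d) : Integrable (alphaHat G k e) (scatLaw d m ν v) := by
  refine Integrable.of_bound (h.continuous_alphaHat k e).aestronglyMeasurable (16 * C) ?_
  have hC := h.nonneg
  filter_upwards [ae_scatLaw_mem hν] with κ hκ
  have key : ∀ x : Space d, ‖x‖ ≤ 16 * C → ‖-(κ.2.2.2 • rot κ.2.1 x)‖ ≤ 16 * C := by
    intro x hx
    rw [norm_neg, norm_smul, norm_rot, Real.norm_eq_abs]
    nlinarith [norm_nonneg x, hκ.2, abs_nonneg κ.2.2.2]
  rcases k with _ | _ | _ | k
  · simp only [alphaHat, norm_zero]; positivity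
  · exact key _ (h.norm_forceMoment_le (by norm_num) _ _ _)
  · exact key _ (h.norm_forceMoment_le (by norm_num) _ _ _)
  · simp only [alphaHat, norm_zero]; positivity

theorem continuous_inner_rot_forceMoment (h : PotentialJet ω w G C) {k : ℕ} (hk : k ≤ 3)
    (a e : Space d) : Continuous fun q : Space d × SO d × Torus m =>
      inner ℝ a (rot q.2.1 (forceMoment G k (rot q.2.1⁻¹ q.1) (rot q.2.1⁻¹ e) q.2.2)) := by
  have h1 := (h.continuous_forceMoment hk).comp (continuous_frame (d := d) (m := m) e)
  exact continuous_const.inner (Continuous.comp (g := fun p : SO d × Space d => rot p.1 p.2)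
    continuous_rot ((continuous_fst.comp continuous_snd).prodMk h1))

theorem abs_inner_rot_forceMoment_le (h : PotentialJet ω w G C) {k : ℕ} (hk : k ≤ 3)
    (a e : Space d) (q : Space d × SO d × Torus m) :
    |inner ℝ a (rot q.2.1 (forceMoment G k (rot q.2.1⁻¹ q.1) (rot q.2.1⁻¹ e) q.2.2))| ≤
      ‖a‖ * (16 * C) := by
  refine (abs_real_inner_le_norm _ _).trans (mul_le_mul_of_nonneg_left ?_ (norm_nonneg a))
  rw [norm_rot]
  exact h.norm_forceMoment_le hk _ _ _

/-- `G 0` is not a derivative in the phase, so the phase average does not help. The impact average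
gives instead the integral over space of a gradient with compact support. -/
theorem integral_impactLaw_forceMoment_zero (h : PotentialJet ω w G C) {e : Space d}
    (he : ‖e‖ = 1) (a : Space d) (M : SO d) (φ : Torus m) :
    ∫ b, inner ℝ a (rot M (forceMoment G 0 (rot M⁻¹ b) (rot M⁻¹ e) φ)) ∂impactLaw e = 0 := by
  have hM : Continuous (rot M⁻¹) := (rotL M⁻¹).continuous
  have h1 : ∀ b, inner ℝ a (rot M (forceMoment G 0 (rot M⁻¹ b) (rot M⁻¹ e) φ)) =
      ∫ t in (0 : ℝ)..2, inner ℝ (G 0 (rot M⁻¹ (line b e t)) φ) (rot M⁻¹ a) := by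
    intro b
    have hl : ∀ t, line (rot M⁻¹ b) (rot M⁻¹ e) t = rot M⁻¹ (line b e t) := by
      intro t; rw [line, line, rot_add, rot_smul]
    have hc : Continuous fun t => G 0 (rot M⁻¹ (line b e t)) φ :=
      h.continuous_G_comp (by norm_num) (hM.comp (continuous_line b e)) continuous_const
    have h2 := (innerSL ℝ (rot M⁻¹ a)).intervalIntegral_comp_comm (μ := volume)
      (hc.intervalIntegrable 0 2)
    simp only [innerSL_apply_apply] at h2
    rw [← inner_rot_rot M⁻¹, rot_inv_rot, forceMoment]
    simp only [pow_zero, one_smul, hl]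
    rw [← h2]
    simp only [real_inner_comm]
  simp only [h1]
  rw [integral_impactLaw_line he (h := fun y => inner ℝ (G 0 (rot M⁻¹ y) φ) (rot M⁻¹ a))
    ((h.continuous_G_comp (by norm_num) hM continuous_const).inner continuous_const)
    (fun y hy => by rw [h.G_supp 0 (by norm_num) _ _ (by rwa [norm_rot]), inner_zero_left]),
    (measurePreserving_rot M⁻¹).integral_comp (rotL M⁻¹).toHomeomorph.measurableEmbedding
      (fun y => inner ℝ (G 0 y φ) (rot M⁻¹ a)), h.integral_inner_G (by norm_num), smul_zero]

theorem integral_alphaHat (h : PotentialJet ω w G C) (hν : ∀ᵐ c ∂ν, c ∈ Icc (-1 : ℝ) 1) {k : ℕ}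
    (hk : k ≤ 2) {e : Space d} (he : ‖e‖ = 1) : ∫ κ, alphaHat G k e κ ∂scatLaw d m ν e = 0 := by
  have hρ : Integrable (fun c : ℝ => -c) ν := by
    have := integrable_pow_of_mem_Icc hν 1
    simp only [pow_one] at this
    exact this.neg
  have hi := h.integrable_alphaHat hν k e e
  -- The formulas for iterated averages are for real functions, hence the pairing with a fixed
  -- vector.
  refine ext_inner_left ℝ fun a => ?_
  rw [inner_zero_right, ← integral_inner hi]
  have h1 : ∀ (j : ℕ) (κ : Params d m), inner ℝ a (-(κ.2.2.2 • rot κ.2.1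
      (forceMoment G j (rot κ.2.1⁻¹ κ.1) (rot κ.2.1⁻¹ e) κ.2.2.1))) = -κ.2.2.2 * inner ℝ a (rot κ.2.1
      (forceMoment G j (rot κ.2.1⁻¹ κ.1) (rot κ.2.1⁻¹ e) κ.2.2.1)) := by
    intro j κ
    rw [inner_neg_right, real_inner_smul_right, neg_mul]
  have hk' : k = 0 ∨ k = 1 ∨ k = 2 := by omega
  rcases hk' with rfl | rfl | rfl
  · simp only [alphaHat, inner_zero_right, integral_zero]
  · simp only [alphaHat, h1]
    refine (integral_scatLaw_symm (F := fun q => inner ℝ a (rot q.2.1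
      (forceMoment G 0 (rot q.2.1⁻¹ q.1) (rot q.2.1⁻¹ e) q.2.2)))
      (h.continuous_inner_rot_forceMoment (by norm_num) a e)
      (h.abs_inner_rot_forceMoment_le (by norm_num) a e) hρ e).trans ?_
    simp only [h.integral_impactLaw_forceMoment_zero he, integral_zero, mul_zero]
  · simp only [alphaHat, h1]
    refine (integral_scatLaw (F := fun q => inner ℝ a (rot q.2.1
      (forceMoment G 1 (rot q.2.1⁻¹ q.1) (rot q.2.1⁻¹ e) q.2.2)))
      (h.continuous_inner_rot_forceMoment (by norm_num) a e)
      (h.abs_inner_rot_forceMoment_le (by norm_num) a e) hρ e).trans ?_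
    have h2 : ∀ b M, ∫ φ, inner ℝ a (rot M (forceMoment G 1 (rot M⁻¹ b) (rot M⁻¹ e) φ)) = 0 := by
      intro b M
      have hc : Continuous fun φ => forceMoment G 1 (rot M⁻¹ b) (rot M⁻¹ e) φ :=
        (h.continuous_forceMoment (k := 1) (by norm_num)).comp
          (f := fun φ => (rot M⁻¹ b, rot M⁻¹ e, φ)) (by fun_prop)
      have h3 : ∀ φ, inner ℝ a (rot M (forceMoment G 1 (rot M⁻¹ b) (rot M⁻¹ e) φ)) =
          inner ℝ (rot M⁻¹ a) (forceMoment G 1 (rot M⁻¹ b) (rot M⁻¹ e) φ) := fun φ => by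
        rw [← inner_rot_rot M⁻¹, rot_inv_rot]
      simp only [h3]
      rw [integral_inner (integrable_torus hc), h.integral_forceMoment_one, inner_zero_right]
    simp only [h2, integral_zero, mul_zero]

/-- For `d ≥ 2` a rotation takes `e` to `-e`, so the averages at `e` and `-e` agree; the laws at `e`
and `-e` are equal and the integrand is odd, so the average is its own negative. For `d = 1` the
integrand vanishes almost surely. -/
theorem integral_work₂_frame (h : PotentialJet ω w G C) (hd : 1 ≤ d)
    (hν : ∀ᵐ c ∂ν, c ∈ Icc (-1 : ℝ) 1) {e : Space d} (he : ‖e‖ = 1) :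
    ∫ κ : Params d m, κ.2.2.2 ^ 2 * work₂ G (rot κ.2.1⁻¹ κ.1) (rot κ.2.1⁻¹ e) κ.2.2.1
      ∂scatLaw d m ν e = 0 := by
  have hρ := integrable_pow_of_mem_Icc hν 2
  have h1 : ∫ κ : Params d m, κ.2.2.2 ^ 2 * work₂ G (rot κ.2.1⁻¹ κ.1) (rot κ.2.1⁻¹ e) κ.2.2.1
      ∂scatLaw d m ν e = -(1 / 2) * ∫ κ : Params d m, κ.2.2.2 ^ 2 *
        crossMoment G (rot κ.2.1⁻¹ κ.1) (rot κ.2.1⁻¹ e) κ.2.2.1 ∂scatLaw d m ν e := by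
    rw [integral_frame h.continuous_work₂ h.abs_work₂_le hρ,
      integral_frame h.continuous_crossMoment h.abs_crossMoment_le hρ]
    simp only [h.integral_work₂, integral_const_mul]
    ring
  rw [h1]
  have hperp : ∀ᵐ κ : Params d m ∂scatLaw d m ν e, inner ℝ e κ.1 = 0 := by
    filter_upwards [ae_scatLaw_mem (v := e) hν] with κ hκ using hκ.1
  have hperp' : ∀ κ : Params d m, inner ℝ e κ.1 = 0 →
      inner ℝ (rot κ.2.1⁻¹ e) (rot κ.2.1⁻¹ κ.1) = 0 := fun κ hκ => by rwa [inner_rot_rot]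
  rcases hd.eq_or_lt with hd1 | hd2
  · rw [integral_eq_zero_of_ae, mul_zero]
    filter_upwards [hperp] with κ hκ
    rw [h.crossMoment_eq_zero hd1.symm (by rw [norm_rot, he]) (hperp' κ hκ), mul_zero, Pi.zero_apply]
  · obtain ⟨N, hN⟩ := exists_rot_eq hd2 he (e' := -e) (by rwa [norm_neg])
    have hcont : Continuous fun q : (Space d × Space d × Torus m) × ℝ =>
        q.2 ^ 2 * crossMoment G q.1.1 q.1.2.1 q.1.2.2 :=
      (continuous_snd.pow 2).mul (h.continuous_crossMoment.comp continuous_fst)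
    have h2 := integral_scatLaw_rot (ν := ν) hcont he N
    have h3 : scatLaw d m ν (-e) = scatLaw d m ν e := by
      rw [← neg_one_smul ℝ e, scatLaw_smul ν (by norm_num)]
    rw [hN, h3] at h2
    simp only [toFrame] at h2
    have h4 : ∫ κ : Params d m, κ.2.2.2 ^ 2 *
        crossMoment G (rot κ.2.1⁻¹ κ.1) (rot κ.2.1⁻¹ (-e)) κ.2.2.1 ∂scatLaw d m ν e =
        -∫ κ : Params d m, κ.2.2.2 ^ 2 *
          crossMoment G (rot κ.2.1⁻¹ κ.1) (rot κ.2.1⁻¹ e) κ.2.2.1 ∂scatLaw d m ν e := by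
      rw [← integral_neg]
      refine integral_congr_ae ?_
      filter_upwards [hperp] with κ hκ
      rw [rot_neg, h.crossMoment_neg (by rw [norm_rot, he]) (hperp' κ hκ), mul_neg]
    linarith

theorem integral_mul_workMoment_frame (h : PotentialJet ω w G C)
    (hν : ∀ᵐ c ∂ν, c ∈ Icc (-1 : ℝ) 1) {k : ℕ} (hk : k ≤ 3) (v e : Space d) :
    ∫ κ : Params d m, κ.2.2.2 * workMoment w k (rot κ.2.1⁻¹ κ.1) (rot κ.2.1⁻¹ e) κ.2.2.1
      ∂scatLaw d m ν v = 0 :=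
  integral_frame_eq_zero (ρ := fun c => c) (h.continuous_workMoment hk) (h.abs_workMoment_le hk)
    (by simpa using integrable_pow_of_mem_Icc hν 1) (h.integral_workMoment hk) v e

theorem integrable_mul_workMoment_frame (h : PotentialJet ω w G C)
    (hν : ∀ᵐ c ∂ν, c ∈ Icc (-1 : ℝ) 1) {k : ℕ} (hk : k ≤ 3) (v e : Space d) :
    Integrable (fun κ : Params d m => κ.2.2.2 *
      workMoment w k (rot κ.2.1⁻¹ κ.1) (rot κ.2.1⁻¹ e) κ.2.2.1) (scatLaw d m ν v) :=
  integrable_frame (ρ := fun c => c) (h.continuous_workMoment hk) (h.abs_workMoment_le hk)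
    (by simpa using integrable_pow_of_mem_Icc hν 1) v e

theorem integral_betaHat_add (h : PotentialJet ω w G C) (hν : ∀ᵐ c ∂ν, c ∈ Icc (-1 : ℝ) 1)
    {k : ℕ} (hk : k ≤ 3) (n : ℝ) {f : Space d → Space d → Torus m → ℝ} {K : ℝ}
    (hf : Continuous fun q : Space d × Space d × Torus m => f q.1 q.2.1 q.2.2)
    (hK : ∀ b e φ, |f b e φ| ≤ K) (e : Space d) :
    ∫ κ : Params d m, (κ.2.2.2 * (workMoment w k (rot κ.2.1⁻¹ κ.1) (rot κ.2.1⁻¹ e) κ.2.2.1 / n) +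
        κ.2.2.2 ^ 2 * f (rot κ.2.1⁻¹ κ.1) (rot κ.2.1⁻¹ e) κ.2.2.1) ∂scatLaw d m ν e =
      ∫ κ : Params d m, κ.2.2.2 ^ 2 * f (rot κ.2.1⁻¹ κ.1) (rot κ.2.1⁻¹ e) κ.2.2.1
        ∂scatLaw d m ν e := by
  simp only [← mul_div_assoc]
  rw [integral_add ((h.integrable_mul_workMoment_frame hν hk e e).div_const n)
    (integrable_frame hf hK (integrable_pow_of_mem_Icc hν 2) e e), integral_div,
    h.integral_mul_workMoment_frame hν hk, zero_div, zero_add]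

theorem integral_betaHat_eq_zero (h : PotentialJet ω w G C) (hd : 1 ≤ d)
    (hν : ∀ᵐ c ∂ν, c ∈ Icc (-1 : ℝ) 1) {l : ℕ} (hl : l ≤ 3) {e : Space d} (he : ‖e‖ = 1) :
    ∫ κ, betaHat w G l e κ ∂scatLaw d m ν e = 0 := by
  have hl' : l = 0 ∨ l = 1 ∨ l = 2 ∨ l = 3 := by omega
  rcases hl' with rfl | rfl | rfl | rfl
  · simp only [betaHat, betaRed, integral_zero]
  · exact h.integral_mul_workMoment_frame hν (by norm_num) e e
  · exact h.integral_mul_workMoment_frame hν (by norm_num) e e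
  · exact (h.integral_betaHat_add hν (by norm_num) 2 h.continuous_work₂ h.abs_work₂_le e).trans
      (h.integral_work₂_frame hd hν he)

/-- The formula for pairs of points is applied with weight `u²`; the `1 / 2` from the symmetrisation
of `work₃` cancels the `2` of the two rays. -/
theorem integral_betaHat_four (h : PotentialJet ω w G C) (hd : 1 ≤ d)
    (hν : ∀ᵐ c ∂ν, c ∈ Icc (-1 : ℝ) 1) {e : Space d} (he : ‖e‖ = 1) :
    ∫ κ, betaHat w G 4 e κ ∂scatLaw d m ν e = (∫ c, c ^ 2 ∂ν) / (sphereArea d * ballVol d) *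
      ∫ φ, ∫ p : Space d × Space d, ‖p.1 - p.2‖ ^ (1 - (d : ℤ)) *
        (‖p.1 - p.2‖ ^ 2 * inner ℝ (G 1 p.1 φ) (G 1 p.2 φ)) := by
  have hρ := integrable_pow_of_mem_Icc hν 2
  have h1 : ∫ κ : Params d m, κ.2.2.2 ^ 2 * work₃ G (rot κ.2.1⁻¹ κ.1) (rot κ.2.1⁻¹ e) κ.2.2.1
      ∂scatLaw d m ν e = 1 / 2 * ∫ κ : Params d m, κ.2.2.2 ^ 2 *
        squareMoment G (rot κ.2.1⁻¹ κ.1) (rot κ.2.1⁻¹ e) κ.2.2.1 ∂scatLaw d m ν e := by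
    rw [integral_frame h.continuous_work₃ h.abs_work₃_le hρ,
      integral_frame h.continuous_squareMoment h.abs_squareMoment_le hρ]
    simp only [h.integral_work₃, integral_const_mul]
    ring
  have h2 : ∀ φ, ∫ M, (∫ b, squareMoment G (rot M⁻¹ b) (rot M⁻¹ e) φ ∂impactLaw e) ∂haarSO d =
      2 / sphereArea d / ballVol d * ∫ p : Space d × Space d, ‖p.1 - p.2‖ ^ (1 - (d : ℤ)) *
        (‖p.1 - p.2‖ ^ 2 * inner ℝ (G 1 p.1 φ) (G 1 p.2 φ)) := fun φ =>
    integral_rot_line_line hd he (k := fun x => x ^ 2) (by fun_prop) (fun u => sq_abs u)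
      (H := fun x y => inner ℝ (G 1 x φ) (G 1 y φ))
      ((h.continuous_G_comp (by norm_num) continuous_fst continuous_const).inner
        (h.continuous_G_comp (by norm_num) continuous_snd continuous_const))
      (fun x y hxy => by
        rcases hxy with hx | hy
        · rw [h.G_supp 1 (by norm_num) x φ hx, inner_zero_left]
        · rw [h.G_supp 1 (by norm_num) y φ hy, inner_zero_right])
  refine (h.integral_betaHat_add hν (k := 3) (by norm_num) 6 h.continuous_work₃
    h.abs_work₃_le e).trans ?_
  rw [h1, integral_frame_symm h.continuous_squareMoment h.abs_squareMoment_le hρ]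
  simp only [h2]
  rw [integral_const_mul]
  field_simp

/-- The square of a line integral is a double integral along the same line, so the formula for pairs
of points applies with weight `1`. -/
theorem integral_betaHat_one_sq (h : PotentialJet ω w G C) (hd : 1 ≤ d)
    (hν : ∀ᵐ c ∂ν, c ∈ Icc (-1 : ℝ) 1) {e : Space d} (he : ‖e‖ = 1) :
    ∫ κ, betaHat w G 1 e κ ^ 2 ∂scatLaw d m ν e =
      2 / sphereArea d * ((∫ c, c ^ 2 ∂ν) / ballVol d) *
      ∫ φ, ∫ p : Space d × Space d, ‖p.1 - p.2‖ ^ (1 - (d : ℤ)) * w 1 p.1 φ * w 1 p.2 φ := by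
  have hρ := integrable_pow_of_mem_Icc hν 2
  have h2 : ∀ φ, ∫ M, (∫ b, workMoment w 0 (rot M⁻¹ b) (rot M⁻¹ e) φ ^ 2 ∂impactLaw e) ∂haarSO d =
      2 / sphereArea d / ballVol d * ∫ p : Space d × Space d, ‖p.1 - p.2‖ ^ (1 - (d : ℤ)) *
        w 1 p.1 φ * w 1 p.2 φ := by
    intro φ
    have h3 := integral_rot_line_line hd he (k := fun _ => 1) continuous_const (fun _ => rfl)
      (H := fun x y => w 1 x φ * w 1 y φ)
      ((h.continuous_w_comp (by norm_num) continuous_fst continuous_const).mul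
        (h.continuous_w_comp (by norm_num) continuous_snd continuous_const))
      (fun x y hxy => by
        rcases hxy with hx | hy
        · rw [h.w_supp 1 (by norm_num) x φ hx, zero_mul]
        · rw [h.w_supp 1 (by norm_num) y φ hy, mul_zero])
    simp only [one_mul, intervalIntegral.integral_const_mul, intervalIntegral.integral_mul_const,
      ← mul_assoc] at h3
    rw [← h3]
    simp only [workMoment, pow_zero, one_mul, zero_add, sq]
  have hfK : ∀ (b e : Space d) (φ : Torus m), |workMoment w 0 b e φ ^ 2| ≤ (16 * C) ^ 2 :=
    fun b e φ => by
      rw [abs_pow]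
      exact pow_le_pow_left₀ (abs_nonneg _) (h.abs_workMoment_le (by norm_num) b e φ) 2
  have h4 := integral_frame_symm (ν := ν) (f := fun b e φ => workMoment w 0 b e φ ^ 2)
    ((h.continuous_workMoment (by norm_num)).pow 2) hfK hρ e e
  simp only [h2] at h4
  simp only [betaHat, betaRed, mul_pow]
  rw [h4, integral_const_mul]
  field_simp

end PotentialJet

end

section

variable {d m : ℕ} {ω : Space m} {w : ℕ → Space d → Torus m → ℝ}
  {G : ℕ → Space d → Torus m → Space d} {C : ℝ}

/-! ### The Riesz kernel identity -/

theorem integrable_pair {H : Space d × Space d → ℝ} (hH : Continuous H)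
    (hs : ∀ x y, 1 / 2 ≤ ‖x‖ ∨ 1 / 2 ≤ ‖y‖ → H (x, y) = 0) : Integrable H :=
  hH.integrable_of_hasCompactSupport (HasCompactSupport.intro
    ((isCompact_closedBall (0 : Space d) (1 / 2)).prod (isCompact_closedBall (0 : Space d) (1 / 2)))
    fun p hp => by
      rw [← Prod.mk.eta (p := p), hs]
      by_contra! h
      exact hp ⟨by simpa using h.1.le, by simpa using h.2.le⟩)

theorem hasGradientAt_rpow_norm_sq (p : ℝ) {η : ℝ} (hη : 0 < η) (a y : Space d) :
    HasGradientAt (fun y => (‖y - a‖ ^ 2 + η) ^ p)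
      ((2 * p * (‖y - a‖ ^ 2 + η) ^ (p - 1)) • (y - a)) y := by
  have h1 : HasFDerivAt (fun y : Space d => ‖y - a‖ ^ 2 + η) (2 • innerSL ℝ (y - a)) y := by
    have := (((hasFDerivAt_id y).sub_const a).norm_sq).add_const η
    simpa using this
  have h2 := h1.rpow_const (p := p) (Or.inl (by positivity))
  rw [hasGradientAt_iff_hasFDerivAt]
  refine h2.congr_fderiv ?_
  ext x
  simp only [_root_.smul_apply, innerSL_apply_apply, InnerProductSpace.toDual_apply_apply,
    real_inner_smul_left, smul_eq_mul, nsmul_eq_mul, Nat.cast_ofNat]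
  ring

theorem continuous_rpow_norm_sq (p : ℝ) {η : ℝ} (hη : 0 < η) {X : Type*} [TopologicalSpace X]
    {f : X → Space d} (hf : Continuous f) : Continuous fun x => (‖f x‖ ^ 2 + η) ^ p :=
  ((hf.norm.pow 2).add continuous_const).rpow_const fun _ =>
    Or.inl (add_pos_of_nonneg_of_pos (sq_nonneg _) hη).ne'

namespace PotentialJet

/-- Integration by parts against the field `(‖y - a‖² + η)^q (y - a)`, coordinate by coordinate; the
bracket on the right is its divergence. The parameter `η > 0` removes the singularity at `a`. -/
theorem integral_rpow_mul_inner_G (h : PotentialJet ω w G C) {k : ℕ} (hk : k ≤ 3) (q : ℝ) {η : ℝ}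
    (hη : 0 < η) (φ : Torus m) (a : Space d) :
    ∫ y, (‖y - a‖ ^ 2 + η) ^ q * inner ℝ (G k y φ) (y - a) =
      -∫ y, (2 * q * (‖y - a‖ ^ 2 + η) ^ (q - 1) * ‖y - a‖ ^ 2 + d * (‖y - a‖ ^ 2 + η) ^ q) *
        w k y φ := by
  have hsub : Continuous fun y : Space d => y - a := by fun_prop
  have hco : ∀ i : Fin d, Continuous fun y : Space d => (y - a) i := fun i => by fun_prop
  let K' : Fin d → Space d → Space d := fun i y =>
    (2 * q * (‖y - a‖ ^ 2 + η) ^ (q - 1) * (y - a) i) • (y - a) +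
      (‖y - a‖ ^ 2 + η) ^ q • EuclideanSpace.single i (1 : ℝ)
  have hK' : ∀ i, Continuous (K' i) := fun i =>
    (((continuous_const.mul (continuous_rpow_norm_sq (q - 1) hη hsub)).mul (hco i)).smul hsub).add
      ((continuous_rpow_norm_sq q hη hsub).smul continuous_const)
  have hK : ∀ i y, HasGradientAt (fun y => (‖y - a‖ ^ 2 + η) ^ q * (y - a) i) (K' i y) y := by
    intro i y
    have h1 := (hasGradientAt_iff_hasFDerivAt.1 (hasGradientAt_rpow_norm_sq q hη a y))
    have h2 : HasFDerivAt (fun y : Space d => (y - a) i)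
        (InnerProductSpace.toDual ℝ (Space d) (EuclideanSpace.single i (1 : ℝ))) y := by
      have h3 := ((InnerProductSpace.toDual ℝ (Space d)
        (EuclideanSpace.single i (1 : ℝ))).hasFDerivAt (x := y)).sub_const (a i)
      refine h3.congr_of_eventuallyEq (Eventually.of_forall fun x => ?_)
      simp [EuclideanSpace.inner_single_left]
    rw [hasGradientAt_iff_hasFDerivAt]
    refine (h1.mul h2).congr_fderiv ?_
    ext x
    simp [K']
    ring
  have h1 := fun i => h.integral_mul_inner_G hk (hK i) (hK' i) φ (EuclideanSpace.single i (1 : ℝ))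
  have hi1 : ∀ i, Integrable fun y => (‖y - a‖ ^ 2 + η) ^ q * (y - a) i *
      inner ℝ (G k y φ) (EuclideanSpace.single i (1 : ℝ)) := fun i =>
    h.integrable_mul_inner_G hk ((continuous_rpow_norm_sq q hη hsub).mul (hco i)) φ _
  have hi2 : ∀ i, Integrable fun y => inner ℝ (K' i y) (EuclideanSpace.single i (1 : ℝ)) * w k y φ :=
    fun i => h.integrable_mul_w (by omega) ((hK' i).inner continuous_const) φ
  have h2 : ∑ i, ∫ y, (‖y - a‖ ^ 2 + η) ^ q * (y - a) i *
      inner ℝ (G k y φ) (EuclideanSpace.single i (1 : ℝ)) =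
      ∑ i, -∫ y, inner ℝ (K' i y) (EuclideanSpace.single i (1 : ℝ)) * w k y φ :=
    Finset.sum_congr rfl fun i _ => h1 i
  rw [Finset.sum_neg_distrib, ← integral_finsetSum _ fun i _ => hi1 i,
    ← integral_finsetSum _ fun i _ => hi2 i] at h2
  have hn : ∀ y : Space d, ‖y - a‖ ^ 2 = ∑ i, (y - a) i * (y - a) i := fun y => by
    rw [EuclideanSpace.real_norm_sq_eq]; simp only [sq]
  refine (integral_congr_ae (Eventually.of_forall fun y => ?_)).trans (h2.trans
    (congrArg Neg.neg (integral_congr_ae (Eventually.of_forall fun y => ?_))))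
  · dsimp only
    rw [PiLp.inner_apply, Finset.mul_sum]
    refine Finset.sum_congr rfl fun i _ => ?_
    simp only [EuclideanSpace.inner_single_right, RCLike.inner_apply, conj_trivial]
    ring
  · dsimp only
    rw [← Finset.sum_mul]
    congr 1
    simp only [K', inner_add_left, real_inner_smul_left]
    simp only [EuclideanSpace.inner_single_right, conj_trivial, one_mul, PiLp.single_apply,
      if_true, mul_one, Finset.sum_add_distrib, Finset.sum_const, Finset.card_univ,
      Fintype.card_fin, nsmul_eq_mul]
    congr 1
    simp only [mul_assoc, ← Finset.mul_sum, ← hn]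

/-- Two integrations by parts, one in each variable, move both gradients onto the regularised kernel
and produce minus its Laplacian. -/
theorem integral_rpow_mul_inner_G_G (h : PotentialJet ω w G C) {k : ℕ} (hk : k ≤ 3) (p : ℝ) {η : ℝ}
    (hη : 0 < η) (φ : Torus m) :
    ∫ z : Space d × Space d, (‖z.1 - z.2‖ ^ 2 + η) ^ p * inner ℝ (G k z.1 φ) (G k z.2 φ) =
      -(2 * p) * ∫ z : Space d × Space d,
        (2 * (p - 1) * (‖z.1 - z.2‖ ^ 2 + η) ^ (p - 1 - 1) * ‖z.1 - z.2‖ ^ 2 +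
          d * (‖z.1 - z.2‖ ^ 2 + η) ^ (p - 1)) * (w k z.1 φ * w k z.2 φ) := by
  have hG := h.continuous_G_comp hk (continuous_id (X := Space d)) (continuous_const (y := φ))
  have hw := h.continuous_w_comp (k := k) (by omega) (continuous_id (X := Space d))
    (continuous_const (y := φ))
  simp only [id] at hG hw
  have hsub : Continuous fun z : Space d × Space d => z.1 - z.2 := by fun_prop
  have hi1 : Integrable fun z : Space d × Space d =>
      (‖z.1 - z.2‖ ^ 2 + η) ^ p * inner ℝ (G k z.1 φ) (G k z.2 φ) :=
    integrable_pair ((continuous_rpow_norm_sq p hη hsub).mul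
      ((hG.comp continuous_fst).inner (hG.comp continuous_snd))) (by
      rintro x y (hx | hy)
      · simp [h.G_supp k hk x φ hx]
      · simp [h.G_supp k hk y φ hy])
  have hi2 : Integrable fun z : Space d × Space d =>
      w k z.1 φ * ((‖z.2 - z.1‖ ^ 2 + η) ^ (p - 1) * inner ℝ (G k z.2 φ) (z.2 - z.1)) :=
    integrable_pair ((hw.comp continuous_fst).mul
      ((continuous_rpow_norm_sq (p - 1) hη (by fun_prop : Continuous
        fun z : Space d × Space d => z.2 - z.1)).mul ((hG.comp continuous_snd).inner
        (by fun_prop)))) (by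
      rintro x y (hx | hy)
      · simp [h.w_supp k (by omega) x φ hx]
      · simp [h.G_supp k hk y φ hy])
  have hi3 : Integrable fun z : Space d × Space d =>
        (2 * (p - 1) * (‖z.1 - z.2‖ ^ 2 + η) ^ (p - 1 - 1) * ‖z.1 - z.2‖ ^ 2 +
          d * (‖z.1 - z.2‖ ^ 2 + η) ^ (p - 1)) * (w k z.1 φ * w k z.2 φ) :=
    integrable_pair ((((continuous_const.mul (continuous_rpow_norm_sq (p - 1 - 1) hη hsub)).mul
      (hsub.norm.pow 2)).add (continuous_const.mul (continuous_rpow_norm_sq (p - 1) hη hsub))).mul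
      ((hw.comp continuous_fst).mul (hw.comp continuous_snd))) (by
      rintro x y (hx | hy)
      · simp [h.w_supp k (by omega) x φ hx]
      · simp [h.w_supp k (by omega) y φ hy])
  rw [Measure.volume_eq_prod] at hi1 hi2 hi3 ⊢
  rw [integral_prod_symm _ hi1, integral_prod _ hi3]
  have h1 : ∀ y', ∫ y, (‖y - y'‖ ^ 2 + η) ^ p * inner ℝ (G k y φ) (G k y' φ) =
      2 * p * ∫ y, w k y φ * ((‖y' - y‖ ^ 2 + η) ^ (p - 1) * inner ℝ (G k y' φ) (y' - y)) := by
    intro y'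
    rw [h.integral_mul_inner_G hk (fun y => hasGradientAt_rpow_norm_sq p hη y' y)
      ((continuous_const.mul (continuous_rpow_norm_sq (p - 1) hη
        (by fun_prop : Continuous fun y : Space d => y - y'))).smul (by fun_prop)) φ (G k y' φ),
      ← integral_neg, ← integral_const_mul]
    refine integral_congr_ae (Eventually.of_forall fun y => ?_)
    beta_reduce
    rw [real_inner_smul_left, norm_sub_rev y y', ← neg_sub y' y, inner_neg_left,
      real_inner_comm (G k y' φ)]
    ring
  simp only [h1]
  rw [integral_const_mul, ← integral_prod_symm _ hi2, integral_prod _ hi2, neg_mul, ← mul_neg,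
    ← integral_neg]
  congr 1
  refine integral_congr_ae (Eventually.of_forall fun y => ?_)
  dsimp only
  rw [integral_const_mul, h.integral_rpow_mul_inner_G hk (p - 1) hη φ y, mul_neg,
    ← integral_const_mul]
  congr 1
  refine integral_congr_ae (Eventually.of_forall fun y' => ?_)
  simp only [norm_sub_rev y y']
  ring

end PotentialJet

end

section

variable {d m : ℕ} {ω : Space m} {w : ℕ → Space d → Torus m → ℝ}
  {G : ℕ → Space d → Torus m → Space d} {C : ℝ}

/-! ### Passage to the limit in the kernel identity -/

theorem sq_rpow_eq_zpow {x : ℝ} (hx : 0 < x) :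
    (x ^ 2) ^ ((3 - (d : ℝ)) / 2 - 1) = x ^ (1 - (d : ℤ)) := by
  rw [← Real.rpow_natCast x 2, ← Real.rpow_mul hx.le, ← Real.rpow_intCast]
  congr 1
  push_cast
  ring

/-- The exponent is `(1 - d) / 2 ≤ 0`, so dropping `η` increases the value. -/
theorem rpow_le_zpow (hd : 1 ≤ d) {x η : ℝ} (hx : 0 < x) (hη : 0 < η) :
    (x ^ 2 + η) ^ ((3 - (d : ℝ)) / 2 - 1) ≤ x ^ (1 - (d : ℤ)) := by
  have hd' : (1 : ℝ) ≤ d := by exact_mod_cast hd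
  rw [← sq_rpow_eq_zpow hx]
  exact Real.rpow_le_rpow_of_nonpos (by positivity) (by linarith) (by linarith)

theorem ae_sub_ne_zero (hd : 1 ≤ d) : ∀ᵐ z : Space d × Space d, z.1 - z.2 ≠ 0 := by
  have : Nonempty (Fin d) := ⟨⟨0, hd⟩⟩
  have h1 : ∀ᵐ z : Space d, z ≠ 0 := by
    rw [ae_iff]; simp
  have h2 := (Measure.quasiMeasurePreserving_fst (μ := (volume : Measure (Space d)))
    (ν := (volume : Measure (Space d)))).comp
    (measurePreserving_sub_prod (volume : Measure (Space d))
      (volume : Measure (Space d))).quasiMeasurePreserving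
  exact h2.ae h1

theorem norm_sub_le_one_of_ne {H : Space d → Space d → ℝ}
    (hs : ∀ x y, 1 / 2 ≤ ‖x‖ ∨ 1 / 2 ≤ ‖y‖ → H x y = 0) {x y : Space d} (h : H x y ≠ 0) :
    ‖x - y‖ ≤ 1 := by
  have h1 : ¬(1 / 2 ≤ ‖x‖ ∨ 1 / 2 ≤ ‖y‖) := fun h2 => h (hs x y h2)
  push Not at h1
  linarith [norm_sub_le x y, h1.1, h1.2]

/-- Dominated convergence. The bound on the kernel is needed only at distances in `(0, 1]`: the
diagonal is a null set, and larger distances do not occur in the support of `H`. -/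
theorem tendsto_integral_kernel (hd : 1 ≤ d) {K : ℝ → ℝ → ℝ} {c A : ℝ}
    (hKc : ∀ η > 0, Measurable fun z : Space d × Space d => K η ‖z.1 - z.2‖)
    (hKb : ∀ η ∈ Ioo (0 : ℝ) 1, ∀ x ∈ Ioc (0 : ℝ) 1, |K η x| ≤ c * x ^ (1 - (d : ℤ)))
    {L : ℝ → ℝ} (hK : ∀ x > 0, Tendsto (fun η => K η x) (𝓝[>] 0) (𝓝 (x ^ (1 - (d : ℤ)) * L x)))
    {H : Space d → Space d → ℝ} (hH : Continuous fun z : Space d × Space d => H z.1 z.2)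
    (hA : ∀ x y, |H x y| ≤ A)
    (hs : ∀ x y, 1 / 2 ≤ ‖x‖ ∨ 1 / 2 ≤ ‖y‖ → H x y = 0) :
    Tendsto (fun η => ∫ z : Space d × Space d, K η ‖z.1 - z.2‖ * H z.1 z.2) (𝓝[>] 0)
      (𝓝 (∫ z : Space d × Space d, ‖z.1 - z.2‖ ^ (1 - (d : ℤ)) * (L ‖z.1 - z.2‖ * H z.1 z.2))) := by
  have hint := integrable_norm_zpow_mul hd (H := fun z => c * |H z.1 z.2|) (K := |c| * A)
    (hH.abs.measurable.const_mul c) (fun p => by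
      rw [abs_mul, abs_abs]; exact mul_le_mul_of_nonneg_left (hA _ _) (abs_nonneg c))
    (fun x y hxy => by simp [hs x y hxy])
  refine tendsto_integral_filter_of_dominated_convergence _ ?_ ?_ hint ?_
  · filter_upwards [self_mem_nhdsWithin] with η hη
    exact ((hKc η hη).mul hH.measurable).aestronglyMeasurable
  · filter_upwards [Ioo_mem_nhdsGT (zero_lt_one' ℝ)] with η hη
    filter_upwards [ae_sub_ne_zero hd] with z hz
    by_cases h0 : H z.1 z.2 = 0
    · simp [h0]
    · rw [norm_mul, Real.norm_eq_abs, Real.norm_eq_abs]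
      have := mul_le_mul_of_nonneg_right (hKb η hη ‖z.1 - z.2‖
        ⟨norm_pos_iff.2 hz, norm_sub_le_one_of_ne hs h0⟩) (abs_nonneg (H z.1 z.2))
      linarith
  · filter_upwards [ae_sub_ne_zero hd] with z hz
    rw [← mul_assoc]
    exact (hK _ (norm_pos_iff.2 hz)).mul_const _

theorem continuous_comp_frame {f : Space d → Space d → Torus m → ℝ}
    (hf : Continuous fun q : Space d × Space d × Torus m => f q.1 q.2.1 q.2.2) (e : Space d) :
    Continuous fun q : (Torus m × SO d) × Space d =>
      f (rot q.1.2⁻¹ q.2) (rot q.1.2⁻¹ e) q.1.1 :=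
  (hf.comp (continuous_frame e)).comp
    (f := fun q : (Torus m × SO d) × Space d => (q.2, q.1.2, q.1.1)) (by fun_prop)

/-- The average over `b` is a nonnegative continuous function of `(φ, M)` with zero integral. Since
phase and Haar measure charge open sets, it vanishes everywhere and may be evaluated at `M = 1`. -/
theorem ae_eq_zero_of_integral_frame_eq_zero {f : Space d → Space d → Torus m → ℝ} {K : ℝ}
    (hf : Continuous fun q : Space d × Space d × Torus m => f q.1 q.2.1 q.2.2)
    (hK : ∀ b e φ, |f b e φ| ≤ K) (hf0 : ∀ b e φ, 0 ≤ f b e φ) {e : Space d}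
    (h0 : ∫ φ, ∫ M, (∫ b, f (rot M⁻¹ b) (rot M⁻¹ e) φ ∂impactLaw e) ∂haarSO d = 0)
    (φ : Torus m) : ∀ᵐ b ∂impactLaw e, f b e φ = 0 := by
  let A : Torus m × SO d → ℝ := fun q => ∫ b, f (rot q.2⁻¹ b) (rot q.2⁻¹ e) q.1 ∂impactLaw e
  have hFc := continuous_comp_frame hf e
  have hA : Continuous A := by
    refine continuous_of_dominated (bound := fun _ => K) ?_ ?_ ?_ ?_
    · exact fun q => (hFc.comp (Continuous.prodMk_right q)).aestronglyMeasurable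
    · exact fun q => Eventually.of_forall fun b => hK _ _ _
    · exact integrable_const _
    · exact Eventually.of_forall fun b => hFc.comp (Continuous.prodMk_left b)
  have hA0 : ∀ q, 0 ≤ A q := fun q => integral_nonneg fun b => hf0 _ _ _
  have hAi : Integrable A ((volume : Measure (Torus m)).prod (haarSO d)) :=
    hA.integrable_of_hasCompactSupport (HasCompactSupport.of_compactSpace A)
  have h3 : ∫ q, A q ∂(volume : Measure (Torus m)).prod (haarSO d) = 0 := by
    rw [integral_prod _ hAi]; exact h0
  have h4 := (integral_eq_zero_iff_of_nonneg hA0 hAi).1 h3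
  have h5 : A = 0 := (hA.ae_eq_iff_eq _ continuous_zero).1 h4
  have h6 : ∫ b, f b e φ ∂impactLaw e = 0 := by
    have := congrFun h5 (φ, 1)
    simpa only [A, inv_one, rot_one, Pi.zero_apply] using this
  have hc : Continuous fun b => f b e φ := hf.comp (f := fun b => (b, e, φ)) (by fun_prop)
  exact (integral_eq_zero_iff_of_nonneg (fun b => hf0 _ _ _)
    (integrable_of_continuous_of_bound hc fun b => hK b e φ)).1 h6

theorem ae_dirac_mem_Icc : ∀ᵐ c ∂Measure.dirac (1 : ℝ), c ∈ Icc (-1 : ℝ) 1 := by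
  simp [ae_dirac_eq]

namespace PotentialJet

/-- Take `p = (3 - d) / 2` in the regularised identity and let `η → 0`. In the limit `Δ ‖z‖^(3-d) =
(3 - d) ‖z‖^(1-d)` appears, a locally integrable function with no point mass at the origin. -/
theorem integral_kernel_inner_G (h : PotentialJet ω w G C) (hd : 1 ≤ d) {k : ℕ} (hk : k ≤ 3)
    (φ : Torus m) :
    ∫ z : Space d × Space d, ‖z.1 - z.2‖ ^ (1 - (d : ℤ)) *
        (‖z.1 - z.2‖ ^ 2 * inner ℝ (G k z.1 φ) (G k z.2 φ)) =
      ((d : ℝ) - 3) * ∫ z : Space d × Space d, ‖z.1 - z.2‖ ^ (1 - (d : ℤ)) *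
        (w k z.1 φ * w k z.2 φ) := by
  have hd' : (1 : ℝ) ≤ d := by exact_mod_cast hd
  have hC := h.nonneg
  set p : ℝ := (3 - (d : ℝ)) / 2 with hp
  have hG := h.continuous_G_comp hk (continuous_id (X := Space d)) (continuous_const (y := φ))
  have hw := h.continuous_w_comp (k := k) (by omega) (continuous_id (X := Space d))
    (continuous_const (y := φ))
  simp only [id] at hG hw
  have hsub : Continuous fun z : Space d × Space d => z.1 - z.2 := by fun_prop
  have hlim : ∀ x > 0, ∀ q : ℝ, Tendsto (fun η : ℝ => (x ^ 2 + η) ^ q) (𝓝[>] 0) (𝓝 ((x ^ 2) ^ q)) := by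
    intro x hx q
    have h1 : Tendsto (fun η : ℝ => x ^ 2 + η) (𝓝[>] 0) (𝓝 (x ^ 2 + 0)) :=
      (tendsto_const_nhds.add tendsto_id).mono_left nhdsWithin_le_nhds
    rw [add_zero] at h1
    exact h1.rpow_const (Or.inl (by positivity))
  have h1 := tendsto_integral_kernel hd (K := fun η x => (x ^ 2 + η) ^ p) (c := 2)
    (L := fun x => x ^ 2) (A := C * C) (H := fun x y => inner ℝ (G k x φ) (G k y φ))
    (fun η hη => (continuous_rpow_norm_sq p hη hsub).measurable)
    (fun η hη x hx => by
      have hs : 0 < x ^ 2 + η := by have := hη.1; positivity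
      have h2 : (x ^ 2 + η) ^ p = (x ^ 2 + η) ^ (p - 1) * (x ^ 2 + η) := by
        rw [Real.rpow_sub_one hs.ne', div_mul_cancel₀ _ hs.ne']
      have h3 := rpow_le_zpow hd hx.1 hη.1
      have h4 : 0 ≤ (x ^ 2 + η) ^ (p - 1) := by positivity
      have h5 : x ^ 2 + η ≤ 2 := by nlinarith [hx.1, hx.2, hη.2]
      rw [abs_of_nonneg (by positivity), h2, mul_comm 2]
      exact mul_le_mul h3 h5 hs.le (h4.trans h3))
    (fun x hx => by
      have h2 : x ^ (1 - (d : ℤ)) * x ^ 2 = (x ^ 2) ^ p := by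
        rw [← sq_rpow_eq_zpow hx, Real.rpow_sub_one (by positivity),
          div_mul_cancel₀ _ (by positivity)]
      rw [h2]
      exact hlim x hx p)
    ((hG.comp continuous_fst).inner (hG.comp continuous_snd))
    (fun x y => (abs_real_inner_le_norm _ _).trans (mul_le_mul (h.G_bound k hk _ _)
      (h.G_bound k hk _ _) (norm_nonneg _) hC))
    (fun x y hxy => by
      rcases hxy with hx | hy
      · rw [h.G_supp k hk x φ hx, inner_zero_left]
      · rw [h.G_supp k hk y φ hy, inner_zero_right])
  have h2 := tendsto_integral_kernel hd (K := fun η x => 2 * (p - 1) * (x ^ 2 + η) ^ (p - 1 - 1) *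
      x ^ 2 + d * (x ^ 2 + η) ^ (p - 1)) (c := 2 * d)
    (L := fun x => 1) (A := C * C) (H := fun x y => w k x φ * w k y φ)
    (fun η hη => (((continuous_const.mul (continuous_rpow_norm_sq (p - 1 - 1) hη hsub)).mul
      (hsub.norm.pow 2)).add (continuous_const.mul
        (continuous_rpow_norm_sq (p - 1) hη hsub))).measurable)
    (fun η hη x hx => by
      have hs : 0 < x ^ 2 + η := by have := hη.1; positivity
      have h3 : (x ^ 2 + η) ^ (p - 1) = (x ^ 2 + η) ^ (p - 1 - 1) * (x ^ 2 + η) := by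
        rw [Real.rpow_sub_one hs.ne' (p - 1), div_mul_cancel₀ _ hs.ne']
      have h4 := rpow_le_zpow hd hx.1 hη.1
      have h5 : 0 ≤ (x ^ 2 + η) ^ (p - 1 - 1) := by positivity
      have h6 : (x ^ 2 + η) ^ (p - 1 - 1) * x ^ 2 ≤ (x ^ 2 + η) ^ (p - 1) := by
        rw [h3]; exact mul_le_mul_of_nonneg_left (by linarith [hη.1]) h5
      have h7 : 0 ≤ (x ^ 2 + η) ^ (p - 1 - 1) * x ^ 2 := by positivity
      -- The two terms have coefficients `1 - d` and `d`, each multiplying at most `x^(1-d)`, which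
      -- explains the constant `2 d`.
      have h8 : 2 * (p - 1) = 1 - d := by rw [hp]; ring
      rw [h8, abs_le]
      constructor <;> nlinarith)
    (fun x hx => by
      -- The coefficients add up to `2 (p - 1) + d = 1`, so the limiting weight is `L = 1`.
      have h3 : x ^ (1 - (d : ℤ)) * 1 = 2 * (p - 1) * (x ^ 2) ^ (p - 1 - 1) * x ^ 2 +
          d * (x ^ 2) ^ (p - 1) := by
        rw [mul_one, ← sq_rpow_eq_zpow hx, ← hp, Real.rpow_sub_one (by positivity) (p - 1),
          mul_assoc, div_mul_cancel₀ _ (by positivity), hp]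
        ring
      rw [h3]
      exact (((hlim x hx _).const_mul _).mul_const _).add ((hlim x hx _).const_mul _))
    ((hw.comp continuous_fst).mul (hw.comp continuous_snd))
    (fun x y => by
      rw [abs_mul]
      exact mul_le_mul (h.w_bound k (by omega) _ _) (h.w_bound k (by omega) _ _) (abs_nonneg _) hC)
    (fun x y hxy => by
      rcases hxy with hx | hy
      · rw [h.w_supp k (by omega) x φ hx, zero_mul]
      · rw [h.w_supp k (by omega) y φ hy, mul_zero])
  have h3 := (h2.const_mul (-(2 * p))).congr' (by
    filter_upwards [self_mem_nhdsWithin] with η hη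
    exact (h.integral_rpow_mul_inner_G_G hk p hη φ).symm)
  have h4 := tendsto_nhds_unique h1 h3
  rw [h4]
  simp only [one_mul]
  congr 1
  rw [hp]; ring

/-! ### Positivity -/

/-- With coupling law `dirac 1` the mean square of the line integral is a constant times the kernel
integral. If the latter is zero, so are the line integrals. -/
theorem ae_workMoment_eq_zero (h : PotentialJet ω w G C) (hd : 1 ≤ d)
    (h0 : ∫ φ, ∫ p : Space d × Space d, ‖p.1 - p.2‖ ^ (1 - (d : ℤ)) * w 1 p.1 φ * w 1 p.2 φ = 0)
    {e : Space d} (he : ‖e‖ = 1) (φ : Torus m) :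
    ∀ᵐ b ∂impactLaw e, workMoment w 0 b e φ = 0 := by
  have h1 := h.integral_betaHat_one_sq (ν := Measure.dirac 1) hd
    ae_dirac_mem_Icc he
  rw [h0, mul_zero] at h1
  have hfK : ∀ (b e : Space d) (φ : Torus m), |workMoment w 0 b e φ ^ 2| ≤ (16 * C) ^ 2 :=
    fun b e φ => by
      rw [abs_pow]
      exact pow_le_pow_left₀ (abs_nonneg _) (h.abs_workMoment_le (by norm_num) b e φ) 2
  have hfc : Continuous fun q : Space d × Space d × Torus m =>
      workMoment w 0 q.1 q.2.1 q.2.2 ^ 2 :=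
    (h.continuous_workMoment (k := 0) (by norm_num)).pow 2
  have h2 := integral_frame_symm (ν := Measure.dirac 1) (ρ := fun c => c ^ 2)
    (f := fun b e φ => workMoment w 0 b e φ ^ 2) hfc hfK
    (integrable_pow_of_mem_Icc ae_dirac_mem_Icc 2) e e
  simp only [betaHat, betaRed, mul_pow] at h1
  rw [h1] at h2
  simp only [integral_dirac, one_pow, one_mul] at h2
  filter_upwards [ae_eq_zero_of_integral_frame_eq_zero hfc hfK (fun b e φ => sq_nonneg _) h2.symm φ]
    with b hb
  exact pow_eq_zero_iff (two_ne_zero) |>.1 hb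

/-- The projection-slice argument: for `ξ` orthogonal to `e` the character is constant along each
line in direction `e`, so the Fourier integral is an average over `b` of multiples of line
integrals, all zero. -/
theorem integral_w_eq_zero (h : PotentialJet ω w G C) (hd : 1 ≤ d)
    (h0 : ∫ φ, ∫ p : Space d × Space d, ‖p.1 - p.2‖ ^ (1 - (d : ℤ)) * w 1 p.1 φ * w 1 p.2 φ = 0)
    {e ξ : Space d} (he : ‖e‖ = 1) (heξ : inner ℝ e ξ = 0) (φ : Torus m) :
    ∫ y, Real.fourierChar (-inner ℝ y ξ) • (w 1 y φ : ℂ) = 0 := by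
  have hw := h.continuous_w_comp (k := 1) (by norm_num) (continuous_id (X := Space d))
    (continuous_const (y := φ))
  simp only [id] at hw
  have hc : Continuous fun y => Real.fourierChar (-inner ℝ y ξ) • (w 1 y φ : ℂ) :=
    (Real.continuous_fourierChar.comp (by fun_prop)).smul (Complex.continuous_ofReal.comp hw)
  have h1 := integral_impactLaw_line he hc fun y hy => by
    rw [h.w_supp 1 (by norm_num) y φ hy, Complex.ofReal_zero, smul_zero]
  have h2 : ∫ b, (∫ t in (0 : ℝ)..2, Real.fourierChar (-inner ℝ (line b e t) ξ) •
      (w 1 (line b e t) φ : ℂ)) ∂impactLaw e = 0 := by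
    refine integral_eq_zero_of_ae ?_
    filter_upwards [h.ae_workMoment_eq_zero hd h0 he φ] with b hb
    have h3 : ∀ t, inner ℝ (line b e t) ξ = inner ℝ b ξ := fun t => by
      rw [line, inner_add_left, real_inner_smul_left, heξ, mul_zero, add_zero]
    simp only [h3, Circle.smul_def, smul_eq_mul]
    rw [intervalIntegral.integral_const_mul, intervalIntegral.integral_ofReal]
    simp only [workMoment, pow_zero, one_mul, zero_add] at hb
    rw [hb, Complex.ofReal_zero, mul_zero, Pi.zero_apply]
  rw [h2] at h1
  exact (smul_eq_zero_iff_right (inv_ne_zero ballVol_pos.ne')).1 h1.symm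

/-- Nonnegativity comes from the mean square. If the value were zero, then for `d ≥ 2` every
frequency has an orthogonal direction, so the Fourier transform vanishes and inversion contradicts
`hne`. For `d = 1` only frequency zero is reached, which is the reason for `hd1`. -/
theorem kernel_integral_pos (h : PotentialJet ω w G C) (hd : 1 ≤ d)
    (hne : ∃ y φ, w 1 y φ ≠ 0) (hd1 : d = 1 → ∃ φ, ∫ y, w 1 y φ ≠ 0) :
    0 < ∫ φ, ∫ p : Space d × Space d, ‖p.1 - p.2‖ ^ (1 - (d : ℤ)) * w 1 p.1 φ * w 1 p.2 φ := by
  have : Nonempty (Fin d) := ⟨⟨0, hd⟩⟩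
  have hS := sphereArea_pos hd
  have hB := ballVol_pos (d := d)
  obtain ⟨e, he⟩ : ∃ e : Space d, ‖e‖ = 1 :=
    ⟨EuclideanSpace.single ⟨0, hd⟩ 1, by simp⟩
  have hnonneg : 0 ≤ ∫ φ, ∫ p : Space d × Space d,
      ‖p.1 - p.2‖ ^ (1 - (d : ℤ)) * w 1 p.1 φ * w 1 p.2 φ := by
    have h1 := h.integral_betaHat_one_sq (ν := Measure.dirac 1) hd
      ae_dirac_mem_Icc he
    have h2 : 0 ≤ ∫ κ, betaHat w G 1 e κ ^ 2 ∂scatLaw d m (Measure.dirac 1) e :=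
      integral_nonneg fun κ => sq_nonneg _
    rw [h1, integral_dirac, one_pow] at h2
    exact (mul_nonneg_iff_of_pos_left (by positivity)).1 h2
  refine hnonneg.lt_of_ne fun h0 => ?_
  rcases hd.eq_or_lt with hd' | hd2
  · obtain ⟨φ, hφ⟩ := hd1 hd'.symm
    have h1 := h.integral_w_eq_zero hd h0.symm he (inner_zero_right e) φ
    simp only [inner_zero_right, neg_zero, AddChar.map_zero_eq_one, one_smul] at h1
    exact hφ (Complex.ofReal_eq_zero.1 ((integral_complex_ofReal).symm.trans h1))
  · obtain ⟨y, φ, hy⟩ := hne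
    have hw := h.continuous_w_comp (k := 1) (by norm_num) (continuous_id (X := Space d))
      (continuous_const (y := φ))
    simp only [id] at hw
    have hF : FourierTransform.fourier (fun y => (w 1 y φ : ℂ)) = 0 := by
      ext ξ
      obtain ⟨e', he', hξ⟩ := exists_orthogonal_unit hd2 ξ
      rw [Real.fourier_eq]
      exact h.integral_w_eq_zero hd h0.symm he' hξ φ
    have hint : Integrable fun y => (w 1 y φ : ℂ) := by
      have := (h.integrable_mul_w (k := 1) (by norm_num) (continuous_const (y := (1 : ℝ))) φ).ofReal (𝕜 := ℂ)
      simpa using this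
    have h1 := Continuous.fourierInv_fourier_eq (Complex.continuous_ofReal.comp hw) hint
      (by rw [Function.comp_def, hF]; exact integrable_zero _ _ _)
    rw [Function.comp_def, hF] at h1
    have h2 := congrFun h1 y
    have h3 : FourierTransformInv.fourierInv (0 : Space d → ℂ) y = 0 := by
      rw [Real.fourierInv_eq]; simp
    rw [h3] at h2
    exact hy (by exact_mod_cast h2.symm)

end PotentialJet

end

section

variable {d m : ℕ} {ω : Space m} {w : ℕ → Space d → Torus m → ℝ}
  {G : ℕ → Space d → Torus m → Space d} {C : ℝ} {ν : Measure ℝ}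

/-! ### Measurability of the energy transfer -/

theorem continuous_picardIter_param {X Y : Type*} [NormedAddCommGroup X] [NormedSpace ℝ X]
    [TopologicalSpace Y] [FirstCountableTopology Y] {F : Y → ℝ → X → X} {x₀ : Y → X}
    (hF : Continuous fun q : Y × ℝ × X => F q.1 q.2.1 q.2.2) (hx : Continuous x₀) (n : ℕ) :
    Continuous fun q : Y × ℝ => picardIter (F q.1) (x₀ q.1) n q.2 := by
  induction n with
  | zero => exact hx.comp continuous_fst
  | succ n ih =>
    have h1 : Continuous fun r : (Y × ℝ) × ℝ =>
        F r.1.1 r.2 (picardIter (F r.1.1) (x₀ r.1.1) n r.2) :=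
      hF.comp (f := fun r : (Y × ℝ) × ℝ => (r.1.1, r.2, picardIter (F r.1.1) (x₀ r.1.1) n r.2))
        ((continuous_fst.comp continuous_fst).prodMk (continuous_snd.prodMk
          (ih.comp (f := fun r : (Y × ℝ) × ℝ => (r.1.1, r.2)) (by fun_prop))))
    have h2 : Continuous fun q : Y × ℝ => ∫ s in (0 : ℝ)..q.2,
        F q.1 s (picardIter (F q.1) (x₀ q.1) n s) :=
      intervalIntegral.continuous_parametric_intervalIntegral_of_continuous
        (f := fun (q : Y × ℝ) s => F q.1 s (picardIter (F q.1) (x₀ q.1) n s)) h1 continuous_snd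
    exact (hx.comp continuous_fst).add h2

namespace PotentialJet

theorem tendsto_picardIter_deltaE (h : PotentialJet ω w G C) {s : ℝ} (hs : 0 < s)
    {e : Space d} (he : ‖e‖ = 1) {κ : Params d m} (hb : inner ℝ e κ.1 = 0) (hc : |κ.2.2.2| ≤ 1)
    (hsC : 12 * C ≤ s ^ 2) :
    Tendsto (fun n => s ^ 2 * ((1 / 2 : ℝ) * (‖(picardIter
      (flightField ω (fun y φ => κ.2.2.2 • G 0 y φ) s⁻¹ κ.2.2.1)
      (line (rot κ.2.1⁻¹ κ.1) (rot κ.2.1⁻¹ e) 0, rot κ.2.1⁻¹ e) n 2).2‖ ^ 2 - 1))) atTop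
      (𝓝 (deltaE (fun y φ => -G 0 y φ) ω (s • e) κ)) := by
  have hj := h.smul hc
  rw [one_mul] at hj
  obtain ⟨x, p, hf, -, -, hp⟩ := R_eq_of_flight h hs he hb (hj.G_bound 0 (by norm_num)) hsC
  obtain ⟨x', p', hf', ht⟩ := hj.exists_flight s⁻¹ κ.2.2.1
    (line (rot κ.2.1⁻¹ κ.1) (rot κ.2.1⁻¹ e) 0) (rot κ.2.1⁻¹ e)
  -- The flight behind the chosen trajectory and the limit of the Picard iterates have the same
  -- initial data, so they agree at time `2`.
  have h1 := (hj.flight_unique (a := 0) (fun t _ => hf.hx t) (fun t _ => hf.hp t)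
    (fun t _ => hf'.hx t) (fun t _ => hf'.hp t) (by rw [hf.x_zero, hf'.x_zero])
    (by rw [hf.p_zero, hf'.p_zero]) 2 (by norm_num)).2
  rw [deltaE_eq_of_flight hs he hp, h1]
  have h2 : Tendsto (fun n => (picardIter
      (flightField ω (fun y φ => κ.2.2.2 • G 0 y φ) s⁻¹ κ.2.2.1)
      (line (rot κ.2.1⁻¹ κ.1) (rot κ.2.1⁻¹ e) 0, rot κ.2.1⁻¹ e) n 2).2) atTop (𝓝 (p' 2)) :=
    (continuous_snd.tendsto _).comp (ht 2)
  exact (((h2.norm.pow 2).sub_const 1).const_mul (1 / 2)).const_mul (s ^ 2)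

/-- `deltaE` is defined through a choice of trajectory and has no evident measurability in `κ`. It
is almost surely the limit of expressions in the Picard iterates at time `2`, which are continuous
in `κ`. -/
theorem aestronglyMeasurable_deltaE (h : PotentialJet ω w G C)
    (hν : ∀ᵐ c ∂ν, c ∈ Icc (-1 : ℝ) 1) {s : ℝ} (hs : 0 < s)
    {e : Space d} (he : ‖e‖ = 1) (hsC : 12 * C ≤ s ^ 2) :
    AEStronglyMeasurable (deltaE (fun y φ => -G 0 y φ) ω (s • e)) (scatLaw d m ν e) := by
  have hF : Continuous fun q : Params d m × ℝ × (Space d × Space d) =>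
      flightField ω (fun y φ => q.1.2.2.2 • G 0 y φ) s⁻¹ q.1.2.2.1 q.2.1 q.2.2 := by
    have h1 : Continuous fun q : Params d m × ℝ × (Space d × Space d) =>
        G 0 q.2.2.1 (q.1.2.2.1 + toTorus ((s⁻¹ * q.2.1) • ω)) :=
      h.continuous_G_comp (by norm_num) (by fun_prop)
        (by have := continuous_toTorus (m := m); fun_prop)
    have h2 : Continuous fun q : Params d m × ℝ × (Space d × Space d) => q.1.2.2.2 := by fun_prop
    have h3 : Continuous fun q : Params d m × ℝ × (Space d × Space d) => q.2.2.2 := by fun_prop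
    exact h3.prodMk ((h2.smul h1).const_smul (-(s⁻¹ ^ 2)))
  have hx : Continuous fun κ : Params d m =>
      (line (rot κ.2.1⁻¹ κ.1) (rot κ.2.1⁻¹ e) 0, rot κ.2.1⁻¹ e) := by
    have h1 : Continuous fun κ : Params d m => rot κ.2.1⁻¹ κ.1 :=
      continuous_rot.comp (f := fun κ : Params d m => (κ.2.1⁻¹, κ.1)) (by fun_prop)
    have h2 : Continuous fun κ : Params d m => rot κ.2.1⁻¹ e :=
      continuous_rot.comp (f := fun κ : Params d m => (κ.2.1⁻¹, e)) (by fun_prop)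
    exact (h1.add (h2.const_smul (0 - 1 / 2 : ℝ))).prodMk h2
  have hP := fun n => (continuous_picardIter_param
    (F := fun κ : Params d m => flightField ω (fun y φ => κ.2.2.2 • G 0 y φ) s⁻¹ κ.2.2.1)
    hF hx n).comp (f := fun κ : Params d m => (κ, (2 : ℝ))) (by fun_prop)
  refine aestronglyMeasurable_of_tendsto_ae atTop (f := fun n (κ : Params d m) =>
    s ^ 2 * ((1 / 2 : ℝ) * (‖(picardIter
      (flightField ω (fun y φ => κ.2.2.2 • G 0 y φ) s⁻¹ κ.2.2.1)
      (line (rot κ.2.1⁻¹ κ.1) (rot κ.2.1⁻¹ e) 0, rot κ.2.1⁻¹ e) n 2).2‖ ^ 2 - 1)))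
    (fun n => Continuous.aestronglyMeasurable ?_) ?_
  · exact continuous_const.mul (continuous_const.mul
      (((continuous_snd.comp (hP n)).norm.pow 2).sub continuous_const))
  · filter_upwards [ae_scatLaw_mem hν] with κ hκ
    exact h.tendsto_picardIter_deltaE hs he hκ.1 hκ.2 hsC

/-! ### The constants `D²` and `B` -/

variable {W : Space d → Torus m → ℝ}

theorem Dsq_eq (hw : w 1 = dtau ω W) : Dsq ω W ν =
    2 / sphereArea d * ((∫ c, c ^ 2 ∂ν) / ballVol d) *
      ∫ φ, ∫ p : Space d × Space d, ‖p.1 - p.2‖ ^ (1 - (d : ℤ)) * w 1 p.1 φ * w 1 p.2 φ := by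
  rw [Dsq, hw]

variable [IsProbabilityMeasure ν]

theorem _root_.SoftLorentz.integral_sq_pos (hν : ∀ᵐ c ∂ν, c ∈ Icc (-1 : ℝ) 1)
    (hν0 : ν ≠ Measure.dirac 0) : 0 < ∫ c, c ^ 2 ∂ν := by
  refine (integral_nonneg fun c => sq_nonneg c).lt_of_ne' fun h0 => hν0 ?_
  have h1 := (integral_eq_zero_iff_of_nonneg (fun c => sq_nonneg c)
    (integrable_pow_of_mem_Icc hν 2)).1 h0
  have h2 : ∀ᵐ c ∂ν, c = 0 := by
    filter_upwards [h1] with c hc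
    exact pow_eq_zero_iff two_ne_zero |>.1 hc
  -- A law under which the identity is almost surely zero is the Dirac mass at zero.
  have h3 : ν.map id = ν.map fun _ => (0 : ℝ) := Measure.map_congr h2
  simpa using h3

theorem Dsq_pos (h : PotentialJet ω w G C) (hw : w 1 = dtau ω W) (hd : 1 ≤ d)
    (hν : ∀ᵐ c ∂ν, c ∈ Icc (-1 : ℝ) 1) (hν0 : ν ≠ Measure.dirac 0)
    (hne : ∃ y φ, dtau ω W y φ ≠ 0) (hd1 : d = 1 → ∃ φ, ∫ y, dtau ω W y φ ≠ 0) :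
    0 < Dsq ω W ν := by
  rw [Dsq_eq hw]
  have h1 := h.kernel_integral_pos hd (by rwa [hw]) (by rwa [hw])
  have hS := sphereArea_pos hd
  have hB := ballVol_pos (d := d)
  have h2 := integral_sq_pos hν hν0
  positivity

theorem integral_betaHat_one_sq_eq (h : PotentialJet ω w G C) (hw : w 1 = dtau ω W) (hd : 1 ≤ d)
    (hν : ∀ᵐ c ∂ν, c ∈ Icc (-1 : ℝ) 1) {e : Space d} (he : ‖e‖ = 1) :
    ∫ κ, betaHat w G 1 e κ ^ 2 ∂scatLaw d m ν e = Dsq ω W ν := by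
  rw [h.integral_betaHat_one_sq hd hν he, Dsq_eq hw]

theorem integral_betaHat_four_eq (h : PotentialJet ω w G C) (hw : w 1 = dtau ω W) (hd : 1 ≤ d)
    (hν : ∀ᵐ c ∂ν, c ∈ Icc (-1 : ℝ) 1) {e : Space d} (he : ‖e‖ = 1) :
    ∫ κ, betaHat w G 4 e κ ∂scatLaw d m ν e = B ω W ν := by
  rw [h.integral_betaHat_four hd hν he, B, Dsq_eq hw]
  simp only [h.integral_kernel_inner_G hd (k := 1) (by norm_num), integral_const_mul]
  simp only [← mul_assoc]
  have hS := (sphereArea_pos hd).ne'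
  have hB := (ballVol_pos (d := d)).ne'
  field_simp

/-! ### Averages of the energy transfer -/

theorem continuous_lineWork (h : PotentialJet ω w G C) (ε : ℝ) :
    Continuous fun q : Space d × Space d × Torus m => lineWork ω w ε q.1 q.2.1 q.2.2 := by
  refine intervalIntegral.continuous_parametric_intervalIntegral_of_continuous'
    (f := fun (q : Space d × Space d × Torus m) t =>
      w 1 (line q.1 q.2.1 t) (q.2.2 + toTorus ((ε * t) • ω))) ?_ 0 2
  exact h.continuous_w_comp (by norm_num)
    (continuous_line_uncurry.comp (f := fun q : (Space d × Space d × Torus m) × ℝ => q) (by fun_prop))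
    (by have := continuous_toTorus (m := m); fun_prop)

theorem abs_lineWork_le (h : PotentialJet ω w G C) (ε : ℝ) (b e : Space d) (φ : Torus m) :
    |lineWork ω w ε b e φ| ≤ 2 * C :=
  norm_intervalIntegral_le (F := ℝ) fun _ _ => h.w_bound 1 (by norm_num) _ _

theorem integral_work₃_frame (h : PotentialJet ω w G C) (hν : ∀ᵐ c ∂ν, c ∈ Icc (-1 : ℝ) 1)
    (e : Space d) :
    ∫ κ : Params d m, κ.2.2.2 ^ 2 * work₃ G (rot κ.2.1⁻¹ κ.1) (rot κ.2.1⁻¹ e) κ.2.2.1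
      ∂scatLaw d m ν e = ∫ κ, betaHat w G 4 e κ ∂scatLaw d m ν e :=
  (h.integral_betaHat_add hν (k := 3) (by norm_num) 6 h.continuous_work₃ h.abs_work₃_le e).symm

/-- First moment: up to `O(s⁻⁵)` the energy transfer is `s⁻¹ L + s⁻³ T₂ + s⁻⁴ T₃`, with means `0`,
`0` and `B`. Second moment: it is `s⁻¹ β^(1) + O(s⁻²)`, and the difference of squares factors into
`O(s⁻²) · O(s⁻¹)`. -/
theorem exists_deltaE_bounds (h : PotentialJet ω w G C) (hw : w 1 = dtau ω W) (hd : 1 ≤ d)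
    (hν : ∀ᵐ c ∂ν, c ∈ Icc (-1 : ℝ) 1) :
    ∃ K, ∀ s, 1 ≤ s → 12 * C ≤ s ^ 2 → ∀ e : Space d, ‖e‖ = 1 →
      Integrable (deltaE (fun y φ => -G 0 y φ) ω (s • e)) (scatLaw d m ν e) ∧
      Integrable (fun κ => deltaE (fun y φ => -G 0 y φ) ω (s • e) κ ^ 2) (scatLaw d m ν e) ∧
      |∫ κ, deltaE (fun y φ => -G 0 y φ) ω (s • e) κ ∂scatLaw d m ν e - B ω W ν / s ^ 4| ≤
        K / s ^ 5 ∧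
      |∫ κ, deltaE (fun y φ => -G 0 y φ) ω (s • e) κ ^ 2 ∂scatLaw d m ν e - Dsq ω W ν / s ^ 2| ≤
        K / s ^ 3 := by
  have hC := h.nonneg
  set K₀ := 2 * workConst C with hK₀
  set K₁ := 4 * C + 2 * (C * (8 * C)) + 2 * (3 * (C * (8 * C))) + K₀ with hK₁
  have hK₀0 : 0 ≤ K₀ := by
    rw [hK₀, workConst]; positivity
  -- `K₀` serves the first moment. For the second, `K₁` bounds `s² |E - s⁻¹ b₁|` and `K₁ + 32 C`
  -- bounds `s |E + s⁻¹ b₁|`, with `|b₁| ≤ 16 C`.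
  refine ⟨max K₀ (K₁ * (K₁ + 32 * C)), fun s hs hsC e he => ?_⟩
  have hs0 : 0 < s := one_pos.trans_le hs
  set μ := scatLaw d m ν e
  set E := deltaE (fun y φ => -G 0 y φ) ω (s • e) with hE
  let L : Params d m → ℝ := fun κ =>
    κ.2.2.2 * lineWork ω w s⁻¹ (rot κ.2.1⁻¹ κ.1) (rot κ.2.1⁻¹ e) κ.2.2.1
  let T₂ : Params d m → ℝ := fun κ =>
    κ.2.2.2 ^ 2 * work₂ G (rot κ.2.1⁻¹ κ.1) (rot κ.2.1⁻¹ e) κ.2.2.1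
  let T₃ : Params d m → ℝ := fun κ =>
    κ.2.2.2 ^ 2 * work₃ G (rot κ.2.1⁻¹ κ.1) (rot κ.2.1⁻¹ e) κ.2.2.1
  have hν1 : Integrable (fun c => c) ν := by simpa using integrable_pow_of_mem_Icc hν 1
  have hν2 := integrable_pow_of_mem_Icc hν 2
  have hLi : Integrable L μ := integrable_frame (ρ := fun c => c) (h.continuous_lineWork s⁻¹)
    (h.abs_lineWork_le s⁻¹) hν1 e e
  have hT₂i : Integrable T₂ μ := integrable_frame h.continuous_work₂ h.abs_work₂_le hν2 e e
  have hT₃i : Integrable T₃ μ := integrable_frame h.continuous_work₃ h.abs_work₃_le hν2 e e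
  have hL0 : ∫ κ, L κ ∂μ = 0 := integral_frame_eq_zero (ρ := fun c => c)
    (h.continuous_lineWork s⁻¹) (h.abs_lineWork_le s⁻¹) hν1 (h.integral_lineWork s⁻¹) e e
  have hT₂0 : ∫ κ, T₂ κ ∂μ = 0 := h.integral_work₂_frame hd hν he
  have hT₃0 : ∫ κ, T₃ κ ∂μ = B ω W ν :=
    (h.integral_work₃_frame hν e).trans (h.integral_betaHat_four_eq hw hd hν he)
  have hrem : ∀ᵐ κ ∂μ, |E κ - s⁻¹ * L κ - (s ^ 3)⁻¹ * T₂ κ - (s ^ 4)⁻¹ * T₃ κ| ≤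
      K₀ * (s ^ 5)⁻¹ := by
    filter_upwards [ae_scatLaw_mem hν] with κ hκ
    have := h.abs_deltaE_sub_le hs he hκ.1 hκ.2 (by rwa [one_mul])
    rwa [one_mul] at this
  have hEm : AEStronglyMeasurable E μ := h.aestronglyMeasurable_deltaE hν hs0 he hsC
  have hSi : Integrable (fun κ => s⁻¹ * L κ + (s ^ 3)⁻¹ * T₂ κ + (s ^ 4)⁻¹ * T₃ κ) μ :=
    ((hLi.const_mul _).add (hT₂i.const_mul _)).add (hT₃i.const_mul _)
  have hDi : Integrable (fun κ => E κ - (s⁻¹ * L κ + (s ^ 3)⁻¹ * T₂ κ + (s ^ 4)⁻¹ * T₃ κ)) μ :=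
    Integrable.of_bound (hEm.sub hSi.aestronglyMeasurable) (K₀ * (s ^ 5)⁻¹) (by
      filter_upwards [hrem] with κ hκ
      rw [Real.norm_eq_abs]
      convert hκ using 2
      ring)
  have hEi : Integrable E μ := by
    have := hDi.add hSi
    refine this.congr (Eventually.of_forall fun κ => ?_)
    simp
  have hint : ∫ κ, (s⁻¹ * L κ + (s ^ 3)⁻¹ * T₂ κ + (s ^ 4)⁻¹ * T₃ κ) ∂μ = B ω W ν / s ^ 4 := by
    rw [integral_add (f := fun κ => s⁻¹ * L κ + (s ^ 3)⁻¹ * T₂ κ)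
      ((hLi.const_mul _).add (hT₂i.const_mul _)) (hT₃i.const_mul _),
      integral_add (hLi.const_mul _) (hT₂i.const_mul _), integral_const_mul,
      integral_const_mul, integral_const_mul, hL0, hT₂0, hT₃0]
    ring
  set b₁ := betaHat w G 1 e with hb₁
  have hb₁le : ∀ᵐ κ ∂μ, |b₁ κ| ≤ 16 * C := by
    filter_upwards [ae_scatLaw_mem hν] with κ hκ
    rw [hb₁]
    simp only [betaHat, betaRed]
    rw [abs_mul]
    exact (mul_le_mul hκ.2 (h.abs_workMoment_le (by norm_num) _ _ _) (abs_nonneg _)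
      zero_le_one).trans_eq (one_mul _)
  have hr1 : s⁻¹ ≤ 1 := inv_le_one_of_one_le₀ hs
  have hr0 : 0 ≤ s⁻¹ := inv_nonneg.2 hs0.le
  have hclose : ∀ᵐ κ ∂μ, |E κ - s⁻¹ * b₁ κ| ≤ K₁ * s⁻¹ ^ 2 := by
    filter_upwards [hrem, ae_scatLaw_mem hν] with κ hκ hκ'
    have hc2 : κ.2.2.2 ^ 2 ≤ 1 := (sq_le_one_iff_abs_le_one _).2 hκ'.2
    have h1 : |L κ - b₁ κ| ≤ 4 * C * s⁻¹ := by
      simp only [L, hb₁, betaHat, betaRed, ← mul_sub, abs_mul]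
      exact (mul_le_mul hκ'.2 (h.abs_work_line_sub_le _ _ _ hr0) (abs_nonneg _)
        zero_le_one).trans_eq (one_mul _)
    have h2 : |T₂ κ| ≤ 2 * (C * (8 * C)) := by
      simp only [T₂, abs_mul, abs_pow, sq_abs]
      exact (mul_le_mul hc2 (h.abs_work₂_le _ _ _) (abs_nonneg _) zero_le_one).trans_eq (one_mul _)
    have h3 : |T₃ κ| ≤ 2 * (3 * (C * (8 * C))) := by
      simp only [T₃, abs_mul, abs_pow, sq_abs]
      exact (mul_le_mul hc2 (h.abs_work₃_le _ _ _) (abs_nonneg _) zero_le_one).trans_eq (one_mul _)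
    simp only [← inv_pow] at hκ
    have hp : ∀ n, 2 ≤ n → s⁻¹ ^ n ≤ s⁻¹ ^ 2 := fun n hn => pow_le_pow_of_le_one hr0 hr1 hn
    calc |E κ - s⁻¹ * b₁ κ|
        = |(E κ - s⁻¹ * L κ - s⁻¹ ^ 3 * T₂ κ - s⁻¹ ^ 4 * T₃ κ) + s⁻¹ * (L κ - b₁ κ) +
            s⁻¹ ^ 3 * T₂ κ + s⁻¹ ^ 4 * T₃ κ| := by congr 1; ring
      _ ≤ K₀ * s⁻¹ ^ 5 + s⁻¹ * (4 * C * s⁻¹) + s⁻¹ ^ 3 * (2 * (C * (8 * C))) +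
            s⁻¹ ^ 4 * (2 * (3 * (C * (8 * C)))) := by
          refine (abs_add_le _ _).trans (add_le_add ((abs_add_le _ _).trans (add_le_add
            ((abs_add_le _ _).trans (add_le_add hκ ?_)) ?_)) ?_) <;>
          · rw [abs_mul, abs_of_nonneg (by positivity)]
            gcongr
      _ ≤ K₀ * s⁻¹ ^ 2 + 4 * C * s⁻¹ ^ 2 + s⁻¹ ^ 2 * (2 * (C * (8 * C))) +
            s⁻¹ ^ 2 * (2 * (3 * (C * (8 * C)))) := by
          have := hp 5 (by norm_num)
          have := hp 3 (by norm_num)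
          have := hp 4 (by norm_num)
          have e1 : s⁻¹ * (4 * C * s⁻¹) = 4 * C * s⁻¹ ^ 2 := by ring
          rw [e1]
          gcongr
      _ = K₁ * s⁻¹ ^ 2 := by rw [hK₁]; ring
  have hK₁0 : 0 ≤ K₁ := by positivity
  have hEb : ∀ᵐ κ ∂μ, |E κ| ≤ K₁ + 16 * C := by
    filter_upwards [hclose, hb₁le] with κ hκ hb
    have h1 : s⁻¹ ^ 2 ≤ 1 := pow_le_one₀ hr0 hr1
    have h2 : |s⁻¹ * b₁ κ| ≤ 1 * (16 * C) := by
      rw [abs_mul, abs_of_nonneg hr0]; gcongr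
    calc |E κ| = |(E κ - s⁻¹ * b₁ κ) + s⁻¹ * b₁ κ| := by congr 1; ring
      _ ≤ K₁ * s⁻¹ ^ 2 + 1 * (16 * C) := (abs_add_le _ _).trans (add_le_add hκ h2)
      _ ≤ K₁ * 1 + 1 * (16 * C) := by gcongr
      _ = _ := by ring
  have hE2i : Integrable (fun κ => E κ ^ 2) μ := Integrable.of_bound (hEm.pow 2)
    ((K₁ + 16 * C) ^ 2) (by
      filter_upwards [hEb] with κ hκ
      rw [norm_pow]
      exact pow_le_pow_left₀ (norm_nonneg _) hκ 2)
  have hb2i : Integrable (fun κ => b₁ κ ^ 2) μ := Integrable.of_bound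
    ((h.integrable_betaHat hν 1 e e).aestronglyMeasurable.pow 2) ((16 * C) ^ 2) (by
      filter_upwards [hb₁le] with κ hκ
      rw [norm_pow]
      exact pow_le_pow_left₀ (norm_nonneg _) hκ 2)
  refine ⟨hEi, hE2i, ?_, ?_⟩
  · rw [← hint, ← integral_sub hEi hSi]
    rw [← Real.norm_eq_abs]
    refine (norm_integral_le_of_norm_le_const (C := K₀ * (s ^ 5)⁻¹) ?_).trans ?_
    · filter_upwards [hrem] with κ hκ
      rw [Real.norm_eq_abs]
      convert hκ using 2
      ring
    · rw [probReal_univ, mul_one, div_eq_mul_inv]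
      gcongr
      exact le_max_left _ _
  · have h2 : Dsq ω W ν / s ^ 2 = ∫ κ, (s⁻¹ * b₁ κ) ^ 2 ∂μ := by
      simp only [mul_pow]
      rw [integral_const_mul, h.integral_betaHat_one_sq_eq hw hd hν he]
      ring
    rw [h2, ← integral_sub hE2i (by simp only [mul_pow]; exact hb2i.const_mul _)]
    rw [← Real.norm_eq_abs]
    refine (norm_integral_le_of_norm_le_const (C := K₁ * (K₁ + 32 * C) * s⁻¹ ^ 3) ?_).trans ?_
    · filter_upwards [hclose, hb₁le] with κ hκ hb
      have h3 : |s⁻¹ * b₁ κ| ≤ s⁻¹ * (16 * C) := by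
        rw [abs_mul, abs_of_nonneg hr0]; gcongr
      have h4 : |E κ + s⁻¹ * b₁ κ| ≤ (K₁ + 32 * C) * s⁻¹ := by
        calc |E κ + s⁻¹ * b₁ κ| = |(E κ - s⁻¹ * b₁ κ) + (s⁻¹ * b₁ κ + s⁻¹ * b₁ κ)| := by
              congr 1; ring
          _ ≤ K₁ * s⁻¹ ^ 2 + (s⁻¹ * (16 * C) + s⁻¹ * (16 * C)) :=
              (abs_add_le _ _).trans (add_le_add hκ ((abs_add_le _ _).trans (add_le_add h3 h3)))
          _ ≤ K₁ * s⁻¹ ^ 1 + (s⁻¹ * (16 * C) + s⁻¹ * (16 * C)) := by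
              have : s⁻¹ ^ 2 ≤ s⁻¹ ^ 1 := pow_le_pow_of_le_one hr0 hr1 (by norm_num)
              gcongr
          _ = _ := by ring
      rw [sq_sub_sq, norm_mul, Real.norm_eq_abs, Real.norm_eq_abs]
      calc _ ≤ (K₁ + 32 * C) * s⁻¹ * (K₁ * s⁻¹ ^ 2) := by gcongr
        _ = _ := by ring
    · rw [probReal_univ, mul_one, div_eq_mul_inv, ← inv_pow]
      gcongr
      exact le_max_right _ _

end PotentialJet

end

section

variable {d m : ℕ} {ω : Space m} {w : ℕ → Space d → Torus m → ℝ}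
  {G : ℕ → Space d → Torus m → Space d} {C : ℝ} {ν : Measure ℝ}

/-! ### The random walk -/

theorem measurable_scatLaw [IsProbabilityMeasure ν] : Measurable (scatLaw d m ν) := by
  let k : Kernel (Space d) (Space d) := ⟨impactLaw, measurable_impactLaw⟩
  have : IsMarkovKernel k := ⟨fun v => inferInstanceAs (IsProbabilityMeasure (impactLaw v))⟩
  have h1 : ∀ v, (k ×ₖ Kernel.const (Space d) ((haarSO d).prod
      ((volume : Measure (Torus m)).prod ν))) v = scatLaw d m ν v := fun v => by
    rw [Kernel.prod_apply, Kernel.const_apply]; rfl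
  have h2 := (k ×ₖ Kernel.const (Space d) ((haarSO d).prod
      ((volume : Measure (Torus m)).prod ν))).measurable
  exact (funext h1 : _ = scatLaw d m ν) ▸ h2

/-- The law of a scattering event as a kernel from the incoming velocity, with an additional
variable on which it does not depend. -/
noncomputable def scatKernel (d m : ℕ) (ν : Measure ℝ) [IsProbabilityMeasure ν] :
    Kernel (ℝ × Space d) (Params d m) :=
  ⟨fun q => scatLaw d m ν q.2, measurable_scatLaw.comp measurable_snd⟩

instance [IsProbabilityMeasure ν] : IsMarkovKernel (scatKernel d m ν) :=
  ⟨fun q => inferInstanceAs (IsProbabilityMeasure (scatLaw d m ν q.2))⟩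

namespace IsRandomWalk

variable [IsProbabilityMeasure ν] {Ω : Type*} {mΩ : MeasurableSpace Ω} {P : Measure Ω}
  [IsProbabilityMeasure P] {ℱ : Filtration ℕ mΩ} {v : ℕ → Ω → Space d} {κ : ℕ → Ω → Params d m}
  {g : Space d → Torus m → Space d}

/-- The defining property of the walk, tested on rectangles. The extra variable `Z` stands for any
real function of the past; it makes the conditional law usable for products with earlier quantities.
-/
theorem map_eq_compProd (hr : IsRandomWalk g ω ν P ℱ v κ) (n : ℕ) {Z : Ω → ℝ}
    (hZ : Measurable[ℱ n] Z) :
    P.map (fun x => ((Z x, v n x), κ n x)) =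
      (P.map fun x => (Z x, v n x)) ⊗ₘ scatKernel d m ν := by
  have hT : Measurable[ℱ n] fun x => (Z x, v n x) := hZ.prodMk (hr.measurable_velocity n)
  have hT' : Measurable fun x => (Z x, v n x) := hT.mono (ℱ.le n) le_rfl
  have hκ : Measurable (κ n) := (hr.measurable_params n).mono (ℱ.le _) le_rfl
  have := Measure.isProbabilityMeasure_map (μ := P) (hT'.prodMk hκ).aemeasurable
  have := Measure.isProbabilityMeasure_map (μ := P) hT'.aemeasurable
  refine Measure.ext_prod fun {s t} hs ht => ?_
  rw [Measure.map_apply (hT'.prodMk hκ) (hs.prod ht), Measure.compProd_apply_prod hs ht,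
    setLIntegral_map hs ((scatKernel d m ν).measurable_coe ht) hT']
  exact hr.law n _ (hT hs) t ht

theorem integral_eq (hr : IsRandomWalk g ω ν P ℱ v κ) (n : ℕ) {Z : Ω → ℝ}
    (hZ : Measurable[ℱ n] Z) {F : (ℝ × Space d) × Params d m → ℝ} (hF : Measurable F)
    (hFi : Integrable (fun x => F ((Z x, v n x), κ n x)) P) :
    ∫ x, F ((Z x, v n x), κ n x) ∂P =
      ∫ x, (∫ k, F ((Z x, v n x), k) ∂scatLaw d m ν (v n x)) ∂P := by
  have hT : Measurable fun x => (Z x, v n x) :=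
    Measurable.mono (hZ.prodMk (hr.measurable_velocity n)) (ℱ.le n) le_rfl
  have hκ : Measurable (κ n) := (hr.measurable_params n).mono (ℱ.le _) le_rfl
  have h1 : ∫ q, F q ∂P.map (fun x => ((Z x, v n x), κ n x)) =
      ∫ x, F ((Z x, v n x), κ n x) ∂P :=
    integral_map (hT.prodMk hκ).aemeasurable hF.aestronglyMeasurable
  have h2 : Integrable F (P.map (fun x => ((Z x, v n x), κ n x))) :=
    (integrable_map_measure hF.aestronglyMeasurable (hT.prodMk hκ).aemeasurable).2 hFi
  rw [hr.map_eq_compProd n hZ] at h1 h2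
  rw [← h1, Measure.integral_compProd h2, integral_map hT.aemeasurable]
  · rfl
  · exact (hF.stronglyMeasurable.integral_kernel_prod_right'
      (κ := scatKernel d m ν)).aestronglyMeasurable

theorem ae_mem (hr : IsRandomWalk g ω ν P ℱ v κ) (hν : ∀ᵐ c ∂ν, c ∈ Icc (-1 : ℝ) 1) (n : ℕ) :
    ∀ᵐ x ∂P, inner ℝ (v n x) (κ n x).1 = 0 ∧ |(κ n x).2.2.2| ≤ 1 := by
  have hT : Measurable fun x => ((0 : ℝ), v n x) :=
    measurable_const.prodMk ((hr.measurable_velocity n).mono (ℱ.le n) le_rfl)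
  have hκ : Measurable (κ n) := (hr.measurable_params n).mono (ℱ.le _) le_rfl
  have hs : MeasurableSet {q : (ℝ × Space d) × Params d m |
      inner ℝ q.1.2 q.2.1 = 0 ∧ |q.2.2.2.2| ≤ 1} :=
    ((isClosed_eq (f := fun q : (ℝ × Space d) × Params d m => inner ℝ q.1.2 q.2.1)
      (by fun_prop) continuous_const).inter
      (isClosed_le (f := fun q : (ℝ × Space d) × Params d m => |q.2.2.2.2|)
        (by fun_prop) continuous_const)).measurableSet
  refine ae_of_ae_map (f := fun x => (((0 : ℝ), v n x), κ n x)) (hT.prodMk hκ).aemeasurable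
    (p := fun q => inner ℝ q.1.2 q.2.1 = 0 ∧ |q.2.2.2.2| ≤ 1) ?_
  rw [hr.map_eq_compProd n measurable_const, Measure.ae_compProd_iff hs]
  exact Eventually.of_forall fun q => ae_scatLaw_mem hν

end IsRandomWalk

/-- The value at step `n` of the explicit expansion coefficient. -/
noncomputable def betaStep (w : ℕ → Space d → Torus m → ℝ) (G : ℕ → Space d → Torus m → Space d)
    {Ω : Type*} (v : ℕ → Ω → Space d) (κ : ℕ → Ω → Params d m) (l n : ℕ) (x : Ω) : ℝ :=
  betaHat w G l (‖v n x‖⁻¹ • v n x) (κ n x)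

theorem scatLaw_direction (ν : Measure ℝ) {v : Space d} (hv : v ≠ 0) :
    scatLaw d m ν v = scatLaw d m ν (‖v‖⁻¹ • v) :=
  (scatLaw_smul ν (inv_ne_zero (norm_ne_zero_iff.2 hv)) v).symm

theorem norm_direction {v : Space d} (hv : v ≠ 0) : ‖‖v‖⁻¹ • v‖ = 1 :=
  norm_smul_inv_norm (𝕜 := ℝ) hv

namespace PotentialJet

section

variable {Ω : Type*} {mΩ : MeasurableSpace Ω} {P : Measure Ω}
  {ℱ : Filtration ℕ mΩ} {v : ℕ → Ω → Space d} {κ : ℕ → Ω → Params d m}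

theorem measurable_betaHat_direction (h : PotentialJet ω w G C) (l : ℕ) :
    Measurable fun q : Space d × Params d m => betaHat w G l (‖q.1‖⁻¹ • q.1) q.2 :=
  (h.continuous_betaHat l).measurable.comp
    (((measurable_fst.norm.inv).smul measurable_fst).prodMk measurable_snd)

theorem measurable_betaHat_direction' (h : PotentialJet ω w G C) (l : ℕ) :
    Measurable fun q : (ℝ × Space d) × Params d m => betaHat w G l (‖q.1.2‖⁻¹ • q.1.2) q.2 :=
  (h.measurable_betaHat_direction l).comp (f := fun q : (ℝ × Space d) × Params d m => (q.1.2, q.2))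
    ((measurable_snd.comp measurable_fst).prodMk measurable_snd)

theorem measurable_betaStep (h : PotentialJet ω w G C)
    (hr : IsRandomWalk (fun y φ => -G 0 y φ) ω ν P ℱ v κ) (l n : ℕ) :
    Measurable[ℱ (n + 1)] (betaStep w G v κ l n) :=
  (h.measurable_betaHat_direction l).comp (f := fun x => (v n x, κ n x))
    (((hr.measurable_velocity n).mono (ℱ.mono n.le_succ) le_rfl).prodMk (hr.measurable_params n))

variable [IsProbabilityMeasure ν] [IsProbabilityMeasure P]

theorem betaWalk_ae_eq (h : PotentialJet ω w G C) (hν : ∀ᵐ c ∂ν, c ∈ Icc (-1 : ℝ) 1)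
    (hr : IsRandomWalk (fun y φ => -G 0 y φ) ω ν P ℱ v κ) {n : ℕ} (hv : ∀ᵐ x ∂P, v n x ≠ 0)
    {l : ℕ} (hl : l ≤ 4) :
    betaWalk (fun y φ => -G 0 y φ) ω v κ l n =ᵐ[P] betaStep w G v κ l n := by
  filter_upwards [hv, hr.ae_mem hν n] with x hx hκ
  exact h.beta_eq (norm_direction hx) (by rw [real_inner_smul_left, hκ.1, mul_zero]) hl

theorem exists_betaStep_bound (h : PotentialJet ω w G C) (hν : ∀ᵐ c ∂ν, c ∈ Icc (-1 : ℝ) 1)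
    (hr : IsRandomWalk (fun y φ => -G 0 y φ) ω ν P ℱ v κ) :
    ∃ K, ∀ l n, ∀ᵐ x ∂P, ‖betaStep w G v κ l n x‖ ≤ K := by
  obtain ⟨K, -, hK⟩ := h.exists_betaRed_bound
  refine ⟨K, fun l n => ?_⟩
  filter_upwards [hr.ae_mem hν n] with x hx
  exact hK l _ _ _ _ hx.2

theorem integrable_betaStep (h : PotentialJet ω w G C) (hν : ∀ᵐ c ∂ν, c ∈ Icc (-1 : ℝ) 1)
    (hr : IsRandomWalk (fun y φ => -G 0 y φ) ω ν P ℱ v κ) (l n : ℕ) :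
    Integrable (betaStep w G v κ l n) P := by
  obtain ⟨K, hK⟩ := h.exists_betaStep_bound hν hr
  exact Integrable.of_bound ((h.measurable_betaStep hr l n).mono (ℱ.le _)
    le_rfl).aestronglyMeasurable K (hK l n)

theorem integrable_mul_betaStep (h : PotentialJet ω w G C) (hν : ∀ᵐ c ∂ν, c ∈ Icc (-1 : ℝ) 1)
    (hr : IsRandomWalk (fun y φ => -G 0 y φ) ω ν P ℱ v κ) {Z : Ω → ℝ} (hZ : Integrable Z P)
    (l n : ℕ) : Integrable (fun x => Z x * betaStep w G v κ l n x) P := by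
  obtain ⟨K, hK⟩ := h.exists_betaStep_bound hν hr
  exact hZ.mul_bdd (h.integrable_betaStep hν hr l n).aestronglyMeasurable (hK l n)

/-- Given the past, the mean of the coefficient is the mean under the law at `v n`, and this is `a`
whatever the direction. The correlation therefore factors. -/
theorem integral_mul_betaStep (h : PotentialJet ω w G C) (hν : ∀ᵐ c ∂ν, c ∈ Icc (-1 : ℝ) 1)
    (hr : IsRandomWalk (fun y φ => -G 0 y φ) ω ν P ℱ v κ) {n : ℕ} (hv : ∀ᵐ x ∂P, v n x ≠ 0)
    {l : ℕ} {a : ℝ} (ha : ∀ e : Space d, ‖e‖ = 1 → ∫ k, betaHat w G l e k ∂scatLaw d m ν e = a)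
    {Z : Ω → ℝ} (hZ : Measurable[ℱ n] Z) (hZi : Integrable Z P) :
    ∫ x, Z x * betaStep w G v κ l n x ∂P = (∫ x, Z x ∂P) * a := by
  have hF : Measurable fun q : (ℝ × Space d) × Params d m =>
      q.1.1 * betaHat w G l (‖q.1.2‖⁻¹ • q.1.2) q.2 :=
    (measurable_fst.comp measurable_fst).mul (h.measurable_betaHat_direction' l)
  have h1 := hr.integral_eq n hZ hF
    (h.integrable_mul_betaStep hν hr hZi l n)
  refine h1.trans ?_
  rw [← integral_mul_const]
  refine integral_congr_ae ?_
  filter_upwards [hv] with x hx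
  rw [integral_const_mul, scatLaw_direction ν hx, ha _ (norm_direction hx)]

theorem integral_betaStep (h : PotentialJet ω w G C) (hν : ∀ᵐ c ∂ν, c ∈ Icc (-1 : ℝ) 1)
    (hr : IsRandomWalk (fun y φ => -G 0 y φ) ω ν P ℱ v κ) {n : ℕ} (hv : ∀ᵐ x ∂P, v n x ≠ 0)
    {l : ℕ} {a : ℝ} (ha : ∀ e : Space d, ‖e‖ = 1 → ∫ k, betaHat w G l e k ∂scatLaw d m ν e = a) :
    ∫ x, betaStep w G v κ l n x ∂P = a := by
  simpa using h.integral_mul_betaStep hν hr hv ha (Z := fun _ => 1) measurable_const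
    (integrable_const _)

theorem integral_betaStep_mul_of_lt (h : PotentialJet ω w G C)
    (hν : ∀ᵐ c ∂ν, c ∈ Icc (-1 : ℝ) 1)
    (hr : IsRandomWalk (fun y φ => -G 0 y φ) ω ν P ℱ v κ) {n n' : ℕ} (hn : n < n')
    (hv : ∀ᵐ x ∂P, v n' x ≠ 0) {l' : ℕ} (l : ℕ) (a : ℝ) {a' : ℝ}
    (ha' : ∀ e : Space d, ‖e‖ = 1 → ∫ k, betaHat w G l' e k ∂scatLaw d m ν e = a') :
    ∫ x, (betaStep w G v κ l n x - a) * (betaStep w G v κ l' n' x - a') ∂P = 0 := by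
  have hZi : Integrable (fun x => betaStep w G v κ l n x - a) P :=
    (h.integrable_betaStep hν hr l n).sub (integrable_const a)
  have hZ : Measurable[ℱ n'] fun x => betaStep w G v κ l n x - a :=
    ((h.measurable_betaStep hr l n).mono (ℱ.mono hn) le_rfl).sub measurable_const
  have h1 := h.integral_mul_betaStep hν hr hv ha' hZ hZi
  simp only [mul_sub (betaStep w G v κ l n _ - a)]
  rw [integral_sub (h.integrable_mul_betaStep hν hr hZi l' n') (hZi.mul_const a'), h1,
    integral_mul_const, sub_self]

theorem integral_betaStep_mul_of_ne (h : PotentialJet ω w G C)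
    (hν : ∀ᵐ c ∂ν, c ∈ Icc (-1 : ℝ) 1)
    (hr : IsRandomWalk (fun y φ => -G 0 y φ) ω ν P ℱ v κ) {n n' : ℕ} (hn : n ≠ n')
    (hv : ∀ᵐ x ∂P, v n x ≠ 0) (hv' : ∀ᵐ x ∂P, v n' x ≠ 0) {l l' : ℕ} {a a' : ℝ}
    (ha : ∀ e : Space d, ‖e‖ = 1 → ∫ k, betaHat w G l e k ∂scatLaw d m ν e = a)
    (ha' : ∀ e : Space d, ‖e‖ = 1 → ∫ k, betaHat w G l' e k ∂scatLaw d m ν e = a') :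
    ∫ x, (betaStep w G v κ l n x - a) * (betaStep w G v κ l' n' x - a') ∂P = 0 := by
  rcases hn.lt_or_gt with hn | hn
  · exact h.integral_betaStep_mul_of_lt hν hr hn hv' l a ha'
  · simp only [mul_comm (betaStep w G v κ l n _ - a)]
    exact h.integral_betaStep_mul_of_lt hν hr hn hv l' a' ha

/-! ### Second moments -/

theorem integral_betaStep_mul_self (h : PotentialJet ω w G C)
    (hν : ∀ᵐ c ∂ν, c ∈ Icc (-1 : ℝ) 1)
    (hr : IsRandomWalk (fun y φ => -G 0 y φ) ω ν P ℱ v κ) {n : ℕ} (hv : ∀ᵐ x ∂P, v n x ≠ 0)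
    (l l' : ℕ) :
    ∫ x, betaStep w G v κ l n x * betaStep w G v κ l' n x ∂P =
      ∫ x, (∫ k, betaHat w G l (‖v n x‖⁻¹ • v n x) k * betaHat w G l' (‖v n x‖⁻¹ • v n x) k
        ∂scatLaw d m ν (‖v n x‖⁻¹ • v n x)) ∂P := by
  have hF : Measurable fun q : (ℝ × Space d) × Params d m =>
      betaHat w G l (‖q.1.2‖⁻¹ • q.1.2) q.2 * betaHat w G l' (‖q.1.2‖⁻¹ • q.1.2) q.2 :=
    (h.measurable_betaHat_direction' l).mul (h.measurable_betaHat_direction' l')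
  have h1 := hr.integral_eq n (Z := fun _ => 0) measurable_const
    hF
    (h.integrable_mul_betaStep hν hr (h.integrable_betaStep hν hr l n) l' n)
  refine h1.trans (integral_congr_ae ?_)
  filter_upwards [hv] with x hx
  rw [← scatLaw_direction ν hx]

theorem integral_betaHat_mul_rot (h : PotentialJet ω w G C) (hd : 2 ≤ d) (l l' : ℕ)
    {e e' : Space d} (he : ‖e‖ = 1) (he' : ‖e'‖ = 1) :
    ∫ k, betaHat w G l e' k * betaHat w G l' e' k ∂scatLaw d m ν e' =
      ∫ k, betaHat w G l e k * betaHat w G l' e k ∂scatLaw d m ν e := by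
  obtain ⟨N, rfl⟩ := exists_rot_eq hd he he'
  exact integral_scatLaw_rot
    (f := fun q => betaRed w G l q.1.1 q.1.2.1 q.1.2.2 q.2 * betaRed w G l' q.1.1 q.1.2.1 q.1.2.2 q.2)
    ((h.continuous_betaRed l).mul (h.continuous_betaRed l')) he N

end

theorem norm_le_gmax (h : PotentialJet ω w G C) (y : Space d) (φ : Torus m) :
    ‖G 0 y φ‖ ≤ gmax fun y φ => -G 0 y φ := by
  have h1 : BddAbove (range fun p : Space d × Torus m => ‖-G 0 p.1 p.2‖) := by
    refine ⟨C, ?_⟩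
    rintro _ ⟨p, rfl⟩
    exact (norm_neg _).trans_le <| h.G_bound 0 (by norm_num) _ _
  have h2 := le_ciSup h1 (y, φ)
  exact (norm_neg _).symm.trans_le h2

/-- A fast particle is not reflected. -/
theorem inner_add_R_pos (h : PotentialJet ω w G C) {v : Space d} (hv : v ≠ 0) {κ : Params d m}
    (hb : inner ℝ v κ.1 = 0) (hc : |κ.2.2.2| ≤ 1)
    (hg : 12 * gmax (fun y φ => -G 0 y φ) ≤ ‖v‖ ^ 2) :
    0 < inner ℝ v (v + R (fun y φ => -G 0 y φ) ω v κ) := by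
  have hs : 0 < ‖v‖ := norm_pos_iff.2 hv
  have he := norm_direction hv
  have hve : ‖v‖ • ‖v‖⁻¹ • v = v := smul_inv_smul₀ hs.ne' v
  -- The force is bounded by `gmax` itself and not by the constant `C` of the jet, so the speed
  -- threshold is the stated one.
  have hA : ∀ y φ, ‖κ.2.2.2 • G 0 y φ‖ ≤ gmax fun y φ => -G 0 y φ := fun y φ => by
    rw [norm_smul, Real.norm_eq_abs]
    exact (mul_le_of_le_one_left (norm_nonneg _) hc).trans (h.norm_le_gmax y φ)
  obtain ⟨x, p, hf, hε, -, hp⟩ := R_eq_of_flight h hs he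
    (by rw [real_inner_smul_left, hb, mul_zero]) hA hg
  have h1 := hf.inner_p_two_pos hA (by rw [norm_rot, he]) hε
  rw [hve] at hp
  rw [hp, real_inner_smul_right]
  refine mul_pos hs ?_
  have h2 := inner_rot_rot κ.2.1 (rot κ.2.1⁻¹ (‖v‖⁻¹ • v)) (p 2)
  rw [rot_rot_inv, real_inner_smul_left] at h2
  rw [← h2] at h1
  exact (pos_iff_pos_of_mul_pos h1).1 (inv_pos.2 hs)

/-- In dimension one a positive inner product is already the case of equality in the Cauchy–Schwarz
inequality. -/
theorem _root_.SoftLorentz.direction_eq_of_inner_pos (hd : d = 1) {v u : Space d}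
    (huv : 0 < inner ℝ v u) : u ≠ 0 ∧ ‖u‖⁻¹ • u = ‖v‖⁻¹ • v := by
  subst hd
  have hu : u ≠ 0 := by rintro rfl; simp at huv
  have hv : v ≠ 0 := by rintro rfl; simp at huv
  refine ⟨hu, ?_⟩
  have h1 : inner ℝ v u = ‖v‖ * ‖u‖ := by
    have e1 : inner ℝ v u = v 0 * u 0 := by
      simp [PiLp.inner_apply, mul_comm]
    have e2 : ∀ z : Space 1, ‖z‖ = |z 0| := fun z => by
      rw [EuclideanSpace.norm_eq]; simp [Real.sqrt_sq_eq_abs]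
    rw [e1] at huv
    rw [e1, e2, e2, ← abs_mul, abs_of_pos huv]
  have h2 := (inner_eq_norm_mul_iff_real).1 h1
  have hvn := norm_ne_zero_iff.2 hv
  have hun := norm_ne_zero_iff.2 hu
  rw [inv_smul_eq_iff₀ hun, smul_comm, ← h2.symm, inv_smul_smul₀ hvn]

variable {Ω : Type*} {mΩ : MeasurableSpace Ω} {P : Measure Ω}
  {ℱ : Filtration ℕ mΩ} {v : ℕ → Ω → Space d} {κ : ℕ → Ω → Params d m}
  [IsProbabilityMeasure ν] [IsProbabilityMeasure P]

/-- For `d = 1` the rotation group is trivial and does not relate the two directions. By induction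
on the steps, a fast particle is never reflected, so its direction is that at step `n`. -/
theorem ae_direction_eq (h : PotentialJet ω w G C) (hd : d = 1)
    (hν : ∀ᵐ c ∂ν, c ∈ Icc (-1 : ℝ) 1)
    (hr : IsRandomWalk (fun y φ => -G 0 y φ) ω ν P ℱ v κ) {n n' : ℕ} (hn : n ≤ n')
    (hv : ∀ᵐ x ∂P, v n x ≠ 0)
    (hg : ∀ k, n ≤ k → k < n' → ∀ᵐ x ∂P, 12 * gmax (fun y φ => -G 0 y φ) ≤ ‖v k x‖ ^ 2) :
    ∀ᵐ x ∂P, v n' x ≠ 0 ∧ ‖v n' x‖⁻¹ • v n' x = ‖v n x‖⁻¹ • v n x := by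
  induction n', hn using Nat.le_induction with
  | base => filter_upwards [hv] with x hx using ⟨hx, rfl⟩
  | succ k hk ih =>
    filter_upwards [ih fun j hj hjk => hg j hj (hjk.trans k.lt_succ_self), hr.step k,
      hr.ae_mem hν k, hg k hk k.lt_succ_self] with x hx hstep hκ hgx
    rw [hstep]
    have := direction_eq_of_inner_pos hd (h.inner_add_R_pos hx.1 hκ.1 hκ.2 hgx)
    exact ⟨this.1, this.2.trans hx.2⟩

/-- Conditioning reduces both sides to averages depending only on the direction: rotation invariance
equates them for `d ≥ 2`, constancy of the direction for `d = 1`. -/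
theorem integral_betaStep_mul_self_eq (h : PotentialJet ω w G C) (hd : 1 ≤ d)
    (hν : ∀ᵐ c ∂ν, c ∈ Icc (-1 : ℝ) 1)
    (hr : IsRandomWalk (fun y φ => -G 0 y φ) ω ν P ℱ v κ) {n n' : ℕ} (hn : n ≤ n')
    (hv : ∀ᵐ x ∂P, v n x ≠ 0) (hv' : ∀ᵐ x ∂P, v n' x ≠ 0)
    (hg : d = 1 → ∀ k, n ≤ k → k < n' →
      ∀ᵐ x ∂P, 12 * gmax (fun y φ => -G 0 y φ) ≤ ‖v k x‖ ^ 2) (l l' : ℕ) :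
    ∫ x, betaStep w G v κ l n x * betaStep w G v κ l' n x ∂P =
      ∫ x, betaStep w G v κ l n' x * betaStep w G v κ l' n' x ∂P := by
  rw [h.integral_betaStep_mul_self hν hr hv, h.integral_betaStep_mul_self hν hr hv']
  refine integral_congr_ae ?_
  rcases hd.eq_or_lt with hd1 | hd2
  · filter_upwards [h.ae_direction_eq hd1.symm hν hr hn hv (hg hd1.symm)] with x hx
    rw [hx.2]
  · filter_upwards [hv, hv'] with x hx hx'
    exact h.integral_betaHat_mul_rot hd2 l l' (norm_direction hx') (norm_direction hx)

end PotentialJet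

end

/-! ### Transfer to the coefficients defined by limits, and assembly -/

section

theorem exists_potentialJet_force {d m : ℕ} (ω : Space m) {W : Space d → Torus m → ℝ}
    (hW : ContDiff ℝ 4 (lift W)) (hsupp : ∀ y φ, 1 / 2 < ‖y‖ → W y φ = 0) :
    ∃ w G C, PotentialJet ω w G C ∧ w 1 = dtau ω W ∧ force W = fun y φ => -G 0 y φ :=
  let ⟨C, h⟩ := exists_potentialJet ω hW hsupp
  ⟨_, _, C, h, rfl, rfl⟩

variable {d m : ℕ} {ω : Space m} {w : ℕ → Space d → Torus m → ℝ}
  {G : ℕ → Space d → Torus m → Space d} {C : ℝ} {ν : Measure ℝ}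

namespace PotentialJet

/-! ### The statements for the coefficients of the asymptotic expansions -/

theorem R_sub_alpha_isBigO (h : PotentialJet ω w G C) {e : Space d} (he : ‖e‖ = 1)
    {κ : Params d m} (hb : inner ℝ e κ.1 = 0) :
    (fun s : ℝ => R (fun y φ => -G 0 y φ) ω (s • e) κ -
      ∑ k ∈ Finset.Icc 1 2, (s ^ k)⁻¹ • alpha (fun y φ => -G 0 y φ) ω k e κ)
      =O[atTop] fun s : ℝ => (s ^ 3)⁻¹ := by
  refine (h.R_isBigO he hb).congr_left fun s => ?_
  congr 1
  refine Finset.sum_congr rfl fun k hk => ?_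
  rw [h.alpha_eq he hb (Finset.mem_Icc.1 hk).2]

theorem deltaE_sub_beta_isLittleO (h : PotentialJet ω w G C) {e : Space d} (he : ‖e‖ = 1)
    {κ : Params d m} (hb : inner ℝ e κ.1 = 0) :
    (fun s : ℝ => deltaE (fun y φ => -G 0 y φ) ω (s • e) κ -
      ∑ l ∈ Finset.range 5, (s ^ l)⁻¹ * beta (fun y φ => -G 0 y φ) ω l e κ)
      =o[atTop] fun s : ℝ => (s ^ 4)⁻¹ := by
  refine (h.deltaE_isLittleO he hb).congr_left fun s => ?_
  congr 1
  refine Finset.sum_congr rfl fun l hl => ?_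
  rw [h.beta_eq he hb (Nat.lt_succ_iff.1 (Finset.mem_range.1 hl))]

theorem alpha_ae_eq (h : PotentialJet ω w G C) (hν : ∀ᵐ c ∂ν, c ∈ Icc (-1 : ℝ) 1) {e : Space d}
    (he : ‖e‖ = 1) {k : ℕ} (hk : k ≤ 2) :
    alpha (fun y φ => -G 0 y φ) ω k e =ᵐ[scatLaw d m ν e] alphaHat G k e := by
  filter_upwards [ae_scatLaw_mem hν] with κ hκ using h.alpha_eq he hκ.1 hk

theorem beta_ae_eq (h : PotentialJet ω w G C) (hν : ∀ᵐ c ∂ν, c ∈ Icc (-1 : ℝ) 1) {e : Space d}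
    (he : ‖e‖ = 1) {l : ℕ} (hl : l ≤ 4) :
    beta (fun y φ => -G 0 y φ) ω l e =ᵐ[scatLaw d m ν e] betaHat w G l e := by
  filter_upwards [ae_scatLaw_mem hν] with κ hκ using h.beta_eq he hκ.1 hl

variable [IsProbabilityMeasure ν] {W : Space d → Torus m → ℝ}

theorem integral_alpha (h : PotentialJet ω w G C) (hν : ∀ᵐ c ∂ν, c ∈ Icc (-1 : ℝ) 1)
    {e : Space d} (he : ‖e‖ = 1) {k : ℕ} (hk : k ≤ 2) :
    Integrable (alpha (fun y φ => -G 0 y φ) ω k e) (scatLaw d m ν e) ∧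
      ∫ κ, alpha (fun y φ => -G 0 y φ) ω k e κ ∂scatLaw d m ν e = 0 :=
  ⟨(h.integrable_alphaHat hν k e e).congr (h.alpha_ae_eq hν he hk).symm,
    (integral_congr_ae (h.alpha_ae_eq hν he hk)).trans (h.integral_alphaHat hν hk he)⟩

theorem integral_beta (h : PotentialJet ω w G C) (hw : w 1 = dtau ω W) (hd : 1 ≤ d)
    (hν : ∀ᵐ c ∂ν, c ∈ Icc (-1 : ℝ) 1) {e : Space d} (he : ‖e‖ = 1) :
    (∀ l ≤ 4, Integrable (beta (fun y φ => -G 0 y φ) ω l e) (scatLaw d m ν e)) ∧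
    (∀ l ≤ 3, ∫ κ, beta (fun y φ => -G 0 y φ) ω l e κ ∂scatLaw d m ν e = 0) ∧
    ∫ κ, beta (fun y φ => -G 0 y φ) ω 4 e κ ∂scatLaw d m ν e = B ω W ν ∧
    Integrable (fun κ => beta (fun y φ => -G 0 y φ) ω 1 e κ ^ 2) (scatLaw d m ν e) ∧
    ∫ κ, beta (fun y φ => -G 0 y φ) ω 1 e κ ^ 2 ∂scatLaw d m ν e = Dsq ω W ν := by
  have h1 : (fun κ => beta (fun y φ => -G 0 y φ) ω 1 e κ ^ 2) =ᵐ[scatLaw d m ν e]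
      fun κ => betaHat w G 1 e κ ^ 2 := by
    filter_upwards [h.beta_ae_eq hν he (l := 1) (by norm_num)] with κ hκ
    rw [hκ]
  have hi := integral_congr_ae h1
  have hsq := h.integral_betaHat_one_sq_eq hw hd hν he
  refine ⟨fun l hl => (h.integrable_betaHat hν l e e).congr (h.beta_ae_eq hν he hl).symm,
    fun l hl => (integral_congr_ae (h.beta_ae_eq hν he (by omega))).trans
      (h.integral_betaHat_eq_zero hd hν hl he),
    (integral_congr_ae (h.beta_ae_eq hν he le_rfl)).trans (h.integral_betaHat_four_eq hw hd hν he),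
    Integrable.congr ?_ h1.symm, hi.trans hsq⟩
  obtain ⟨K, -, hK⟩ := h.exists_betaRed_bound
  refine Integrable.of_bound ((h.integrable_betaHat hν 1 e e).aestronglyMeasurable.pow 2) (K ^ 2) ?_
  filter_upwards [ae_scatLaw_mem hν] with κ hκ
  rw [norm_pow]
  exact pow_le_pow_left₀ (norm_nonneg _) (hK 1 _ _ _ _ hκ.2) 2

theorem exists_averaged_deltaE (h : PotentialJet ω w G C) (hw : w 1 = dtau ω W) (hd : 1 ≤ d)
    (hν : ∀ᵐ c ∂ν, c ∈ Icc (-1 : ℝ) 1) :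
    ∃ K V : ℝ, 0 < V ∧ ∀ v : Space d, V ≤ ‖v‖ →
      Integrable (deltaE (fun y φ => -G 0 y φ) ω v) (scatLaw d m ν v) ∧
      Integrable (fun κ => deltaE (fun y φ => -G 0 y φ) ω v κ ^ 2) (scatLaw d m ν v) ∧
      |∫ κ, deltaE (fun y φ => -G 0 y φ) ω v κ ∂scatLaw d m ν v - B ω W ν / ‖v‖ ^ 4| ≤
        K / ‖v‖ ^ 5 ∧
      |∫ κ, deltaE (fun y φ => -G 0 y φ) ω v κ ^ 2 ∂scatLaw d m ν v - Dsq ω W ν / ‖v‖ ^ 2| ≤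
        K / ‖v‖ ^ 3 := by
  obtain ⟨K, hK⟩ := h.exists_deltaE_bounds hw hd hν
  have hC := h.nonneg
  -- This threshold ensures both `1 ≤ ‖v‖` and `12 C ≤ ‖v‖²`.
  refine ⟨K, 1 + 12 * C, by positivity, fun v hv => ?_⟩
  have h1 : 1 ≤ ‖v‖ := by linarith
  have hv0 : v ≠ 0 := norm_pos_iff.1 (by linarith)
  have h2 := hK ‖v‖ h1 (by nlinarith) _ (norm_direction hv0)
  rwa [smul_inv_smul₀ (norm_ne_zero_iff.2 hv0), ← scatLaw_direction ν hv0] at h2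

/-! ### The statements for the random walk -/

variable {Ω : Type*} {mΩ : MeasurableSpace Ω} {P : Measure Ω} [IsProbabilityMeasure P]
  {ℱ : Filtration ℕ mΩ} {v : ℕ → Ω → Space d} {κ : ℕ → Ω → Params d m}

theorem integral_betaWalk (h : PotentialJet ω w G C) (hw : w 1 = dtau ω W) (hd : 1 ≤ d)
    (hν : ∀ᵐ c ∂ν, c ∈ Icc (-1 : ℝ) 1)
    (hr : IsRandomWalk (fun y φ => -G 0 y φ) ω ν P ℱ v κ) {n : ℕ} (hv : ∀ᵐ x ∂P, v n x ≠ 0) :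
    (∀ l ≤ 4, Integrable (betaWalk (fun y φ => -G 0 y φ) ω v κ l n) P) ∧
    (∀ l ≤ 3, ∫ x, betaWalk (fun y φ => -G 0 y φ) ω v κ l n x ∂P = 0) ∧
    ∫ x, betaWalk (fun y φ => -G 0 y φ) ω v κ 4 n x ∂P = B ω W ν :=
  ⟨fun l hl => (h.integrable_betaStep hν hr l n).congr (h.betaWalk_ae_eq hν hr hv hl).symm,
    fun l hl => (integral_congr_ae (h.betaWalk_ae_eq hν hr hv (by omega))).trans
      (h.integral_betaStep hν hr hv fun _ he => h.integral_betaHat_eq_zero hd hν hl he),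
    (integral_congr_ae (h.betaWalk_ae_eq hν hr hv le_rfl)).trans
      (h.integral_betaStep hν hr hv fun _ he => h.integral_betaHat_four_eq hw hd hν he)⟩

theorem betaWalk_mul_ae_eq (h : PotentialJet ω w G C) (hν : ∀ᵐ c ∂ν, c ∈ Icc (-1 : ℝ) 1)
    (hr : IsRandomWalk (fun y φ => -G 0 y φ) ω ν P ℱ v κ) {n n' : ℕ}
    (hv : ∀ᵐ x ∂P, v n x ≠ 0) (hv' : ∀ᵐ x ∂P, v n' x ≠ 0) {l l' : ℕ} (hl : l ≤ 4) (hl' : l' ≤ 4)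
    (a a' : ℝ) :
    (fun x => (betaWalk (fun y φ => -G 0 y φ) ω v κ l n x - a) *
      (betaWalk (fun y φ => -G 0 y φ) ω v κ l' n' x - a')) =ᵐ[P]
    fun x => (betaStep w G v κ l n x - a) * (betaStep w G v κ l' n' x - a') := by
  filter_upwards [h.betaWalk_ae_eq hν hr hv hl, h.betaWalk_ae_eq hν hr hv' hl'] with x hx hx'
  rw [hx, hx']

theorem integral_betaWalk_mul_of_ne (h : PotentialJet ω w G C) (hw : w 1 = dtau ω W) (hd : 1 ≤ d)
    (hν : ∀ᵐ c ∂ν, c ∈ Icc (-1 : ℝ) 1)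
    (hr : IsRandomWalk (fun y φ => -G 0 y φ) ω ν P ℱ v κ) {n n' : ℕ} (hn : n ≠ n')
    (hv : ∀ᵐ x ∂P, v n x ≠ 0) (hv' : ∀ᵐ x ∂P, v n' x ≠ 0) :
    (∀ l l' : ℕ, l ≤ 3 → l' ≤ 3 → ∫ x, betaWalk (fun y φ => -G 0 y φ) ω v κ l n x *
      betaWalk (fun y φ => -G 0 y φ) ω v κ l' n' x ∂P = 0) ∧
    (∀ l ≤ 3, ∫ x, betaWalk (fun y φ => -G 0 y φ) ω v κ l n x *
      (betaWalk (fun y φ => -G 0 y φ) ω v κ 4 n' x - B ω W ν) ∂P = 0) ∧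
    ∫ x, (betaWalk (fun y φ => -G 0 y φ) ω v κ 4 n x - B ω W ν) *
      (betaWalk (fun y φ => -G 0 y φ) ω v κ 4 n' x - B ω W ν) ∂P = 0 := by
  have key : ∀ {l l' : ℕ} {a a' : ℝ}, l ≤ 4 → l' ≤ 4 →
      (∀ e : Space d, ‖e‖ = 1 → ∫ k, betaHat w G l e k ∂scatLaw d m ν e = a) →
      (∀ e : Space d, ‖e‖ = 1 → ∫ k, betaHat w G l' e k ∂scatLaw d m ν e = a') →
      ∫ x, (betaWalk (fun y φ => -G 0 y φ) ω v κ l n x - a) *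
        (betaWalk (fun y φ => -G 0 y φ) ω v κ l' n' x - a') ∂P = 0 :=
    fun hl hl' ha ha' => (integral_congr_ae (h.betaWalk_mul_ae_eq hν hr hv hv' hl hl' _ _)).trans
      (h.integral_betaStep_mul_of_ne hν hr hn hv hv' ha ha')
  have h0 : ∀ l ≤ 3, ∀ e : Space d, ‖e‖ = 1 → ∫ k, betaHat w G l e k ∂scatLaw d m ν e = 0 :=
    fun l hl e he => h.integral_betaHat_eq_zero hd hν hl he
  have h4 : ∀ e : Space d, ‖e‖ = 1 → ∫ k, betaHat w G 4 e k ∂scatLaw d m ν e = B ω W ν :=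
    fun e he => h.integral_betaHat_four_eq hw hd hν he
  refine ⟨fun l l' hl hl' => ?_, fun l hl => ?_, key le_rfl le_rfl h4 h4⟩
  · simpa only [sub_zero] using key (by omega) (by omega) (h0 l hl) (h0 l' hl')
  · simpa only [sub_zero] using key (by omega) le_rfl (h0 l hl) h4

theorem integrable_betaWalk_mul (h : PotentialJet ω w G C) (hν : ∀ᵐ c ∂ν, c ∈ Icc (-1 : ℝ) 1)
    (hr : IsRandomWalk (fun y φ => -G 0 y φ) ω ν P ℱ v κ) {n n' : ℕ}
    (hv : ∀ᵐ x ∂P, v n x ≠ 0) (hv' : ∀ᵐ x ∂P, v n' x ≠ 0) {l l' : ℕ} (hl : l ≤ 4)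
    (hl' : l' ≤ 4) :
    Integrable (fun x => betaWalk (fun y φ => -G 0 y φ) ω v κ l n x *
      betaWalk (fun y φ => -G 0 y φ) ω v κ l' n' x) P := by
  have h1 := h.betaWalk_mul_ae_eq hν hr hv hv' hl hl' 0 0
  simp only [sub_zero] at h1
  exact (h.integrable_mul_betaStep hν hr (h.integrable_betaStep hν hr l n) l' n').congr h1.symm

theorem integral_betaWalk_mul_self_eq (h : PotentialJet ω w G C) (hd : 1 ≤ d)
    (hν : ∀ᵐ c ∂ν, c ∈ Icc (-1 : ℝ) 1)
    (hr : IsRandomWalk (fun y φ => -G 0 y φ) ω ν P ℱ v κ) {n n' : ℕ} (hn : n ≤ n')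
    (hv : ∀ᵐ x ∂P, v n x ≠ 0) (hv' : ∀ᵐ x ∂P, v n' x ≠ 0)
    (hg : d = 1 → ∀ k, n ≤ k → k < n' →
      ∀ᵐ x ∂P, 12 * gmax (fun y φ => -G 0 y φ) ≤ ‖v k x‖ ^ 2) {l l' : ℕ} (hl : l ≤ 4)
    (hl' : l' ≤ 4) :
    ∫ x, betaWalk (fun y φ => -G 0 y φ) ω v κ l n x *
      betaWalk (fun y φ => -G 0 y φ) ω v κ l' n x ∂P =
    ∫ x, betaWalk (fun y φ => -G 0 y φ) ω v κ l n' x *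
      betaWalk (fun y φ => -G 0 y φ) ω v κ l' n' x ∂P := by
  have h1 := h.betaWalk_mul_ae_eq hν hr hv hv hl hl' 0 0
  have h2 := h.betaWalk_mul_ae_eq hν hr hv' hv' hl hl' 0 0
  simp only [sub_zero] at h1 h2
  exact (integral_congr_ae h1).trans ((h.integral_betaStep_mul_self_eq hd hν hr hn hv hv' hg l
    l').trans (integral_congr_ae h2).symm)

end PotentialJet

end

end SoftLorentz

theorem mainTheorem1 {d m : ℕ} (hd : 1 ≤ d)
    (ω : SoftLorentz.Space m) (hω : ‖ω‖ = 1)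
    (ν : Measure ℝ) [IsProbabilityMeasure ν]
    (hν : ∀ᵐ c ∂ν, c ∈ Icc (-1 : ℝ) 1) (hν0 : ν ≠ Measure.dirac 0)
    (W : SoftLorentz.Space d → SoftLorentz.Torus m → ℝ)
    (hW : ContDiff ℝ 4 fun p : SoftLorentz.Space d × SoftLorentz.Space m =>
      W p.1 (SoftLorentz.toTorus p.2))
    (hsupp : ∀ y φ, 1 / 2 < ‖y‖ → W y φ = 0)
    (hWτ : ∃ y φ, SoftLorentz.dtau ω W y φ ≠ 0)
    (hd1 : d = 1 → ∃ φ, ∫ y, SoftLorentz.dtau ω W y φ ≠ 0)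
    (g : SoftLorentz.Space d → SoftLorentz.Torus m → SoftLorentz.Space d)
    (hg : g = SoftLorentz.force W) :
    -- the expansions that define `α^(1), α^(2)` and `β^(0), …, β^(4)` are valid
    (∀ (e : SoftLorentz.Space d) (κ : SoftLorentz.Params d m), ‖e‖ = 1 → inner ℝ e κ.1 = 0 →
      ((fun s : ℝ => SoftLorentz.R g ω (s • e) κ -
          ∑ k ∈ Finset.Icc 1 2, (s ^ k)⁻¹ • SoftLorentz.alpha g ω k e κ)
        =O[atTop] fun s : ℝ => (s ^ 3)⁻¹) ∧
      ((fun s : ℝ => SoftLorentz.deltaE g ω (s • e) κ -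
          ∑ l ∈ Finset.range 5, (s ^ l)⁻¹ * SoftLorentz.beta g ω l e κ)
        =o[atTop] fun s : ℝ => (s ^ 4)⁻¹)) ∧
    -- (i) vanishing averages of `α^(1)` and `α^(2)`
    (∀ e : SoftLorentz.Space d, ‖e‖ = 1 → ∀ k : ℕ, 1 ≤ k → k ≤ 2 →
      Integrable (SoftLorentz.alpha g ω k e) (SoftLorentz.scatLaw d m ν e) ∧
      ∫ κ, SoftLorentz.alpha g ω k e κ ∂(SoftLorentz.scatLaw d m ν e) = 0) ∧
    -- (i) averaged energy transfer and averaged squared energy transfer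
    (∃ K V : ℝ, 0 < V ∧ ∀ v : SoftLorentz.Space d, V ≤ ‖v‖ →
      Integrable (SoftLorentz.deltaE g ω v) (SoftLorentz.scatLaw d m ν v) ∧
      Integrable (fun κ => SoftLorentz.deltaE g ω v κ ^ 2) (SoftLorentz.scatLaw d m ν v) ∧
      |∫ κ, SoftLorentz.deltaE g ω v κ ∂(SoftLorentz.scatLaw d m ν v)
          - SoftLorentz.B ω W ν / ‖v‖ ^ 4| ≤ K / ‖v‖ ^ 5 ∧
      |∫ κ, SoftLorentz.deltaE g ω v κ ^ 2 ∂(SoftLorentz.scatLaw d m ν v)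
          - SoftLorentz.Dsq ω W ν / ‖v‖ ^ 2| ≤ K / ‖v‖ ^ 3) ∧
    -- (i) positivity of `D²` and averages of the `β^(ℓ)`
    0 < SoftLorentz.Dsq ω W ν ∧
    (∀ e : SoftLorentz.Space d, ‖e‖ = 1 →
      (∀ l : ℕ, l ≤ 4 →
        Integrable (SoftLorentz.beta g ω l e) (SoftLorentz.scatLaw d m ν e)) ∧
      (∀ l : ℕ, l ≤ 3 →
        ∫ κ, SoftLorentz.beta g ω l e κ ∂(SoftLorentz.scatLaw d m ν e) = 0) ∧
      ∫ κ, SoftLorentz.beta g ω 4 e κ ∂(SoftLorentz.scatLaw d m ν e) = SoftLorentz.B ω W ν ∧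
      Integrable (fun κ => SoftLorentz.beta g ω 1 e κ ^ 2) (SoftLorentz.scatLaw d m ν e) ∧
      ∫ κ, SoftLorentz.beta g ω 1 e κ ^ 2 ∂(SoftLorentz.scatLaw d m ν e)
        = SoftLorentz.Dsq ω W ν) ∧
    -- (ii) the random walk
    (∀ {Ω : Type*} {mΩ : MeasurableSpace Ω} (P : Measure Ω) [IsProbabilityMeasure P]
      (ℱ : Filtration ℕ mΩ) (v : ℕ → Ω → SoftLorentz.Space d)
      (κ : ℕ → Ω → SoftLorentz.Params d m), SoftLorentz.IsRandomWalk g ω ν P ℱ v κ →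
      -- mean values
      (∀ n : ℕ, (∀ᵐ x ∂P, v n x ≠ 0) →
        (∀ l : ℕ, l ≤ 4 → Integrable (SoftLorentz.betaWalk g ω v κ l n) P) ∧
        (∀ l : ℕ, l ≤ 3 → ∫ x, SoftLorentz.betaWalk g ω v κ l n x ∂P = 0) ∧
        ∫ x, SoftLorentz.betaWalk g ω v κ 4 n x ∂P = SoftLorentz.B ω W ν) ∧
      -- vanishing correlations at distinct steps, and second moments
      (∀ n n' : ℕ, (∀ᵐ x ∂P, v n x ≠ 0) → (∀ᵐ x ∂P, v n' x ≠ 0) →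
        (∀ l l' : ℕ, l ≤ 4 → l' ≤ 4 →
          Integrable (fun x => SoftLorentz.betaWalk g ω v κ l n x *
            SoftLorentz.betaWalk g ω v κ l' n' x) P) ∧
        (n ≠ n' →
          (∀ l l' : ℕ, l ≤ 3 → l' ≤ 3 →
            ∫ x, SoftLorentz.betaWalk g ω v κ l n x *
              SoftLorentz.betaWalk g ω v κ l' n' x ∂P = 0) ∧
          (∀ l : ℕ, l ≤ 3 →
            ∫ x, SoftLorentz.betaWalk g ω v κ l n x *
              (SoftLorentz.betaWalk g ω v κ 4 n' x - SoftLorentz.B ω W ν) ∂P = 0) ∧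
          ∫ x, (SoftLorentz.betaWalk g ω v κ 4 n x - SoftLorentz.B ω W ν) *
            (SoftLorentz.betaWalk g ω v κ 4 n' x - SoftLorentz.B ω W ν) ∂P = 0) ∧
        -- independence of `n`; if `d = 1`, the particle is fast between the two steps
        (n ≤ n' →
          (d = 1 → ∀ k : ℕ, n ≤ k → k < n' →
            ∀ᵐ x ∂P, 12 * SoftLorentz.gmax g ≤ ‖v k x‖ ^ 2) →
          ∀ l l' : ℕ, l ≤ 4 → l' ≤ 4 →
            ∫ x, SoftLorentz.betaWalk g ω v κ l n x *
                SoftLorentz.betaWalk g ω v κ l' n x ∂P =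
              ∫ x, SoftLorentz.betaWalk g ω v κ l n' x *
                SoftLorentz.betaWalk g ω v κ l' n' x ∂P))) := by
  obtain ⟨w, G, C, h, hw, hG⟩ := SoftLorentz.exists_potentialJet_force ω hW hsupp
  rw [hG] at hg
  subst hg
  refine ⟨fun e κ he hb => ⟨h.R_sub_alpha_isBigO he hb, h.deltaE_sub_beta_isLittleO he hb⟩,
    fun e he k _ hk => h.integral_alpha hν he hk, h.exists_averaged_deltaE hw hd hν,
    h.Dsq_pos hw hd hν hν0 hWτ hd1, fun e he => h.integral_beta hw hd hν he, ?_⟩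
  intro Ω mΩ P _ ℱ v κ hr
  exact ⟨fun n hv => h.integral_betaWalk hw hd hν hr hv, fun n n' hv hv' =>
    ⟨fun l l' hl hl' => h.integrable_betaWalk_mul hν hr hv hv' hl hl',
      fun hn => h.integral_betaWalk_mul_of_ne hw hd hν hr hn hv hv',
      fun hn hg l l' hl hl' =>
        h.integral_betaWalk_mul_self_eq hd hν hr hn hv hv' hg hl hl'⟩⟩
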